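/- Let $n\in\mathbb N$, $\alpha>1/2$, $b>0$, $a\in\mathbb R^n$, and let $g(u)=|u|^bu$ or $g(u)=-|u|^bu$, for real- or complex-valued $u$. Consider the Cauchy problem $$u_t+(-\Delta)^\alpha u=(a\cdot\nabla)g(u)\ \text{ in }(0,\infty)\times\mathbb R^n,\qquad u(0)=\varphi .$$ A mild solution on an interval $I=[0,T)$ is a solution of $$u(t)=S_\alpha(t)\varphi+\int_0^tS_\alpha(t-\tau)(a\cdot\nabla)g(u(\tau))\,d\tau,\quad t\in I,$$ where $S_\alpha(t)=e^{-t(-\Delta)^\alpha}$ is convolution with the inverse Fourier transform $K_t$ of $e^{-t|\xi|^{2\alpha}}$ and $S_\alpha(t)(a\cdot\nabla)$ is convolution with $a\cdot\nabla K_t$. Let $$r_1=\frac{nb}{2\alpha-1}>1,\qquad r\ge r_1,$$ and let $(q,p,r)$ be an admissible triplet with $p>b+1$; that is, $$\frac1q=\frac n{2\alpha}\Big(\frac1r-\frac1p\Big),\qquad r\le p<\infty,\qquad p<\frac{nr}{n-2\alpha}\ \text{ if } n>2\alpha$$ (so $q=\infty$ if $p=r$). Put $X(I)=C(I;L^r(\mathbb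 R^n))\cap L^q(I;L^p(\mathbb R^n))$. (i) For every $\varphi\in L^r(\mathbb R^n)$ there is $T>0$ such that, with $I=[0,T)$, the problem has a mild solution $u\in X(I)$, and it is the only mild solution in $X(I)$. If $r>r_1$, then $T$ can be chosen depending on $\varphi$ only through $\|\varphi\|_{L^r}$ (uniformly for $\varphi$ in bounded sets of $L^r$); if $r=r_1$, then $T$ depends on $\varphi$ itself. (ii) If $r=r_1$, there is $\varepsilon>0$ such that for every $\varphi\in L^r(\mathbb R^n)$ with $\|\varphi\|_{L^r}\le\varepsilon$ one can take $T=\infty$ in (i), and the global solution satisfies $u\in C_b([0,\infty);L^r(\mathbb R^n))\cap L^q((0,\infty);L^p(\mathbb R^n))$. (iii) If $r>r_1$, there is $C>0$, independent of $\varphi$, $T^*$, $u$ and $s$, such that the following holds. Let $0<T^*<\infty$ and let $[0,T^*)$ be the maximal existence interval of a mild solution $u$ in the class $C_b(\cdot\,;L^r)\cap L^q(\cdot\,;L^p)$: on $[0,T')$ the function $u$ is a mild solution in this class for each $T'<T^*$, and $u$ does not extend to a mild solution in this class on $[0,T')$ for any $T'>T^*$. Then $$\|u(s)\|_{L^r}\ge\frac{C}{(T^*-s)^{\frac1b-\frac1{2b\alpha}-\frac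 n{2r\alpha}}}\qquad(0\le s<T^*).$$ -/

import Mathlib

open MeasureTheory Set
open scoped ENNReal Convolution FourierTransform

namespace FracConv

noncomputable section

/-- The kernel `K_t` of `S_α(t) = exp (-t (-Δ)^α)`, `t > 0`: the inverse Fourier transform of
`exp (-t |ξ|^{2α})`. Mathlib's Fourier transform uses the frequency `2πξ`, hence the factor `2π`.
The symbol is even, so the inverse transform is real-valued. -/
def kernel (n : ℕ) (α t : ℝ) (x : EuclideanSpace ℝ (Fin n)) : ℝ :=
  (𝓕⁻ (fun ξ : EuclideanSpace ℝ (Fin n) =>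
    (Real.exp (-t * (2 * Real.pi * ‖ξ‖) ^ (2 * α)) : ℂ)) x).re

/-- The kernel `(a·∇) K_t`. -/
def derivKernel {n : ℕ} (α : ℝ) (a : EuclideanSpace ℝ (Fin n)) (t : ℝ)
    (x : EuclideanSpace ℝ (Fin n)) : ℝ :=
  fderiv ℝ (kernel n α t) x a

/-- `S_α(t) f = K_t * f`, for `t > 0`. -/
def semigroup {𝕜 : Type*} [RCLike 𝕜] {n : ℕ} (α t : ℝ) (f : EuclideanSpace ℝ (Fin n) → 𝕜) :
    EuclideanSpace ℝ (Fin n) → 𝕜 :=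
  kernel n α t ⋆[ContinuousLinearMap.lsmul ℝ ℝ, volume] f

/-- `S_α(t) (a·∇) f = ((a·∇) K_t) * f`, for `t > 0`. -/
def semigroupDeriv {𝕜 : Type*} [RCLike 𝕜] {n : ℕ} (α : ℝ) (a : EuclideanSpace ℝ (Fin n)) (t : ℝ)
    (f : EuclideanSpace ℝ (Fin n) → 𝕜) : EuclideanSpace ℝ (Fin n) → 𝕜 :=
  derivKernel α a t ⋆[ContinuousLinearMap.lsmul ℝ ℝ, volume] f

/-- The nonlinearity `g(z) = σ |z|^b z`, to be used with `σ = 1` or `σ = -1`. -/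
def nonlin {𝕜 : Type*} [RCLike 𝕜] (σ b : ℝ) (z : 𝕜) : 𝕜 := (σ * ‖z‖ ^ b) • z

/-- Admissible triplets `(q, p, r)`; here `q = ∞` is allowed and corresponds to `p = r`. -/
structure IsAdmissible (n : ℕ) (α : ℝ) (q : ℝ≥0∞) (p r : ℝ) : Prop where
  one_lt : 1 < r
  le : r ≤ p
  lt : 2 * α < n → p < n * r / (n - 2 * α)
  inv_eq : q⁻¹ = ENNReal.ofReal (n / (2 * α) * (1 / r - 1 / p))

section Spaces

variable {𝕜 : Type*} [RCLike 𝕜] {n : ℕ}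

/-- `u` is a mild solution on the time interval `I` (with `0 ∈ I ⊆ [0, ∞)`) of
`u_t + (-Δ)^α u = (a·∇) (σ |u|^b u)`, `u(0) = φ`:
`u(t) = S_α(t) φ + ∫_0^t S_α(t - τ) (a·∇) g(u(τ)) dτ` for all `t ∈ I`, as an identity of elements
of `L^r`, where the convolutions and the time integral converge absolutely almost everywhere. -/
structure IsMildSolution {r : ℝ≥0∞} (α b σ : ℝ) (a : EuclideanSpace ℝ (Fin n))
    (φ : Lp 𝕜 r (volume : Measure (EuclideanSpace ℝ (Fin n)))) (I : Set ℝ)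
    (u : ℝ → Lp 𝕜 r (volume : Measure (EuclideanSpace ℝ (Fin n)))) : Prop where
  initial : u 0 = φ
  conv_exists : ∀ t ∈ I, 0 < t → ∀ᵐ x ∂(volume : Measure (EuclideanSpace ℝ (Fin n))),
    ∀ᵐ τ ∂(volume.restrict (Ioo 0 t)), ConvolutionExistsAt (derivKernel α a (t - τ))
      (fun y => nonlin σ b (u τ y)) x (ContinuousLinearMap.lsmul ℝ ℝ) volume
  integrable : ∀ t ∈ I, 0 < t → ∀ᵐ x ∂(volume : Measure (EuclideanSpace ℝ (Fin n))),
    IntegrableOn (fun τ => semigroupDeriv α a (t - τ) (fun y => nonlin σ b (u τ y)) x) (Ioo 0 t)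
  duhamel : ∀ t ∈ I, 0 < t → ∀ᵐ x ∂(volume : Measure (EuclideanSpace ℝ (Fin n))),
    u t x = semigroup α t φ x +
      ∫ τ in Ioo 0 t, semigroupDeriv α a (t - τ) (fun y => nonlin σ b (u τ y)) x

/-- `u ∈ X(I) = C(I; L^r) ∩ L^q(I; L^p)`. Membership in the Bochner space `L^q(I; L^p)` means that
`u` agrees almost everywhere on `I` with an `L^p`-valued `L^q` function. -/
structure MemX {r : ℝ≥0∞} [Fact (1 ≤ r)] (q p : ℝ≥0∞) [Fact (1 ≤ p)] (I : Set ℝ)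
    (u : ℝ → Lp 𝕜 r (volume : Measure (EuclideanSpace ℝ (Fin n)))) : Prop where
  continuousOn : ContinuousOn u I
  memLp : ∃ v : ℝ → Lp 𝕜 p (volume : Measure (EuclideanSpace ℝ (Fin n))),
    MemLp v q (volume.restrict I) ∧
      ∀ᵐ t ∂(volume.restrict I), v t =ᵐ[(volume : Measure (EuclideanSpace ℝ (Fin n)))] u t

/-- `u ∈ C_b(I; L^r) ∩ L^q(I; L^p)`. -/
structure MemXb {r : ℝ≥0∞} [Fact (1 ≤ r)] (q p : ℝ≥0∞) [Fact (1 ≤ p)] (I : Set ℝ)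
    (u : ℝ → Lp 𝕜 r (volume : Measure (EuclideanSpace ℝ (Fin n)))) : Prop where
  memX : MemX q p I u
  bounded : ∃ M : ℝ, ∀ t ∈ I, ‖u t‖ ≤ M

/-- `[0, T)`, `0 < T < ∞`, is the maximal existence interval of the mild solution `u` in
`C_b ∩ L^q L^p`: `u` is a solution in this class on `[0, T')` for each `T' < T`, and it does not
extend to a solution in this class on `[0, T')` for any `T' > T`. -/
structure IsMaximal {r : ℝ≥0∞} [Fact (1 ≤ r)] (q p : ℝ≥0∞) [Fact (1 ≤ p)] (α b σ : ℝ)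
    (a : EuclideanSpace ℝ (Fin n))
    (φ : Lp 𝕜 r (volume : Measure (EuclideanSpace ℝ (Fin n)))) (T : ℝ)
    (u : ℝ → Lp 𝕜 r (volume : Measure (EuclideanSpace ℝ (Fin n)))) : Prop where
  pos : 0 < T
  sol : ∀ T', 0 < T' → T' < T →
    IsMildSolution α b σ a φ (Ico 0 T') u ∧ MemXb q p (Ico 0 T') u
  maximal : ∀ T', T < T' → ∀ v : ℝ → Lp 𝕜 r (volume : Measure (EuclideanSpace ℝ (Fin n))),
    IsMildSolution α b σ a φ (Ico 0 T') v → MemXb q p (Ico 0 T') v → ¬ EqOn v u (Ico 0 T)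

end Spaces

end

end FracConv

namespace FracConv

open Filter Topology
open ENNReal (ofReal ofReal_mul ofReal_ne_top ofReal_le_ofReal rpow_ne_top_of_nonneg ofReal_rpow_of_pos
  zero_rpow_of_pos ofReal_add mul_ne_top mul_rpow_of_nonneg rpow_add_of_nonneg ofReal_rpow_of_nonneg
  ofReal_toReal rpow_le_rpow rpow_one)
open Real (rpow_mul rpow_add mul_rpow sqrt rpow_nonneg rpow_pos_of_pos norm_of_nonneg fourierInv_eq)
open Function (uncurry)
open scoped Real

/-! Put d = n/(2α) and `gapExp` = 1 - 1/(2α) - d b/r. Scaling makes `gapExp` vanish at r = r₁ and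
positive for r > r₁, and every estimate below produces exactly this power of time.

Kernels. The symbol exp(-|ξ|^{2α}) is in general not smooth at the origin, so decay of K_t does not
follow from smoothness of the symbol. Instead the symbol is written as a mixture, over s > 0, of
dilates of the compactly supported truncated power (1 - |ξ|²/s)_+^{n+2} (`exists_mixWeight`,
`exists_bound_fourierInv_symb`). This gives |K_t(x)| ≤ C t^{1/(2α)} (t^{1/(2α)} + |x|)^{-(n+1)}, and
the same bound without the factor t^{1/(2α)} for (a·∇)K_t. By Young's inequality S_α(t)(a·∇) maps
L^ρ to L^m with norm at most C t^{-1/(2α) - d(1/ρ - 1/m)}.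

Existence is Kato's method. For an auxiliary exponent p₁ > r and δ = d(1/r - 1/p₁), the Duhamel map
is estimated in the norm sup t^δ ‖u(t)‖_{p₁}. On a ball of radius M its Lipschitz constant is a
multiple of M^b Θ, where Θ bounds t^{gapExp} (`exists_picard_bounds`). If r > r₁, one takes M = C‖φ‖
and a short interval. If r = r₁, then Θ = 1 and M has to be small, either because φ is small, or
because t^δ ‖S_α(t)φ‖_{p₁} tends to 0 with t for each fixed φ (`lpn_sgMaj_small`). Membership in
L^q(L^p) follows from a space-time bound for the linear part (`exists_lpn_lpn_sgMaj_le`), obtained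
by splitting φ at a time-dependent level and needing r < q. A Hardy inequality then bounds all
Picard iterates, and Fatou's lemma bounds their limit (`exists_space_time_bound`).

Uniqueness holds in all of X(I), where nothing is small a priori, so that only endpoint estimates
are available when r = r₁. If r < p, both solutions lie in L^{1/δ}(L^{p₁}), and their distance is
dominated by the fractional integral of order bδ of its product with a function in L^{1/(bδ)}, small
on short intervals. If p = r, the distance is measured by ∫_E |u - v| ≤ N |E|^{1-1/r}, and |u|^b,
|v|^b are dominated by a part small in L^{r/b} plus a part bounded in L^{2r/b}. In both cases the
layer-cake duality `lintegral_mul_le_of_weak` shows that an admissible constant N may be replaced by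
N/2, so the difference vanishes (`eq_zero_of_halving`).

Blow-up. For r > r₁ a solution with data ψ exists on [0, L) as soon as c‖ψ‖^b L^{gapExp} ≤ 1. If
‖u(s)‖ were too small, the solution with data u(s) would outlive T* - s. Gluing it to u, by the
semigroup property and Fubini, and invoking uniqueness would extend u past T*. -/

/-- Euclidean space. -/
abbrev Eu (n : ℕ) := EuclideanSpace ℝ (Fin n)

/-- The Lebesgue space on Euclidean space. -/
noncomputable abbrev LpEu (𝕜 : Type*) [RCLike 𝕜] (n : ℕ) (r : ℝ≥0∞) :=
  Lp 𝕜 r (volume : Measure (EuclideanSpace ℝ (Fin n)))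

/-! ### Smoothness of truncated powers on the line -/

section TruncatedPower

lemma hasDerivAt_max_zero_pow (N : ℕ) (u : ℝ) :
    HasDerivAt (fun u : ℝ => (max u 0) ^ (N + 2)) ((N + 2) * (max u 0) ^ (N + 1)) u := by
  rcases lt_trichotomy u 0 with h | h | h
  · have : (fun u : ℝ => (max u 0) ^ (N + 2)) =ᶠ[𝓝 u] fun _ => 0 := by
      filter_upwards [gt_mem_nhds h] with v hv
      simp [max_eq_right hv.le]
    rw [max_eq_right h.le]
    simpa using (hasDerivAt_const u (0 : ℝ)).congr_of_eventuallyEq this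
  · subst h
    have h1 : HasDerivWithinAt (fun u : ℝ => (max u 0) ^ (N + 2)) 0 (Iic 0) 0 :=
      (hasDerivWithinAt_const (0 : ℝ) (Iic 0) (0 : ℝ)).congr
        (fun v hv => by simp [max_eq_right (mem_Iic.1 hv)]) (by simp)
    have h2 : HasDerivWithinAt (fun u : ℝ => (max u 0) ^ (N + 2)) 0 (Ici 0) 0 := by
      have := ((hasDerivAt_pow (N + 2) (0 : ℝ)).hasDerivWithinAt (s := Ici 0))
      simp only [Nat.add_one_sub_one, ne_eq, Nat.add_eq_zero_iff, one_ne_zero, and_false,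
        not_false_eq_true, zero_pow, mul_zero] at this
      refine HasDerivWithinAt.congr ?_ (f := fun v : ℝ => v ^ (N + 2))
        (fun v hv => by simp [max_eq_left (mem_Ici.1 hv)]) (by simp)
      simpa using this
    have := h1.union h2
    rw [Iic_union_Ici, hasDerivWithinAt_univ] at this
    simpa using this
  · have : (fun u : ℝ => (max u 0) ^ (N + 2)) =ᶠ[𝓝 u] fun v => v ^ (N + 2) := by
      filter_upwards [lt_mem_nhds h] with v hv
      simp [max_eq_left hv.le]
    rw [max_eq_left h.le]
    have h3 := (hasDerivAt_pow (N + 2) u).congr_of_eventuallyEq this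
    simpa using h3

/-- Differentiation lowers the exponent by one and keeps the form, so N derivatives of the power N +
1 leave a continuous function. -/
lemma contDiff_max_zero_pow (N : ℕ) : ContDiff ℝ N (fun u : ℝ => (max u 0) ^ (N + 1)) := by
  induction N with
  | zero =>
    simp only [Nat.cast_zero, zero_add, pow_one]
    exact contDiff_zero.2 (by fun_prop)
  | succ N ih =>
    have hd : deriv (fun u : ℝ => (max u 0) ^ (N + 2)) =
        fun u => ((N : ℝ) + 2) * (max u 0) ^ (N + 1) :=
      funext fun u => (hasDerivAt_max_zero_pow N u).deriv
    have := (contDiff_succ_iff_deriv (𝕜 := ℝ) (n := (N : WithTop ℕ∞))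
      (f := fun u : ℝ => (max u 0) ^ (N + 2)))
    have h2 := this.2 ⟨fun u => (hasDerivAt_max_zero_pow N u).differentiableAt, by simp, ?_⟩
    · exact_mod_cast h2
    · rw [hd]
      exact contDiff_const.mul ih

end TruncatedPower

/-! ### Decay and dilation of inverse Fourier transforms -/

section FourierDecay

variable {n : ℕ}

/-- Each integrable derivative of f buys one power of decay of the transform; compact support makes
all derivatives up to order N integrable. -/
lemma exists_bound_fourierInv_of_contDiff {f : Eu n → ℂ} {N : ℕ}
    (hf : ContDiff ℝ N f) (hs : HasCompactSupport f) :
    ∃ C : ℝ, 0 ≤ C ∧ ∀ x, ‖𝓕⁻ f x‖ ≤ C ∧ ‖x‖ ^ N * ‖𝓕⁻ f x‖ ≤ C := by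
  have hint : ∀ (k m : ℕ), k ≤ ((0 : ℕ∞)) → m ≤ ((N : ℕ∞)) →
      Integrable (fun v => ‖v‖ ^ k * ‖iteratedFDeriv ℝ m f v‖) := by
    intro k m _ hm
    have hm' : ((m : ℕ) : WithTop ℕ∞) ≤ N := by exact_mod_cast hm
    refine Continuous.integrable_of_hasCompactSupport ?_ ?_
    · exact (continuous_norm.pow k).mul (hf.continuous_iteratedFDeriv hm').norm
    · exact ((hs.iteratedFDeriv (𝕜 := ℝ) m).norm).mul_left
  have hfN : ContDiff ℝ ((N : ℕ∞) : WithTop ℕ∞) f := by exact_mod_cast hf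
  have key : ∀ m : ℕ, m ≤ N → ∃ C : ℝ, ∀ x, ‖x‖ ^ m * ‖𝓕⁻ f x‖ ≤ C := by
    intro m hm
    have := fun x => Real.pow_mul_norm_iteratedFDeriv_fourier_le (K := 0) hfN hint (k := 0)
      (n := m) le_rfl (by exact_mod_cast hm) (-x)
    simp only [norm_neg, norm_iteratedFDeriv_zero, ← Real.fourierInv_eq_fourier_neg] at this
    exact ⟨_, this⟩
  obtain ⟨C₁, h₁⟩ := key 0 (Nat.zero_le _)
  obtain ⟨C₂, h₂⟩ := key N le_rfl
  refine ⟨max (max C₁ C₂) 0, le_max_right _ _, fun x => ⟨?_, ?_⟩⟩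
  · exact le_trans (by simpa using h₁ x) (le_trans (le_max_left C₁ C₂) (le_max_left _ _))
  · exact (h₂ x).trans (le_trans (le_max_right C₁ C₂) (le_max_left _ _))

lemma fourierInv_comp_inv_smul (f : Eu n → ℂ) {c : ℝ} (hc : 0 < c) (x : Eu n) :
    𝓕⁻ (fun ξ => f (c⁻¹ • ξ)) x = (c : ℂ) ^ n * 𝓕⁻ f (c • x) := by
  rw [fourierInv_eq, fourierInv_eq]
  have := Measure.integral_comp_inv_smul_of_nonneg (volume : Measure (Eu n))
    (fun ξ => Real.fourierChar (inner ℝ ξ (c • x)) • f ξ) hc.le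
  simp only [finrank_euclideanSpace, Fintype.card_fin] at this
  have h2 : ∀ ξ : Eu n, inner ℝ (c⁻¹ • ξ) (c • x) = (inner ℝ ξ x : ℝ) := by
    intro ξ
    rw [real_inner_smul_left, real_inner_smul_right, ← mul_assoc, inv_mul_cancel₀ hc.ne', one_mul]
  simp only [h2] at this
  rw [this, Complex.real_smul]
  push_cast
  rfl

end FourierDecay

/-! ### The stretched exponential as a mixture of truncated powers -/

section Mixture

/-- The weight `s ^ (α - 1) Q(s ^ α) exp (-c s ^ α)`. -/
noncomputable def mixWeight (α c : ℝ) (Q : Polynomial ℝ) (s : ℝ) : ℝ :=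
  s ^ (α - 1) * (Q.eval (s ^ α) * Real.exp (-c * s ^ α))

lemma measurable_mixWeight (α c : ℝ) (Q : Polynomial ℝ) : Measurable (mixWeight α c Q) := by
  unfold mixWeight
  have h : Measurable fun s : ℝ => Q.eval (s ^ α) :=
    Q.continuous.measurable.comp (measurable_id.pow_const α)
  have h2 : Measurable fun s : ℝ => s ^ α := measurable_id.pow_const α
  have h3 : Measurable fun s : ℝ => s ^ (α - 1) := measurable_id.pow_const _
  fun_prop

lemma integrableOn_rpow_mul_mixWeight {α c γ : ℝ} (hα : 0 < α) (hc : 0 < c) (hγ : 0 < γ + α)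
    (Q : Polynomial ℝ) :
    IntegrableOn (fun s => s ^ γ * mixWeight α c Q s) (Ioi 0) := by
  unfold mixWeight
  induction Q using Polynomial.induction_on' with
  | add p q hp hq =>
    refine (hp.add hq).congr_fun (fun s _ => ?_) measurableSet_Ioi
    simp only [Pi.add_apply, Polynomial.eval_add]
    ring
  | monomial k a =>
    have := (integrableOn_rpow_mul_exp_neg_mul_rpow (p := α) (s := γ + (α - 1) + α * k) (b := c)
      (by nlinarith [mul_nonneg hα.le (Nat.cast_nonneg (α := ℝ) k)]) hα hc).const_mul a
    refine IntegrableOn.congr_fun this (fun s hs => ?_) measurableSet_Ioi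
    have hs : 0 < s := hs
    simp only [Polynomial.eval_monomial]
    rw [rpow_add hs, rpow_add hs, rpow_mul hs.le, Real.rpow_natCast]
    ring

/-- Whenever the derivative hits s^α or the exponential it produces α s^{α-1} = α s^α / s, so this
family of weights is stable under differentiation up to a factor 1/s and a new polynomial. This lets
integration by parts be iterated. -/
lemma hasDerivAt_mixWeight_div {α c s : ℝ} (hs : 0 < s) (M : ℕ) (Q : Polynomial ℝ) :
    HasDerivAt (fun s => s ^ (-(M : ℝ)) * mixWeight α c Q s) (-(s ^ (-(M + 1 : ℝ)) * mixWeight α c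
        (Polynomial.C (M + 1 - α) * Q - Polynomial.C α * Polynomial.X * Polynomial.derivative Q +
          Polynomial.C (c * α) * Polynomial.X * Q) s)) s := by
  have h1 : HasDerivAt (fun s : ℝ => s ^ (-(M : ℝ) + (α - 1)))
      ((-(M : ℝ) + (α - 1)) * s ^ (-(M : ℝ) + (α - 1) - 1)) s :=
    Real.hasDerivAt_rpow_const (Or.inl hs.ne')
  have h2 : HasDerivAt (fun s : ℝ => s ^ α) (α * s ^ (α - 1)) s :=
    Real.hasDerivAt_rpow_const (Or.inl hs.ne')
  have h3 : HasDerivAt (fun s : ℝ => Q.eval (s ^ α))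
      ((Polynomial.derivative Q).eval (s ^ α) * (α * s ^ (α - 1))) s :=
    HasDerivAt.comp (h₂ := fun y => Q.eval y) s (Q.hasDerivAt (s ^ α)) h2
  have h4 : HasDerivAt (fun s : ℝ => Real.exp (-c * s ^ α))
      (Real.exp (-c * s ^ α) * (-c * (α * s ^ (α - 1)))) s := (h2.const_mul (-c)).exp
  have h5 := h1.mul (h3.mul h4)
  refine (h5.congr_of_eventuallyEq ?_).congr_deriv ?_
  · filter_upwards [lt_mem_nhds hs] with u hu
    simp only [mixWeight, Pi.mul_apply]
    rw [rpow_add hu]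
    ring
  · have e1 : s ^ (-(M : ℝ) + (α - 1) - 1) = s ^ (-(M + 1 : ℝ)) * s ^ (α - 1) := by
      rw [← rpow_add hs]; congr 1; ring
    have e2 : s ^ (-(M : ℝ) + (α - 1)) * s ^ (α - 1) =
        s ^ (-(M + 1 : ℝ)) * s ^ (α - 1) * s ^ α := by
      rw [← rpow_add hs, ← rpow_add hs, ← rpow_add hs]; congr 1; ring
    simp only [mixWeight, Pi.mul_apply, Polynomial.eval_add, Polynomial.eval_sub, Polynomial.eval_mul,
      Polynomial.eval_C, Polynomial.eval_X, e1]
    linear_combination ((Polynomial.derivative Q).eval (s ^ α) * α - Q.eval (s ^ α) * c * α) *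
        Real.exp (-c * s ^ α) * e2

/-- `exp (-c λ ^ α)` as a mixture of truncated powers. -/
lemma exists_mixWeight {α c : ℝ} (hα : 0 < α) (hc : 0 < c) (M : ℕ) :
    ∃ Q : Polynomial ℝ, ∀ l : ℝ, 0 < l →
      IntegrableOn (fun s => (s - l) ^ M * (s ^ (-(M : ℝ)) * mixWeight α c Q s)) (Ioi l) ∧
      ∫ s in Ioi l, (s - l) ^ M * (s ^ (-(M : ℝ)) * mixWeight α c Q s) = Real.exp (-c * l ^ α) := by
  -- On (l, ∞) the bound (s - l)^M ≤ s^M absorbs the truncated power into s^γ.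
  have hInt : ∀ (M : ℕ) (Q : Polynomial ℝ) (γ : ℝ) (l : ℝ), 0 < l → -1 ≤ γ + M → 0 < γ + M + α →
      IntegrableOn (fun s => (s - l) ^ M * (s ^ γ * mixWeight α c Q s)) (Ioi l) := by
    intro M Q γ l hl _ hγ
    have := (integrableOn_rpow_mul_mixWeight hα hc (γ := γ + M) hγ Q).mono_set
      (Ioi_subset_Ioi hl.le)
    refine Integrable.mono this ?_ ?_
    · have := measurable_mixWeight α c Q
      have h3 : Measurable fun s : ℝ => s ^ γ := measurable_id.pow_const _
      exact Measurable.aestronglyMeasurable (by fun_prop)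
    · refine (ae_restrict_iff' measurableSet_Ioi).2 (.of_forall fun s hs => ?_)
      have hs' : 0 < s := hl.trans hs
      rw [← mul_assoc, norm_mul, norm_mul (s ^ (γ + M))]
      refine mul_le_mul_of_nonneg_right ?_ (norm_nonneg (mixWeight α c Q s))
      rw [norm_mul, Real.norm_eq_abs, Real.norm_eq_abs, Real.norm_eq_abs,
        abs_of_nonneg (pow_nonneg (sub_nonneg.2 (le_of_lt hs)) _), rpow_add hs',
        abs_of_nonneg (rpow_nonneg hs'.le _),
        abs_of_nonneg (mul_nonneg (rpow_nonneg hs'.le _) (rpow_nonneg hs'.le _)),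
        mul_comm, Real.rpow_natCast]
      gcongr
      · exact sub_nonneg.2 (le_of_lt hs)
      · linarith
  induction M with
  | zero =>
    -- For M = 0 the weight is the exact derivative of -exp(-c s^α).
    refine ⟨Polynomial.C (c * α), fun l hl => ?_⟩
    have h0 := hInt 0 (Polynomial.C (c * α)) (-((0 : ℕ) : ℝ)) l hl (by norm_num) (by simpa using hα)
    refine ⟨h0, ?_⟩
    have hd : ∀ s ∈ Ici l, HasDerivAt (fun s : ℝ => -Real.exp (-c * s ^ α))
        ((s - l) ^ 0 * (s ^ (-((0 : ℕ) : ℝ)) * mixWeight α c (Polynomial.C (c * α)) s)) s := by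
      intro s hs
      have hs' : 0 < s := hl.trans_le hs
      have h2 : HasDerivAt (fun s : ℝ => s ^ α) (α * s ^ (α - 1)) s :=
        Real.hasDerivAt_rpow_const (Or.inl hs'.ne')
      refine ((h2.const_mul (-c)).exp.neg).congr_deriv ?_
      simp only [mixWeight, Polynomial.eval_C, pow_zero, Nat.cast_zero, neg_zero, Real.rpow_zero]
      ring
    have ht : Tendsto (fun s : ℝ => -Real.exp (-c * s ^ α)) atTop (𝓝 0) := by
      have : Tendsto (fun s : ℝ => c * s ^ α) atTop atTop :=
        (tendsto_rpow_atTop hα).const_mul_atTop hc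
      have := (Real.tendsto_exp_neg_atTop_nhds_zero.comp this).neg
      simpa [Function.comp_def, neg_mul] using this
    rw [integral_Ioi_of_hasDerivAt_of_tendsto' hd h0 ht]
    ring
  | succ M ih =>
    obtain ⟨Q, hQ⟩ := ih
    set R : Polynomial ℝ := Polynomial.C (M + 1 - α) * Q -
      Polynomial.C α * Polynomial.X * Polynomial.derivative Q +
          Polynomial.C (c * α) * Polynomial.X * Q with hR
    -- Integration by parts: (s - l)^M is the derivative of (s - l)^{M+1}/(M+1), and R is the
    -- polynomial that appears in minus the derivative of the old weight. The boundary term at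
    -- infinity vanishes because it is integrable together with its derivative.
    refine ⟨Polynomial.C ((M + 1 : ℝ)⁻¹) * R, fun l hl => ?_⟩
    have hM : (M + 1 : ℝ) ≠ 0 := by positivity
    have hmw : ∀ s, mixWeight α c (Polynomial.C ((M + 1 : ℝ)⁻¹) * R) s =
        (M + 1 : ℝ)⁻¹ * mixWeight α c R s := by
      intro s
      simp only [mixWeight, Polynomial.eval_mul, Polynomial.eval_C]
      ring
    have h0 := hInt (M + 1) (Polynomial.C ((M + 1 : ℝ)⁻¹) * R) (-((M + 1 : ℕ) : ℝ)) l hl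
      (by simp) (by simpa using hα)
    refine ⟨h0, ?_⟩
    obtain ⟨hQ1, hQ2⟩ := hQ l hl
    have hd : ∀ s ∈ Ici l, HasDerivAt
        (fun s : ℝ => (M + 1 : ℝ)⁻¹ * ((s - l) ^ (M + 1) * (s ^ (-(M : ℝ)) * mixWeight α c Q s)))
        ((s - l) ^ M * (s ^ (-(M : ℝ)) * mixWeight α c Q s) - (s - l) ^ (M + 1) *
          (s ^ (-((M + 1 : ℕ) : ℝ)) * mixWeight α c (Polynomial.C ((M + 1 : ℝ)⁻¹) * R) s)) s := by
      intro s hs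
      have hs' : 0 < s := hl.trans_le hs
      have h1 : HasDerivAt (fun s : ℝ => (s - l) ^ (M + 1)) ((M + 1 : ℝ) * (s - l) ^ M) s := by
        have := ((hasDerivAt_id s).sub_const l).fun_pow (M + 1)
        simpa using this
      refine ((h1.mul (hasDerivAt_mixWeight_div hs' M Q)).const_mul (M + 1 : ℝ)⁻¹).congr_deriv ?_
      rw [hmw, ← hR]
      push_cast
      field_simp
      ring
    have hint' := hQ1.sub h0
    have h2 := (hInt (M + 1) Q (-(M : ℝ)) l hl (by push_cast; linarith)
      (by push_cast; linarith)).const_mul (M + 1 : ℝ)⁻¹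
    have ht := tendsto_zero_of_hasDerivAt_of_integrableOn_Ioi
      (fun s hs => hd s (Ioi_subset_Ici_self hs)) hint' h2
    have := integral_Ioi_of_hasDerivAt_of_tendsto' hd hint' ht
    rw [integral_sub hQ1 h0, hQ2] at this
    simp only [sub_self, ne_eq, Nat.add_eq_zero_iff, one_ne_zero, and_false, not_false_eq_true,
      zero_pow, zero_mul, mul_zero] at this
    linarith

end Mixture

/-! ### Decay of the kernels at time one -/

section KernelDecay

variable {n : ℕ}

/-- The symbol `exp (-t (2π|ξ|)^{2α})`. -/
noncomputable def symb (α t : ℝ) (ξ : Eu n) : ℂ := (Real.exp (-t * (2 * π * ‖ξ‖) ^ (2 * α)) : ℂ)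

/-- The truncated power `(1 - |ξ|^2)_+^M`. -/
noncomputable def truncPow (M : ℕ) (ξ : Eu n) : ℝ := (max (1 - ‖ξ‖ ^ 2) 0) ^ M

lemma contDiff_truncPow (N : ℕ) : ContDiff ℝ N (truncPow (n := n) (N + 1)) :=
  (contDiff_max_zero_pow N).comp (contDiff_const.sub (contDiff_norm_sq ℝ))

lemma truncPow_eq_zero {M : ℕ} (hM : M ≠ 0) {ξ : Eu n} (h : 1 ≤ ‖ξ‖) : truncPow M ξ = 0 := by
  have : 1 - ‖ξ‖ ^ 2 ≤ 0 := by nlinarith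
  rw [truncPow, max_eq_right this, zero_pow hM]

lemma hasCompactSupport_truncPow {M : ℕ} (hM : M ≠ 0) :
    HasCompactSupport (truncPow (n := n) M) := by
  refine HasCompactSupport.intro (isCompact_closedBall (0 : Eu n) 1)
    fun ξ hξ => truncPow_eq_zero hM ?_
  rw [mem_closedBall_zero_iff, not_le] at hξ
  exact hξ.le

/-- The mixture formula at l = |ξ|², where s^{-(M+1)} (s - |ξ|²)_+^{M+1} is a dilate of `truncPow`.
The singularity of the symbol at ξ = 0 is thereby moved into the behaviour of the weight as s → 0.
-/
lemma symb_eq_integral {α : ℝ} (hα : 0 < α) (M : ℕ) : ∃ Q : Polynomial ℝ, ∀ ξ : Eu n, ξ ≠ 0 →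
      symb α 1 ξ = ∫ s in Ioi (0 : ℝ), ((mixWeight α ((2 * π) ^ (2 * α)) Q s : ℝ) : ℂ) *
        (truncPow (M + 1) ((sqrt s)⁻¹ • ξ) : ℝ) := by
  have hc : 0 < (2 * π) ^ (2 * α) := rpow_pos_of_pos Real.two_pi_pos _
  obtain ⟨Q, hQ⟩ := exists_mixWeight hα hc (M + 1)
  refine ⟨Q, fun ξ hξ => ?_⟩
  have hξ' : 0 < ‖ξ‖ := norm_pos_iff.2 hξ
  have hl : 0 < ‖ξ‖ ^ 2 := by positivity
  have h1 := (hQ _ hl).2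
  have h2 : (‖ξ‖ ^ 2) ^ α = ‖ξ‖ ^ (2 * α) := by
    rw [← Real.rpow_natCast, ← rpow_mul (norm_nonneg _)]; norm_num
  have h3 : symb α 1 ξ = ((Real.exp (-(2 * π) ^ (2 * α) * (‖ξ‖ ^ 2) ^ α) : ℝ) : ℂ) := by
    rw [symb, h2, mul_rpow Real.two_pi_pos.le (norm_nonneg _)]
    congr 2
    ring
  rw [h3, ← h1]
  have h4 : ∀ s ∈ Ioi (0 : ℝ), ((mixWeight α ((2 * π) ^ (2 * α)) Q s : ℝ) : ℂ) *
        (truncPow (M + 1) ((sqrt s)⁻¹ • ξ) : ℝ) = (((Ioi (‖ξ‖ ^ 2)).indicator (fun s =>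
        (s - ‖ξ‖ ^ 2) ^ (M + 1) * (s ^ (-((M + 1 : ℕ) : ℝ)) *
          mixWeight α ((2 * π) ^ (2 * α)) Q s)) s : ℝ) : ℂ) := by
    intro s hs
    have hs : 0 < s := hs
    rw [← Complex.ofReal_mul]
    congr 1
    have h5 : ‖(sqrt s)⁻¹ • ξ‖ ^ 2 = ‖ξ‖ ^ 2 / s := by
      rw [norm_smul, mul_pow, norm_inv, Real.norm_eq_abs, abs_of_nonneg (Real.sqrt_nonneg _),
        inv_pow, Real.sq_sqrt hs.le]
      field_simp
    by_cases h : ‖ξ‖ ^ 2 < s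
    · rw [indicator_of_mem (mem_Ioi.2 h), truncPow, h5, max_eq_left, Real.rpow_neg hs.le,
        Real.rpow_natCast, mul_comm, ← mul_assoc]
      · congr 1
        rw [← inv_pow, ← mul_pow]
        congr 1
        field_simp
      · rw [sub_nonneg, div_le_one hs]
        exact h.le
    · rw [indicator_of_notMem (by simpa using h), truncPow, h5, max_eq_right, zero_pow (by simp),
        mul_zero]
      rw [sub_nonpos, one_le_div hs]
      exact not_lt.1 h
  rw [setIntegral_congr_fun measurableSet_Ioi h4, integral_complex_ofReal,
    setIntegral_indicator measurableSet_Ioi, inter_eq_self_of_subset_right (Ioi_subset_Ioi hl.le)]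

/-- A positively homogeneous smooth multiplier of degree `k`. -/
structure IsHomMul (ℓ : Eu n → ℂ) (k : ℕ) : Prop where
  contDiff : ∀ N : ℕ, ContDiff ℝ N ℓ
  hom : ∀ (c : ℝ), 0 < c → ∀ ξ, ℓ (c • ξ) = (c : ℂ) ^ k * ℓ ξ

/-- Each dilate of ℓ times the truncated power is C^{n+1} with compact support, so its transform
decays like |x|^{-(n+1)}. The dilation by √s contributes s^{(n+k)/2}, and using the decay at the
point √s x costs s^{-(n+1)/2}, so it remains to integrate s^{(k-1)/2} against the weight. -/
lemma exists_bound_fourierInv_symb (hn : 0 < n) {α : ℝ} (hα : 1 / 2 < α)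
    {ℓ : Eu n → ℂ} {k : ℕ} (hℓ : IsHomMul ℓ k) :
    Integrable (fun ξ => ℓ ξ * symb α 1 ξ) ∧
    ∃ C : ℝ, 0 ≤ C ∧ ∀ x, ‖𝓕⁻ (fun ξ => ℓ ξ * symb α 1 ξ) x‖ ≤ C ∧
      ‖x‖ ^ (n + 1) * ‖𝓕⁻ (fun ξ => ℓ ξ * symb α 1 ξ) x‖ ≤ C := by
  have hα0 : 0 < α := by linarith
  have hc : 0 < (2 * π) ^ (2 * α) := rpow_pos_of_pos Real.two_pi_pos _
  obtain ⟨Q, hQ⟩ := symb_eq_integral (n := n) hα0 (n + 1)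
  set w := mixWeight α ((2 * π) ^ (2 * α)) Q with hw
  set f : Eu n → ℂ := fun ξ => ℓ ξ * (truncPow (n + 1 + 1) ξ : ℝ) with hf
  have hfc : ContDiff ℝ ((n + 1 : ℕ) : WithTop ℕ∞) f :=
    (hℓ.contDiff _).mul (Complex.ofRealCLM.contDiff.comp (contDiff_truncPow (n + 1)))
  have hfs : HasCompactSupport f := by
    have : HasCompactSupport (fun ξ : Eu n =>
        ((truncPow (n + 1 + 1) ξ : ℝ) : ℂ)) :=
      (hasCompactSupport_truncPow (by simp)).comp_left (g := fun x : ℝ => (x : ℂ)) (by simp)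
    exact this.mul_left
  have hfi : Integrable f := hfc.continuous.integrable_of_hasCompactSupport hfs
  obtain ⟨C, hC0, hC⟩ := exists_bound_fourierInv_of_contDiff hfc hfs
  have hscale : ∀ s : ℝ, 0 < s → ∀ ξ : Eu n,
      ℓ ξ * (truncPow (n + 1 + 1) ((sqrt s)⁻¹ • ξ) : ℝ) =
        ((sqrt s : ℝ) : ℂ) ^ k * f ((sqrt s)⁻¹ • ξ) := by
    intro s hs ξ
    have h0 : 0 < sqrt s := Real.sqrt_pos.2 hs
    have := hℓ.hom _ h0 ((sqrt s)⁻¹ • ξ)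
    rw [smul_smul, mul_inv_cancel₀ h0.ne', one_smul] at this
    rw [this, hf]
    ring
  have hwm : Measurable w := measurable_mixWeight _ _ _
  set G : Eu n × ℝ → ℂ := fun z =>
    ((w z.2 : ℝ) : ℂ) * (ℓ z.1 * (truncPow (n + 1 + 1) ((sqrt z.2)⁻¹ • z.1) : ℝ)) with hG
  have htm : Measurable (truncPow (n := n) (n + 1 + 1)) := (contDiff_truncPow (n + 1)).continuous.measurable
  have hℓm : Measurable ℓ := (hℓ.contDiff 0).continuous.measurable
  have hGm : Measurable G := by
    have h1 : Measurable fun z : Eu n × ℝ =>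
        truncPow (n + 1 + 1) ((sqrt z.2)⁻¹ • z.1) := htm.comp (by fun_prop)
    have h2 : Measurable fun z : Eu n × ℝ => ℓ z.1 := hℓm.comp measurable_fst
    have h3 : Measurable fun z : Eu n × ℝ => w z.2 := hwm.comp measurable_snd
    have h4 : Measurable fun z : Eu n × ℝ => ((w z.2 : ℝ) : ℂ) := Complex.measurable_ofReal.comp h3
    have h5 : Measurable fun z : Eu n × ℝ =>
        ((truncPow (n + 1 + 1) ((sqrt z.2)⁻¹ • z.1) : ℝ) : ℂ) :=
      Complex.measurable_ofReal.comp h1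
    exact h4.mul (h2.mul h5)
  have hsq : ∀ s : ℝ, 0 < s → ∀ j : ℕ, (sqrt s) ^ j = s ^ ((j : ℝ) / 2) := by
    intro s hs j
    rw [Real.sqrt_eq_rpow, ← Real.rpow_natCast, ← rpow_mul hs.le]
    congr 1; ring
  -- The lowest exponent needed is -1/2, from (k - 1)/2 at k = 0. The weight behaves no worse than
  -- s^{α-1} near 0, and this is where α > 1/2 enters.
  have hwint : ∀ γ : ℝ, -(1 / 2) ≤ γ → IntegrableOn (fun s => s ^ γ * ‖w s‖) (Ioi 0) := by
    intro γ hγ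
    have := (integrableOn_rpow_mul_mixWeight (γ := γ) hα0 hc (by linarith) Q).norm
    refine IntegrableOn.congr_fun this (fun s hs => ?_) measurableSet_Ioi
    simp only [norm_mul]
    rw [norm_of_nonneg (rpow_nonneg (le_of_lt hs) _)]
  have hGi : Integrable G ((volume : Measure (Eu n)).prod (volume.restrict (Ioi (0 : ℝ)))) := by
    rw [integrable_prod_iff' hGm.aestronglyMeasurable]
    have hsl : ∀ s : ℝ, 0 < s → ∀ ξ, G (ξ, s) =
        ((w s : ℝ) : ℂ) * (((sqrt s : ℝ) : ℂ) ^ k * f ((sqrt s)⁻¹ • ξ)) := by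
      intro s hs ξ
      simp only [hG]
      rw [hscale s hs]
    constructor
    · refine (ae_restrict_iff' measurableSet_Ioi).2 (.of_forall fun s hs => ?_)
      have hs : 0 < s := hs
      simp only [hsl s hs]
      refine Integrable.const_mul (Integrable.const_mul ?_ _) _
      exact hfi.comp_smul (inv_ne_zero (Real.sqrt_pos.2 hs).ne')
    · have : IntegrableOn (fun s => (∫ ξ, ‖f ξ‖) * (s ^ (((n + k : ℕ) : ℝ) / 2) * ‖w s‖)) (Ioi 0) :=
        (hwint _ (by have : (0 : ℝ) ≤ ((n + k : ℕ) : ℝ) / 2 := by positivity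
                     linarith)).const_mul _
      refine IntegrableOn.congr_fun this (fun s hs => ?_) measurableSet_Ioi
      have hs : 0 < s := hs
      simp only [hsl s hs, norm_mul, norm_pow, Complex.norm_real, Real.norm_eq_abs,
        abs_of_nonneg (Real.sqrt_nonneg s)]
      rw [integral_const_mul, integral_const_mul,
        Measure.integral_comp_inv_smul_of_nonneg volume (fun ξ => ‖f ξ‖) (Real.sqrt_nonneg s),
        finrank_euclideanSpace, Fintype.card_fin, smul_eq_mul, ← hsq s hs, pow_add]
      ring
  have hne : ∀ᵐ ξ : Eu n, ξ ≠ 0 := by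
    have : Nonempty (Fin n) := ⟨⟨0, hn⟩⟩
    have : Nontrivial (Eu n) := inferInstance
    exact Measure.ae_ne volume 0
  have hmix : ∀ ξ : Eu n, ξ ≠ 0 → ℓ ξ * symb α 1 ξ = ∫ s in Ioi (0 : ℝ), G (ξ, s) := by
    intro ξ hξ
    rw [hQ ξ hξ, ← integral_const_mul]
    refine integral_congr_ae (.of_forall fun s => ?_)
    simp only [hG, hw]
    ring
  refine ⟨hGi.integral_prod_left.congr ?_, ?_⟩
  · filter_upwards [hne] with ξ hξ using (hmix ξ hξ).symm
  have key : ∀ x, 𝓕⁻ (fun ξ => ℓ ξ * symb α 1 ξ) x = ∫ s in Ioi (0 : ℝ),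
      ((w s : ℝ) : ℂ) * (((sqrt s : ℝ) : ℂ) ^ (n + k) * 𝓕⁻ f (sqrt s • x)) := by
    intro x
    calc 𝓕⁻ (fun ξ => ℓ ξ * symb α 1 ξ) x
        = ∫ ξ, ∫ s in Ioi (0 : ℝ), (Real.fourierChar (inner ℝ ξ x)) • G (ξ, s) := by
          rw [fourierInv_eq]
          refine integral_congr_ae ?_
          filter_upwards [hne] with ξ hξ
          simp only [Circle.smul_def, smul_eq_mul]
          rw [integral_const_mul, hmix ξ hξ]
      _ = ∫ s in Ioi (0 : ℝ), ∫ ξ, (Real.fourierChar (inner ℝ ξ x)) • G (ξ, s) := by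
          refine integral_integral_swap ?_
          refine hGi.mono ?_ (.of_forall fun z => ?_)
          · have h1 : Continuous fun z : Eu n × ℝ =>
                ((Real.fourierChar (inner ℝ z.1 x) : Circle) : ℂ) := by
              have := Real.continuous_fourierChar
              fun_prop
            exact (h1.measurable.mul hGm).aestronglyMeasurable
          · simp [uncurry]
      _ = _ := by
          refine setIntegral_congr_fun measurableSet_Ioi fun s hs => ?_
          have hs : 0 < s := hs
          have h0 : 0 < sqrt s := Real.sqrt_pos.2 hs
          rw [← fourierInv_eq]
          have h1 : (fun ξ => G (ξ, s)) = fun ξ =>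
              (((w s : ℝ) : ℂ) * ((sqrt s : ℝ) : ℂ) ^ k) * f ((sqrt s)⁻¹ • ξ) := by
            funext ξ
            simp only [hG]
            rw [hscale s hs]
            ring
          have h2 := fourierInv_comp_inv_smul f h0 x
          rw [h1, fourierInv_eq]
          rw [fourierInv_eq] at h2
          rw [pow_add]
          calc _ = (((w s : ℝ) : ℂ) * ((sqrt s : ℝ) : ℂ) ^ k) * ∫ v : Eu n,
                Real.fourierChar (inner ℝ v x) • f ((sqrt s)⁻¹ • v) := by
                rw [← integral_const_mul]
                congr 1
                funext v
                simp only [Circle.smul_def, smul_eq_mul]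
                ring
            _ = _ := by rw [h2]; ring
  have hbd : ∀ x, ∀ s : ℝ, 0 < s →
      ‖((w s : ℝ) : ℂ) * (((sqrt s : ℝ) : ℂ) ^ (n + k) * 𝓕⁻ f (sqrt s • x))‖ =
        s ^ (((n + k : ℕ) : ℝ) / 2) * ‖w s‖ * ‖𝓕⁻ f (sqrt s • x)‖ := by
    intro x s hs
    rw [norm_mul, norm_mul, norm_pow, Complex.norm_real, Complex.norm_real,
      norm_of_nonneg (Real.sqrt_nonneg s), hsq s hs]
    ring
  have hk0 : (0 : ℝ) ≤ ((n + k : ℕ) : ℝ) / 2 := by positivity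
  set C₁ := ∫ s in Ioi (0 : ℝ), s ^ (((n + k : ℕ) : ℝ) / 2) * ‖w s‖ * C with hC₁
  set C₂ := ∫ s in Ioi (0 : ℝ), s ^ (((k : ℝ) - 1) / 2) * ‖w s‖ * C with hC₂
  have hi₁ : IntegrableOn (fun s => s ^ (((n + k : ℕ) : ℝ) / 2) * ‖w s‖ * C) (Ioi 0) :=
    (hwint _ (by linarith)).mul_const _
  have hi₂ : IntegrableOn (fun s => s ^ (((k : ℝ) - 1) / 2) * ‖w s‖ * C) (Ioi 0) :=
    (hwint _ (by have : (0 : ℝ) ≤ k := Nat.cast_nonneg _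
                 linarith)).mul_const _
  refine ⟨max (max C₁ C₂) 0, le_max_right _ _, fun x => ⟨?_, ?_⟩⟩
  · rw [key x]
    refine le_trans (norm_integral_le_of_norm_le hi₁ ?_) (le_trans (le_max_left C₁ C₂) (le_max_left _ _))
    refine (ae_restrict_iff' measurableSet_Ioi).2 (.of_forall fun s hs => ?_)
    rw [hbd x s hs]
    refine mul_le_mul_of_nonneg_left (hC _).1 ?_
    exact mul_nonneg (rpow_nonneg (le_of_lt hs) _) (norm_nonneg _)
  · rw [key x]
    have h1 : ‖x‖ ^ (n + 1) * ‖∫ s in Ioi (0 : ℝ),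
        ((w s : ℝ) : ℂ) * (((sqrt s : ℝ) : ℂ) ^ (n + k) * 𝓕⁻ f (sqrt s • x))‖ =
        ‖∫ s in Ioi (0 : ℝ), ((‖x‖ ^ (n + 1) : ℝ) : ℂ) * (((w s : ℝ) : ℂ) *
          (((sqrt s : ℝ) : ℂ) ^ (n + k) * 𝓕⁻ f (sqrt s • x)))‖ := by
      rw [integral_const_mul, norm_mul, Complex.norm_real, norm_of_nonneg (by positivity)]
    rw [h1]
    refine le_trans (norm_integral_le_of_norm_le hi₂ ?_) (le_trans (le_max_right C₁ C₂) (le_max_left _ _))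
    refine (ae_restrict_iff' measurableSet_Ioi).2 (.of_forall fun s hs => ?_)
    have hs : 0 < s := hs
    have h0 : 0 < sqrt s := Real.sqrt_pos.2 hs
    rw [norm_mul, hbd x s hs, Complex.norm_real, norm_of_nonneg (by positivity)]
    have h3 := (hC (sqrt s • x)).2
    rw [norm_smul, mul_pow, norm_of_nonneg h0.le, hsq s hs] at h3
    have h4 : s ^ (((n + k : ℕ) : ℝ) / 2) =
        s ^ (((k : ℝ) - 1) / 2) * s ^ (((n + 1 : ℕ) : ℝ) / 2) := by
      rw [← rpow_add hs]; congr 1; push_cast; ring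
    rw [h4]
    calc _ = s ^ (((k : ℝ) - 1) / 2) * ‖w s‖ *
          (s ^ (((n + 1 : ℕ) : ℝ) / 2) * ‖x‖ ^ (n + 1) * ‖𝓕⁻ f (sqrt s • x)‖) := by ring
      _ ≤ _ := mul_le_mul_of_nonneg_left h3 (mul_nonneg (rpow_nonneg hs.le _) (norm_nonneg _))

end KernelDecay

/-! ### Scaling, convolution and differentiation of the kernels -/

section SymbolKernel

variable {n : ℕ}

/-- The inverse Fourier transform of `ℓ(ξ) exp (-t (2π|ξ|)^{2α})`. -/
noncomputable def symK (ℓ : Eu n → ℂ) (α t : ℝ) (x : Eu n) : ℂ := 𝓕⁻ (fun ξ => ℓ ξ * symb α t ξ) x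

/-- The symbol of the directional derivative along `a`. -/
noncomputable def dirSymb (a ξ : Eu n) : ℂ := 2 * π * Complex.I * ((inner ℝ ξ a : ℝ) : ℂ)

lemma isHomMul_one : IsHomMul (n := n) (fun _ => 1) 0 :=
  ⟨fun _ => contDiff_const, fun c _ ξ => by simp⟩

lemma isHomMul_dirSymb (a : Eu n) : IsHomMul (dirSymb a) 1 := by
  refine ⟨fun N => ?_, fun c _ ξ => ?_⟩
  · have h : ContDiff ℝ N fun ξ : Eu n => (inner ℝ ξ a : ℝ) := contDiff_id.inner ℝ contDiff_const
    exact contDiff_const.mul (Complex.ofRealCLM.contDiff.comp h)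
  · simp only [dirSymb, real_inner_smul_left]
    push_cast
    ring

lemma isHomMul_norm_sq : IsHomMul (n := n) (fun ξ => ((‖ξ‖ ^ 2 : ℝ) : ℂ)) 2 := by
  refine ⟨fun N => Complex.ofRealCLM.contDiff.comp (contDiff_norm_sq ℝ), fun c hc ξ => ?_⟩
  rw [norm_smul, norm_of_nonneg hc.le]
  push_cast
  ring

lemma symb_eq_symb_one {α t : ℝ} (hα : 0 < α) (ht : 0 < t) (ξ : Eu n) :
    symb α t ξ = symb α 1 ((t ^ (-(1 / (2 * α))))⁻¹ • ξ) := by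
  have h0 : 0 < t ^ (-(1 / (2 * α))) := rpow_pos_of_pos ht _
  have h1 : (t ^ (-(1 / (2 * α))))⁻¹ = t ^ (1 / (2 * α)) := by
    rw [← Real.rpow_neg ht.le, neg_neg]
  rw [symb, symb, h1, norm_smul, norm_of_nonneg (rpow_nonneg ht.le _)]
  congr 2
  rw [show 2 * π * (t ^ (1 / (2 * α)) * ‖ξ‖) = t ^ (1 / (2 * α)) * (2 * π * ‖ξ‖) by ring,
    mul_rpow (rpow_nonneg ht.le _) (by positivity), ← rpow_mul ht.le]
  have : 1 / (2 * α) * (2 * α) = 1 := by field_simp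
  rw [this, Real.rpow_one]
  ring

lemma mul_symb_eq {α t : ℝ} (hα : 0 < α) (ht : 0 < t) {ℓ : Eu n → ℂ} {k : ℕ} (hℓ : IsHomMul ℓ k) :
    (fun ξ => ℓ ξ * symb α t ξ) = fun ξ => ((t ^ (-(1 / (2 * α))) : ℝ) : ℂ) ^ k *
      (fun ξ => ℓ ξ * symb α 1 ξ) ((t ^ (-(1 / (2 * α))))⁻¹ • ξ) := by
  have h0 : 0 < t ^ (-(1 / (2 * α))) := rpow_pos_of_pos ht _
  funext ξ
  have := hℓ.hom _ h0 ((t ^ (-(1 / (2 * α))))⁻¹ • ξ)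
  rw [smul_smul, mul_inv_cancel₀ h0.ne', one_smul] at this
  simp only
  rw [this, symb_eq_symb_one hα ht]
  ring

lemma symK_scaling {α t : ℝ} (hα : 0 < α) (ht : 0 < t) {ℓ : Eu n → ℂ} {k : ℕ}
    (hℓ : IsHomMul ℓ k) (x : Eu n) :
    symK ℓ α t x = ((t ^ (-(1 / (2 * α))) : ℝ) : ℂ) ^ (n + k) *
      symK ℓ α 1 (t ^ (-(1 / (2 * α))) • x) := by
  have h0 : 0 < t ^ (-(1 / (2 * α))) := rpow_pos_of_pos ht _
  have h := fourierInv_comp_inv_smul (fun ξ => ℓ ξ * symb α 1 ξ) h0 x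
  rw [symK, mul_symb_eq hα ht hℓ, fourierInv_eq]
  rw [fourierInv_eq] at h
  simp only [Circle.smul_def, smul_eq_mul] at h ⊢
  rw [symK, pow_add, mul_comm (_ ^ n), mul_assoc, ← h, ← integral_const_mul]
  congr 1
  funext v
  ring

lemma integrable_mul_symb (hn : 0 < n) {α t : ℝ} (hα : 1 / 2 < α) (ht : 0 < t)
    {ℓ : Eu n → ℂ} {k : ℕ} (hℓ : IsHomMul ℓ k) :
    Integrable (fun ξ => ℓ ξ * symb α t ξ) := by
  have h0 : 0 < t ^ (-(1 / (2 * α))) := rpow_pos_of_pos ht _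
  rw [mul_symb_eq (by linarith) ht hℓ]
  exact ((exists_bound_fourierInv_symb hn hα hℓ).1.comp_smul (inv_ne_zero h0.ne')).const_mul _

lemma continuous_symb {α : ℝ} (hα : 0 < α) (t : ℝ) : Continuous (symb (n := n) α t) := by
  have : Continuous fun ξ : Eu n => (2 * π * ‖ξ‖) ^ (2 * α) :=
    (continuous_const.mul continuous_norm).rpow_const fun _ => Or.inr (by linarith)
  exact Complex.continuous_ofReal.comp (Real.continuous_exp.comp (continuous_const.mul this))

lemma continuous_fourierInv {f : Eu n → ℂ} (hf : Integrable f) : Continuous (𝓕⁻ f) := by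
  have h : Continuous (𝓕 f) := VectorFourier.fourierIntegral_continuous Real.continuous_fourierChar
    (by exact continuous_inner) hf
  have : 𝓕⁻ f = fun x => 𝓕 f (-x) := funext fun x => Real.fourierInv_eq_fourier_neg f x
  rw [this]
  exact h.comp continuous_neg

/-- Boundedness and decay of order n + 1 at time one combine into (1 + |x|)^{-(n+1)}, and parabolic
scaling transports this to time t. The degree k of the multiplier accounts for the factor on the
left: k = 0 yields K_t and k = 1 yields (a·∇)K_t. -/
lemma exists_bound_symK (hn : 0 < n) {α : ℝ} (hα : 1 / 2 < α)
    {ℓ : Eu n → ℂ} {k : ℕ} (hℓ : IsHomMul ℓ k) :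
    ∃ C : ℝ, 0 < C ∧ ∀ t, 0 < t → ∀ x : Eu n,
      (t ^ (1 / (2 * α))) ^ k * ‖symK ℓ α t x‖ ≤
        C * (t ^ (1 / (2 * α)) * ((t ^ (1 / (2 * α)) + ‖x‖) ^ (n + 1))⁻¹) := by
  obtain ⟨C, hC0, hC⟩ := (exists_bound_fourierInv_symb hn hα hℓ).2
  have hone : ∀ y, ‖symK ℓ α 1 y‖ * (1 + ‖y‖) ^ (n + 1) ≤ 2 ^ n * (2 * C) := by
    intro y
    have h1 := add_pow_le zero_le_one (norm_nonneg y) (n + 1)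
    simp only [one_pow, Nat.add_one_sub_one] at h1
    calc ‖symK ℓ α 1 y‖ * (1 + ‖y‖) ^ (n + 1)
        ≤ ‖symK ℓ α 1 y‖ * (2 ^ n * (1 + ‖y‖ ^ (n + 1))) :=
          mul_le_mul_of_nonneg_left h1 (norm_nonneg _)
      _ = 2 ^ n * (‖symK ℓ α 1 y‖ + ‖y‖ ^ (n + 1) * ‖symK ℓ α 1 y‖) := by ring
      _ ≤ 2 ^ n * (2 * C) := by
          have h2 := hC y
          refine mul_le_mul_of_nonneg_left ?_ (by positivity)
          rw [symK]
          linarith [h2.1, h2.2]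
  refine ⟨2 ^ n * (2 * C) + 1, by positivity, fun t ht x => ?_⟩
  have hT : 0 < t ^ (1 / (2 * α)) := rpow_pos_of_pos ht _
  have hc : t ^ (-(1 / (2 * α))) = (t ^ (1 / (2 * α)))⁻¹ := Real.rpow_neg ht.le _
  rw [symK_scaling (by linarith) ht hℓ, hc, norm_mul, norm_pow, Complex.norm_real]
  set T := t ^ (1 / (2 * α)) with hTd
  rw [norm_of_nonneg (inv_nonneg.2 hT.le)]
  have h := hone (T⁻¹ • x)
  have hpos : 0 < T + ‖x‖ := add_pos_of_pos_of_nonneg hT (norm_nonneg _)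
  have e1 : 1 + ‖T⁻¹ • x‖ = T⁻¹ * (T + ‖x‖) := by
    rw [norm_smul, norm_of_nonneg (inv_nonneg.2 hT.le)]
    field_simp
  rw [e1, mul_pow] at h
  have hp : 0 < (T + ‖x‖) ^ (n + 1) := pow_pos hpos _
  rw [← mul_assoc _ T, ← div_eq_mul_inv, le_div_iff₀ hp]
  calc T ^ k * (T⁻¹ ^ (n + k) * ‖symK ℓ α 1 (T⁻¹ • x)‖) * (T + ‖x‖) ^ (n + 1)
      = ‖symK ℓ α 1 (T⁻¹ • x)‖ * (T⁻¹ ^ (n + 1) * (T + ‖x‖) ^ (n + 1)) * T := by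
        simp only [inv_pow, pow_add, pow_one]
        field_simp
    _ ≤ (2 ^ n * (2 * C) + 1) * T := by
        refine mul_le_mul_of_nonneg_right ?_ hT.le
        linarith

/-- A Hermitian symbol has a real inverse transform, so nothing is lost when the kernels are defined
through real parts; identities can be proved for complex transforms and read back. -/
lemma conj_symK {α t : ℝ} {ℓ : Eu n → ℂ} (hℓ : ∀ ξ, (starRingEnd ℂ) (ℓ (-ξ)) = ℓ ξ) (x : Eu n) :
    ((symK ℓ α t x).re : ℂ) = symK ℓ α t x := by
  rw [← Complex.conj_eq_iff_re, symK, fourierInv_eq, ← integral_conj, ← integral_neg_eq_self]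
  congr 1
  funext ξ
  simp only [Circle.smul_def, smul_eq_mul, map_mul, hℓ]
  have h1 : (starRingEnd ℂ) (symb α t (-ξ)) = symb α t ξ := by
    simp only [symb, norm_neg, Complex.conj_ofReal]
  rw [h1, inner_neg_left, AddChar.map_neg_eq_inv, Circle.coe_inv_eq_conj, Complex.conj_conj]

lemma conj_dirSymb (a ξ : Eu n) : (starRingEnd ℂ) (dirSymb a (-ξ)) = dirSymb a ξ := by
  have : (starRingEnd ℂ) 2 = 2 := Complex.conj_ofNat 2
  simp [dirSymb, inner_neg_left, this]

lemma kernel_eq_re_symK (α t : ℝ) (x : Eu n) : kernel n α t x = (symK (fun _ => 1) α t x).re := by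
  simp only [kernel, symK, symb, one_mul]

lemma ofReal_kernel (α t : ℝ) (x : Eu n) :
    ((kernel n α t x : ℝ) : ℂ) = symK (fun _ => 1) α t x := by
  rw [kernel_eq_re_symK, conj_symK (by simp)]

/-- Differentiation under the Fourier integral requires |ξ| times the symbol to be integrable. As
|ξ| is not a smooth multiplier, it is dominated by 1 + |ξ|², whose two terms are. -/
lemma hasFDerivAt_kernel (hn : 0 < n) {α t : ℝ} (hα : 1 / 2 < α) (ht : 0 < t) (a x : Eu n) :
    DifferentiableAt ℝ (kernel n α t) x ∧ derivKernel α a t x = (symK (dirSymb a) α t x).re := by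
  have hi : Integrable (symb (n := n) α t) := by
    simpa using integrable_mul_symb hn hα ht isHomMul_one
  have hi2 : Integrable (fun ξ : Eu n => ‖ξ‖ * ‖symb α t ξ‖) := by
    have h := hi.norm.add (integrable_mul_symb hn hα ht isHomMul_norm_sq).norm
    refine h.mono ?_ (.of_forall fun ξ => ?_)
    · exact (continuous_norm.mul (continuous_symb (by linarith) t).norm).aestronglyMeasurable
    · simp only [norm_mul, norm_norm, Pi.add_apply, Complex.norm_real, norm_pow]
      rw [norm_of_nonneg (by positivity)]
      nlinarith [norm_nonneg (symb α t ξ), norm_nonneg ξ, sq_nonneg (‖ξ‖ - 1)]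
  have hneg : HasFDerivAt (fun y : Eu n => -y)
      (-ContinuousLinearMap.id ℝ (Eu n)) x := (hasFDerivAt_id x).neg
  have h1 := (Real.hasFDerivAt_fourier hi hi2 (-x)).comp x hneg
  have h2 := (Complex.reCLM.hasFDerivAt).comp x h1
  have h3 : kernel n α t = Complex.reCLM ∘ (𝓕 (symb (n := n) α t) ∘ fun y => -y) := by
    funext y
    simp only [kernel, Function.comp_apply, Complex.reCLM_apply]
    rw [Real.fourierInv_eq_fourier_neg]
    rfl
  rw [← h3] at h2
  refine ⟨h2.differentiableAt, ?_⟩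
  rw [derivKernel, h2.fderiv]
  simp only [ContinuousLinearMap.comp_apply, neg_apply,
    ContinuousLinearMap.id_apply, map_neg, Complex.reCLM_apply]
  have hint : Integrable (VectorFourier.fourierSMulRight (innerSL ℝ) (symb (n := n) α t)) := by
    refine ((hi2.const_mul (2 * π * ‖innerSL (E := Eu n) ℝ‖))).mono'
      hi.aestronglyMeasurable.fourierSMulRight (.of_forall fun v => ?_)
    exact (VectorFourier.norm_fourierSMulRight_le _ _ _).trans_eq (by ring)
  rw [Real.fourier_continuousLinearMap_apply hint, symK, Real.fourierInv_eq_fourier_neg,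
    Real.fourier_eq, Real.fourier_eq]
  rw [← Complex.neg_re, ← integral_neg]
  congr 2
  funext v
  simp only [VectorFourier.fourierSMulRight_apply, Circle.smul_def, dirSymb, smul_eq_mul]
  have hin : ((innerSL ℝ) v) a = inner ℝ v a := rfl
  simp only [Complex.real_smul, hin]
  ring

lemma ofReal_derivKernel (hn : 0 < n) {α t : ℝ} (hα : 1 / 2 < α) (ht : 0 < t) (a x : Eu n) :
    ((derivKernel α a t x : ℝ) : ℂ) = symK (dirSymb a) α t x := by
  rw [(hasFDerivAt_kernel hn hα ht a x).2, conj_symK (conj_dirSymb a)]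

lemma integrable_inv_add_norm_pow {T : ℝ} (hT : 0 < T) :
    Integrable (fun x : Eu n => ((T + ‖x‖) ^ (n + 1))⁻¹) := by
  have h := (integrable_one_add_norm (E := Eu n) (μ := volume)
    (r := ((n + 1 : ℕ) : ℝ)) (by simp)).const_mul (((min T 1) ^ (n + 1))⁻¹)
  refine h.mono' ?_ (.of_forall fun x => ?_)
  · exact Measurable.aestronglyMeasurable (by fun_prop)
  · have hm : 0 < min T 1 := lt_min hT one_pos
    have h0 := norm_nonneg x
    rw [norm_of_nonneg (by positivity), Real.rpow_neg (by positivity), Real.rpow_natCast,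
      ← mul_inv, ← mul_pow]
    refine inv_anti₀ (by positivity) (pow_le_pow_left₀ (by positivity) ?_ _)
    nlinarith [min_le_left T 1, min_le_right T 1]

lemma continuous_symK (hn : 0 < n) {α t : ℝ} (hα : 1 / 2 < α) (ht : 0 < t)
    {ℓ : Eu n → ℂ} {k : ℕ} (hℓ : IsHomMul ℓ k) : Continuous (symK ℓ α t) :=
  continuous_fourierInv (integrable_mul_symb hn hα ht hℓ)

lemma integrable_symK (hn : 0 < n) {α t : ℝ} (hα : 1 / 2 < α) (ht : 0 < t)
    {ℓ : Eu n → ℂ} {k : ℕ} (hℓ : IsHomMul ℓ k) : Integrable (symK ℓ α t) := by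
  obtain ⟨C, -, hC⟩ := exists_bound_symK hn hα hℓ
  have hT : 0 < t ^ (1 / (2 * α)) := rpow_pos_of_pos ht _
  refine (((integrable_inv_add_norm_pow hT).const_mul (t ^ (1 / (2 * α)))).const_mul
    (((t ^ (1 / (2 * α))) ^ k)⁻¹ * C)).mono'
    (continuous_symK hn hα ht hℓ).aestronglyMeasurable (.of_forall fun x => ?_)
  rw [mul_assoc, inv_mul_eq_div, le_div_iff₀ (by positivity), mul_comm]
  exact hC t ht x

lemma integrable_fourier_of_fourierInv {f : Eu n → ℂ}
    (hf : Integrable (𝓕⁻ f)) : Integrable (𝓕 f) := by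
  have : 𝓕 f = fun x => 𝓕⁻ f (-x) := by
    funext x
    rw [Real.fourierInv_eq_fourier_neg, neg_neg]
  rw [this]
  exact hf.comp_neg

lemma fourier_symK (hn : 0 < n) {α t : ℝ} (hα : 1 / 2 < α) (ht : 0 < t)
    {ℓ : Eu n → ℂ} {k : ℕ} (hℓ : IsHomMul ℓ k) :
    𝓕 (symK ℓ α t) = fun ξ => ℓ ξ * symb α t ξ :=
  ((hℓ.contDiff 0).continuous.mul (continuous_symb (by linarith) t)).fourier_fourierInv_eq
    (integrable_mul_symb hn hα ht hℓ)
    (integrable_fourier_of_fourierInv (integrable_symK hn hα ht hℓ))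

/-- On the Fourier side the symbols multiply and the times add; the convolution is continuous and
integrable, so Fourier inversion identifies it. Keeping ℓ on one factor covers both K_t * K_s and
K_t * (a·∇)K_s. -/
lemma symK_convolution (hn : 0 < n) {α t s : ℝ} (hα : 1 / 2 < α) (ht : 0 < t) (hs : 0 < s)
    {ℓ : Eu n → ℂ} {k : ℕ} (hℓ : IsHomMul ℓ k) (x : Eu n) :
    ∫ y, symK (fun _ => 1) α t y * symK ℓ α s (x - y) = symK ℓ α (t + s) x := by
  have hi1 := integrable_symK hn hα ht isHomMul_one
  have hi2 := integrable_symK hn hα hs hℓ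
  have hc2 := continuous_symK hn hα hs hℓ
  set L := ContinuousLinearMap.mul ℂ ℂ with hL
  have hbdd : BddAbove (range fun x => ‖symK ℓ α s x‖) := by
    refine ⟨∫ ξ, ‖ℓ ξ * symb α s ξ‖, ?_⟩
    rintro _ ⟨x, rfl⟩
    simp only
    rw [symK, fourierInv_eq]
    refine (norm_integral_le_integral_norm _).trans_eq ?_
    congr 1
    funext ξ
    rw [Circle.norm_smul]
  have hcont : Continuous (symK (fun _ => 1) α t ⋆[L] symK ℓ α s) :=
    BddAbove.continuous_convolution_right_of_integrable L hbdd hi1 hc2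
  have hint : Integrable (symK (fun _ => 1) α t ⋆[L] symK ℓ α s) := hi1.integrable_convolution L hi2
  have hF : 𝓕 (symK (fun _ => 1) α t ⋆[L] symK ℓ α s) = fun ξ => ℓ ξ * symb α (t + s) ξ := by
    funext ξ
    rw [Real.fourier_mul_convolution_eq hi1 hi2, fourier_symK hn hα ht isHomMul_one,
      fourier_symK hn hα hs hℓ]
    simp only [one_mul, symb]
    rw [mul_left_comm, ← Complex.ofReal_mul, ← Real.exp_add]
    congr 3
    ring
  have := hcont.fourierInv_fourier_eq hint
    (by rw [hF]; exact integrable_mul_symb hn hα (add_pos ht hs) hℓ)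
  rw [hF] at this
  exact (congrFun this x).symm

lemma integral_symK_one (hn : 0 < n) {α t : ℝ} (hα : 1 / 2 < α) (ht : 0 < t) :
    ∫ y, symK (n := n) (fun _ => 1) α t y = 1 := by
  have h := congrFun (fourier_symK hn hα ht isHomMul_one) 0
  rw [Real.fourier_eq] at h
  simpa [symb, Real.zero_rpow (by linarith : 2 * α ≠ 0)] using h

end SymbolKernel

/-! ### Bounds and identities for K_t and (a·∇)K_t -/

section Kernel

variable {n : ℕ}

lemma exists_kernel_bound (hn : 0 < n) {α : ℝ} (hα : 1 / 2 < α) :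
    ∃ C : ℝ, 0 < C ∧ ∀ t, 0 < t → ∀ x : Eu n,
      |kernel n α t x| ≤ C * (t ^ (1 / (2 * α)) * ((t ^ (1 / (2 * α)) + ‖x‖) ^ (n + 1))⁻¹) := by
  obtain ⟨C, hC0, hC⟩ := exists_bound_symK hn hα isHomMul_one
  refine ⟨C, hC0, fun t ht x => ?_⟩
  have := hC t ht x
  rwa [← ofReal_kernel, Complex.norm_real, pow_zero, one_mul] at this

lemma exists_derivKernel_bound (hn : 0 < n) {α : ℝ} (hα : 1 / 2 < α) (a : Eu n) :
    ∃ C : ℝ, 0 < C ∧ ∀ t, 0 < t → ∀ x : Eu n,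
      |derivKernel α a t x| ≤ C * ((t ^ (1 / (2 * α)) + ‖x‖) ^ (n + 1))⁻¹ := by
  obtain ⟨C, hC0, hC⟩ := exists_bound_symK hn hα (isHomMul_dirSymb a)
  refine ⟨C, hC0, fun t ht x => ?_⟩
  have hT : 0 < t ^ (1 / (2 * α)) := rpow_pos_of_pos ht _
  have := hC t ht x
  rw [← ofReal_derivKernel hn hα ht, Complex.norm_real, pow_one, mul_left_comm] at this
  exact le_of_mul_le_mul_left this hT

/-- By scaling, joint continuity in (t, x) reduces to continuity in x at time one. It later supplies
joint measurability of the kernels and their continuity in time. -/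
lemma continuousOn_symK (hn : 0 < n) {α : ℝ} (hα : 1 / 2 < α)
    {ℓ : Eu n → ℂ} {k : ℕ} (hℓ : IsHomMul ℓ k) :
    ContinuousOn (fun z : ℝ × Eu n => symK ℓ α z.1 z.2) (Ioi 0 ×ˢ univ) := by
  have hr : ContinuousOn (fun z : ℝ × Eu n => z.1 ^ (-(1 / (2 * α)))) (Ioi 0 ×ˢ univ) :=
    ContinuousOn.rpow_const continuousOn_fst fun _ hz => Or.inl (ne_of_gt hz.1)
  have h1 : ContinuousOn (fun z : ℝ × Eu n =>
      ((z.1 ^ (-(1 / (2 * α))) : ℝ) : ℂ) ^ (n + k) *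
      symK ℓ α 1 (z.1 ^ (-(1 / (2 * α))) • z.2)) (Ioi 0 ×ˢ univ) :=
    ((Complex.continuous_ofReal.comp_continuousOn hr).pow _).mul
      ((continuous_symK hn hα one_pos hℓ).comp_continuousOn (hr.smul continuousOn_snd))
  exact h1.congr fun z hz => symK_scaling (by linarith) hz.1 hℓ z.2

lemma continuousOn_kernel (hn : 0 < n) {α : ℝ} (hα : 1 / 2 < α) :
    ContinuousOn (fun z : ℝ × Eu n => kernel n α z.1 z.2) (Ioi 0 ×ˢ univ) :=
  (Complex.continuous_re.comp_continuousOn (continuousOn_symK hn hα isHomMul_one)).congr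
    fun _ _ => kernel_eq_re_symK _ _ _

lemma continuousOn_derivKernel (hn : 0 < n) {α : ℝ} (hα : 1 / 2 < α) (a : Eu n) :
    ContinuousOn (fun z : ℝ × Eu n => derivKernel α a z.1 z.2) (Ioi 0 ×ˢ univ) :=
  (Complex.continuous_re.comp_continuousOn (continuousOn_symK hn hα (isHomMul_dirSymb a))).congr
    fun z hz => (hasFDerivAt_kernel hn hα hz.1 a z.2).2

lemma kernel_scaling {α t : ℝ} (hα : 0 < α) (ht : 0 < t) (x : Eu n) :
    kernel n α t x = (t ^ (-(1 / (2 * α)))) ^ n * kernel n α 1 (t ^ (-(1 / (2 * α))) • x) := by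
  have := symK_scaling hα ht isHomMul_one x
  rw [← ofReal_kernel, ← ofReal_kernel] at this
  exact_mod_cast this

lemma integral_kernel (hn : 0 < n) {α t : ℝ} (hα : 1 / 2 < α) (ht : 0 < t) :
    ∫ y, kernel n α t y = 1 := by
  have := integral_symK_one hn hα ht
  simp only [← ofReal_kernel] at this
  rw [integral_complex_ofReal] at this
  exact_mod_cast this

lemma kernel_convolution_kernel (hn : 0 < n) {α t s : ℝ} (hα : 1 / 2 < α) (ht : 0 < t)
    (hs : 0 < s) (x : Eu n) :
    ∫ y, kernel n α t y * kernel n α s (x - y) = kernel n α (t + s) x := by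
  have := symK_convolution hn hα ht hs isHomMul_one x
  simp only [← ofReal_kernel, ← Complex.ofReal_mul] at this
  rw [integral_complex_ofReal] at this
  exact_mod_cast this

lemma kernel_convolution_derivKernel (hn : 0 < n) {α t s : ℝ} (hα : 1 / 2 < α) (ht : 0 < t)
    (hs : 0 < s) (a x : Eu n) :
    ∫ y, kernel n α t y * derivKernel α a s (x - y) = derivKernel α a (t + s) x := by
  have := symK_convolution hn hα ht hs (isHomMul_dirSymb a) x
  simp only [← ofReal_kernel, ← ofReal_derivKernel hn hα hs,
    ← ofReal_derivKernel hn hα (add_pos ht hs), ← Complex.ofReal_mul] at this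
  rw [integral_complex_ofReal] at this
  exact_mod_cast this

end Kernel

/-! ### Lebesgue functionals, interpolation and Minkowski's inequality -/

section Lpn

variable {X : Type*} [MeasurableSpace X] {μ : Measure X}

/-- The `L^p` functional on nonnegative functions, for a finite exponent `p`. -/
noncomputable def lpn (μ : Measure X) (p : ℝ) (F : X → ℝ≥0∞) : ℝ≥0∞ := (∫⁻ x, F x ^ p ∂μ) ^ (1 / p)

lemma lpn_mono_ae {p : ℝ} (hp : 0 < p) {F G : X → ℝ≥0∞} (h : ∀ᵐ x ∂μ, F x ≤ G x) :
    lpn μ p F ≤ lpn μ p G :=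
  rpow_le_rpow (lintegral_mono_ae (h.mono fun _ hx => rpow_le_rpow hx hp.le)) (by positivity)

lemma lpn_mono {p : ℝ} (hp : 0 < p) {F G : X → ℝ≥0∞} (h : ∀ x, F x ≤ G x) : lpn μ p F ≤ lpn μ p G :=
  lpn_mono_ae hp (.of_forall h)

lemma lpn_congr_ae {p : ℝ} {F G : X → ℝ≥0∞} (h : ∀ᵐ x ∂μ, F x = G x) : lpn μ p F = lpn μ p G := by
  have : ∀ᵐ x ∂μ, F x ^ p = G x ^ p := h.mono fun x hx => by rw [hx]
  rw [lpn, lpn, lintegral_congr_ae this]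

lemma lpn_zero {p : ℝ} (hp : 0 < p) : lpn μ p (fun _ => 0) = 0 := by
  simp [lpn, zero_rpow_of_pos hp, hp]

lemma lpn_rpow_self {p : ℝ} (hp : 0 < p) (F : X → ℝ≥0∞) : lpn μ p F ^ p = ∫⁻ x, F x ^ p ∂μ := by
  rw [lpn, ← ENNReal.rpow_mul, one_div_mul_cancel hp.ne', rpow_one]

lemma lpn_const_mul {p : ℝ} (hp : 0 < p) {F : X → ℝ≥0∞} (hF : Measurable F) (c : ℝ≥0∞) :
    lpn μ p (fun x => c * F x) = c * lpn μ p F := by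
  simp only [lpn, mul_rpow_of_nonneg _ _ hp.le]
  rw [lintegral_const_mul _ (hF.pow_const p), mul_rpow_of_nonneg _ _ (by positivity),
    ← ENNReal.rpow_mul, mul_one_div_cancel hp.ne', rpow_one]

lemma lpn_rpow {p b : ℝ} (hp : 0 < p) (hb : 0 < b) (F : X → ℝ≥0∞) :
    lpn μ p (fun x => F x ^ b) = lpn μ (b * p) F ^ b := by
  simp only [lpn, ← ENNReal.rpow_mul]
  congr 1
  field_simp

lemma lpn_add_le {p : ℝ} (hp : 1 ≤ p) {F G : X → ℝ≥0∞} (hF : Measurable F) (hG : Measurable G) :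
    lpn μ p (fun x => F x + G x) ≤ lpn μ p F + lpn μ p G :=
  ENNReal.lintegral_Lp_add_le hF.aemeasurable hG.aemeasurable hp

lemma lpn_mul_le {p s t : ℝ} (hp : 0 < p) (hs : 0 < s) (ht : 0 < t) (h : 1 / p = 1 / s + 1 / t)
    {F G : X → ℝ≥0∞} (hF : Measurable F) (hG : Measurable G) :
    lpn μ p (fun x => F x * G x) ≤ lpn μ s F * lpn μ t G := by
  refine ENNReal.lintegral_Lp_mul_le_Lq_mul_Lr hp ?_ h μ hF.aemeasurable hG.aemeasurable
  have : 0 < 1 / t := by positivity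
  exact (one_div_lt_one_div hs hp).1 (by linarith)

/-- Hölder's inequality for F^r and F^p with the weights (1-l)m/r and lm/p, whose sum is 1 by the
relation between the exponents. -/
lemma lpn_interpolation {m r p l : ℝ} (hm : 0 < m) (hr : 0 < r) (hp : 0 < p) (hl0 : 0 ≤ l)
    (hl1 : l ≤ 1) (h : 1 / m = (1 - l) / r + l / p) {F : X → ℝ≥0∞} (hF : Measurable F) :
    lpn μ m F ≤ lpn μ r F ^ (1 - l) * lpn μ p F ^ l := by
  have ha : 0 ≤ (1 - l) * m / r := by have : 0 ≤ 1 - l := by linarith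
                                      positivity
  have hb : 0 ≤ l * m / p := by positivity
  have hab : (1 - l) * m / r + l * m / p = 1 := by
    have : (1 - l) * m / r + l * m / p = m * ((1 - l) / r + l / p) := by ring
    rw [this, ← h, mul_one_div_cancel hm.ne']
  have key : ∫⁻ x, F x ^ m ∂μ ≤
      (∫⁻ x, F x ^ r ∂μ) ^ ((1 - l) * m / r) * (∫⁻ x, F x ^ p ∂μ) ^ (l * m / p) := by
    refine le_trans (le_of_eq ?_) (ENNReal.lintegral_mul_norm_pow_le
      (hF.pow_const r).aemeasurable (hF.pow_const p).aemeasurable ha hb hab)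
    refine lintegral_congr fun x => ?_
    rw [← ENNReal.rpow_mul, ← ENNReal.rpow_mul, ← rpow_add_of_nonneg _ _
      (by rw [mul_div_cancel₀ _ hr.ne']; exact mul_nonneg (by linarith) hm.le)
      (by rw [mul_div_cancel₀ _ hp.ne']; positivity)]
    congr 1
    field_simp
    ring
  refine (rpow_le_rpow key (by positivity)).trans_eq ?_
  rw [mul_rpow_of_nonneg _ _ (by positivity), lpn, lpn, ← ENNReal.rpow_mul,
    ← ENNReal.rpow_mul, ← ENNReal.rpow_mul, ← ENNReal.rpow_mul]
  congr 2 <;> field_simp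

lemma eLpNorm_eq_lpn {E : Type*} [NormedAddCommGroup E] {p : ℝ} (hp : 0 < p) (f : X → E) :
    eLpNorm f (ofReal p) μ = lpn μ p (fun x => ‖f x‖ₑ) := by
  rw [eLpNorm_eq_lintegral_rpow_enorm_toReal (by simpa using hp) ofReal_ne_top,
    ENNReal.toReal_ofReal hp.le, lpn]

/-- Converts an L^r bound into the form "tested on sets" in which the uniqueness arguments propagate
information; it supplies their initial constant. -/
lemma setLIntegral_le_lpn {r : ℝ} (hr : 1 < r) {F : X → ℝ≥0∞} (hF : Measurable F) {s : Set X}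
    (hs : MeasurableSet s) : ∫⁻ x in s, F x ∂μ ≤ lpn μ r F * μ s ^ (1 - 1 / r) := by
  have hpq := Real.HolderConjugate.conjExponent hr
  have h := ENNReal.lintegral_mul_le_Lp_mul_Lq μ hpq hF.aemeasurable
    (measurable_one.indicator hs : Measurable (s.indicator (1 : X → ℝ≥0∞))).aemeasurable
  have h1 : ∫⁻ x, (F * s.indicator (1 : X → ℝ≥0∞)) x ∂μ = ∫⁻ x in s, F x ∂μ := by
    rw [← lintegral_indicator hs]
    refine lintegral_congr fun x => ?_
    by_cases hx : x ∈ s <;> simp [hx]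
  have h2 : ∫⁻ x, (s.indicator (1 : X → ℝ≥0∞) x) ^ r.conjExponent ∂μ = μ s := by
    rw [← lintegral_indicator_one hs]
    refine lintegral_congr fun x => ?_
    by_cases hx : x ∈ s
    · simp [hx]
    · simp [hx, zero_rpow_of_pos hpq.symm.pos]
  rw [h1, h2] at h
  have h3 : 1 / r.conjExponent = 1 - 1 / r := by
    have := hpq.inv_add_inv_eq_one
    rw [one_div, one_div]; linarith
  rwa [h3] at h

/-- Minkowski's integral inequality. -/
lemma lpn_lintegral_le {T : Type*} [MeasurableSpace T] {ν : Measure T} [SFinite ν] [SigmaFinite μ]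
    {m : ℝ} (hm : 1 ≤ m) {F : T → X → ℝ≥0∞} (hF : Measurable (uncurry F)) :
    lpn μ m (fun x => ∫⁻ τ, F τ x ∂ν) ≤ ∫⁻ τ, lpn μ m (F τ) ∂ν := by
  rcases hm.eq_or_lt with rfl | hm
  · simp only [lpn, rpow_one, div_one]
    rw [lintegral_lintegral_swap]
    exact (hF.comp measurable_swap).aemeasurable
  have hm0 : 0 < m := by linarith
  have hpq := Real.HolderConjugate.conjExponent hm
  set q := m.conjExponent
  set G : X → ℝ≥0∞ := fun x => ∫⁻ τ, F τ x ∂ν with hG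
  have hGm : Measurable G := by
    have : Measurable (uncurry fun x τ => F τ x) := hF.comp measurable_swap
    exact this.lintegral_prod_right'
  set B := ∫⁻ τ, lpn μ m (F τ) ∂ν with hB
  -- Truncation in height and in support makes the m-th moment A of `g N` finite, which is needed to
  -- divide by A^{1/q}.
  set g : ℕ → X → ℝ≥0∞ := fun N => (spanningSets μ N).indicator fun x => min (G x) N with hg
  have hgm : ∀ N, Measurable (g N) := fun N =>
    (hGm.min measurable_const).indicator (measurableSet_spanningSets μ N)
  have hgG : ∀ N x, g N x ≤ G x := by
    intro N x
    simp only [hg]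
    by_cases hx : x ∈ spanningSets μ N
    · simp [hx]
    · simp [hx]
  have hbound : ∀ N, ∫⁻ x, g N x ^ m ∂μ ≤ B ^ m := by
    intro N
    set A := ∫⁻ x, g N x ^ m ∂μ with hA
    have hfin : A ≠ ∞ := by
      have h1 : A ≤ ∫⁻ x in spanningSets μ N, (N : ℝ≥0∞) ^ m ∂μ := by
        rw [← lintegral_indicator (measurableSet_spanningSets μ N)]
        refine lintegral_mono fun x => ?_
        simp only [hg]
        by_cases hx : x ∈ spanningSets μ N
        · simp only [hx, indicator_of_mem]
          exact rpow_le_rpow (min_le_right _ _) hm0.le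
        · simp [hx, zero_rpow_of_pos hm0]
      refine ne_top_of_le_ne_top ?_ h1
      rw [setLIntegral_const]
      exact mul_ne_top (rpow_ne_top_of_nonneg hm0.le (ENNReal.natCast_ne_top N))
        (measure_spanningSets_lt_top μ N).ne
    -- Duality with g^{m-1} as test function: g^m ≤ G g^{m-1}, then Fubini, then Hölder in x for
    -- each τ.
    have h2 : A ≤ B * A ^ (1 / q) := by
      calc A ≤ ∫⁻ x, (∫⁻ τ, F τ x ∂ν) * g N x ^ (m - 1) ∂μ := by
            refine lintegral_mono fun x => ?_
            have : g N x ^ m = g N x * g N x ^ (m - 1) := by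
              conv_rhs => rw [← rpow_one (g N x), ← ENNReal.rpow_mul]
              rw [← rpow_add_of_nonneg _ _ zero_le_one (by linarith)]
              congr 1; ring
            rw [this]
            gcongr
            exact hgG N x
        _ = ∫⁻ x, ∫⁻ τ, F τ x * g N x ^ (m - 1) ∂ν ∂μ := by
            refine lintegral_congr fun x => ?_
            rw [lintegral_mul_const]
            exact hF.comp measurable_prodMk_right
        _ = ∫⁻ τ, ∫⁻ x, F τ x * g N x ^ (m - 1) ∂μ ∂ν := by
            rw [lintegral_lintegral_swap]
            exact ((hF.comp measurable_swap).mul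
              (((hgm N).comp measurable_fst).pow_const _)).aemeasurable
        _ ≤ ∫⁻ τ, lpn μ m (F τ) * A ^ (1 / q) ∂ν := by
            refine lintegral_mono fun τ => ?_
            exact ENNReal.lintegral_mul_rpow_le_lintegral_rpow_mul_lintegral_rpow hpq
              (hF.comp measurable_prodMk_left).aemeasurable (hgm N).aemeasurable
        _ = B * A ^ (1 / q) := by
            rw [lintegral_mul_const'' ]
            have : Measurable fun τ => ∫⁻ x, F τ x ^ m ∂μ :=
              Measurable.lintegral_prod_right' (f := fun z : T × X => F z.1 z.2 ^ m)
                (hF.pow_const m)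
            exact (this.pow_const _).aemeasurable
    rcases eq_or_ne A 0 with h0 | h0
    · rw [h0]; exact zero_le
    have h3 : A ^ (1 / m) ≤ B := by
      have hA1 : A = A ^ (1 / m) * A ^ (1 / q) := by
        rw [← ENNReal.rpow_add _ _ h0 hfin, one_div, one_div, hpq.inv_add_inv_eq_one, rpow_one]
      have hpos : A ^ (1 / q) ≠ 0 := by
        simp [ENNReal.rpow_eq_zero_iff, h0, hfin]
      have htop : A ^ (1 / q) ≠ ∞ :=
        rpow_ne_top_of_nonneg (by have := hpq.symm.pos; positivity) hfin
      rw [hA1] at h2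
      have h2' : A ^ (1 / m) * A ^ (1 / q) ≤ B * A ^ (1 / q) := by
        rwa [← hA1] at h2 ⊢
      exact (ENNReal.mul_le_mul_iff_left hpos htop).1 h2'
    calc A = (A ^ (1 / m)) ^ m := by
          rw [← ENNReal.rpow_mul, one_div_mul_cancel hm0.ne', rpow_one]
      _ ≤ B ^ m := rpow_le_rpow h3 hm0.le
  have hsup : ∀ x, ⨆ N, g N x ^ m = G x ^ m := by
    intro x
    refine le_antisymm (iSup_le fun N => rpow_le_rpow (hgG N x) hm0.le) ?_
    have ht : Tendsto (fun N : ℕ => min (G x) (N : ℝ≥0∞) ^ m) atTop (𝓝 (min (G x) ∞ ^ m)) :=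
      ((ENNReal.continuous_rpow_const (y := m)).tendsto _).comp
        (tendsto_const_nhds.min ENNReal.tendsto_nat_nhds_top)
    rw [min_eq_left le_top] at ht
    refine le_of_tendsto ht ?_
    obtain ⟨N₀, hN₀⟩ : ∃ N, x ∈ spanningSets μ N :=
      mem_iUnion.1 (by rw [iUnion_spanningSets]; trivial)
    filter_upwards [eventually_ge_atTop N₀] with N hN
    refine le_iSup_of_le N ?_
    simp only [hg]
    rw [indicator_of_mem (monotone_spanningSets μ hN hN₀)]
  have hmono : Monotone fun N x => g N x ^ m := by
    intro N N' hN x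
    refine rpow_le_rpow ?_ hm0.le
    simp only [hg]
    by_cases hx : x ∈ spanningSets μ N
    · have hx' := monotone_spanningSets μ hN hx
      simp only [hx, hx', indicator_of_mem]
      exact min_le_min le_rfl (by exact_mod_cast hN)
    · simp [hx]
  have hfinal : ∫⁻ x, G x ^ m ∂μ ≤ B ^ m := by
    calc ∫⁻ x, G x ^ m ∂μ = ∫⁻ x, ⨆ N, g N x ^ m ∂μ := by simp only [hsup]
      _ = ⨆ N, ∫⁻ x, g N x ^ m ∂μ := lintegral_iSup (fun N => (hgm N).pow_const m) hmono
      _ ≤ B ^ m := iSup_le hbound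
  calc lpn μ m G ≤ (B ^ m) ^ (1 / m) := rpow_le_rpow hfinal (by positivity)
    _ = B := by rw [← ENNReal.rpow_mul, mul_one_div_cancel hm0.ne', rpow_one]

end Lpn

/-! ### Young's convolution inequality -/

section Young

variable {G : Type*} [AddCommGroup G] [MeasurableSpace G] [MeasurableAdd₂ G] [MeasurableNeg G]
  {μ : Measure G}

/-- Convolution of nonnegative functions. -/
noncomputable def cv (μ : Measure G) (k F : G → ℝ≥0∞) (x : G) : ℝ≥0∞ := ∫⁻ y, k y * F (x - y) ∂μ

lemma measurable_cv [SFinite μ] {k F : G → ℝ≥0∞} (hk : Measurable k) (hF : Measurable F) :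
    Measurable (cv μ k F) := by
  have : Measurable fun z : G × G => k z.2 * F (z.1 - z.2) :=
    (hk.comp measurable_snd).mul (hF.comp (measurable_fst.sub measurable_snd))
  exact this.lintegral_prod_right'

/-- Young's convolution inequality. -/
lemma lpn_cv_le [SFinite μ] [μ.IsAddLeftInvariant] [μ.IsNegInvariant] {m h ρ : ℝ}
    (hh : 0 < h) (hρ : 0 < ρ) (hhm : h ≤ m) (hρm : ρ ≤ m) (heq : 1 + 1 / m = 1 / h + 1 / ρ)
    {k F : G → ℝ≥0∞} (hk : Measurable k) (hF : Measurable F) :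
    lpn μ m (cv μ k F) ≤ lpn μ h k * lpn μ ρ F := by
  have hm : 0 < m := hh.trans_le hhm
  have e1 : 0 ≤ 1 / h - 1 / m := sub_nonneg.2 (one_div_le_one_div_of_le hh hhm)
  have e2 : 0 ≤ 1 / ρ - 1 / m := sub_nonneg.2 (one_div_le_one_div_of_le hρ hρm)
  set K := ∫⁻ y, k y ^ h ∂μ with hK
  set Φ := ∫⁻ y, F y ^ ρ ∂μ with hΦ
  have hpt : ∀ x, cv μ k F x ≤ (∫⁻ y, k y ^ h * F (x - y) ^ ρ ∂μ) ^ (1 / m) *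
      (K ^ (1 / h - 1 / m) * Φ ^ (1 / ρ - 1 / m)) := by
    intro x
    have hFx : Measurable fun y => F (x - y) := hF.comp (measurable_const.sub measurable_id)
    -- Hölder with three factors: kF = (k^h F^ρ)^{1/m} · (k^h)^{1/h-1/m} · (F^ρ)^{1/ρ-1/m}, whose
    -- outer exponents add up to 1 by `heq`. Only the first factor couples x and y, and it is
    -- integrated in x by Fubini.
    set f : Fin 3 → G → ℝ≥0∞ := ![fun y => k y ^ h * F (x - y) ^ ρ, fun y => k y ^ h,
      fun y => F (x - y) ^ ρ] with hf
    set p : Fin 3 → ℝ := ![1 / m, 1 / h - 1 / m, 1 / ρ - 1 / m] with hp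
    have h3 := ENNReal.lintegral_prod_norm_pow_le (μ := μ) (Finset.univ : Finset (Fin 3)) (f := f)
      (p := p) (by
        intro i _
        fin_cases i
        · exact ((hk.pow_const h).mul (hFx.pow_const ρ)).aemeasurable
        · exact (hk.pow_const h).aemeasurable
        · exact (hFx.pow_const ρ).aemeasurable)
      (by simp only [hp, Fin.sum_univ_three, Matrix.cons_val_zero, Matrix.cons_val_one,
            Matrix.cons_val]
          linarith)
      (by
        intro i _
        fin_cases i
        · change 0 ≤ 1 / m
          positivity
        · exact e1
        · exact e2)
    simp only [Fin.prod_univ_three, hf, hp, Matrix.cons_val_zero, Matrix.cons_val_one,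
      Matrix.cons_val] at h3
    have h4 : ∫⁻ y, F (x - y) ^ ρ ∂μ = Φ := lintegral_sub_left_eq_self (fun y => F y ^ ρ) x
    rw [h4] at h3
    refine le_trans (le_of_eq ?_) (h3.trans_eq (mul_assoc _ _ _))
    refine lintegral_congr fun y => ?_
    rw [mul_rpow_of_nonneg _ _ (by positivity), ← ENNReal.rpow_mul, ← ENNReal.rpow_mul,
      ← ENNReal.rpow_mul, ← ENNReal.rpow_mul]
    calc k y * F (x - y) = k y ^ (h * (1 / m) + h * (1 / h - 1 / m)) *
          F (x - y) ^ (ρ * (1 / m) + ρ * (1 / ρ - 1 / m)) := by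
          have a1 : h * (1 / m) + h * (1 / h - 1 / m) = 1 := by field_simp; ring
          have a2 : ρ * (1 / m) + ρ * (1 / ρ - 1 / m) = 1 := by field_simp; ring
          rw [a1, a2, rpow_one, rpow_one]
      _ = _ := by
          rw [rpow_add_of_nonneg _ _ (by positivity) (mul_nonneg hh.le e1),
            rpow_add_of_nonneg _ _ (by positivity) (mul_nonneg hρ.le e2)]
          ring
  have hint : ∫⁻ x, ∫⁻ y, k y ^ h * F (x - y) ^ ρ ∂μ ∂μ = K * Φ := by
    rw [lintegral_lintegral_swap]
    · rw [hK, ← lintegral_mul_const _ (hk.pow_const h)]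
      refine lintegral_congr fun y => ?_
      have hFy : Measurable fun x => F (x - y) ^ ρ :=
        (hF.comp (measurable_id.sub measurable_const)).pow_const ρ
      rw [lintegral_const_mul _ hFy]
      congr 1
      exact lintegral_sub_right_eq_self (fun z => F z ^ ρ) y
    · exact (((hk.comp measurable_snd).pow_const h).mul
        ((hF.comp (measurable_fst.sub measurable_snd)).pow_const ρ)).aemeasurable
  have hfin : ∫⁻ x, cv μ k F x ^ m ∂μ ≤ K ^ (m / h) * Φ ^ (m / ρ) := by
    calc ∫⁻ x, cv μ k F x ^ m ∂μ
        ≤ ∫⁻ x, (∫⁻ y, k y ^ h * F (x - y) ^ ρ ∂μ) *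
            (K ^ (1 / h - 1 / m) * Φ ^ (1 / ρ - 1 / m)) ^ m ∂μ := by
          refine lintegral_mono fun x => (rpow_le_rpow (hpt x) hm.le).trans_eq ?_
          rw [mul_rpow_of_nonneg _ _ hm.le, ← ENNReal.rpow_mul, one_div_mul_cancel hm.ne', rpow_one]
      _ = K * Φ * (K ^ (1 / h - 1 / m) * Φ ^ (1 / ρ - 1 / m)) ^ m := by
          rw [lintegral_mul_const, hint]
          have : Measurable fun z : G × G => k z.2 ^ h * F (z.1 - z.2) ^ ρ :=
            ((hk.comp measurable_snd).pow_const h).mul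
              ((hF.comp (measurable_fst.sub measurable_snd)).pow_const ρ)
          exact this.lintegral_prod_right'
      _ = K ^ (1 + (1 / h - 1 / m) * m) * Φ ^ (1 + (1 / ρ - 1 / m) * m) := by
          rw [mul_rpow_of_nonneg _ _ hm.le, ← ENNReal.rpow_mul, ← ENNReal.rpow_mul,
            rpow_add_of_nonneg _ _ zero_le_one (mul_nonneg e1 hm.le),
            rpow_add_of_nonneg _ _ zero_le_one (mul_nonneg e2 hm.le), rpow_one, rpow_one]
          ring
      _ = K ^ (m / h) * Φ ^ (m / ρ) := by
          congr 2 <;> field_simp <;> ring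
  refine (rpow_le_rpow hfin (by positivity)).trans_eq ?_
  rw [mul_rpow_of_nonneg _ _ (by positivity), ← ENNReal.rpow_mul, ← ENNReal.rpow_mul, lpn, lpn]
  congr 2 <;> field_simp

end Young

/-! ### Change of variables under dilations -/

section Scaling

lemma lintegral_comp_smul_of_pos {E : Type*} [NormedAddCommGroup E] [NormedSpace ℝ E]
    [MeasurableSpace E] [BorelSpace E] [FiniteDimensional ℝ E] (μ : Measure E) [μ.IsAddHaarMeasure]
    {f : E → ℝ≥0∞} (hf : Measurable f) {c : ℝ} (hc : 0 < c) :
    ∫⁻ x, f (c • x) ∂μ = ofReal ((c ^ Module.finrank ℝ E)⁻¹) * ∫⁻ x, f x ∂μ := by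
  have h := lintegral_map (μ := μ) hf (measurable_const_smul (α := E) c)
  rw [← h]
  have h2 := Measure.map_addHaar_smul μ hc.ne'
  rw [h2, lintegral_smul_measure, abs_of_pos (by positivity), smul_eq_mul]

lemma lintegral_comp_mul_of_pos {f : ℝ → ℝ≥0∞} (hf : Measurable f) {c : ℝ} (hc : 0 < c) :
    ∫⁻ x, f (c * x) = ofReal c⁻¹ * ∫⁻ x, f x := by
  have := lintegral_comp_smul_of_pos volume hf hc
  simpa using this

lemma setLIntegral_Ioo_eq_mul {f : ℝ → ℝ≥0∞} (hf : Measurable f) {t : ℝ} (ht : 0 < t) :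
    ∫⁻ τ in Ioo 0 t, f τ = ofReal t * ∫⁻ s in Ioo (0 : ℝ) 1, f (t * s) := by
  have h := lintegral_comp_mul_of_pos (hf.indicator (measurableSet_Ioo (a := (0 : ℝ)) (b := t))) ht
  rw [lintegral_indicator measurableSet_Ioo] at h
  have h2 : ∀ s, (Ioo 0 t).indicator f (t * s) =
      (Ioo (0 : ℝ) 1).indicator (fun s => f (t * s)) s := by
    intro s
    have : t * s ∈ Ioo 0 t ↔ s ∈ Ioo (0 : ℝ) 1 := by
      simp only [mem_Ioo, mul_pos_iff_of_pos_left ht]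
      constructor
      · rintro ⟨h1, h2⟩; exact ⟨h1, by nlinarith⟩
      · rintro ⟨h1, h2⟩; exact ⟨h1, by nlinarith⟩
    by_cases hs : s ∈ Ioo (0 : ℝ) 1
    · rw [indicator_of_mem (this.2 hs), indicator_of_mem hs]
    · rw [indicator_of_notMem (fun h => hs (this.1 h)), indicator_of_notMem hs]
  simp only [h2] at h
  rw [lintegral_indicator measurableSet_Ioo] at h
  rw [h, ← mul_assoc, ← ofReal_mul ht.le, mul_inv_cancel₀ ht.ne', ENNReal.ofReal_one, one_mul]

end Scaling

/-! ### The algebraic majorant of the kernels -/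

section Jk

variable {n : ℕ}

/-- The majorant `(T + |x|)^{-(n+1)}` of the kernels. -/
noncomputable def jk (T : ℝ) (x : Eu n) : ℝ≥0∞ := ofReal ((T + ‖x‖) ^ (n + 1))⁻¹

lemma measurable_jk (T : ℝ) : Measurable (jk (n := n) T) := by
  unfold jk
  fun_prop

/-- The power of T is scaling. One constant serves all h ≥ 1 because `jk 1` is at most 1, hence its
h-th power is at most itself, and the h-th root does not increase a number that is at least 1. -/
lemma exists_lpn_jk_le (n : ℕ) : ∃ C : ℝ, 0 < C ∧ ∀ h T : ℝ, 1 ≤ h → 0 < T →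
    lpn volume h (jk (n := n) T) ≤ ofReal (C * T ^ (n / h - (n + 1))) := by
  have hint := integrable_inv_add_norm_pow (n := n) one_pos
  set A := ∫⁻ x, jk (n := n) 1 x with hA
  have hAfin : A ≠ ∞ := hint.lintegral_lt_top.ne
  refine ⟨max 1 A.toReal, by positivity, fun h T hh hT => ?_⟩
  have h0 : 0 < h := by linarith
  have h1 : lpn volume h (jk (n := n) 1) ≤ ofReal (max 1 A.toReal) := by
    have hle : ∫⁻ x, jk (n := n) 1 x ^ h ≤ A := by
      refine lintegral_mono fun x => ?_
      have hj : jk (n := n) 1 x ≤ 1 := by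
        rw [jk, ENNReal.ofReal_le_one]
        refine inv_le_one_of_one_le₀ (one_le_pow₀ ?_)
        linarith [norm_nonneg x]
      calc jk (n := n) 1 x ^ h ≤ jk (n := n) 1 x ^ (1 : ℝ) :=
            ENNReal.rpow_le_rpow_of_exponent_ge hj hh
        _ = jk 1 x := rpow_one _
    have hmax : A ≤ ofReal (max 1 A.toReal) := by
      rw [← ofReal_toReal hAfin]
      refine ofReal_le_ofReal ?_
      rw [ENNReal.toReal_ofReal ENNReal.toReal_nonneg]
      exact le_max_right _ _
    have h1max : 1 ≤ ofReal (max 1 A.toReal) := by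
      rw [ENNReal.one_le_ofReal]; exact le_max_left _ _
    calc lpn volume h (jk (n := n) 1) ≤ (ofReal (max 1 A.toReal)) ^ (1 / h) :=
          rpow_le_rpow (hle.trans hmax) (by positivity)
      _ ≤ (ofReal (max 1 A.toReal)) ^ (1 : ℝ) :=
          ENNReal.rpow_le_rpow_of_exponent_le h1max (by rw [div_le_one h0]; exact hh)
      _ = _ := rpow_one _
  have h2 : jk (n := n) T = fun x => ofReal ((T ^ (n + 1))⁻¹) * jk 1 (T⁻¹ • x) := by
    funext x
    rw [jk, jk, ← ofReal_mul (by positivity), norm_smul,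
      norm_of_nonneg (inv_nonneg.2 hT.le), ← mul_inv, ← mul_pow]
    congr 3
    field_simp
  have h3 : lpn volume h (fun x : Eu n => jk 1 (T⁻¹ • x)) =
      ofReal (T ^ ((n : ℝ) / h)) * lpn volume h (jk (n := n) 1) := by
    rw [lpn, lintegral_comp_smul_of_pos volume ((measurable_jk (n := n) 1).pow_const h)
      (inv_pos.2 hT), mul_rpow_of_nonneg _ _ (by positivity), finrank_euclideanSpace,
      Fintype.card_fin, inv_pow, inv_inv, ofReal_rpow_of_pos (by positivity),
      ← Real.rpow_natCast, ← rpow_mul hT.le, mul_one_div]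
    rfl
  have hjm : Measurable fun x : Eu n => jk 1 (T⁻¹ • x) :=
    (measurable_jk 1).comp (measurable_const_smul _)
  rw [h2, lpn_const_mul h0 hjm, h3, ← mul_assoc, ← ofReal_mul (by positivity),
    mul_comm (max 1 A.toReal), ofReal_mul (by positivity : 0 ≤ T ^ ((n : ℝ) / h - (n + 1)))]
  refine mul_le_mul' (le_of_eq ?_) h1
  congr 1
  rw [Real.rpow_sub hT, ← Real.rpow_natCast]
  push_cast
  field_simp

/-- Young's inequality with 1/h = 1 + 1/m - 1/ρ. With T = t^{1/(2α)} this is the smoothing estimate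
for S_α(t)(a·∇). -/
lemma exists_lpn_cv_jk_le (n : ℕ) : ∃ C : ℝ, 0 < C ∧ ∀ ρ m T : ℝ, 1 ≤ ρ → ρ ≤ m → 0 < T →
    ∀ F : Eu n → ℝ≥0∞, Measurable F →
    lpn volume m (cv volume (jk T) F) ≤
      ofReal (C * T ^ (-1 - n * (1 / ρ - 1 / m))) * lpn volume ρ F := by
  obtain ⟨C, hC, h⟩ := exists_lpn_jk_le n
  refine ⟨C, hC, fun ρ m T hρ hm hT F hF => ?_⟩
  have hm0 : 0 < m := by linarith
  have hρ1 : 1 / ρ ≤ 1 := by rw [div_le_one (by linarith)]; exact hρ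
  have hmρ : 1 / m ≤ 1 / ρ := one_div_le_one_div_of_le (by linarith) hm
  have hm1 : 0 < 1 / m := by positivity
  set e := 1 + 1 / m - 1 / ρ with he
  have he0 : 0 < e := by linarith
  have hY := lpn_cv_le (μ := volume) (m := m) (h := 1 / e) (ρ := ρ) (by positivity) (by linarith)
    (by rw [div_le_iff₀ he0]
        have : m * e = 1 + m * (1 - 1 / ρ) := by rw [he]; field_simp; ring
        rw [this]
        nlinarith) hm (by rw [one_div_one_div]; linarith) (measurable_jk T) hF
  refine hY.trans (mul_le_mul_left ?_ _)
  refine (h (1 / e) T ?_ hT).trans_eq ?_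
  · rw [le_div_iff₀ he0]; linarith
  · congr 3
    rw [div_div_eq_mul_div, div_one, he]
    ring

end Jk

/-! ### Power integrals in time and a Hardy-type inequality -/

section PowerIntegrals

lemma setLIntegral_Ioo_rpow {f t : ℝ} (hf : f < 1) (ht : 0 < t) :
    ∫⁻ τ in Ioo 0 t, ofReal (τ ^ (-f)) = ofReal (t ^ (1 - f) / (1 - f)) := by
  have h1 : IntervalIntegrable (fun τ : ℝ => τ ^ (-f)) volume 0 t :=
    intervalIntegral.intervalIntegrable_rpow' (by linarith)
  rw [intervalIntegrable_iff_integrableOn_Ioo_of_le ht.le] at h1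
  rw [← ofReal_integral_eq_lintegral_ofReal h1, ← integral_Ioc_eq_integral_Ioo,
    ← intervalIntegral.integral_of_le ht.le, integral_rpow (Or.inl (by linarith)),
    Real.zero_rpow (by linarith)]
  · rw [sub_zero, show -f + 1 = 1 - f by ring]
  · exact (ae_restrict_iff' measurableSet_Ioo).2 (.of_forall fun τ hτ => rpow_nonneg hτ.1.le _)

lemma setLIntegral_Ioo_reflect (f : ℝ → ℝ≥0∞) (s t : ℝ) :
    ∫⁻ τ in Ioo s t, f (t - τ) = ∫⁻ τ in Ioo 0 (t - s), f τ := by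
  rw [← lintegral_indicator measurableSet_Ioo, ← lintegral_indicator measurableSet_Ioo,
    ← lintegral_sub_left_eq_self ((Ioo 0 (t - s)).indicator f) t]
  refine lintegral_congr fun τ => ?_
  by_cases h : τ ∈ Ioo s t
  · rw [indicator_of_mem h, indicator_of_mem]
    exact ⟨by linarith [h.2], by linarith [h.1]⟩
  · rw [indicator_of_notMem h, indicator_of_notMem]
    rintro ⟨h1, h2⟩
    exact h ⟨by linarith, by linarith⟩

/-- On each half of (0, t) one of the two factors is at most its value at t/2, and the other is
integrated exactly. -/
lemma exists_beta_bound {e f : ℝ} (he0 : 0 ≤ e) (he : e < 1) (hf0 : 0 ≤ f) (hf : f < 1) :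
    ∃ C : ℝ, 0 < C ∧ ∀ t, 0 < t → ∫⁻ τ in Ioo 0 t, ofReal ((t - τ) ^ (-e) * τ ^ (-f)) ≤
        ofReal (C * t ^ (1 - e - f)) := by
  refine ⟨2 ^ e * (1 / (1 - f)) + 2 ^ f * (1 / (1 - e)), ?_, fun t ht => ?_⟩
  · have : 0 < 1 - f := by linarith
    have : 0 < 1 - e := by linarith
    positivity
  have hpt : ∀ τ ∈ Ioo 0 t, ofReal ((t - τ) ^ (-e) * τ ^ (-f)) ≤
      ofReal ((t / 2) ^ (-e)) * ofReal (τ ^ (-f)) +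
        ofReal ((t / 2) ^ (-f)) * ofReal ((t - τ) ^ (-e)) := by
    intro τ hτ
    have h1 : 0 < t - τ := by linarith [hτ.2]
    have h2 := hτ.1
    have n1 := rpow_nonneg h1.le (-e)
    have n2 := rpow_nonneg h2.le (-f)
    rw [← ofReal_mul (by positivity), ← ofReal_mul (by positivity),
      ← ofReal_add (by positivity) (by positivity)]
    refine ofReal_le_ofReal ?_
    rcases le_total τ (t / 2) with h | h
    · have : (t - τ) ^ (-e) ≤ (t / 2) ^ (-e) :=
        Real.rpow_le_rpow_of_nonpos (by positivity) (by linarith) (by linarith)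
      have n3 : 0 ≤ (t / 2) ^ (-f) * (t - τ) ^ (-e) := by positivity
      nlinarith [mul_le_mul_of_nonneg_right this n2]
    · have : τ ^ (-f) ≤ (t / 2) ^ (-f) :=
        Real.rpow_le_rpow_of_nonpos (by positivity) h (by linarith)
      have n3 : 0 ≤ (t / 2) ^ (-e) * τ ^ (-f) := by positivity
      nlinarith [mul_le_mul_of_nonneg_left this n1]
  have m1 : Measurable fun τ : ℝ => ofReal (τ ^ (-f)) := by fun_prop
  have m2 : Measurable fun τ : ℝ => ofReal ((t - τ) ^ (-e)) := by fun_prop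
  calc _ ≤ ∫⁻ τ in Ioo 0 t, (ofReal ((t / 2) ^ (-e)) * ofReal (τ ^ (-f)) +
        ofReal ((t / 2) ^ (-f)) * ofReal ((t - τ) ^ (-e))) :=
        setLIntegral_mono' measurableSet_Ioo hpt
    _ = _ := by
        rw [lintegral_add_left (m1.const_mul _), lintegral_const_mul _ m1, lintegral_const_mul _ m2,
          setLIntegral_Ioo_rpow hf ht, setLIntegral_Ioo_reflect (fun s => ofReal (s ^ (-e))) 0 t,
          sub_zero, setLIntegral_Ioo_rpow he ht, ← ofReal_mul (by positivity),
          ← ofReal_mul (by positivity), ← ofReal_add]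
        · congr 1
          rw [Real.div_rpow ht.le zero_le_two, Real.div_rpow ht.le zero_le_two,
            Real.rpow_neg zero_le_two, Real.rpow_neg zero_le_two]
          have e1 : t ^ (1 - e - f) = t ^ (-e) * t ^ (1 - f) := by
            rw [← rpow_add ht]; congr 1; ring
          have e2 : t ^ (1 - e - f) = t ^ (-f) * t ^ (1 - e) := by
            rw [← rpow_add ht]; congr 1; ring
          rw [add_mul, mul_assoc, mul_assoc, e1]
          nth_rewrite 2 [← e1]
          rw [e2]
          field_simp
        · have : 0 < 1 - f := by linarith
          positivity
        · have : 0 < 1 - e := by linarith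
          positivity

/-- Hardy-type inequality for the kernel `(t-τ)^{-e} τ^{-β}` on `L^q`. -/
lemma exists_hardy {e β q : ℝ} (he0 : 0 ≤ e) (he : e < 1) (hβ0 : 0 ≤ β) (hq : 1 ≤ q)
    (hβq : β + 1 / q < 1) :
    ∃ C : ℝ, 0 < C ∧ ∀ (I : Set ℝ) (Θ : ℝ), MeasurableSet I → (∀ t ∈ I, 0 < t) →
      (∀ t ∈ I, ∀ s, 0 < s → s < t → s ∈ I) → (∀ t ∈ I, t ^ (1 - e - β) ≤ Θ) → 0 ≤ Θ →
      ∀ U : ℝ → ℝ≥0∞, Measurable U →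
      lpn (volume.restrict I) q (fun t => ∫⁻ τ in Ioo 0 t,
        ofReal ((t - τ) ^ (-e) * τ ^ (-β)) * U τ) ≤
        ofReal (C * Θ) * lpn (volume.restrict I) q U := by
  have hq0 : 0 < q := by linarith
  obtain ⟨C, hC, hb⟩ := exists_beta_bound he0 he (f := β + 1 / q) (by positivity) hβq
  refine ⟨C, hC, fun I Θ hI hpos hstar hΘ hΘ0 U hU => ?_⟩
  set k : ℝ → ℝ≥0∞ := fun s => ofReal ((1 - s) ^ (-e) * s ^ (-β)) with hk
  have hkm : Measurable k := by simp only [hk]; fun_prop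
  -- The substitution τ = ts turns the operator into an average of dilations of U; the power
  -- t^{1-e-β} that is left over is absorbed by Θ.
  have hrep : ∀ t ∈ I, ∫⁻ τ in Ioo 0 t, ofReal ((t - τ) ^ (-e) * τ ^ (-β)) * U τ ≤
      ofReal Θ * ∫⁻ s in Ioo (0 : ℝ) 1, k s * U (t * s) := by
    intro t ht
    have ht0 := hpos t ht
    have hm : Measurable fun τ => ofReal ((t - τ) ^ (-e) * τ ^ (-β)) * U τ := by fun_prop
    rw [setLIntegral_Ioo_eq_mul hm ht0]
    have : ∀ s ∈ Ioo (0 : ℝ) 1, ofReal ((t - t * s) ^ (-e) * (t * s) ^ (-β)) * U (t * s) =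
        ofReal (t ^ (-e - β)) * (k s * U (t * s)) := by
      intro s hs
      rw [hk, ← mul_assoc, ← ofReal_mul (by positivity)]
      congr 2
      rw [show t - t * s = t * (1 - s) by ring, mul_rpow ht0.le (by linarith [hs.2]),
        mul_rpow ht0.le hs.1.le, show -e - β = -e + -β by ring, rpow_add ht0]
      ring
    rw [setLIntegral_congr_fun measurableSet_Ioo this, lintegral_const_mul, ← mul_assoc,
      ← ofReal_mul ht0.le]
    · refine mul_le_mul_left (ofReal_le_ofReal ?_) _
      refine le_trans (le_of_eq ?_) (hΘ t ht)
      rw [show 1 - e - β = 1 + (-e - β) by ring, rpow_add ht0, Real.rpow_one]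
    · exact hkm.mul (hU.comp (measurable_const.mul measurable_id))
  have hjm : Measurable (uncurry fun s t : ℝ => k s * U (t * s)) :=
    (hkm.comp measurable_fst).mul (hU.comp (measurable_snd.mul measurable_fst))
  have hVm : Measurable fun t => ∫⁻ s in Ioo (0 : ℝ) 1, k s * U (t * s) :=
    (hjm.comp measurable_swap).lintegral_prod_right'
  -- Dilation by s < 1 maps I into itself and costs s^{-1/q} in L^q. After Minkowski, the integral
  -- of (1-s)^{-e} s^{-β-1/q} remains, finite by `he` and `hβq`.
  have hdil : ∀ s ∈ Ioo (0 : ℝ) 1, lpn (volume.restrict I) q (fun t => k s * U (t * s)) ≤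
      ofReal ((1 - s) ^ (-e) * s ^ (-(β + 1 / q))) * lpn (volume.restrict I) q U := by
    intro s hs
    have hUs : Measurable fun t => U (t * s) := hU.comp (measurable_id.mul measurable_const)
    rw [lpn_const_mul hq0 hUs]
    have h1 : lpn (volume.restrict I) q (fun t => U (t * s)) ≤
        ofReal (s ^ (-(1 / q))) * lpn (volume.restrict I) q U := by
      have h2 : ∫⁻ t in I, U (t * s) ^ q ≤ ofReal s⁻¹ * ∫⁻ t in I, U t ^ q := by
        rw [← lintegral_indicator hI, ← lintegral_indicator hI,
          ← lintegral_comp_mul_of_pos ((hU.pow_const q).indicator hI) hs.1]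
        refine lintegral_mono fun t => ?_
        by_cases ht : t ∈ I
        · have : s * t ∈ I := hstar t ht _ (mul_pos hs.1 (hpos t ht))
            (by nlinarith [hpos t ht, hs.2])
          simp only [ht, this, indicator_of_mem, mul_comm t s, le_refl]
        · simp [ht]
      refine (rpow_le_rpow h2 (by positivity)).trans_eq ?_
      rw [mul_rpow_of_nonneg _ _ (by positivity), ofReal_rpow_of_pos (inv_pos.2 hs.1),
        Real.inv_rpow hs.1.le, ← Real.rpow_neg hs.1.le]
      rfl
    refine (mul_le_mul_right h1 _).trans_eq ?_
    have hs1 : 0 < 1 - s := by linarith [hs.2]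
    rw [hk, ← mul_assoc, ← ofReal_mul (mul_nonneg (rpow_nonneg hs1.le _)
      (rpow_nonneg hs.1.le _)), mul_assoc, ← rpow_add hs.1]
    congr 4
    ring
  calc _ ≤ lpn (volume.restrict I) q (fun t => ofReal Θ * ∫⁻ s in Ioo (0 : ℝ) 1, k s * U (t * s)) :=
        lpn_mono_ae hq0 ((ae_restrict_iff' hI).2 (.of_forall hrep))
    _ = ofReal Θ * lpn (volume.restrict I) q
        (fun t => ∫⁻ s in Ioo (0 : ℝ) 1, k s * U (t * s)) := lpn_const_mul hq0 hVm _
    _ ≤ ofReal Θ * ∫⁻ s in Ioo (0 : ℝ) 1, lpn (volume.restrict I) q (fun t => k s * U (t * s)) :=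
        mul_le_mul_right (lpn_lintegral_le hq hjm) _
    _ ≤ ofReal Θ * ∫⁻ s in Ioo (0 : ℝ) 1,
        ofReal ((1 - s) ^ (-e) * s ^ (-(β + 1 / q))) * lpn (volume.restrict I) q U :=
        mul_le_mul_right (setLIntegral_mono' measurableSet_Ioo hdil) _
    _ ≤ ofReal Θ * (ofReal C * lpn (volume.restrict I) q U) := by
        rw [lintegral_mul_const _ (by fun_prop)]
        refine mul_le_mul_right (mul_le_mul_left ?_ _) _
        have := hb 1 one_pos
        rwa [Real.one_rpow, mul_one] at this
    _ = _ := by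
        rw [mul_comm C Θ, ofReal_mul hΘ0, mul_assoc]

end PowerIntegrals

/-! ### Weak-type duality -/

section Endpoint

variable {X : Type*} [MeasurableSpace X] {μ : Measure X}

/-- Layer-cake duality: a function in weak `L^{1/(1-a)}` (tested on sets) integrates against a
function controlled in two Lebesgue spaces around `L^{1/a}`. -/
lemma lintegral_mul_le_of_weak [SFinite μ] {a δ : ℝ} (hδ : 0 < δ) (hδa : δ < a) {W H : X → ℝ≥0∞}
    (hW : Measurable W) (hH : Measurable H) {N : ℝ≥0∞}
    (hN : ∀ s, MeasurableSet s → μ s ≠ ∞ → ∫⁻ x in s, W x ∂μ ≤ N * μ s ^ a) {B Z : ℝ} (hB : 0 < B)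
    (hZ : 0 < Z) (h1 : lpn μ (1 / (a + δ)) H ≤ ofReal (B * Z ^ δ))
    (h2 : lpn μ (1 / (a - δ)) H ≤ ofReal (B * Z ^ (-δ))) :
    ∫⁻ x, W x * H x ∂μ ≤ ofReal (2 * a / δ) * (N * ofReal B) := by
  have ha : 0 < a := hδ.trans hδa
  -- The level at which the two Chebyshev bounds for the a-th power of the measure of {H > l}
  -- coincide; both equal Z^a there.
  set Λ := B * Z ^ (-a) with hΛ
  have hΛ0 : 0 < Λ := by positivity
  -- Chebyshev
  have cheb : ∀ c : ℝ, 0 < c → ∀ A : ℝ, 0 < A → lpn μ (1 / c) H ≤ ofReal A → ∀ l : ℝ,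
      0 < l → μ {x | ofReal l < H x} ^ a ≤ ofReal ((A / l) ^ (a / c)) := by
    intro c hc A hA hle l hl
    have hc' : 0 < 1 / c := by positivity
    have h3 : ofReal l ^ (1 / c) * μ {x | ofReal l < H x} ≤ ofReal A ^ (1 / c) := by
      calc _ ≤ ofReal l ^ (1 / c) * μ {x | ofReal l ^ (1 / c) ≤ H x ^ (1 / c)} := by
            gcongr with x
            intro hx
            exact rpow_le_rpow (le_of_lt hx) hc'.le
        _ ≤ ∫⁻ x, H x ^ (1 / c) ∂μ := mul_meas_ge_le_lintegral (hH.pow_const _) _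
        _ = lpn μ (1 / c) H ^ (1 / c) := (lpn_rpow_self hc' H).symm
        _ ≤ _ := rpow_le_rpow hle hc'.le
    rw [ofReal_rpow_of_pos hl, ofReal_rpow_of_pos hA] at h3
    have h4 : μ {x | ofReal l < H x} ≤ ofReal ((A / l) ^ (1 / c)) := by
      have hlp : 0 < l ^ (1 / c) := rpow_pos_of_pos hl _
      rw [Real.div_rpow hA.le hl.le, ENNReal.ofReal_div_of_pos hlp,
        ENNReal.le_div_iff_mul_le (Or.inl (by simpa using hlp)) (Or.inl ofReal_ne_top), mul_comm]
      exact h3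
    refine (rpow_le_rpow h4 ha.le).trans_eq ?_
    rw [ofReal_rpow_of_pos (by positivity), ← rpow_mul (by positivity)]
    congr 2
    ring
  have hc1 : 0 < a + δ := by linarith
  have hc2 : 0 < a - δ := by linarith
  have c1 := cheb (a + δ) hc1 _ (by positivity) h1
  have c2 := cheb (a - δ) hc2 _ (by positivity) h2
  have hfin : ∀ l : ℝ, 0 < l → μ {x | ofReal l < H x} ≠ ∞ := by
    intro l hl htop
    have := c1 l hl
    rw [htop, ENNReal.top_rpow_of_pos ha] at this
    exact ofReal_ne_top (top_le_iff.1 this)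
  have hset : ∀ l : ℝ, MeasurableSet {x | ofReal l < H x} := fun l =>
    measurableSet_lt measurable_const hH
  -- layer cake
  have hHx : ∀ y : ℝ≥0∞, y = ∫⁻ l in Ioi (0 : ℝ),
      ({l : ℝ | ofReal l < y}.indicator 1 l : ℝ≥0∞) := by
    intro y
    have hms : MeasurableSet {l : ℝ | ofReal l < y} :=
      measurableSet_lt ENNReal.measurable_ofReal measurable_const
    rw [lintegral_indicator_one hms, Measure.restrict_apply hms]
    rcases eq_or_ne y ∞ with rfl | hy
    · have : {l : ℝ | ofReal l < ∞} = univ := by ext; simp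
      rw [this, univ_inter, Real.volume_Ioi]
    · have : {l : ℝ | ofReal l < y} ∩ Ioi 0 = Ioo 0 y.toReal := by
        ext l
        simp only [mem_inter_iff, mem_ofPred_eq, mem_Ioi, mem_Ioo]
        rw [and_comm]
        refine and_congr_right fun hl => ?_
        rw [ENNReal.ofReal_lt_iff_lt_toReal hl.le hy]
      rw [this, Real.volume_Ioo, sub_zero, ofReal_toReal hy]
  have hjm : Measurable fun z : X × ℝ =>
      W z.1 * ({z : X × ℝ | ofReal z.2 < H z.1}.indicator 1 z : ℝ≥0∞) := by
    refine (hW.comp measurable_fst).mul (measurable_one.indicator ?_)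
    exact measurableSet_lt (ENNReal.measurable_ofReal.comp measurable_snd) (hH.comp measurable_fst)
  have hcake : ∫⁻ x, W x * H x ∂μ = ∫⁻ l in Ioi (0 : ℝ), ∫⁻ x in {x | ofReal l < H x}, W x ∂μ := by
    calc ∫⁻ x, W x * H x ∂μ = ∫⁻ x, (∫⁻ l in Ioi (0 : ℝ),
          W x * ({z : X × ℝ | ofReal z.2 < H z.1}.indicator 1 (x, l) : ℝ≥0∞)) ∂μ := by
          refine lintegral_congr fun x => ?_
          rw [lintegral_const_mul]
          · congr 1
            exact hHx (H x)
          · refine Measurable.indicator measurable_one ?_ |>.comp measurable_prodMk_left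
            exact measurableSet_lt (ENNReal.measurable_ofReal.comp measurable_snd)
              (hH.comp measurable_fst)
      _ = ∫⁻ l in Ioi (0 : ℝ), ∫⁻ x,
          W x * ({z : X × ℝ | ofReal z.2 < H z.1}.indicator 1 (x, l) : ℝ≥0∞) ∂μ :=
          lintegral_lintegral_swap hjm.aemeasurable
      _ = _ := by
          refine lintegral_congr fun l => ?_
          rw [← lintegral_indicator (hset l)]
          refine lintegral_congr fun x => ?_
          by_cases hx : ofReal l < H x
          · simp [indicator, hx]
          · simp [indicator, hx]
  have hZa : 0 < Z ^ a := by positivity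
  -- As p1 < 1, the bound from the first norm is integrable in l near 0; as p2 > 1, the bound from
  -- the second is integrable at infinity. With a single norm at the exponent 1/a itself one would
  -- meet the divergent integral of 1/l.
  set p1 := a / (a + δ) with hp1
  set p2 := a / (a - δ) with hp2
  have hp1lt : p1 < 1 := by rw [hp1, div_lt_one hc1]; linarith
  have hp2gt : 1 < p2 := by rw [hp2, lt_div_iff₀ hc2]; linarith
  have e1 : ∀ l : ℝ, 0 < l → (B * Z ^ δ / l) ^ p1 = (B * Z ^ δ) ^ p1 * l ^ (-p1) := by
    intro l hl
    rw [Real.div_rpow (by positivity) hl.le, Real.rpow_neg hl.le, div_eq_mul_inv]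
  have e2 : ∀ l : ℝ, 0 < l → (B * Z ^ (-δ) / l) ^ p2 = (B * Z ^ (-δ)) ^ p2 * l ^ (-p2) := by
    intro l hl
    rw [Real.div_rpow (by positivity) hl.le, Real.rpow_neg hl.le, div_eq_mul_inv]
  have hBΛ1 : (B * Z ^ δ) ^ p1 * Λ ^ (1 - p1) = B := by
    rw [hΛ, mul_rpow hB.le (by positivity), mul_rpow hB.le (by positivity),
      ← rpow_mul hZ.le, ← rpow_mul hZ.le]
    calc _ = (B ^ p1 * B ^ (1 - p1)) * (Z ^ (δ * p1) * Z ^ (-a * (1 - p1))) := by ring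
      _ = B := by
        rw [← rpow_add hB, ← rpow_add hZ]
        have z1 : δ * p1 + -a * (1 - p1) = 0 := by rw [hp1]; field_simp; ring
        have z2 : p1 + (1 - p1) = 1 := by ring
        rw [z1, z2, Real.rpow_one, Real.rpow_zero, mul_one]
  have hBΛ2 : (B * Z ^ (-δ)) ^ p2 * Λ ^ (1 - p2) = B := by
    rw [hΛ, mul_rpow hB.le (by positivity), mul_rpow hB.le (by positivity),
      ← rpow_mul hZ.le, ← rpow_mul hZ.le]
    calc _ = (B ^ p2 * B ^ (1 - p2)) * (Z ^ (-δ * p2) * Z ^ (-a * (1 - p2))) := by ring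
      _ = B := by
        rw [← rpow_add hB, ← rpow_add hZ]
        have z1 : -δ * p2 + -a * (1 - p2) = 0 := by rw [hp2]; field_simp; ring
        have z2 : p2 + (1 - p2) = 1 := by ring
        rw [z1, z2, Real.rpow_one, Real.rpow_zero, mul_one]
  have hlow : ∫⁻ l in Ioo 0 Λ, μ {x | ofReal l < H x} ^ a ≤ ofReal (B / (1 - p1)) := by
    calc _ ≤ ∫⁻ l in Ioo 0 Λ, ofReal ((B * Z ^ δ) ^ p1) * ofReal (l ^ (-p1)) := by
          refine setLIntegral_mono' measurableSet_Ioo fun l hl => (c1 l hl.1).trans_eq ?_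
          rw [e1 l hl.1, ofReal_mul (by positivity)]
      _ = _ := by
          rw [lintegral_const_mul _ (by fun_prop), setLIntegral_Ioo_rpow hp1lt hΛ0,
            ← ofReal_mul (by positivity), ← mul_div_assoc, hBΛ1]
  have hhigh : ∫⁻ l in Ici Λ, μ {x | ofReal l < H x} ^ a ≤ ofReal (B / (p2 - 1)) := by
    calc _ ≤ ∫⁻ l in Ici Λ, ofReal ((B * Z ^ (-δ)) ^ p2) * ofReal (l ^ (-p2)) := by
          refine setLIntegral_mono' measurableSet_Ici fun l hl =>
            (c2 l (hΛ0.trans_le hl)).trans_eq ?_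
          rw [e2 l (hΛ0.trans_le hl), ofReal_mul (by positivity)]
      _ = _ := by
          rw [lintegral_const_mul _ (by fun_prop), setLIntegral_congr Ioi_ae_eq_Ici.symm,
            ← ofReal_integral_eq_lintegral_ofReal (integrableOn_Ioi_rpow_of_lt (by linarith) hΛ0),
            integral_Ioi_rpow_of_lt (by linarith) hΛ0, ← ofReal_mul (by positivity)]
          · congr 1
            have h5 : -p2 + 1 = 1 - p2 := by ring
            have h6 : p2 - 1 ≠ 0 := by linarith
            have h7 : 1 - p2 ≠ 0 := by linarith
            rw [h5, neg_div, mul_neg, ← mul_div_assoc, hBΛ2, ← div_neg, neg_sub]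
          · exact (ae_restrict_iff' measurableSet_Ioi).2 (.of_forall fun l hl =>
              rpow_nonneg (hΛ0.le.trans (le_of_lt hl)) _)
  have hmeas : Measurable fun l : ℝ => μ {x | ofReal l < H x} ^ a := by
    have : Measurable fun l : ℝ => μ {x | ofReal l < H x} := by
      have hanti : Antitone fun l : ℝ => μ {x | ofReal l < H x} := by
        intro l l' hll
        exact measure_mono fun x hx => lt_of_le_of_lt (ofReal_le_ofReal hll) hx
      exact hanti.measurable
    exact this.pow_const a
  calc ∫⁻ x, W x * H x ∂μ = ∫⁻ l in Ioi (0 : ℝ), ∫⁻ x in {x | ofReal l < H x}, W x ∂μ :=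
        hcake
    _ ≤ ∫⁻ l in Ioi (0 : ℝ), N * μ {x | ofReal l < H x} ^ a :=
        setLIntegral_mono' measurableSet_Ioi fun l hl => hN _ (hset l) (hfin l hl)
    _ = N * ∫⁻ l in Ioi (0 : ℝ), μ {x | ofReal l < H x} ^ a :=
        lintegral_const_mul _ hmeas
    _ ≤ N * (ofReal (B / (1 - p1)) + ofReal (B / (p2 - 1))) := by
        gcongr
        rw [← Ioo_union_Ici_eq_Ioi hΛ0]
        refine (lintegral_union_le _ _ _).trans (add_le_add hlow hhigh)
    _ = ofReal (2 * a / δ) * (N * ofReal B) := by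
        rw [mul_left_comm, ← ofReal_mul (by positivity), ← ofReal_add]
        · congr 2
          have h5 : 1 - p1 = δ / (a + δ) := by rw [hp1]; field_simp; ring
          have h6 : p2 - 1 = δ / (a - δ) := by rw [hp2]; field_simp; ring
          rw [h5, h6]
          field_simp
          ring
        · have : 0 < 1 - p1 := by linarith
          positivity
        · have : 0 < p2 - 1 := by linarith
          positivity

end Endpoint

/-! ### Linear operators and their positive majorants -/

section LinearOperators

variable {𝕜 : Type*} [RCLike 𝕜] {n : ℕ} {α : ℝ}

lemma measurable_jk_uncurry : Measurable fun z : ℝ × Eu n => jk (n := n) z.1 z.2 := by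
  unfold jk
  fun_prop

lemma jk_anti {S T : ℝ} (hS : 0 < S) (hST : S ≤ T) (x : Eu n) : jk T x ≤ jk S x := by
  unfold jk
  refine ofReal_le_ofReal (inv_anti₀ (by positivity) ?_)
  gcongr

lemma measurable_cv_param {X : Type*} [MeasurableSpace X] {k F : X → Eu n → ℝ≥0∞}
    (hk : Measurable (uncurry k)) (hF : Measurable (uncurry F)) :
    Measurable fun z : X × Eu n => cv volume (k z.1) (F z.1) z.2 := by
  have : Measurable fun z : (X × Eu n) × Eu n =>
      uncurry k (z.1.1, z.2) * uncurry F (z.1.1, z.1.2 - z.2) := by fun_prop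
  exact this.lintegral_prod_right'

/-- The positive majorant of the Duhamel integral. -/
noncomputable def maj (α : ℝ) (F : ℝ → Eu n → ℝ≥0∞) (t : ℝ) (x : Eu n) : ℝ≥0∞ :=
  ∫⁻ τ in Ioo 0 t, cv volume (jk ((t - τ) ^ (1 / (2 * α)))) (F τ) x

lemma measurable_maj_integrand {F : ℝ → Eu n → ℝ≥0∞} (hF : Measurable (uncurry F))
    (t : ℝ) : Measurable (uncurry fun (τ : ℝ) (x : Eu n) =>
      cv volume (jk ((t - τ) ^ (1 / (2 * α)))) (F τ) x) := by
  have hk : Measurable (uncurry fun (τ : ℝ) (y : Eu n) =>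
      jk ((t - τ) ^ (1 / (2 * α))) y) := by
    refine measurable_jk_uncurry.comp (f := fun z : ℝ × Eu n => ((t - z.1) ^ (1 / (2 * α)), z.2)) ?_
    fun_prop
  exact measurable_cv_param hk hF

lemma measurable_maj {F : ℝ → Eu n → ℝ≥0∞} (hF : Measurable (uncurry F)) (t : ℝ) :
    Measurable (maj α F t) := by
  have := (measurable_maj_integrand (α := α) hF t).comp measurable_swap
  exact this.lintegral_prod_right'

lemma rpow_inv_exponent {s : ℝ} (hs : 0 < s) (hα : 0 < α) (n : ℕ) (c : ℝ) :
    (s ^ (1 / (2 * α))) ^ (-1 - n * c) = s ^ (-(1 / (2 * α)) - n / (2 * α) * c) := by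
  rw [← rpow_mul hs.le]
  congr 1
  field_simp

lemma exists_lpn_cv_jk_time_le (hα : 0 < α) (n : ℕ) : ∃ C : ℝ, 0 < C ∧ ∀ ρ m s : ℝ, 1 ≤ ρ → ρ ≤ m →
    0 < s → ∀ F : Eu n → ℝ≥0∞, Measurable F →
    lpn volume m (cv volume (jk (s ^ (1 / (2 * α)))) F) ≤
      ofReal (C * s ^ (-(1 / (2 * α)) - n / (2 * α) * (1 / ρ - 1 / m))) * lpn volume ρ F := by
  obtain ⟨C, hC, h⟩ := exists_lpn_cv_jk_le n
  refine ⟨C, hC, fun ρ m s hρ hm hs F hF => ?_⟩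
  rw [← rpow_inv_exponent hs hα]
  exact h ρ m _ hρ hm (by positivity) F hF

lemma exists_lpn_maj_le (hα : 0 < α) (n : ℕ) : ∃ C : ℝ, 0 < C ∧ ∀ ρ m t : ℝ, 1 ≤ ρ → ρ ≤ m →
    ∀ F : ℝ → Eu n → ℝ≥0∞, Measurable (uncurry F) →
    lpn volume m (maj α F t) ≤ ∫⁻ τ in Ioo 0 t,
      ofReal (C * (t - τ) ^ (-(1 / (2 * α)) - n / (2 * α) * (1 / ρ - 1 / m))) *
        lpn volume ρ (F τ) := by
  obtain ⟨C, hC, h⟩ := exists_lpn_cv_jk_time_le hα n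
  refine ⟨C, hC, fun ρ m t hρ hm F hF => ?_⟩
  refine (lpn_lintegral_le (hρ.trans hm) (measurable_maj_integrand hF t)).trans ?_
  refine setLIntegral_mono' measurableSet_Ioo fun τ hτ => ?_
  exact h ρ m _ hρ hm (sub_pos.2 hτ.2) _ (hF.comp measurable_prodMk_left)

/-- `K_t`, cut off to `t > 0`. -/
lemma measurable_indicator_kernel (hn : 0 < n) (hα : 1 / 2 < α) : Measurable fun z : ℝ × Eu n =>
    (Ioi (0 : ℝ) ×ˢ (univ : Set (Eu n))).indicator (fun z => kernel n α z.1 z.2) z := by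
  have hs : MeasurableSet (Ioi (0 : ℝ) ×ˢ (univ : Set (Eu n))) :=
    measurableSet_Ioi.prod MeasurableSet.univ
  classical
  have := (continuousOn_kernel hn hα).measurable_piecewise
    (continuousOn_const (c := (0 : ℝ)) (s := (Ioi (0 : ℝ) ×ˢ (univ : Set (Eu n)))ᶜ)) hs
  convert this using 1
  exact (piecewise_eq_indicator (f := fun z : ℝ × Eu n => _)).symm

lemma measurable_indicator_derivKernel (hn : 0 < n) (hα : 1 / 2 < α) (a : Eu n) :
    Measurable fun z : ℝ × Eu n =>
    (Ioi (0 : ℝ) ×ˢ (univ : Set (Eu n))).indicator (fun z => derivKernel α a z.1 z.2) z := by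
  have hs : MeasurableSet (Ioi (0 : ℝ) ×ˢ (univ : Set (Eu n))) :=
    measurableSet_Ioi.prod MeasurableSet.univ
  classical
  have := (continuousOn_derivKernel hn hα a).measurable_piecewise
    (continuousOn_const (c := (0 : ℝ)) (s := (Ioi (0 : ℝ) ×ˢ (univ : Set (Eu n)))ᶜ)) hs
  convert this using 1
  exact (piecewise_eq_indicator (f := fun z : ℝ × Eu n => _)).symm

lemma measurable_kernel (hn : 0 < n) (hα : 1 / 2 < α) {t : ℝ} (ht : 0 < t) :
    Measurable (kernel n α t) := by
  have := (measurable_indicator_kernel hn hα).comp (measurable_prodMk_left (x := t))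
  convert this using 1
  ext x
  simp [indicator, ht]

lemma measurable_derivKernel (hn : 0 < n) (hα : 1 / 2 < α) (a : Eu n) {t : ℝ} (ht : 0 < t) :
    Measurable (derivKernel α a t) := by
  have := (measurable_indicator_derivKernel hn hα a).comp (measurable_prodMk_left (x := t))
  convert this using 1
  ext x
  simp [indicator, ht]

lemma semigroup_apply (t : ℝ) (f : Eu n → 𝕜) (x : Eu n) :
    semigroup α t f x = ∫ y, kernel n α t y • f (x - y) := rfl

lemma semigroupDeriv_apply (a : Eu n) (t : ℝ) (f : Eu n → 𝕜) (x : Eu n) :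
    semigroupDeriv α a t f x = ∫ y, derivKernel α a t y • f (x - y) := rfl

lemma exists_enorm_kernel_le (hn : 0 < n) (hα : 1 / 2 < α) : ∃ C : ℝ, 0 < C ∧ ∀ t, 0 < t →
    ∀ x : Eu n, ‖kernel n α t x‖ₑ ≤ ofReal (C * t ^ (1 / (2 * α))) * jk (t ^ (1 / (2 * α))) x := by
  obtain ⟨C, hC, h⟩ := exists_kernel_bound hn hα
  refine ⟨C, hC, fun t ht x => ?_⟩
  rw [jk, ← ofReal_mul (by positivity), ← ofReal_norm, Real.norm_eq_abs]
  refine ofReal_le_ofReal ((h t ht x).trans_eq ?_)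
  ring

lemma exists_enorm_derivKernel_le (hn : 0 < n) (hα : 1 / 2 < α) (a : Eu n) : ∃ C : ℝ, 0 < C ∧
    ∀ t, 0 < t → ∀ x : Eu n, ‖derivKernel α a t x‖ₑ ≤ ofReal C * jk (t ^ (1 / (2 * α))) x := by
  obtain ⟨C, hC, h⟩ := exists_derivKernel_bound hn hα a
  refine ⟨C, hC, fun t ht x => ?_⟩
  rw [jk, ← ofReal_mul hC.le, ← ofReal_norm, Real.norm_eq_abs]
  exact ofReal_le_ofReal (h t ht x)

lemma cv_const_mul {k F : Eu n → ℝ≥0∞} {c : ℝ≥0∞} (hc : c ≠ ∞) (x : Eu n) :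
    cv volume (fun y => c * k y) F x = c * cv volume k F x := by
  simp only [cv, mul_assoc]
  rw [lintegral_const_mul' _ _ hc]

lemma cv_mono_left {k k' F : Eu n → ℝ≥0∞} (h : ∀ y, k y ≤ k' y) (x : Eu n) :
    cv volume k F x ≤ cv volume k' F x :=
  lintegral_mono fun y => by gcongr; exact h y

lemma enorm_integral_smul_le (k : Eu n → ℝ) (f : Eu n → 𝕜) (x : Eu n) :
    ‖∫ y, k y • f (x - y)‖ₑ ≤ cv volume (fun y => ‖k y‖ₑ) (fun y => ‖f y‖ₑ) x := by
  refine (enorm_integral_le_lintegral_enorm _).trans_eq (lintegral_congr fun y => ?_)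
  rw [enorm_smul]

lemma exists_enorm_semigroup_le (𝕜 : Type*) [RCLike 𝕜] (hn : 0 < n) (hα : 1 / 2 < α) :
    ∃ C : ℝ, 0 < C ∧ ∀ t, 0 < t →
    ∀ (f : Eu n → 𝕜) (x : Eu n), ‖semigroup α t f x‖ₑ ≤ ofReal (C * t ^ (1 / (2 * α))) *
      cv volume (jk (t ^ (1 / (2 * α)))) (fun y => ‖f y‖ₑ) x := by
  obtain ⟨C, hC, h⟩ := exists_enorm_kernel_le hn hα
  refine ⟨C, hC, fun t ht f x => ?_⟩
  rw [semigroup_apply, ← cv_const_mul ofReal_ne_top]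
  exact (enorm_integral_smul_le _ _ _).trans (cv_mono_left (h t ht) x)

lemma exists_enorm_semigroupDeriv_le (𝕜 : Type*) [RCLike 𝕜] (hn : 0 < n) (hα : 1 / 2 < α)
    (a : Eu n) : ∃ C : ℝ, 0 < C ∧ ∀ t, 0 < t →
    ∀ (f : Eu n → 𝕜) (x : Eu n), ‖semigroupDeriv α a t f x‖ₑ ≤ ofReal C *
      cv volume (jk (t ^ (1 / (2 * α)))) (fun y => ‖f y‖ₑ) x := by
  obtain ⟨C, hC, h⟩ := exists_enorm_derivKernel_le hn hα a
  refine ⟨C, hC, fun t ht f x => ?_⟩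
  rw [semigroupDeriv_apply, ← cv_const_mul ofReal_ne_top]
  exact (enorm_integral_smul_le _ _ _).trans (cv_mono_left (h t ht) x)

lemma exists_lpn_semigroup_majorant_le (hα : 0 < α) (n : ℕ) : ∃ C : ℝ, 0 < C ∧ ∀ ρ m t : ℝ, 1 ≤ ρ →
    ρ ≤ m → 0 < t → ∀ F : Eu n → ℝ≥0∞, Measurable F →
    lpn volume m (fun x => ofReal (t ^ (1 / (2 * α))) * cv volume (jk (t ^ (1 / (2 * α)))) F x) ≤
      ofReal (C * t ^ (-(n / (2 * α) * (1 / ρ - 1 / m)))) * lpn volume ρ F := by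
  obtain ⟨C, hC, h⟩ := exists_lpn_cv_jk_time_le hα n
  refine ⟨C, hC, fun ρ m t hρ hm ht F hF => ?_⟩
  rw [lpn_const_mul (by linarith) (measurable_cv (measurable_jk _) hF)]
  refine (mul_le_mul_right (h ρ m t hρ hm ht F hF) _).trans_eq ?_
  rw [← mul_assoc, ← ofReal_mul (by positivity)]
  congr 2
  rw [mul_left_comm, ← rpow_add ht]
  congr 2
  ring

lemma exists_lpn_semigroup_le (𝕜 : Type*) [RCLike 𝕜] (hn : 0 < n) (hα : 1 / 2 < α) :
    ∃ C : ℝ, 0 < C ∧ ∀ ρ m t : ℝ, 1 ≤ ρ → ρ ≤ m → 0 < t → ∀ f : Eu n → 𝕜, Measurable f →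
    lpn volume m (fun x => ‖semigroup α t f x‖ₑ) ≤
      ofReal (C * t ^ (-(n / (2 * α) * (1 / ρ - 1 / m)))) * lpn volume ρ (fun x => ‖f x‖ₑ) := by
  obtain ⟨C, hC, h⟩ := exists_lpn_semigroup_majorant_le (α := α) (by linarith) n
  obtain ⟨C', hC', h'⟩ := exists_enorm_semigroup_le 𝕜 hn hα
  refine ⟨C' * C, by positivity, fun ρ m t hρ hm ht f hf => ?_⟩
  have hm0 : 0 < m := by linarith
  have h1 : lpn volume m (fun x => ‖semigroup α t f x‖ₑ) ≤ lpn volume m (fun x =>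
      ofReal C' * (ofReal (t ^ (1 / (2 * α))) *
      cv volume (jk (t ^ (1 / (2 * α)))) (fun y => ‖f y‖ₑ) x)) := by
    refine lpn_mono hm0 fun x => ?_
    rw [← mul_assoc, ← ofReal_mul hC'.le]
    exact h' t ht f x
  rw [lpn_const_mul hm0 ((measurable_cv (measurable_jk _) hf.enorm).const_mul _)] at h1
  refine h1.trans ((mul_le_mul_right (h ρ m t hρ hm ht _ hf.enorm) _).trans_eq ?_)
  rw [← mul_assoc, ← ofReal_mul hC'.le, mul_assoc C']

end LinearOperators

/-! ### The Duhamel integral -/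

section Duhamel

variable {𝕜 : Type*} [RCLike 𝕜] {n : ℕ} {α : ℝ} {a : Eu n}

/-- `∫_0^t S_α(t - τ) (a·∇) f(τ) dτ`. -/
noncomputable def duh (α : ℝ) (a : Eu n) (f : ℝ → Eu n → 𝕜) (t : ℝ) (x : Eu n) : 𝕜 :=
  ∫ τ in Ioo 0 t, semigroupDeriv α a (t - τ) (f τ) x

/-- Absolute convergence of the Duhamel integral at `(t, x)`. -/
def DuhAt (α : ℝ) (a : Eu n) (f : ℝ → Eu n → 𝕜) (t : ℝ) (x : Eu n) : Prop :=
  (∀ᵐ τ ∂volume.restrict (Ioo 0 t), ConvolutionExistsAt (derivKernel α a (t - τ)) (f τ) x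
    (ContinuousLinearMap.lsmul ℝ ℝ) volume) ∧
  IntegrableOn (fun τ => semigroupDeriv α a (t - τ) (f τ) x) (Ioo 0 t)

lemma ae_comp_sub_left {𝕜 : Type*} {f g : Eu n → 𝕜} (h : f =ᵐ[volume] g) (x : Eu n) :
    (fun y => f (x - y)) =ᵐ[volume] fun y => g (x - y) :=
  (quasiMeasurePreserving_sub_left volume x).ae_eq_comp h

lemma semigroup_congr {f g : Eu n → 𝕜} (h : f =ᵐ[volume] g) (t : ℝ) :
    semigroup α t f = semigroup α t g := by
  ext x
  rw [semigroup_apply, semigroup_apply]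
  refine integral_congr_ae ?_
  filter_upwards [ae_comp_sub_left h x] with y hy
  rw [hy]

lemma semigroupDeriv_congr {f g : Eu n → 𝕜} (h : f =ᵐ[volume] g) (t : ℝ) :
    semigroupDeriv α a t f = semigroupDeriv α a t g := by
  ext x
  rw [semigroupDeriv_apply, semigroupDeriv_apply]
  refine integral_congr_ae ?_
  filter_upwards [ae_comp_sub_left h x] with y hy
  rw [hy]

lemma duh_congr {f g : ℝ → Eu n → 𝕜} {t : ℝ}
    (h : ∀ᵐ τ ∂volume.restrict (Ioo 0 t), f τ =ᵐ[volume] g τ) : duh α a f t = duh α a g t := by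
  ext x
  refine integral_congr_ae ?_
  filter_upwards [h] with τ hτ
  rw [semigroupDeriv_congr hτ]

lemma DuhAt.congr {f g : ℝ → Eu n → 𝕜} {t : ℝ} {x : Eu n} (hf : DuhAt α a f t x)
    (h : ∀ᵐ τ ∂volume.restrict (Ioo 0 t), f τ =ᵐ[volume] g τ) : DuhAt α a g t x := by
  refine ⟨?_, hf.2.congr ?_⟩
  · filter_upwards [h, hf.1] with τ hτ h1
    refine Integrable.congr h1 ?_
    filter_upwards [ae_comp_sub_left hτ x] with y hy
    rw [hy]
  · filter_upwards [h] with τ hτ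
    rw [semigroupDeriv_congr hτ]

/-- The kernel is controlled for positive times only, hence the cut-off to s > 0. It is harmless,
because a Duhamel integral over (0, t) only sees t - τ > 0. -/
lemma measurable_semigroupDeriv_param {X : Type*} [MeasurableSpace X] (hn : 0 < n) (hα : 1 / 2 < α)
    (a : Eu n) {s : X → ℝ} (hs : Measurable s) {f : X → Eu n → 𝕜}
    (hf : Measurable (uncurry f)) : Measurable fun z : X × Eu n =>
      ((s ⁻¹' Ioi 0) ×ˢ univ : Set (X × Eu n)).indicator
        (fun z : X × Eu n => semigroupDeriv α a (s z.1) (f z.1) z.2) z := by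
  have hk := measurable_indicator_derivKernel hn hα a
  have h1 : Measurable fun w : (X × Eu n) × Eu n =>
      ((Ioi (0 : ℝ) ×ˢ (univ : Set (Eu n))).indicator (fun z => derivKernel α a z.1 z.2)
        (s w.1.1, w.2)) • uncurry f (w.1.1, w.1.2 - w.2) := by
    refine Measurable.smul (hk.comp (by fun_prop)) (hf.comp (by fun_prop))
  have h2 := (h1.stronglyMeasurable.integral_prod_right' (ν := volume)).measurable
  convert h2 using 1
  ext z
  by_cases hz : 0 < s z.1
  · rw [indicator_of_mem (by simpa using hz), semigroupDeriv_apply]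
    simp [indicator, hz, uncurry]
  · rw [indicator_of_notMem (by simpa using hz)]
    simp [indicator, hz]

lemma measurable_duh (hn : 0 < n) (hα : 1 / 2 < α) (a : Eu n) {f : ℝ → Eu n → 𝕜}
    (hf : Measurable (uncurry f)) : Measurable (uncurry (duh α a f)) := by
  have h1 := measurable_semigroupDeriv_param (X := ℝ × ℝ) hn hα a (s := fun z => z.1 - z.2)
    (by fun_prop) (f := fun z => f z.2) (hf.comp (f := fun w : (ℝ × ℝ) × Eu n => (w.1.2, w.2))
      (by fun_prop))
  have h2 : Measurable fun w : (ℝ × Eu n) × ℝ => (Ioi (0 : ℝ)).indicator (fun _ =>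
      (((fun z : ℝ × ℝ => z.1 - z.2) ⁻¹' Ioi 0) ×ˢ univ : Set ((ℝ × ℝ) × Eu n)).indicator
        (fun z : (ℝ × ℝ) × Eu n => semigroupDeriv α a (z.1.1 - z.1.2) (f z.1.2) z.2)
        ((w.1.1, w.2), w.1.2)) w.2 := by
    have h3 := h1.comp (f := fun w : (ℝ × Eu n) × ℝ => ((w.1.1, w.2), w.1.2)) (by fun_prop)
    have h4 := h3.indicator (measurableSet_Ioi.preimage measurable_snd :
      MeasurableSet ((fun w : (ℝ × Eu n) × ℝ => w.2) ⁻¹' Ioi 0))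
    convert h4 using 1
    ext w
    by_cases hw : 0 < w.2 <;> simp [indicator, hw]
  have h3 := (h2.stronglyMeasurable.integral_prod_right' (ν := volume)).measurable
  convert h3 using 1
  ext ⟨t, x⟩
  simp only [uncurry, duh]
  rw [← integral_indicator measurableSet_Ioo]
  refine integral_congr_ae (.of_forall fun τ => ?_)
  by_cases h1 : 0 < τ <;> by_cases h2 : τ < t <;> simp [indicator, h1, h2]

lemma convolutionExistsAt_of_cv_lt_top (hn : 0 < n) (hα : 1 / 2 < α) {t : ℝ} (ht : 0 < t)
    {f : Eu n → 𝕜} (hf : Measurable f) {x : Eu n}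
    (h : cv volume (jk (t ^ (1 / (2 * α)))) (fun y => ‖f y‖ₑ) x ≠ ∞) :
    ConvolutionExistsAt (derivKernel α a t) f x (ContinuousLinearMap.lsmul ℝ ℝ) volume := by
  obtain ⟨C, hC, hb⟩ := exists_enorm_derivKernel_le hn hα a
  refine ⟨?_, ?_⟩
  · exact ((measurable_derivKernel hn hα a ht).smul
      (hf.comp (measurable_const.sub measurable_id))).aestronglyMeasurable
  · rw [hasFiniteIntegral_iff_enorm]
    refine lt_of_le_of_lt (b := ofReal C *
      cv volume (jk (t ^ (1 / (2 * α)))) (fun y => ‖f y‖ₑ) x) ?_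
      (ENNReal.mul_lt_top ENNReal.ofReal_lt_top h.lt_top)
    rw [← cv_const_mul ofReal_ne_top]
    refine lintegral_mono fun y => ?_
    rw [ContinuousLinearMap.lsmul_apply, enorm_smul]
    gcongr
    exact hb t ht y

/-- A finite majorant has a finite integrand for almost every τ, which gives the convolutions, and
dominates the time integral. Absolute convergence for almost every x can therefore be checked
through some L^m norm of `maj`. -/
lemma duhAt_of_maj_ne_top (hn : 0 < n) (hα : 1 / 2 < α) (a : Eu n) {f : ℝ → Eu n → 𝕜}
    (hf : Measurable (uncurry f)) {t : ℝ} {x : Eu n}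
    (h : maj α (fun τ y => ‖f τ y‖ₑ) t x ≠ ∞) : DuhAt α a f t x := by
  obtain ⟨C, hC, hb⟩ := exists_enorm_semigroupDeriv_le 𝕜 hn hα a
  have hF : Measurable (uncurry fun τ y => ‖f τ y‖ₑ) := hf.enorm
  have hm := (measurable_maj_integrand (α := α) hF t).comp (measurable_prodMk_right (y := x))
  refine ⟨?_, ?_⟩
  · have h1 := ae_lt_top hm h
    filter_upwards [h1, ae_restrict_mem measurableSet_Ioo] with τ h2 hτ
    exact convolutionExistsAt_of_cv_lt_top hn hα (sub_pos.2 hτ.2) (hf.comp measurable_prodMk_left)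
      h2.ne
  · have h1 := measurable_semigroupDeriv_param hn hα a (s := fun τ => t - τ) (by fun_prop) hf
    have h2 := h1.comp (measurable_prodMk_right (y := x))
    refine ⟨h2.aestronglyMeasurable.congr ?_, ?_⟩
    · filter_upwards [ae_restrict_mem measurableSet_Ioo] with τ hτ
      simp [indicator, hτ.2]
    · rw [hasFiniteIntegral_iff_enorm]
      refine lt_of_le_of_lt (b := ofReal C * maj α (fun τ y => ‖f τ y‖ₑ) t x) ?_
        (ENNReal.mul_lt_top ENNReal.ofReal_lt_top h.lt_top)
      rw [maj, ← lintegral_const_mul' _ _ ofReal_ne_top]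
      exact setLIntegral_mono' measurableSet_Ioo fun τ hτ => hb _ (sub_pos.2 hτ.2) _ _

lemma semigroupDeriv_sub {f g : Eu n → 𝕜} {s : ℝ} {x : Eu n}
    (hf : ConvolutionExistsAt (derivKernel α a s) f x (ContinuousLinearMap.lsmul ℝ ℝ) volume)
    (hg : ConvolutionExistsAt (derivKernel α a s) g x (ContinuousLinearMap.lsmul ℝ ℝ) volume) :
    semigroupDeriv α a s f x - semigroupDeriv α a s g x =
      semigroupDeriv α a s (fun y => f y - g y) x := by
  have := integral_sub hf hg
  simp only [ContinuousLinearMap.lsmul_apply] at this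
  simp only [semigroupDeriv_apply, smul_sub]
  rw [this]

lemma exists_enorm_duh_sub_le (𝕜 : Type*) [RCLike 𝕜] (hn : 0 < n) (hα : 1 / 2 < α) (a : Eu n) :
    ∃ C : ℝ, 0 < C ∧ ∀ (f g : ℝ → Eu n → 𝕜) (t : ℝ) (x : Eu n), DuhAt α a f t x → DuhAt α a g t x →
      ‖duh α a f t x - duh α a g t x‖ₑ ≤ ofReal C * maj α (fun τ y => ‖f τ y - g τ y‖ₑ) t x := by
  obtain ⟨C, hC, hb⟩ := exists_enorm_semigroupDeriv_le 𝕜 hn hα a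
  refine ⟨C, hC, fun f g t x hf hg => ?_⟩
  rw [duh, duh, ← integral_sub hf.2 hg.2, maj, ← lintegral_const_mul' _ _ ofReal_ne_top]
  refine (enorm_integral_le_lintegral_enorm _).trans (lintegral_mono_ae ?_)
  filter_upwards [hf.1, hg.1, ae_restrict_mem measurableSet_Ioo] with τ h1 h2 hτ
  rw [semigroupDeriv_sub h1 h2]
  exact hb _ (sub_pos.2 hτ.2) _ _

lemma exists_enorm_duh_le (𝕜 : Type*) [RCLike 𝕜] (hn : 0 < n) (hα : 1 / 2 < α) (a : Eu n) :
    ∃ C : ℝ, 0 < C ∧ ∀ (f : ℝ → Eu n → 𝕜) (t : ℝ) (x : Eu n),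
      ‖duh α a f t x‖ₑ ≤ ofReal C * maj α (fun τ y => ‖f τ y‖ₑ) t x := by
  obtain ⟨C, hC, hb⟩ := exists_enorm_semigroupDeriv_le 𝕜 hn hα a
  refine ⟨C, hC, fun f t x => ?_⟩
  rw [duh, maj, ← lintegral_const_mul' _ _ ofReal_ne_top]
  exact (enorm_integral_le_lintegral_enorm _).trans
    (setLIntegral_mono' measurableSet_Ioo fun τ hτ => hb _ (sub_pos.2 hτ.2) _ _)

end Duhamel

/-! ### Strong continuity of the semigroup -/

section StrongContinuity

variable {𝕜 : Type*} [RCLike 𝕜] {n : ℕ} {α : ℝ}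

/-- `S_α(t) f` in scaled form, valid for `t ≥ 0`. -/
noncomputable def sg (α t : ℝ) (f : Eu n → 𝕜) (x : Eu n) : 𝕜 :=
  ∫ z, kernel n α 1 z • f (x - t ^ (1 / (2 * α)) • z)

lemma integrable_kernel (hn : 0 < n) (hα : 1 / 2 < α) {t : ℝ} (ht : 0 < t) :
    Integrable (kernel n α t) := by
  by_contra h
  have := integral_kernel hn hα ht
  rw [integral_undef h] at this
  exact zero_ne_one this

lemma sg_zero (hn : 0 < n) (hα : 1 / 2 < α) (f : Eu n → 𝕜) : sg α 0 f = f := by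
  ext x
  have h0 : (0 : ℝ) ^ (1 / (2 * α)) = 0 := Real.zero_rpow (by positivity)
  simp only [sg, h0, zero_smul, sub_zero]
  rw [integral_smul_const, integral_kernel hn hα one_pos, one_smul]

/-- The substitution y = t^{1/(2α)} z. In scaled form the kernel no longer depends on t, and time
enters only through a translation of f, which makes sense down to t = 0. -/
lemma sg_of_pos (hα : 1 / 2 < α) {t : ℝ} (ht : 0 < t) (f : Eu n → 𝕜) :
    sg α t f = semigroup α t f := by
  ext x
  set c := t ^ (-(1 / (2 * α))) with hc
  have hc0 : 0 < c := by positivity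
  have hcc : ∀ y : Eu n, t ^ (1 / (2 * α)) • c • y = y := fun y => by
    rw [smul_smul, hc, ← rpow_add ht]
    simp
  have h := Measure.integral_comp_smul (volume : Measure (Eu n))
    (fun z => kernel n α 1 z • f (x - t ^ (1 / (2 * α)) • z)) c
  simp only [hcc] at h
  rw [semigroup_apply, sg]
  have h2 : ∀ y, kernel n α t y • f (x - y) = c ^ n • (kernel n α 1 (c • y) • f (x - y)) := by
    intro y
    rw [kernel_scaling (by linarith) ht, ← hc, smul_smul]
  simp only [h2]
  rw [integral_smul, h, smul_smul, abs_of_pos (by positivity)]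
  simp [hc0.ne']

lemma lpn_comp_sub_right {r : ℝ} (F : Eu n → ℝ≥0∞) (h : Eu n) :
    lpn volume r (fun x => F (x - h)) = lpn volume r F := by
  unfold lpn
  rw [lintegral_sub_right_eq_self (fun x => F x ^ r) h]

lemma measurable_sg_integrand (hn : 0 < n) (hα : 1 / 2 < α) (c : ℝ) {f : Eu n → 𝕜}
    (hf : Measurable f) :
    Measurable fun w : Eu n × Eu n => kernel n α 1 w.1 • f (w.2 - c • w.1) :=
  ((measurable_kernel hn hα one_pos).comp measurable_fst).smul (hf.comp (by fun_prop))

lemma ae_integrable_sg (hn : 0 < n) (hα : 1 / 2 < α) {r : ℝ} (hr : 1 ≤ r) (c : ℝ) {f : Eu n → 𝕜}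
    (hf : Measurable f) (hfr : lpn volume r (fun x => ‖f x‖ₑ) ≠ ∞) :
    ∀ᵐ x : Eu n, Integrable fun z => kernel n α 1 z • f (x - c • z) := by
  have hm := measurable_sg_integrand hn hα c hf
  have h1 := lpn_lintegral_le (μ := (volume : Measure (Eu n))) (ν := (volume : Measure (Eu n)))
    hr (F := fun z x => ‖kernel n α 1 z • f (x - c • z)‖ₑ) hm.enorm
  have h2 : ∫⁻ z, lpn volume r (fun x => ‖kernel n α 1 z • f (x - c • z)‖ₑ) < ∞ := by
    have h3 : ∀ z, lpn volume r (fun x => ‖kernel n α 1 z • f (x - c • z)‖ₑ) =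
        ‖kernel n α 1 z‖ₑ * lpn volume r (fun x => ‖f x‖ₑ) := by
      intro z
      simp only [enorm_smul]
      rw [lpn_const_mul (by linarith) (by fun_prop), lpn_comp_sub_right (fun x => ‖f x‖ₑ)]
    simp only [h3]
    rw [lintegral_mul_const' _ _ hfr]
    exact ENNReal.mul_lt_top (integrable_kernel hn hα one_pos).2 hfr.lt_top
  have h4 : ∫⁻ x, (∫⁻ z, ‖kernel n α 1 z • f (x - c • z)‖ₑ) ^ r < ∞ := by
    rw [← lpn_rpow_self (by linarith)]
    exact ENNReal.rpow_lt_top_of_nonneg (by linarith) (h1.trans_lt h2).ne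
  have hm2 : Measurable fun x : Eu n => ∫⁻ z, ‖kernel n α 1 z • f (x - c • z)‖ₑ :=
    (hm.comp measurable_swap).enorm.lintegral_prod_right'
  filter_upwards [ae_lt_top (hm2.pow_const r) h4.ne] with x hx
  refine ⟨(hm.comp measurable_prodMk_right).aestronglyMeasurable, ?_⟩
  rw [hasFiniteIntegral_iff_enorm]
  exact lt_top_of_rpow_lt_top (by linarith) hx
where
  lt_top_of_rpow_lt_top {y : ℝ≥0∞} {r : ℝ} (hr : 0 < r) (h : y ^ r < ∞) : y < ∞ := by
    rcases eq_or_ne y ∞ with rfl | hy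
    · simp [hr] at h
    · exact hy.lt_top

lemma tendsto_lpn_translation {r : ℝ} (hr : 1 ≤ r) (f : LpEu 𝕜 n (ofReal r)) (z : Eu n) (c₀ : ℝ) :
    Tendsto (fun c : ℝ => lpn volume r (fun x => ‖f (x - c • z) - f (x - c₀ • z)‖ₑ)) (𝓝 c₀)
      (𝓝 0) := by
  have : Fact (1 ≤ ofReal r) := ⟨by simpa using hr⟩
  have : Fact (ofReal r ≠ ∞) := ⟨ofReal_ne_top⟩
  set τ : ℝ → LpEu 𝕜 n (ofReal r) := fun c => DomAddAct.mk (-(c • z)) +ᵥ f with hτ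
  have hcont : Continuous τ := by
    have h1 : Continuous fun c : ℝ => DomAddAct.mk (-(c • z)) :=
      DomAddAct.continuous_mk.comp (by fun_prop)
    exact h1.vadd continuous_const
  have hnorm : ∀ c, lpn volume r (fun x => ‖f (x - c • z) - f (x - c₀ • z)‖ₑ) = ‖τ c - τ c₀‖ₑ := by
    intro c
    rw [Lp.enorm_def, eLpNorm_eq_lpn (by linarith)]
    refine lpn_congr_ae ?_
    have hv : ∀ c : ℝ, ∀ᵐ x, τ c x = f (x - c • z) := by
      intro c
      filter_upwards [DomAddAct.vadd_Lp_ae_eq (DomAddAct.mk (-(c • z))) f] with x hx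
      simp only [hτ]
      rw [hx]
      simp [sub_eq_neg_add]
    filter_upwards [hv c, hv c₀, Lp.coeFn_sub (τ c) (τ c₀)] with x h1 h2 h3
    rw [h3, Pi.sub_apply, h1, h2]
  simp only [hnorm]
  have : Tendsto (fun c => ‖τ c - τ c₀‖ₑ) (𝓝 c₀) (𝓝 ‖τ c₀ - τ c₀‖ₑ) :=
    ((hcont.sub continuous_const).enorm).tendsto c₀
  simpa using this

/-- The `L^r` modulus of continuity of `f` under translations by multiples of `z`. -/
noncomputable def transMod (r : ℝ) (f : Eu n → 𝕜) (c₀ c : ℝ) (z : Eu n) : ℝ≥0∞ :=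
  lpn volume r (fun x => ‖f (x - c • z) - f (x - c₀ • z)‖ₑ)

lemma measurable_transMod_integrand {f : Eu n → 𝕜} (hf : Measurable f) (c₀ c : ℝ) :
    Measurable fun w : Eu n × Eu n => ‖f (w.2 - c • w.1) - f (w.2 - c₀ • w.1)‖ₑ := by
  have h : ∀ c : ℝ, Measurable fun w : Eu n × Eu n => w.2 - c • w.1 := fun c =>
    (continuous_snd.sub (continuous_fst.const_smul c)).measurable
  have h1 : ∀ c : ℝ, Measurable fun w : Eu n × Eu n => f (w.2 - c • w.1) := fun c => hf.comp (h c)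
  exact ((h1 c).sub (h1 c₀)).enorm

lemma measurable_transMod {f : Eu n → 𝕜} (hf : Measurable f) (r c₀ c : ℝ) :
    Measurable (transMod r f c₀ c) :=
  (((measurable_transMod_integrand hf c₀ c).pow_const r).lintegral_prod_right').pow_const _

lemma transMod_le {r : ℝ} (hr : 1 ≤ r) {f : Eu n → 𝕜} (hf : Measurable f) (c₀ c : ℝ) (z : Eu n) :
    transMod r f c₀ c z ≤ 2 * lpn volume r (fun x => ‖f x‖ₑ) := by
  have hm : ∀ c : ℝ, Measurable fun x => ‖f (x - c • z)‖ₑ := fun c =>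
    (hf.comp (measurable_id.sub_const _)).enorm
  refine (lpn_mono (by linarith) fun x => enorm_sub_le).trans ?_
  refine (lpn_add_le hr (hm c) (hm c₀)).trans ?_
  rw [lpn_comp_sub_right (fun x => ‖f x‖ₑ), lpn_comp_sub_right (fun x => ‖f x‖ₑ), two_mul]

lemma lpn_sg_sub_le (hn : 0 < n) (hα : 1 / 2 < α) {r : ℝ} (hr : 1 ≤ r) {f : Eu n → 𝕜}
    (hf : Measurable f) (hfr : lpn volume r (fun x => ‖f x‖ₑ) ≠ ∞) (t₀ t : ℝ) :
    lpn volume r (fun x => ‖sg α t f x - sg α t₀ f x‖ₑ) ≤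
      ∫⁻ z, ‖kernel n α 1 z‖ₑ * transMod r f (t₀ ^ (1 / (2 * α))) (t ^ (1 / (2 * α))) z := by
  have hr0 : 0 < r := by linarith
  have h1 : lpn volume r (fun x => ‖sg α t f x - sg α t₀ f x‖ₑ) ≤ lpn volume r (fun x =>
      ∫⁻ z, ‖kernel n α 1 z‖ₑ *
        ‖f (x - t ^ (1 / (2 * α)) • z) - f (x - (t₀ ^ (1 / (2 * α))) • z)‖ₑ) := by
    refine lpn_mono_ae hr0 ?_
    filter_upwards [ae_integrable_sg hn hα hr (t ^ (1 / (2 * α))) hf hfr,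
      ae_integrable_sg hn hα hr (t₀ ^ (1 / (2 * α))) hf hfr] with x hx hx0
    rw [sg, sg, ← integral_sub hx hx0]
    refine (enorm_integral_le_lintegral_enorm _).trans_eq (lintegral_congr fun z => ?_)
    rw [← smul_sub, enorm_smul]
  refine h1.trans ((lpn_lintegral_le hr ?_).trans_eq ?_)
  · exact (((measurable_kernel hn hα one_pos).comp measurable_fst).enorm).mul
      (measurable_transMod_integrand hf _ _)
  · refine lintegral_congr fun z => ?_
    exact lpn_const_mul hr0
      ((measurable_transMod_integrand hf _ _).comp (measurable_prodMk_left (x := z))) _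

/-- Minkowski bounds the difference by an average of translation moduli against one fixed integrable
kernel. Each modulus tends to 0 by continuity of translations in L^r and is at most twice the norm
of f, so dominated convergence applies, at t₀ = 0 as well. -/
lemma tendsto_lpn_sg (hn : 0 < n) (hα : 1 / 2 < α) {r : ℝ} (hr : 1 ≤ r)
    (f : LpEu 𝕜 n (ofReal r)) (t₀ : ℝ) :
    Tendsto (fun t : ℝ => lpn volume r (fun x => ‖sg α t f x - sg α t₀ f x‖ₑ)) (𝓝 t₀) (𝓝 0) := by
  have hr0 : 0 < r := by linarith
  have hfm : Measurable (f : Eu n → 𝕜) := (Lp.stronglyMeasurable f).measurable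
  have hfin : lpn volume r (fun x => ‖f x‖ₑ) ≠ ∞ := by
    rw [← eLpNorm_eq_lpn hr0]
    exact Lp.eLpNorm_ne_top f
  have hkm := (measurable_kernel hn hα one_pos).enorm
  have hlim : Tendsto (fun t : ℝ => ∫⁻ z, ‖kernel n α 1 z‖ₑ *
      transMod r f (t₀ ^ (1 / (2 * α))) (t ^ (1 / (2 * α))) z) (𝓝 t₀) (𝓝 (∫⁻ _ : Eu n, 0)) := by
    refine tendsto_lintegral_filter_of_dominated_convergence
      (fun z => ‖kernel n α 1 z‖ₑ * (2 * lpn volume r (fun x => ‖f x‖ₑ)))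
      (.of_forall fun t => hkm.mul (measurable_transMod hfm _ _ _))
      (.of_forall fun t => .of_forall fun z => mul_le_mul_right (transMod_le hr hfm _ _ _) _)
      ?_ (.of_forall fun z => ?_)
    · rw [lintegral_mul_const' _ _ (mul_ne_top (by simp) hfin)]
      exact (ENNReal.mul_lt_top (integrable_kernel hn hα one_pos).2
        (ENNReal.mul_lt_top (by simp) hfin.lt_top)).ne
    · have h1 := tendsto_lpn_translation hr f z (t₀ ^ (1 / (2 * α)))
      have h2 : Tendsto (fun t : ℝ => t ^ (1 / (2 * α))) (𝓝 t₀) (𝓝 (t₀ ^ (1 / (2 * α)))) :=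
        (Real.continuous_rpow_const (by positivity)).tendsto t₀
      have h3 := ENNReal.Tendsto.const_mul (h1.comp h2)
        (Or.inr (enorm_ne_top (x := kernel n α 1 z)))
      rw [mul_zero] at h3
      exact h3
  rw [lintegral_zero] at hlim
  exact tendsto_of_tendsto_of_tendsto_of_le_of_le tendsto_const_nhds hlim (fun t => zero_le)
    (lpn_sg_sub_le hn hα hr hfm hfin t₀)

end StrongContinuity

/-! ### Smoothing estimates for small times -/

section Smoothing

variable {n : ℕ} {α : ℝ}

/-- The positive majorant of the semigroup. -/
noncomputable def sgMaj (α t : ℝ) (F : Eu n → ℝ≥0∞) (x : Eu n) : ℝ≥0∞ :=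
  ofReal (t ^ (1 / (2 * α))) * cv volume (jk (t ^ (1 / (2 * α)))) F x

lemma measurable_sgMaj (t : ℝ) {F : Eu n → ℝ≥0∞} (hF : Measurable F) : Measurable (sgMaj α t F) :=
  (measurable_cv (measurable_jk _) hF).const_mul _

lemma cv_add {k F G : Eu n → ℝ≥0∞} (hk : Measurable k) (hF : Measurable F) (x : Eu n) :
    cv volume k (fun y => F y + G y) x = cv volume k F x + cv volume k G x := by
  simp only [cv, mul_add]
  rw [lintegral_add_left]
  exact hk.mul (hF.comp (measurable_const.sub measurable_id))

lemma sgMaj_add (t : ℝ) {F G : Eu n → ℝ≥0∞} (hF : Measurable F) (x : Eu n) :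
    sgMaj α t (fun y => F y + G y) x = sgMaj α t F x + sgMaj α t G x := by
  simp only [sgMaj, cv_add (measurable_jk _) hF, mul_add]

/-- The part of `F` above the level `l` tends to zero in `L^r` as `l → ∞`. -/
lemma tendsto_lpn_indicator_lt {X : Type*} [MeasurableSpace X] {μ : Measure X} {r : ℝ} (hr : 0 < r)
    {F : X → ℝ≥0∞} (hF : Measurable F) (hfin : lpn μ r F ≠ ∞) :
    Tendsto (fun k : ℕ => lpn μ r ({x | (k : ℝ≥0∞) < F x}.indicator F)) atTop (𝓝 0) := by
  have hI : ∫⁻ x, F x ^ r ∂μ ≠ ∞ := by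
    rw [← lpn_rpow_self hr]
    exact rpow_ne_top_of_nonneg hr.le hfin
  have hS : ∀ k : ℕ, MeasurableSet {x | (k : ℝ≥0∞) < F x} := fun k => measurableSet_lt (by fun_prop) hF
  have h1 : Tendsto (fun k : ℕ => ∫⁻ x, ({x | (k : ℝ≥0∞) < F x}.indicator F x) ^ r ∂μ) atTop
      (𝓝 (∫⁻ _, 0 ∂μ)) := by
    refine tendsto_lintegral_of_dominated_convergence (fun x => F x ^ r)
      (fun k => (hF.indicator (hS k)).pow_const r)
      (fun k => .of_forall fun x => ?_) hI ?_
    · exact rpow_le_rpow (indicator_le_self _ _ _) hr.le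
    · filter_upwards [ae_lt_top (hF.pow_const r) hI] with x hx
      have hx' : F x ≠ ∞ := by
        intro h
        simp [h, hr] at hx
      obtain ⟨N, hN⟩ := ENNReal.exists_nat_gt hx'
      refine tendsto_const_nhds.congr' ?_
      filter_upwards [eventually_ge_atTop N] with k hk
      rw [indicator_of_notMem, zero_rpow_of_pos hr]
      have : (N : ℝ≥0∞) ≤ k := by exact_mod_cast hk
      simpa using hN.le.trans this
  rw [lintegral_zero] at h1
  have h2 := h1.ennrpow_const (1 / r)
  rwa [zero_rpow_of_pos (by positivity)] at h2

/-- Where F ≤ k one has F^m ≤ k^{m-r} F^r: a truncated function gains integrability. -/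
lemma lpn_indicator_le_ne_top {X : Type*} [MeasurableSpace X] {μ : Measure X} {r m : ℝ} (hr : 0 < r)
    (hrm : r ≤ m) {F : X → ℝ≥0∞} (hF : Measurable F) (hfin : lpn μ r F ≠ ∞) (k : ℕ) :
    lpn μ m ({x | (k : ℝ≥0∞) < F x}ᶜ.indicator F) ≠ ∞ := by
  have hm : 0 < m := by linarith
  have hI : ∫⁻ x, F x ^ r ∂μ ≠ ∞ := by
    rw [← lpn_rpow_self hr]
    exact rpow_ne_top_of_nonneg hr.le hfin
  refine rpow_ne_top_of_nonneg (by positivity) ?_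
  refine ne_top_of_le_ne_top (b := (k : ℝ≥0∞) ^ (m - r) * ∫⁻ x, F x ^ r ∂μ) (mul_ne_top
    (rpow_ne_top_of_nonneg (by linarith) (by simp)) hI) ?_
  rw [← lintegral_const_mul _ (hF.pow_const r)]
  refine lintegral_mono fun x => ?_
  by_cases hx : (k : ℝ≥0∞) < F x
  · rw [indicator_of_notMem (by simpa using hx), zero_rpow_of_pos hm]
    exact zero_le
  · rw [indicator_of_mem (by simpa using hx)]
    calc F x ^ m = F x ^ (m - r) * F x ^ r := by
          rw [← rpow_add_of_nonneg _ _ (by linarith) hr.le, sub_add_cancel]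
      _ ≤ _ := by
          gcongr
          exact not_lt.1 hx

/-- The part of F above a high level is small in L^r and pays the full weight t^{-δ}; the rest lies
in L^m, where the semigroup is bounded without a singular factor, so that its contribution is
o(t^{-δ}). In the critical case this replaces smallness of the data. -/
lemma lpn_sgMaj_small (hα : 0 < α) (hn : 0 < n) {r m : ℝ} (hr : 1 ≤ r) (hrm : r < m)
    {F : Eu n → ℝ≥0∞} (hF : Measurable F) (hfin : lpn volume r F ≠ ∞) {ε : ℝ} (hε : 0 < ε) :
    ∃ t₀ : ℝ, 0 < t₀ ∧ ∀ t, 0 < t → t < t₀ → lpn volume m (sgMaj α t F) ≤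
      ofReal (ε * t ^ (-(n / (2 * α) * (1 / r - 1 / m)))) := by
  obtain ⟨C, hC, hb⟩ := exists_lpn_semigroup_majorant_le hα n
  have hm : 1 ≤ m := hr.trans hrm.le
  set δ := n / (2 * α) * (1 / r - 1 / m) with hδ
  have hδ0 : 0 < δ := by
    have : 1 / m < 1 / r := one_div_lt_one_div_of_lt (by linarith) hrm
    have h2 : (0 : ℝ) < n := by exact_mod_cast hn
    have : 0 < 1 / r - 1 / m := by linarith
    positivity
  have h1 := tendsto_lpn_indicator_lt (μ := volume) (by linarith) hF hfin
  obtain ⟨k, hk⟩ := ((tendsto_order.1 h1).2 (ofReal (ε / (2 * C)))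
    (ENNReal.ofReal_pos.2 (by positivity))).exists
  set S := {x | (k : ℝ≥0∞) < F x} with hS
  have hSm : MeasurableSet S := measurableSet_lt (by fun_prop) hF
  have hB := lpn_indicator_le_ne_top (μ := volume) (by linarith) hrm.le hF hfin k
  rw [← hS] at hB
  set B := lpn volume m (Sᶜ.indicator F) with hBdef
  have ht : Tendsto (fun t : ℝ => C * B.toReal * t ^ δ) (𝓝 0) (𝓝 (C * B.toReal * 0 ^ δ)) :=
    ((Real.continuous_rpow_const hδ0.le).tendsto 0).const_mul _
  rw [Real.zero_rpow hδ0.ne', mul_zero] at ht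
  obtain ⟨t₀, ht₀, hsm⟩ := Metric.eventually_nhds_iff.1 ((tendsto_order.1 ht).2 (ε / 2)
    (by positivity))
  refine ⟨t₀, ht₀, fun t ht htt => ?_⟩
  have hsplit : F = fun x => Sᶜ.indicator F x + S.indicator F x := by
    ext x
    exact (congrFun (indicator_compl_add_self S F) x).symm
  have hm1 := hF.indicator hSm.compl
  have hm2 := hF.indicator hSm
  have e1 : lpn volume m (sgMaj α t (Sᶜ.indicator F)) ≤ ofReal (ε / 2 * t ^ (-δ)) := by
    refine (hb m m t hm le_rfl ht _ hm1).trans ?_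
    rw [← hBdef, ← ofReal_toReal hB, ← ofReal_mul (by positivity)]
    refine ofReal_le_ofReal ?_
    have h2 := hsm (y := t) (by simpa [abs_of_pos ht] using htt)
    have h3 : C * B.toReal ≤ ε / 2 * t ^ (-δ) := by
      have h4 : (C * B.toReal * t ^ δ) * t ^ (-δ) ≤ ε / 2 * t ^ (-δ) := by gcongr
      rwa [mul_assoc, ← rpow_add ht, add_neg_cancel, Real.rpow_zero, mul_one] at h4
    simpa using h3
  have e2 : lpn volume m (sgMaj α t (S.indicator F)) ≤ ofReal (ε / 2 * t ^ (-δ)) := by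
    refine (hb r m t hr hrm.le ht _ hm2).trans ?_
    refine (mul_le_mul_right hk.le _).trans ?_
    rw [← ofReal_mul (by positivity)]
    refine ofReal_le_ofReal (le_of_eq ?_)
    rw [← hδ]
    field_simp
  calc lpn volume m (sgMaj α t F)
      = lpn volume m (fun x => sgMaj α t (Sᶜ.indicator F) x + sgMaj α t (S.indicator F) x) := by
        conv_lhs => rw [hsplit]
        congr 1
        ext x
        exact sgMaj_add t hm1 x
    _ ≤ _ := lpn_add_le hm (measurable_sgMaj t hm1) (measurable_sgMaj t hm2)
    _ ≤ _ := add_le_add e1 e2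
    _ = _ := by
        rw [← ofReal_add (by positivity) (by positivity)]
        congr 1
        ring

end Smoothing

/-! ### Splitting a function at a time-dependent level -/

section Levels

variable {X : Type*} [MeasurableSpace X] {μ : Measure X} {F : X → ℝ≥0∞}

/-- The set where `F` exceeds the level `t ^ (-γ)`. -/
def levelSet (F : X → ℝ≥0∞) (γ t : ℝ) : Set X := {x | ofReal (t ^ (-γ)) < F x}

lemma measurableSet_levelSet (hF : Measurable F) (γ t : ℝ) : MeasurableSet (levelSet F γ t) :=
  measurableSet_lt measurable_const hF

lemma measurable_levelSet_indicator (hF : Measurable F) (γ : ℝ) :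
    Measurable fun z : ℝ × X => (levelSet F γ z.1).indicator F z.2 := by
  have hS : MeasurableSet {z : ℝ × X | ofReal (z.1 ^ (-γ)) < F z.2} :=
    measurableSet_lt (by fun_prop) (by fun_prop)
  exact (hF.comp measurable_snd).indicator hS

lemma measurable_levelSet_compl_indicator (hF : Measurable F) (γ : ℝ) :
    Measurable fun z : ℝ × X => (levelSet F γ z.1)ᶜ.indicator F z.2 := by
  have hS : MeasurableSet {z : ℝ × X | ofReal (z.1 ^ (-γ)) < F z.2} :=
    measurableSet_lt (by fun_prop) (by fun_prop)
  exact (hF.comp measurable_snd).indicator hS.compl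

lemma ofReal_rpow_neg_lt_iff {γ t f : ℝ} (hγ : 0 < γ) (ht : 0 < t) (hf : 0 < f) :
    ofReal (t ^ (-γ)) < ofReal f ↔ f ^ (-(1 / γ)) < t := by
  rw [ENNReal.ofReal_lt_ofReal_iff hf]
  constructor
  · intro h
    have := Real.rpow_lt_rpow_of_neg (by positivity) h (z := -(1 / γ)) (by
      have : 0 < 1 / γ := by positivity
      linarith)
    rwa [← rpow_mul ht.le, neg_mul_neg, mul_one_div_cancel hγ.ne', Real.rpow_one] at this
  · intro h
    have := Real.rpow_lt_rpow_of_neg (by positivity) h (z := -γ) (by linarith)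
    rwa [← rpow_mul hf.le, neg_mul_neg, one_div_mul_cancel hγ.ne', Real.rpow_one] at this

/-- Fubini: at fixed x the condition F x > t^{-γ} means t > F(x)^{-1/γ}, and the weight integrated
over this half-line gives a multiple of F(x)^{r-1}. -/
lemma lintegral_level_above [SFinite μ] (hF : Measurable F) {γ r : ℝ} (hγ : 0 < γ) (hr : 1 < r) :
    ∫⁻ t in Ioi (0 : ℝ), ofReal (t ^ (-1 - γ * (r - 1))) * ∫⁻ x, (levelSet F γ t).indicator F x ∂μ ≤
      ofReal (1 / (γ * (r - 1))) * ∫⁻ x, F x ^ r ∂μ := by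
  set η := γ * (r - 1) with hη
  have hη0 : 0 < η := mul_pos hγ (by linarith)
  have hm := measurable_levelSet_indicator hF γ
  have h1 : ∀ t : ℝ, ofReal (t ^ (-1 - η)) * ∫⁻ x, (levelSet F γ t).indicator F x ∂μ =
      ∫⁻ x, ofReal (t ^ (-1 - η)) * (levelSet F γ t).indicator F x ∂μ := fun t =>
    (lintegral_const_mul _ (hm.comp measurable_prodMk_left)).symm
  simp only [h1]
  rw [lintegral_lintegral_swap, ← lintegral_const_mul _ (hF.pow_const r)]
  swap
  · exact ((by fun_prop : Measurable fun z : ℝ × X => ofReal (z.1 ^ (-1 - η))).mul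
      hm).aemeasurable
  refine lintegral_mono fun x => ?_
  rcases eq_or_ne (F x) ∞ with hx | hx
  · rw [hx, ENNReal.top_rpow_of_pos (by linarith), ENNReal.mul_top]
    · exact le_top
    · simpa using hη0
  rcases eq_or_ne (F x) 0 with h0 | h0
  · have : ∀ t, (levelSet F γ t).indicator F x = 0 := fun t => by
      rw [indicator_apply_eq_zero]
      intro _; exact h0
    simp [this]
  set f := (F x).toReal with hf
  have hfx : F x = ofReal f := (ofReal_toReal hx).symm
  have hf0 : 0 < f := ENNReal.toReal_pos h0 hx
  set c := f ^ (-(1 / γ)) with hc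
  have hc0 : 0 < c := by positivity
  have h2 : ∀ t ∈ Ioi (0 : ℝ), ofReal (t ^ (-1 - η)) * (levelSet F γ t).indicator F x =
      (Ioi c).indicator (fun t => ofReal (t ^ (-1 - η)) * ofReal f) t := by
    intro t ht
    by_cases h : x ∈ levelSet F γ t
    · have h' := h
      rw [levelSet, Set.mem_ofPred_eq, hfx, ofReal_rpow_neg_lt_iff hγ ht hf0] at h'
      rw [indicator_of_mem h, indicator_of_mem (mem_Ioi.2 h'), hfx]
    · have h' := h
      rw [levelSet, Set.mem_ofPred_eq, hfx, ofReal_rpow_neg_lt_iff hγ ht hf0] at h'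
      rw [indicator_of_notMem h, indicator_of_notMem (notMem_Ioi.2 (not_lt.1 h')), mul_zero]
  rw [setLIntegral_congr_fun measurableSet_Ioi h2, lintegral_indicator measurableSet_Ioi,
    Measure.restrict_restrict measurableSet_Ioi, Ioi_inter_Ioi, max_eq_left hc0.le,
    lintegral_mul_const _ (by fun_prop)]
  have hint := integrableOn_Ioi_rpow_of_lt (a := -1 - η) (by linarith) hc0
  rw [← ofReal_integral_eq_lintegral_ofReal hint, integral_Ioi_rpow_of_lt (by linarith) hc0, hfx,
    ← ENNReal.ofReal_mul' hf0.le, ofReal_rpow_of_pos hf0, ← ofReal_mul (by positivity)]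
  · refine ofReal_le_ofReal (le_of_eq ?_)
    have h3 : c ^ (-1 - η + 1) = f ^ (r - 1) := by
      rw [hc, ← rpow_mul hf0.le]
      congr 1
      rw [hη]
      field_simp
      ring
    rw [h3, show -1 - η + 1 = -η by ring, neg_div_neg_eq]
    have h4 : f ^ r = f ^ (r - 1) * f := by
      conv_lhs => rw [show r = (r - 1) + 1 by ring, rpow_add hf0, Real.rpow_one]
    rw [h4]
    ring
  · filter_upwards [ae_restrict_mem measurableSet_Ioi] with t ht
    exact rpow_nonneg (hc0.le.trans ht.le) _

/-- The companion below the level: the condition becomes t ≤ F(x)^{-1/γ}, the weight integrates to a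
multiple of F(x)^{-(s-r)}, and F^s turns into F^r. -/
lemma lintegral_level_below [SFinite μ] (hF : Measurable F) {γ r s : ℝ} (hγ : 0 < γ) (hr : 0 < r)
    (hrs : r < s) :
    ∫⁻ t in Ioi (0 : ℝ), ofReal (t ^ (-1 + γ * (s - r))) *
      ∫⁻ x, (levelSet F γ t)ᶜ.indicator F x ^ s ∂μ ≤
      ofReal (1 / (γ * (s - r))) * ∫⁻ x, F x ^ r ∂μ := by
  set η := γ * (s - r) with hη
  have hη0 : 0 < η := mul_pos hγ (by linarith)
  have hs : 0 < s := hr.trans hrs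
  have hm := (measurable_levelSet_compl_indicator hF γ).pow_const s
  have h1 : ∀ t : ℝ, ofReal (t ^ (-1 + η)) * ∫⁻ x, (levelSet F γ t)ᶜ.indicator F x ^ s ∂μ =
      ∫⁻ x, ofReal (t ^ (-1 + η)) * (levelSet F γ t)ᶜ.indicator F x ^ s ∂μ := fun t =>
    (lintegral_const_mul _ (hm.comp measurable_prodMk_left)).symm
  simp only [h1]
  rw [lintegral_lintegral_swap, ← lintegral_const_mul _ (hF.pow_const r)]
  swap
  · exact ((by fun_prop : Measurable fun z : ℝ × X => ofReal (z.1 ^ (-1 + η))).mul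
      hm).aemeasurable
  refine lintegral_mono fun x => ?_
  rcases eq_or_ne (F x) ∞ with hx | hx
  · rw [hx, ENNReal.top_rpow_of_pos (by linarith), ENNReal.mul_top]
    · exact le_top
    · simpa using hη0
  rcases eq_or_ne (F x) 0 with h0 | h0
  · have : ∀ t, (levelSet F γ t)ᶜ.indicator F x = 0 := fun t => by
      rw [indicator_apply_eq_zero]
      intro _; exact h0
    simp [this, hs]
  set f := (F x).toReal with hf
  have hfx : F x = ofReal f := (ofReal_toReal hx).symm
  have hf0 : 0 < f := ENNReal.toReal_pos h0 hx
  set c := f ^ (-(1 / γ)) with hc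
  have hc0 : 0 < c := by positivity
  have h2 : ∀ t ∈ Ioi (0 : ℝ), ofReal (t ^ (-1 + η)) * (levelSet F γ t)ᶜ.indicator F x ^ s =
      (Iic c).indicator (fun t => ofReal (t ^ (-1 + η)) * ofReal f ^ s) t := by
    intro t ht
    by_cases h : x ∈ levelSet F γ t
    · have h' := h
      rw [levelSet, Set.mem_ofPred_eq, hfx, ofReal_rpow_neg_lt_iff hγ ht hf0] at h'
      rw [indicator_of_notMem (by simpa using h), indicator_of_notMem (notMem_Iic.2 h'),
        zero_rpow_of_pos hs, mul_zero]
    · have h' := h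
      rw [levelSet, Set.mem_ofPred_eq, hfx, ofReal_rpow_neg_lt_iff hγ ht hf0] at h'
      rw [indicator_of_mem (by simpa using h), indicator_of_mem (mem_Iic.2 (not_lt.1 h')), hfx]
  rw [setLIntegral_congr_fun measurableSet_Ioi h2, lintegral_indicator measurableSet_Iic,
    Measure.restrict_restrict measurableSet_Iic, inter_comm, Ioi_inter_Iic,
    restrict_Ioo_eq_restrict_Ioc.symm, lintegral_mul_const _ (by fun_prop)]
  have h3 := setLIntegral_Ioo_rpow (f := 1 - η) (by linarith) hc0
  rw [show -(1 - η) = -1 + η by ring, show 1 - (1 - η) = η by ring] at h3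
  rw [h3, hfx, ofReal_rpow_of_pos hf0, ofReal_rpow_of_pos hf0,
    ← ofReal_mul (by positivity), ← ofReal_mul (by positivity)]
  refine ofReal_le_ofReal (le_of_eq ?_)
  have h4 : c ^ η = f ^ (-(s - r)) := by
    rw [hc, ← rpow_mul hf0.le]
    congr 1
    rw [hη]
    field_simp
  have h5 : f ^ r = f ^ (-(s - r)) * f ^ s := by
    rw [← rpow_add hf0]
    congr 1
    ring
  rw [h4, h5]
  ring

/-- Above the level, F ≤ t^{γ(r-1)} F^r pointwise. This crude bound for a fixed time is used for all
but one power of the integral. -/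
lemma lintegral_levelSet_le (hF : Measurable F) {γ r : ℝ} (hr : 1 < r)
    (hI : ∫⁻ x, F x ^ r ∂μ ≤ 1) {t : ℝ} (ht : 0 < t) :
    ∫⁻ x, (levelSet F γ t).indicator F x ∂μ ≤ ofReal (t ^ (γ * (r - 1))) := by
  refine le_trans ?_ (mul_le_of_le_one_right' hI)
  rw [← lintegral_const_mul _ (hF.pow_const r)]
  refine lintegral_mono fun x => ?_
  by_cases hx : x ∈ levelSet F γ t
  · rw [indicator_of_mem hx]
    have hx' : ofReal (t ^ (-γ)) < F x := hx
    rcases eq_or_ne (F x) ∞ with h | h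
    · rw [h, ENNReal.top_rpow_of_pos (by linarith), ENNReal.mul_top]
      simpa using rpow_pos_of_pos ht _
    have h1 : F x ^ r = F x ^ (r - 1) * F x := by
      conv_lhs => rw [show r = (r - 1) + 1 by ring,
        rpow_add_of_nonneg _ _ (by linarith) zero_le_one, rpow_one]
    rw [h1, ← mul_assoc]
    refine le_mul_of_one_le_left' ?_
    have h2 : ofReal (t ^ (-γ)) ^ (r - 1) ≤ F x ^ (r - 1) := rpow_le_rpow hx'.le (by linarith)
    refine le_trans (le_of_eq ?_) (mul_le_mul_right h2 _)
    rw [ofReal_rpow_of_pos (by positivity), ← ofReal_mul (by positivity),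
      ← rpow_mul ht.le, ← rpow_add ht]
    simp
  · rw [indicator_of_notMem hx]
    exact zero_le

lemma lintegral_levelSet_compl_le (hF : Measurable F) {γ r s : ℝ} (hr : 0 < r) (hrs : r < s)
    (hI : ∫⁻ x, F x ^ r ∂μ ≤ 1) {t : ℝ} (ht : 0 < t) :
    ∫⁻ x, (levelSet F γ t)ᶜ.indicator F x ^ s ∂μ ≤ ofReal (t ^ (-(γ * (s - r)))) := by
  refine le_trans ?_ (mul_le_of_le_one_right' hI)
  rw [← lintegral_const_mul _ (hF.pow_const r)]
  refine lintegral_mono fun x => ?_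
  by_cases hx : x ∈ levelSet F γ t
  · rw [indicator_of_notMem (by simpa using hx), zero_rpow_of_pos (by linarith)]
    exact zero_le
  · rw [indicator_of_mem (by simpa using hx)]
    have hx' : F x ≤ ofReal (t ^ (-γ)) := not_lt.1 hx
    have h1 : F x ^ s = F x ^ (s - r) * F x ^ r := by
      rw [← rpow_add_of_nonneg _ _ (by linarith) hr.le, sub_add_cancel]
    rw [h1]
    refine mul_le_mul_left ?_ _
    refine (rpow_le_rpow hx' (by linarith)).trans_eq ?_
    rw [ofReal_rpow_of_pos (by positivity), ← rpow_mul ht.le, neg_mul]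

end Levels

/-! ### Space-time bound for the linear evolution -/

section Giga

variable {n : ℕ} {α : ℝ}

/-- Fubini can only treat the first power of an integral over level sets, so the surplus powers are
traded for a crude bound. -/
lemma rpow_mul_rpow_le {X A : ℝ≥0∞} {κ : ℝ} (hκ : 1 ≤ κ) (h : X ≤ A) : X ^ κ ≤ X * A ^ (κ - 1) := by
  calc X ^ κ = X * X ^ (κ - 1) := by
        conv_lhs => rw [show κ = 1 + (κ - 1) by ring,
          rpow_add_of_nonneg _ _ zero_le_one (by linarith), rpow_one]
    _ ≤ _ := by gcongr

lemma measurable_lpn_sgMaj (p : ℝ) {G : ℝ → Eu n → ℝ≥0∞} (hG : Measurable (uncurry G)) :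
    Measurable fun t => lpn volume p (sgMaj α t (G t)) := by
  have hk : Measurable (uncurry fun (t : ℝ) (y : Eu n) => jk (t ^ (1 / (2 * α))) y) := by
    refine measurable_jk_uncurry.comp (f := fun z : ℝ × Eu n => (z.1 ^ (1 / (2 * α)), z.2)) ?_
    fun_prop
  have h1 : Measurable fun z : ℝ × Eu n => sgMaj α z.1 (G z.1) z.2 :=
    (by fun_prop : Measurable fun z : ℝ × Eu n => ofReal (z.1 ^ (1 / (2 * α)))).mul
      (measurable_cv_param hk hG)
  exact ((h1.pow_const p).lintegral_prod_right').pow_const _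

/-- The space-time estimate for the linear semigroup. -/
lemma exists_lpn_lpn_sgMaj_le (hα : 0 < α) (hn : 0 < n) {r p q : ℝ} (hr : 1 < r) (hrp : r < p)
    (hq : 1 / q = n / (2 * α) * (1 / r - 1 / p)) (hrq : r < q) :
    ∃ C : ℝ, 0 < C ∧ ∀ F : Eu n → ℝ≥0∞, Measurable F →
      lpn (volume.restrict (Ioi (0 : ℝ))) q (fun t => lpn volume p (sgMaj α t F)) ≤
        ofReal C * lpn volume r F := by
  obtain ⟨C, hC, hb⟩ := exists_lpn_semigroup_majorant_le hα n
  set d := n / (2 * α) with hd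
  have hn' : (0 : ℝ) < n := by exact_mod_cast hn
  have hd0 : 0 < d := by positivity
  -- The part below the level is measured in L^s: s > r makes its weight integrable near t = 0, s <
  -- p allows smoothing into L^p, and s < q leaves a power q/s ≥ 1 to trade.
  obtain ⟨s, hs1, hs2⟩ := exists_between (lt_min hrp hrq)
  have hsp : s < p := hs2.trans_le (min_le_left _ _)
  have hsq : s < q := hs2.trans_le (min_le_right _ _)
  have hr0 : 0 < r := by linarith
  have hp0 : 0 < p := by linarith
  have hq0 : 0 < q := by linarith
  have hs0 : 0 < s := by linarith
  -- The scale at which the smoothing factors and the crude bounds multiply to exactly the weights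
  -- of the two level-set integrals, given that q d (1/r - 1/p) = 1.
  set γ := d / r with hγ
  have hγ0 : 0 < γ := by positivity
  set A₁ := 1 / (γ * (r - 1)) with hA₁
  set A₂ := 1 / (γ * (s - r)) with hA₂
  have hA₁0 : 0 < A₁ := one_div_pos.2 (mul_pos hγ0 (by linarith))
  have hA₂0 : 0 < A₂ := one_div_pos.2 (mul_pos hγ0 (by linarith))
  set D := C * A₁ ^ (1 / q) + C * A₂ ^ (1 / q) with hD
  have hD0 : 0 < D := by positivity
  -- Marcinkiewicz-style interpolation: the part of F above t^{-γ} is smoothed from L^1 to L^p, the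
  -- part below from L^s to L^p. The level is not homogeneous in F, hence the normalisation, removed
  -- at the end by scaling.
  have norm : ∀ F : Eu n → ℝ≥0∞, Measurable F → ∫⁻ x, F x ^ r ≤ 1 →
      lpn (volume.restrict (Ioi (0 : ℝ))) q (fun t => lpn volume p (sgMaj α t F)) ≤ ofReal D := by
    intro F hF hI
    have hm1 := measurable_levelSet_indicator hF γ
    have hm2 := measurable_levelSet_compl_indicator hF γ
    set X : ℝ → ℝ≥0∞ := fun t => ofReal (C * t ^ (-(d * (1 / 1 - 1 / p)))) *
      ∫⁻ x, (levelSet F γ t).indicator F x with hX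
    set Y : ℝ → ℝ≥0∞ := fun t => ofReal (C * t ^ (-(d * (1 / s - 1 / p)))) *
      lpn volume s ((levelSet F γ t)ᶜ.indicator F) with hY
    have hXm : Measurable X := (by fun_prop : Measurable fun t : ℝ =>
      ofReal (C * t ^ (-(d * (1 / 1 - 1 / p))))).mul hm1.lintegral_prod_right'
    have hYm : Measurable Y := (by fun_prop : Measurable fun t : ℝ =>
      ofReal (C * t ^ (-(d * (1 / s - 1 / p))))).mul
        ((hm2.pow_const s).lintegral_prod_right'.pow_const _)
    have h1 : ∀ t ∈ Ioi (0 : ℝ), lpn volume p (sgMaj α t F) ≤ X t + Y t := by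
      intro t ht
      have e : sgMaj α t F = fun x => sgMaj α t ((levelSet F γ t).indicator F) x +
          sgMaj α t ((levelSet F γ t)ᶜ.indicator F) x := by
        ext x
        rw [← sgMaj_add t (hF.indicator (measurableSet_levelSet hF γ t))]
        congr 1
        ext y
        exact (congrFun (indicator_self_add_compl (levelSet F γ t) F) y).symm
      rw [e]
      have hS := measurableSet_levelSet hF γ t
      refine (lpn_add_le (by linarith) (measurable_sgMaj t (hF.indicator hS))
        (measurable_sgMaj t (hF.indicator hS.compl))).trans (add_le_add ?_ ?_)
      · have := hb 1 p t le_rfl (by linarith) ht _ (hF.indicator hS)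
        refine this.trans_eq ?_
        simp only [hX, lpn, rpow_one, div_one]
      · exact hb s p t (by linarith) hsp.le ht _ (hF.indicator hS.compl)
    have h2 : lpn (volume.restrict (Ioi (0 : ℝ))) q (fun t => lpn volume p (sgMaj α t F)) ≤
        lpn (volume.restrict (Ioi (0 : ℝ))) q X + lpn (volume.restrict (Ioi (0 : ℝ))) q Y :=
      (lpn_mono_ae hq0 ((ae_restrict_iff' measurableSet_Ioi).2 (.of_forall h1))).trans
        (lpn_add_le (by linarith) hXm hYm)
    have hqq : q * (d * (1 / r - 1 / p)) = 1 := by rw [← hq, mul_one_div_cancel hq0.ne']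
    have hend : ∀ {Z : ℝ → ℝ≥0∞} {A : ℝ}, 0 ≤ A →
        ∫⁻ t in Ioi (0 : ℝ), Z t ^ q ≤ ofReal (C ^ q) * ofReal A →
        lpn (volume.restrict (Ioi (0 : ℝ))) q Z ≤ ofReal (C * A ^ (1 / q)) := by
      intro Z A hA h3
      refine (rpow_le_rpow h3 (by positivity)).trans_eq ?_
      rw [← ofReal_mul (by positivity), ofReal_rpow_of_nonneg (by positivity) (by positivity),
        mul_rpow (by positivity) hA, ← rpow_mul hC.le, mul_one_div_cancel hq0.ne', Real.rpow_one]
    have hXb : lpn (volume.restrict (Ioi (0 : ℝ))) q X ≤ ofReal (C * A₁ ^ (1 / q)) := by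
      refine hend hA₁0.le ?_
      have h4 : ∀ t ∈ Ioi (0 : ℝ), X t ^ q ≤ ofReal (C ^ q) * (ofReal (t ^ (-1 - γ * (r - 1))) *
            ∫⁻ x, (levelSet F γ t).indicator F x) := by
        intro t ht
        have ht0 : 0 < t := ht
        have h5 := rpow_mul_rpow_le (κ := q) (by linarith)
          (lintegral_levelSet_le (μ := volume) hF (γ := γ) hr hI ht0)
        simp only [hX]
        rw [mul_rpow_of_nonneg _ _ hq0.le]
        refine (mul_le_mul_right h5 _).trans_eq ?_
        rw [ofReal_rpow_of_pos (by positivity), ofReal_rpow_of_pos (by positivity), mul_left_comm,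
          mul_comm, ← ofReal_mul (by positivity), ← mul_assoc, ← ofReal_mul (by positivity)]
        congr 2
        rw [mul_rpow hC.le (by positivity), mul_assoc, ← rpow_mul ht0.le,
          ← rpow_mul ht0.le, ← rpow_add ht0]
        congr 2
        have e2 : γ * (r - 1) = d * (1 - 1 / r) := by rw [hγ]; field_simp
        rw [e2]
        linear_combination (-1) * hqq
      refine (setLIntegral_mono' measurableSet_Ioi h4).trans ?_
      rw [lintegral_const_mul]
      · refine mul_le_mul_right ((lintegral_level_above hF hγ0 hr).trans ?_) _
        exact mul_le_of_le_one_right' hI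
      · exact (by fun_prop : Measurable fun t : ℝ => ofReal (t ^ (-1 - γ * (r - 1)))).mul
          hm1.lintegral_prod_right'
    have hYb : lpn (volume.restrict (Ioi (0 : ℝ))) q Y ≤ ofReal (C * A₂ ^ (1 / q)) := by
      refine hend hA₂0.le ?_
      have h4 : ∀ t ∈ Ioi (0 : ℝ), Y t ^ q ≤ ofReal (C ^ q) * (ofReal (t ^ (-1 + γ * (s - r))) *
            ∫⁻ x, (levelSet F γ t)ᶜ.indicator F x ^ s) := by
        intro t ht
        have ht0 : 0 < t := ht
        have h5 := rpow_mul_rpow_le (κ := q / s) (by rw [le_div_iff₀ hs0]; linarith)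
          (lintegral_levelSet_compl_le (μ := volume) hF (γ := γ) hr0 hs1 hI ht0)
        simp only [hY, lpn]
        rw [mul_rpow_of_nonneg _ _ hq0.le, ← ENNReal.rpow_mul, show 1 / s * q = q / s by ring]
        refine (mul_le_mul_right h5 _).trans_eq ?_
        rw [ofReal_rpow_of_pos (by positivity), ofReal_rpow_of_pos (by positivity), mul_left_comm,
          mul_comm, ← ofReal_mul (by positivity), ← mul_assoc, ← ofReal_mul (by positivity)]
        congr 2
        rw [mul_rpow hC.le (by positivity), mul_assoc, ← rpow_mul ht0.le,
          ← rpow_mul ht0.le, ← rpow_add ht0]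
        congr 2
        have e2 : γ * (s - r) * (q / s) = q * d * (1 / r - 1 / s) := by rw [hγ]; field_simp
        linear_combination (-1) * hqq - e2
      refine (setLIntegral_mono' measurableSet_Ioi h4).trans ?_
      rw [lintegral_const_mul]
      · refine mul_le_mul_right ((lintegral_level_below hF hγ0 hr0 hs1).trans ?_) _
        exact mul_le_of_le_one_right' hI
      · exact (by fun_prop : Measurable fun t : ℝ => ofReal (t ^ (-1 + γ * (s - r)))).mul
          (hm2.pow_const s).lintegral_prod_right'
    refine h2.trans ((add_le_add hXb hYb).trans_eq ?_)
    rw [← ofReal_add (by positivity) (by positivity)]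
  refine ⟨D, hD0, fun F hF => ?_⟩
  rcases eq_or_ne (lpn volume r F) ∞ with h | h
  · rw [h, ENNReal.mul_top (by simpa using hD0)]
    exact le_top
  rcases eq_or_ne (lpn volume r F) 0 with h0 | h0
  · have h1 : F =ᵐ[volume] fun _ => 0 := by
      have h2 : ∫⁻ x, F x ^ r = 0 := by
        rw [← lpn_rpow_self hr0, h0, zero_rpow_of_pos hr0]
      filter_upwards [(lintegral_eq_zero_iff (hF.pow_const r)).1 h2] with x hx
      exact (ENNReal.rpow_eq_zero_iff_of_pos hr0).1 hx
    have h3 : ∀ t, sgMaj α t F = fun _ => 0 := by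
      intro t
      ext x
      rw [sgMaj, cv, lintegral_congr_ae (g := fun _ => 0)]
      · simp
      · filter_upwards [(quasiMeasurePreserving_sub_left volume x).ae_eq_comp h1] with y hy
        simp only [Function.comp_apply] at hy
        rw [hy, mul_zero]
    simp only [h3, lpn_zero hp0, lpn_zero hq0]
    exact zero_le
  set A := lpn volume r F with hA
  have hG : Measurable fun x => A⁻¹ * F x := hF.const_mul _
  have h1 := norm (fun x => A⁻¹ * F x) hG (by
    rw [← lpn_rpow_self hr0, lpn_const_mul hr0 hF, ← hA, ENNReal.inv_mul_cancel h0 h,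
      ENNReal.one_rpow])
  have h2 : ∀ t, lpn volume p (sgMaj α t F) =
      A * lpn volume p (sgMaj α t (fun x => A⁻¹ * F x)) := by
    intro t
    rw [← lpn_const_mul hp0 (measurable_sgMaj t hG)]
    congr 1
    ext x
    have h3 : cv volume (jk (t ^ (1 / (2 * α)))) F x = A *
        cv volume (jk (t ^ (1 / (2 * α)))) (fun x => A⁻¹ * F x) x := by
      rw [cv, cv, ← lintegral_const_mul' _ _ h]
      refine lintegral_congr fun y => ?_
      rw [mul_left_comm, ← mul_assoc A, ENNReal.mul_inv_cancel h0 h, one_mul]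
    rw [sgMaj, sgMaj, h3]
    ring
  simp only [h2]
  rw [lpn_const_mul hq0 (measurable_lpn_sgMaj p (G := fun _ x => A⁻¹ * F x)
    (hG.comp measurable_snd)), mul_comm]
  exact mul_le_mul_left h1 _

end Giga

/-! ### Weighted bounds for Duhamel integrals -/

section DuhamelBounds

variable {n : ℕ} {α : ℝ}

lemma exists_lpn_maj_le_rpow (hα : 0 < α) (n : ℕ) {ρ m e f₀ : ℝ} (hρ : 1 ≤ ρ) (hρm : ρ ≤ m)
    (he : e = 1 / (2 * α) + n / (2 * α) * (1 / ρ - 1 / m)) (he1 : e < 1) (hf0 : 0 ≤ f₀)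
    (hf1 : f₀ < 1) :
    ∃ C : ℝ, 0 < C ∧ ∀ F : ℝ → Eu n → ℝ≥0∞, Measurable (uncurry F) → ∀ t A : ℝ, 0 < t →
      0 ≤ A → (∀ τ ∈ Ioo 0 t, lpn volume ρ (F τ) ≤ ofReal (A * τ ^ (-f₀))) →
      lpn volume m (maj α F t) ≤ ofReal (C * A * t ^ (1 - e - f₀)) := by
  obtain ⟨C₁, hC₁, h₁⟩ := exists_lpn_maj_le hα n
  have he0 : 0 ≤ e := by
    have : 1 / m ≤ 1 / ρ := one_div_le_one_div_of_le (by linarith) hρm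
    have : 0 ≤ 1 / ρ - 1 / m := by linarith
    rw [he]
    positivity
  obtain ⟨C₂, hC₂, h₂⟩ := exists_beta_bound he0 he1 hf0 hf1
  refine ⟨C₁ * C₂, by positivity, fun F hF t A ht hA hb => ?_⟩
  refine (h₁ ρ m t hρ hρm F hF).trans ?_
  calc ∫⁻ τ in Ioo 0 t, ofReal
        (C₁ * (t - τ) ^ (-(1 / (2 * α)) - n / (2 * α) * (1 / ρ - 1 / m))) * lpn volume ρ (F τ)
      ≤ ∫⁻ τ in Ioo 0 t, ofReal (C₁ * A) * ofReal ((t - τ) ^ (-e) * τ ^ (-f₀)) := by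
        refine setLIntegral_mono' measurableSet_Ioo fun τ hτ => ?_
        have h3 : 0 < t - τ := sub_pos.2 hτ.2
        have h4 : 0 < τ := hτ.1
        refine (mul_le_mul_right (hb τ hτ) _).trans_eq ?_
        rw [← ofReal_mul (by positivity), ← ofReal_mul (by positivity),
          show -(1 / (2 * α)) - n / (2 * α) * (1 / ρ - 1 / m) = -e by rw [he]; ring]
        congr 1
        ring
    _ = ofReal (C₁ * A) *
        ∫⁻ τ in Ioo 0 t, ofReal ((t - τ) ^ (-e) * τ ^ (-f₀)) :=
        lintegral_const_mul _ (by fun_prop)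
    _ ≤ ofReal (C₁ * A) * ofReal (C₂ * t ^ (1 - e - f₀)) :=
        mul_le_mul_right (h₂ t ht) _
    _ = _ := by
        rw [← ofReal_mul (by positivity)]
        congr 1
        ring

lemma ae_ne_top_of_lpn_ne_top {X : Type*} [MeasurableSpace X] {μ : Measure X} {m : ℝ} (hm : 0 < m)
    {F : X → ℝ≥0∞} (hF : Measurable F) (h : lpn μ m F ≠ ∞) : ∀ᵐ x ∂μ, F x ≠ ∞ := by
  have h1 : ∫⁻ x, F x ^ m ∂μ ≠ ∞ := by
    rw [← lpn_rpow_self hm]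
    exact rpow_ne_top_of_nonneg hm.le h
  filter_upwards [ae_lt_top (hF.pow_const m) h1] with x hx hx'
  simp [hx', hm] at hx

lemma ae_duhAt_of_lpn_maj_ne_top {𝕜 : Type*} [RCLike 𝕜] (hn : 0 < n) (hα : 1 / 2 < α) (a : Eu n)
    {f : ℝ → Eu n → 𝕜} (hf : Measurable (uncurry f)) {t m : ℝ} (hm : 0 < m)
    (h : lpn volume m (maj α (fun τ y => ‖f τ y‖ₑ) t) ≠ ∞) : ∀ᵐ x, DuhAt α a f t x := by
  have hF : Measurable (uncurry fun τ y => ‖f τ y‖ₑ) := hf.enorm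
  filter_upwards [ae_ne_top_of_lpn_ne_top hm (measurable_maj hF t) h] with x hx
  exact duhAt_of_maj_ne_top hn hα a hf hx

end DuhamelBounds

/-! ### Continuity in time of Duhamel integrals -/

section Continuity

variable {𝕜 : Type*} [RCLike 𝕜] {n : ℕ} {α : ℝ} {a : Eu n}

/-- The `L^h` distance of two derivative kernels. -/
noncomputable def kerDist (α : ℝ) (a : Eu n) (h s s₀ : ℝ) : ℝ≥0∞ :=
  lpn volume h (fun y => ‖derivKernel α a s y - derivKernel α a s₀ y‖ₑ)

lemma exists_enorm_derivKernel_sub_le (hn : 0 < n) (hα : 1 / 2 < α) (a : Eu n) : ∃ C : ℝ, 0 < C ∧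
    ∀ δ s s₀ : ℝ, 0 < δ → δ ≤ s → δ ≤ s₀ → ∀ y : Eu n,
      ‖derivKernel α a s y - derivKernel α a s₀ y‖ₑ ≤ ofReal C * jk (δ ^ (1 / (2 * α))) y := by
  obtain ⟨C, hC, hb⟩ := exists_enorm_derivKernel_le hn hα a
  refine ⟨2 * C, by positivity, fun δ s s₀ hδ hs hs₀ y => ?_⟩
  have h1 : ∀ s, δ ≤ s → ‖derivKernel α a s y‖ₑ ≤ ofReal C * jk (δ ^ (1 / (2 * α))) y := by
    intro s hs
    refine (hb s (hδ.trans_le hs) y).trans (mul_le_mul_right (jk_anti (by positivity) ?_ y) _)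
    exact Real.rpow_le_rpow hδ.le hs (by positivity)
  refine enorm_sub_le.trans ((add_le_add (h1 s hs) (h1 s₀ hs₀)).trans_eq ?_)
  rw [← two_mul, ofReal_mul zero_le_two, ← mul_assoc]
  simp

lemma exists_kerDist_le (hn : 0 < n) (hα : 1 / 2 < α) (a : Eu n) {h : ℝ} (hh : 1 ≤ h) {δ : ℝ}
    (hδ : 0 < δ) : ∃ K : ℝ, 0 < K ∧ ∀ s s₀ : ℝ, δ ≤ s → δ ≤ s₀ → kerDist α a h s s₀ ≤ ofReal K := by
  obtain ⟨C, hC, hb⟩ := exists_enorm_derivKernel_sub_le hn hα a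
  obtain ⟨C', hC', hb'⟩ := exists_lpn_jk_le n
  have hT : 0 < δ ^ (1 / (2 * α)) := by positivity
  refine ⟨C * (C' * (δ ^ (1 / (2 * α))) ^ ((n : ℝ) / h - (n + 1))), by positivity,
    fun s s₀ hs hs₀ => ?_⟩
  refine (lpn_mono (by linarith) (hb δ s s₀ hδ hs hs₀)).trans ?_
  rw [lpn_const_mul (by linarith) (measurable_jk _), ofReal_mul hC.le]
  exact mul_le_mul_right (hb' h _ hh hT) _

/-- Pointwise convergence comes from joint continuity of the kernel, and for all s ≥ s₀/2 the
majorant at time s₀/2 dominates. -/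
lemma tendsto_kerDist (hn : 0 < n) (hα : 1 / 2 < α) (a : Eu n) {h : ℝ} (hh : 1 ≤ h) {s₀ : ℝ}
    (hs₀ : 0 < s₀) : Tendsto (fun s => kerDist α a h s s₀) (𝓝 s₀) (𝓝 0) := by
  have hh0 : 0 < h := by linarith
  obtain ⟨C, hC, hb⟩ := exists_enorm_derivKernel_sub_le hn hα a
  obtain ⟨C', hC', hb'⟩ := exists_lpn_jk_le n
  set δ := s₀ / 2 with hδ
  have hδ0 : 0 < δ := by positivity
  have hT : 0 < δ ^ (1 / (2 * α)) := by positivity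
  have hev : ∀ᶠ s in 𝓝 s₀, δ ≤ s := by
    filter_upwards [Ioi_mem_nhds (show δ < s₀ by linarith)] with s hs
    exact le_of_lt hs
  have h1 : Tendsto (fun s => ∫⁻ y, ‖derivKernel α a s y - derivKernel α a s₀ y‖ₑ ^ h) (𝓝 s₀)
      (𝓝 (∫⁻ _ : Eu n, 0)) := by
    refine tendsto_lintegral_filter_of_dominated_convergence
      (fun y => (ofReal C * jk (δ ^ (1 / (2 * α))) y) ^ h) ?_ ?_ ?_ ?_
    · filter_upwards [hev] with s hs
      exact (((measurable_derivKernel hn hα a (hδ0.trans_le hs)).sub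
        (measurable_derivKernel hn hα a hs₀)).enorm).pow_const h
    · filter_upwards [hev] with s hs
      exact .of_forall fun y => rpow_le_rpow (hb δ s s₀ hδ0 hs (by linarith) y) hh0.le
    · rw [← lpn_rpow_self hh0, lpn_const_mul hh0 (measurable_jk _)]
      refine rpow_ne_top_of_nonneg hh0.le (mul_ne_top ofReal_ne_top ?_)
      exact ne_top_of_le_ne_top ofReal_ne_top (hb' h _ hh hT)
    · refine .of_forall fun y => ?_
      have hc : ContinuousAt (fun s : ℝ => derivKernel α a s y) s₀ := by
        have h2 := (continuousOn_derivKernel hn hα a).continuousAt (x := (s₀, y))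
          (prod_mem_nhds (Ioi_mem_nhds hs₀) univ_mem)
        exact h2.comp (f := fun s : ℝ => (s, y)) (by fun_prop)
      have h3 := (hc.sub (continuousAt_const (y := derivKernel α a s₀ y))).enorm
      have h4 : Tendsto (fun s => ‖derivKernel α a s y - derivKernel α a s₀ y‖ₑ) (𝓝 s₀) (𝓝 0) := by
        simpa [ContinuousAt] using h3
      have h5 := h4.ennrpow_const h
      rwa [zero_rpow_of_pos hh0] at h5
  rw [lintegral_zero] at h1
  have h2 := h1.ennrpow_const (1 / h)
  rwa [zero_rpow_of_pos (by positivity)] at h2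

lemma measurable_kerDist (hn : 0 < n) (hα : 1 / 2 < α) (a : Eu n) (h t t₀ c : ℝ) (hct : c ≤ t)
    (hct₀ : c ≤ t₀) : Measurable ((Iio c).indicator fun τ => kerDist α a h (t - τ) (t₀ - τ)) := by
  have hk := measurable_indicator_derivKernel hn hα a
  have h1 : ∀ t : ℝ, Measurable fun z : ℝ × Eu n =>
      (Ioi (0 : ℝ) ×ˢ (univ : Set (Eu n))).indicator (fun z => derivKernel α a z.1 z.2)
        (t - z.1, z.2) := fun t => hk.comp (by fun_prop)
  have h2 : Measurable fun τ : ℝ => lpn volume h (fun y =>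
      ‖(Ioi (0 : ℝ) ×ˢ (univ : Set (Eu n))).indicator (fun z => derivKernel α a z.1 z.2) (t - τ, y) -
        (Ioi (0 : ℝ) ×ˢ (univ : Set (Eu n))).indicator (fun z => derivKernel α a z.1 z.2)
          (t₀ - τ, y)‖ₑ) :=
    ((((h1 t).sub (h1 t₀)).enorm.pow_const h).lintegral_prod_right').pow_const _
  convert h2.indicator (measurableSet_Iio (a := c)) using 1
  ext τ
  by_cases hτ : τ < c
  · have h3 : 0 < t - τ := by linarith
    have h4 : 0 < t₀ - τ := by linarith
    rw [indicator_of_mem (mem_Iio.2 hτ), indicator_of_mem (mem_Iio.2 hτ), kerDist]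
    congr 1
    ext y
    rw [indicator_of_mem (by simpa using h3), indicator_of_mem (by simpa using h4)]
  · rw [indicator_of_notMem (by simpa using hτ), indicator_of_notMem (by simpa using hτ)]

/-- Both integrals are cut at a common time c: before c the kernels are compared, after c no
cancellation is used and each tail is estimated alone. -/
lemma enorm_duh_sub_le_of_split {f : ℝ → Eu n → 𝕜} {t t₀ c : ℝ} (hc : 0 < c) (hct : c ≤ t)
    (hct₀ : c ≤ t₀) {x : Eu n} (h : DuhAt α a f t x) (h₀ : DuhAt α a f t₀ x) :
    ‖duh α a f t x - duh α a f t₀ x‖ₑ ≤ (∫⁻ τ in Ioo 0 c, cv volume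
        (fun y => ‖derivKernel α a (t - τ) y - derivKernel α a (t₀ - τ) y‖ₑ)
        (fun y => ‖f τ y‖ₑ) x) +
      ((∫⁻ τ in Ico c t, ‖semigroupDeriv α a (t - τ) (f τ) x‖ₑ) +
      ∫⁻ τ in Ico c t₀, ‖semigroupDeriv α a (t₀ - τ) (f τ) x‖ₑ) := by
  have hsplit : ∀ t, c ≤ t → DuhAt α a f t x → duh α a f t x =
      (∫ τ in Ioo 0 c, semigroupDeriv α a (t - τ) (f τ) x) +
        ∫ τ in Ico c t, semigroupDeriv α a (t - τ) (f τ) x := by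
    intro t hct h
    have hu := Ioo_union_Ico_eq_Ioo hc hct
    rw [duh, ← hu]
    refine setIntegral_union ?_ measurableSet_Ico (h.2.mono_set ?_) (h.2.mono_set ?_)
    · rw [Set.disjoint_left]
      exact fun τ h1 h2 => absurd h1.2 (not_lt.2 h2.1)
    · exact Ioo_subset_Ioo_right hct
    · exact fun τ hτ => ⟨hc.trans_le hτ.1, hτ.2⟩
  have hsub : ∀ t, c ≤ t → Ioo 0 c ⊆ Ioo 0 t := fun t ht => Ioo_subset_Ioo_right ht
  rw [hsplit t hct h, hsplit t₀ hct₀ h₀, add_sub_add_comm,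
    ← integral_sub (h.2.mono_set (hsub t hct)) (h₀.2.mono_set (hsub t₀ hct₀))]
  refine (enorm_add_le _ _).trans (add_le_add ?_ (enorm_sub_le.trans (add_le_add
    (enorm_integral_le_lintegral_enorm _) (enorm_integral_le_lintegral_enorm _))))
  refine (enorm_integral_le_lintegral_enorm _).trans (lintegral_mono_ae ?_)
  filter_upwards [ae_restrict_of_ae_restrict_of_subset (hsub t hct) h.1,
    ae_restrict_of_ae_restrict_of_subset (hsub t₀ hct₀) h₀.1] with τ h1 h2
  have h3 := integral_sub h1 h2
  simp only [ContinuousLinearMap.lsmul_apply, ← sub_smul] at h3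
  rw [semigroupDeriv_apply, semigroupDeriv_apply, ← h3]
  exact enorm_integral_smul_le _ _ _

lemma measurable_tail (hn : 0 < n) (hα : 1 / 2 < α) (a : Eu n) {f : ℝ → Eu n → 𝕜}
    (hf : Measurable (uncurry f)) (c t : ℝ) :
    Measurable fun x => ∫⁻ τ in Ico c t, ‖semigroupDeriv α a (t - τ) (f τ) x‖ₑ := by
  have h1 := measurable_semigroupDeriv_param hn hα a (s := fun τ => t - τ) (by fun_prop) hf
  have h2 := ((h1.comp measurable_swap).enorm).lintegral_prod_right'
    (ν := volume.restrict (Ico c t))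
  convert h2 using 1
  ext x
  refine setLIntegral_congr_fun measurableSet_Ico fun τ hτ => ?_
  simp [indicator, hτ.2]

lemma lpn_lintegral_cv_le {ρ m k : ℝ} (hρ : 1 ≤ ρ) (hρm : ρ ≤ m) (hk : k = 1 + 1 / m - 1 / ρ)
    {G F : ℝ → Eu n → ℝ≥0∞} (hG : Measurable (uncurry G))
    (hF : Measurable (uncurry F)) (S : Set ℝ) :
    Measurable (fun x => ∫⁻ τ in S, cv volume (G τ) (F τ) x) ∧
    lpn volume m (fun x => ∫⁻ τ in S, cv volume (G τ) (F τ) x) ≤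
      ∫⁻ τ in S, lpn volume (1 / k) (G τ) * lpn volume ρ (F τ) := by
  have hm : 1 ≤ m := hρ.trans hρm
  have hmρ : 1 / m ≤ 1 / ρ := one_div_le_one_div_of_le (by linarith) hρm
  have hρ1 : 1 / ρ ≤ 1 := by rw [div_le_one (by linarith)]; exact hρ
  have hm1 : 0 < 1 / m := by positivity
  have hk0 : 0 < k := by linarith
  have hhm : 1 / k ≤ m := by
    rw [div_le_iff₀ hk0]
    have : 1 / m ≤ k := by linarith
    calc (1 : ℝ) = m * (1 / m) := by field_simp
      _ ≤ m * k := by gcongr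
  have hcv := measurable_cv_param hG hF
  refine ⟨(hcv.comp measurable_swap).lintegral_prod_right', ?_⟩
  refine (lpn_lintegral_le hm hcv).trans (lintegral_mono fun τ => ?_)
  have hGτ : Measurable (G τ) := hG.comp measurable_prodMk_left
  have hFτ : Measurable (F τ) := hF.comp measurable_prodMk_left
  refine lpn_cv_le (by positivity) (by linarith) hhm hρm ?_ hGτ hFτ
  rw [one_div_one_div, hk]
  ring

/-- The derivative kernel, cut off to positive times. -/
noncomputable def posDerivKernel (α : ℝ) (a : Eu n) (s : ℝ) (y : Eu n) : ℝ :=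
  (Ioi (0 : ℝ) ×ˢ (univ : Set (Eu n))).indicator (fun z => derivKernel α a z.1 z.2) (s, y)

lemma posDerivKernel_of_pos {s : ℝ} (hs : 0 < s) (y : Eu n) :
    posDerivKernel α a s y = derivKernel α a s y :=
  indicator_of_mem (by simpa using hs) _

lemma lpn_cv_kerDist_le (hn : 0 < n) (hα : 1 / 2 < α) (a : Eu n) {ρ m k : ℝ} (hρ : 1 ≤ ρ)
    (hρm : ρ ≤ m) (hk : k = 1 + 1 / m - 1 / ρ) {f : ℝ → Eu n → 𝕜}
    (hf : Measurable (uncurry f)) {c t t₀ : ℝ} (hct : c ≤ t) (hct₀ : c ≤ t₀) :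
    Measurable (fun x => ∫⁻ τ in Ioo 0 c, cv volume
        (fun y => ‖derivKernel α a (t - τ) y - derivKernel α a (t₀ - τ) y‖ₑ)
        (fun y => ‖f τ y‖ₑ) x) ∧
    lpn volume m (fun x => ∫⁻ τ in Ioo 0 c, cv volume
        (fun y => ‖derivKernel α a (t - τ) y - derivKernel α a (t₀ - τ) y‖ₑ)
        (fun y => ‖f τ y‖ₑ) x) ≤
      ∫⁻ τ in Ioo 0 c, kerDist α a (1 / k) (t - τ) (t₀ - τ) * lpn volume ρ (fun y => ‖f τ y‖ₑ) := by
  have hF : Measurable (uncurry fun τ y => ‖f τ y‖ₑ) := hf.enorm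
  have hker : Measurable (uncurry (posDerivKernel α a)) := measurable_indicator_derivKernel hn hα a
  have h1 : ∀ t : ℝ, Measurable fun z : ℝ × Eu n => posDerivKernel α a (t - z.1) z.2 :=
    fun t => hker.comp (f := fun z : ℝ × Eu n => (t - z.1, z.2)) (by fun_prop)
  have hGm : Measurable (uncurry fun τ y =>
      ‖posDerivKernel α a (t - τ) y - posDerivKernel α a (t₀ - τ) y‖ₑ) :=
    ((h1 t).sub (h1 t₀)).enorm
  have hGe : ∀ τ ∈ Ioo 0 c,
      (fun y => ‖derivKernel α a (t - τ) y - derivKernel α a (t₀ - τ) y‖ₑ) =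
        fun y => ‖posDerivKernel α a (t - τ) y - posDerivKernel α a (t₀ - τ) y‖ₑ := by
    intro τ hτ
    ext y
    rw [posDerivKernel_of_pos (by linarith [hτ.2]), posDerivKernel_of_pos (by linarith [hτ.2])]
  obtain ⟨h2, h3⟩ := lpn_lintegral_cv_le hρ hρm hk hGm hF (Ioo 0 c)
  have hP : (fun x => ∫⁻ τ in Ioo 0 c, cv volume
        (fun y => ‖derivKernel α a (t - τ) y - derivKernel α a (t₀ - τ) y‖ₑ)
        (fun y => ‖f τ y‖ₑ) x) =
      fun x => ∫⁻ τ in Ioo 0 c, cv volume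
        (fun y => ‖posDerivKernel α a (t - τ) y - posDerivKernel α a (t₀ - τ) y‖ₑ)
        (fun y => ‖f τ y‖ₑ) x := by
    ext x
    exact setLIntegral_congr_fun measurableSet_Ioo fun τ hτ => by simp only [hGe τ hτ]
  rw [hP]
  refine ⟨h2, h3.trans (setLIntegral_mono' measurableSet_Ioo fun τ hτ => ?_)⟩
  rw [kerDist, hGe τ hτ]

lemma exists_lpn_tail_le (𝕜 : Type*) [RCLike 𝕜] (hn : 0 < n) (hα : 1 / 2 < α) (a : Eu n)
    {ρ m e f₀ : ℝ} (hρ : 1 ≤ ρ) (hρm : ρ ≤ m)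
    (he : e = 1 / (2 * α) + n / (2 * α) * (1 / ρ - 1 / m)) (he1 : e < 1) (hf0 : 0 ≤ f₀) :
    ∃ C : ℝ, 0 < C ∧ ∀ f : ℝ → Eu n → 𝕜, Measurable (uncurry f) → ∀ c t A : ℝ, 0 < c →
      c < t → 0 ≤ A →
      (∀ τ ∈ Ico c t, lpn volume ρ (fun y => ‖f τ y‖ₑ) ≤ ofReal (A * τ ^ (-f₀))) →
      lpn volume m (fun x => ∫⁻ τ in Ico c t, ‖semigroupDeriv α a (t - τ) (f τ) x‖ₑ) ≤
        ofReal (C * A * c ^ (-f₀) * (t - c) ^ (1 - e)) := by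
  obtain ⟨C₁, hC₁, h₁⟩ := exists_enorm_semigroupDeriv_le 𝕜 hn hα a
  obtain ⟨C₂, hC₂, h₂⟩ := exists_lpn_cv_jk_time_le (α := α) (by linarith) n
  have he' : 0 < 1 - e := by linarith
  refine ⟨C₁ * C₂ * (1 / (1 - e)), by positivity, fun f hf c t A hc hct hA hb => ?_⟩
  have hF : Measurable (uncurry fun τ y => ‖f τ y‖ₑ) := hf.enorm
  have hm0 : 0 < m := by linarith
  have hmeas := measurable_maj_integrand (α := α) hF t
  have e1 : lpn volume m (fun x => ∫⁻ τ in Ico c t, ‖semigroupDeriv α a (t - τ) (f τ) x‖ₑ) ≤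
      lpn volume m (fun x => ∫⁻ τ in Ico c t, ofReal C₁ *
        cv volume (jk ((t - τ) ^ (1 / (2 * α)))) (fun y => ‖f τ y‖ₑ) x) :=
    lpn_mono hm0 fun x => setLIntegral_mono' measurableSet_Ico fun τ hτ => h₁ _ (sub_pos.2 hτ.2) _ _
  refine e1.trans ((lpn_lintegral_le (hρ.trans hρm) (hmeas.const_mul _)).trans ?_)
  have e2 : ∀ τ ∈ Ico c t, lpn volume m (fun x => ofReal C₁ *
        cv volume (jk ((t - τ) ^ (1 / (2 * α)))) (fun y => ‖f τ y‖ₑ) x) ≤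
      ofReal (C₁ * C₂ * A * c ^ (-f₀)) * ofReal ((t - τ) ^ (-e)) := by
    intro τ hτ
    have h3 : 0 < t - τ := sub_pos.2 hτ.2
    have h4 : 0 < τ := hc.trans_le hτ.1
    have hFτ : Measurable fun y => ‖f τ y‖ₑ := hF.comp measurable_prodMk_left
    rw [lpn_const_mul hm0 (measurable_cv (measurable_jk _) hFτ)]
    have h5 := (h₂ ρ m (t - τ) hρ hρm h3 _ hFτ).trans (mul_le_mul_right (hb τ hτ) _)
    refine (mul_le_mul_right h5 _).trans ?_
    rw [← ofReal_mul (by positivity), ← ofReal_mul (by positivity), ← ofReal_mul (by positivity),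
      show -(1 / (2 * α)) - n / (2 * α) * (1 / ρ - 1 / m) = -e by rw [he]; ring]
    refine ofReal_le_ofReal ?_
    have h6 : τ ^ (-f₀) ≤ c ^ (-f₀) := Real.rpow_le_rpow_of_nonpos hc hτ.1 (by linarith)
    calc C₁ * (C₂ * (t - τ) ^ (-e) * (A * τ ^ (-f₀)))
        ≤ C₁ * (C₂ * (t - τ) ^ (-e) * (A * c ^ (-f₀))) := by gcongr
      _ = _ := by ring
  refine (setLIntegral_mono' measurableSet_Ico e2).trans ?_
  rw [lintegral_const_mul _ (by fun_prop), restrict_Ioo_eq_restrict_Ico.symm,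
    setLIntegral_Ioo_reflect (fun s => ofReal (s ^ (-e))),
    setLIntegral_Ioo_rpow he1 (sub_pos.2 hct), ← ofReal_mul (by positivity)]
  refine ofReal_le_ofReal (le_of_eq ?_)
  ring

/-- With c = t₀ - 2η and |t - t₀| < η, the kernel times before c stay above η, so the kernel
distance is bounded and tends to 0. The tails have length at most 3η and contribute O((3η)^{1-e}).
-/
lemma tendsto_lpn_duh (hn : 0 < n) (hα : 1 / 2 < α) (a : Eu n) {ρ m e f₀ : ℝ} (hρ : 1 ≤ ρ)
    (hρm : ρ ≤ m) (he : e = 1 / (2 * α) + n / (2 * α) * (1 / ρ - 1 / m)) (he1 : e < 1)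
    (hf0 : 0 ≤ f₀) (hf1 : f₀ < 1) {f : ℝ → Eu n → 𝕜} (hf : Measurable (uncurry f)) {T A : ℝ}
    (hA : 0 ≤ A) (hb : ∀ τ ∈ Ioo 0 T, lpn volume ρ (fun y => ‖f τ y‖ₑ) ≤ ofReal (A * τ ^ (-f₀)))
    {t₀ : ℝ} (ht₀ : t₀ ∈ Ioo 0 T) :
    Tendsto (fun t => lpn volume m (fun x => ‖duh α a f t x - duh α a f t₀ x‖ₑ)) (𝓝 t₀) (𝓝 0) := by
  have hm : 1 ≤ m := hρ.trans hρm
  have hm0 : 0 < m := by linarith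
  have hF : Measurable (uncurry fun τ y => ‖f τ y‖ₑ) := hf.enorm
  obtain ⟨C₁, hC₁, h₁⟩ := exists_lpn_maj_le_rpow (α := α) (by linarith) n hρ hρm he he1 hf0 hf1
  obtain ⟨C₂, hC₂, h₂⟩ := exists_lpn_tail_le 𝕜 hn hα a hρ hρm he he1 hf0
  have hduh : ∀ t ∈ Ioo 0 T, ∀ᵐ x, DuhAt α a f t x := fun t ht =>
    ae_duhAt_of_lpn_maj_ne_top hn hα a hf hm0 (ne_top_of_le_ne_top ofReal_ne_top
      (h₁ _ hF t A ht.1 hA fun τ hτ => hb τ ⟨hτ.1, hτ.2.trans ht.2⟩))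
  -- the exponent in Young's inequality
  have hmρ : 1 / m ≤ 1 / ρ := one_div_le_one_div_of_le (by linarith) hρm
  have hρ1 : 1 / ρ ≤ 1 := by rw [div_le_one (by linarith)]; exact hρ
  have hm1 : 0 < 1 / m := by positivity
  set k := 1 + 1 / m - 1 / ρ with hk
  have hk0 : 0 < k := by linarith
  have hk1 : k ≤ 1 := by linarith
  have hh : 1 ≤ 1 / k := by rw [le_div_iff₀ hk0]; linarith
  have hhm : 1 / k ≤ m := by
    rw [div_le_iff₀ hk0]
    have : 1 / m ≤ k := by linarith
    calc (1 : ℝ) = m * (1 / m) := by field_simp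
      _ ≤ m * k := by gcongr
  rw [ENNReal.tendsto_nhds_zero]
  intro ε hε
  have ht0 := ht₀.1
  -- smallness of the tails
  obtain ⟨η, hη0, hη1, hηT, hηε⟩ : ∃ η : ℝ, 0 < η ∧ η ≤ t₀ / 4 ∧ η < T - t₀ ∧
      ofReal (C₂ * A * (t₀ / 2) ^ (-f₀) * (3 * η) ^ (1 - e)) ≤ ε / 2 / 2 := by
    have h3 : Tendsto (fun η : ℝ => ofReal (C₂ * A * (t₀ / 2) ^ (-f₀) * (3 * η) ^ (1 - e)))
        (𝓝 0) (𝓝 0) := by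
      have hc : Continuous fun η : ℝ => (3 * η) ^ (1 - e) :=
        (Real.continuous_rpow_const (by linarith)).comp (by fun_prop)
      have h4 := ENNReal.tendsto_ofReal (((continuous_const (y := C₂ * A * (t₀ / 2) ^ (-f₀))).mul hc).tendsto 0)
      simpa [Real.zero_rpow (show 1 - e ≠ 0 by linarith)] using h4
    have h5 := ENNReal.tendsto_nhds_zero.1 h3 (ε / 2 / 2) (ENNReal.div_pos (ENNReal.div_pos hε.ne' (by simp)).ne' (by simp))
    obtain ⟨δ, hδ, h6⟩ := Metric.eventually_nhds_iff.1 h5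
    have hT : 0 < T - t₀ := sub_pos.2 ht₀.2
    refine ⟨min (δ / 2) (min (t₀ / 4) ((T - t₀) / 2)), by positivity,
      (min_le_right _ _).trans (min_le_left _ _),
      ((min_le_right _ _).trans (min_le_right _ _)).trans_lt (by linarith), h6 ?_⟩
    rw [Real.dist_eq, sub_zero, abs_of_pos (by positivity)]
    exact (min_le_left _ _).trans_lt (by linarith)
  set c := t₀ - 2 * η with hc
  have hc2 : t₀ / 2 ≤ c := by linarith
  have hc0 : 0 < c := by linarith
  obtain ⟨K, hK, hKb⟩ := exists_kerDist_le hn hα a hh hη0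
  have hmain : Tendsto (fun t => ∫⁻ τ in Ioo 0 c,
      (Iio c).indicator (fun τ => kerDist α a (1 / k) (t - τ) (t₀ - τ)) τ *
        ofReal (A * τ ^ (-f₀))) (𝓝 t₀) (𝓝 (∫⁻ τ in Ioo 0 c, 0)) := by
    have hnear : ∀ᶠ t in 𝓝 t₀, t₀ - η < t := Ioi_mem_nhds (by linarith)
    refine tendsto_lintegral_filter_of_dominated_convergence
      (fun τ => ofReal K * ofReal (A * τ ^ (-f₀))) ?_ ?_ ?_ ?_
    · filter_upwards [hnear] with t ht
      exact (measurable_kerDist hn hα a (1 / k) t t₀ c (by linarith) (by linarith)).mul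
        (by fun_prop)
    · filter_upwards [hnear] with t ht
      filter_upwards [ae_restrict_mem measurableSet_Ioo] with τ hτ
      rw [indicator_of_mem (mem_Iio.2 hτ.2)]
      exact mul_le_mul_left (hKb _ _ (by linarith [hτ.2]) (by linarith [hτ.2])) _
    · simp only [ofReal_mul hA]
      rw [lintegral_const_mul _ (by fun_prop), lintegral_const_mul _ (by fun_prop),
        setLIntegral_Ioo_rpow hf1 hc0]
      exact mul_ne_top ofReal_ne_top (mul_ne_top ofReal_ne_top ofReal_ne_top)
    · filter_upwards [ae_restrict_mem measurableSet_Ioo] with τ hτ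
      simp only [indicator_of_mem (mem_Iio.2 hτ.2)]
      have h3 := tendsto_kerDist hn hα a hh (s₀ := t₀ - τ) (by linarith [hτ.2])
      have h4 : Tendsto (fun t => t - τ) (𝓝 t₀) (𝓝 (t₀ - τ)) :=
        (continuous_id.sub continuous_const).tendsto t₀
      have h5 := ENNReal.Tendsto.mul_const (h3.comp h4)
        (Or.inr (ofReal_ne_top (r := A * τ ^ (-f₀))))
      rw [zero_mul] at h5
      exact h5
  rw [lintegral_zero] at hmain
  filter_upwards [ENNReal.tendsto_nhds_zero.1 hmain (ε / 2) (ENNReal.div_pos hε.ne' (by simp)),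
    Ioi_mem_nhds (show t₀ - η < t₀ by linarith), Iio_mem_nhds (show t₀ < t₀ + η by linarith)]
    with t ht1 ht2 ht3
  rw [mem_Ioi] at ht2
  rw [mem_Iio] at ht3
  have htT : t ∈ Ioo 0 T := ⟨by linarith, by linarith⟩
  obtain ⟨hPm, hPle⟩ := lpn_cv_kerDist_le hn hα a hρ hρm hk hf (c := c) (t := t) (t₀ := t₀)
    (by linarith) (by linarith)
  have hQm := measurable_tail hn hα a hf c t
  have hRm := measurable_tail hn hα a hf c t₀
  have hQR : ∀ s, c < s → s - c ≤ 3 * η → s < T →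
      lpn volume m (fun x => ∫⁻ τ in Ico c s, ‖semigroupDeriv α a (s - τ) (f τ) x‖ₑ) ≤ ε / 2 / 2 := by
    intro s hs hs3 hsT
    refine (h₂ f hf c s A hc0 hs hA fun τ hτ => hb τ ⟨hc0.trans_le hτ.1, hτ.2.trans hsT⟩).trans
      (le_trans (ofReal_le_ofReal ?_) hηε)
    have e1 : c ^ (-f₀) ≤ (t₀ / 2) ^ (-f₀) :=
      Real.rpow_le_rpow_of_nonpos (by positivity) hc2 (by linarith)
    have e2 : (s - c) ^ (1 - e) ≤ (3 * η) ^ (1 - e) :=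
      Real.rpow_le_rpow (by linarith) hs3 (by linarith)
    gcongr
  have hP : lpn volume m (fun x => ∫⁻ τ in Ioo 0 c, cv volume
        (fun y => ‖derivKernel α a (t - τ) y - derivKernel α a (t₀ - τ) y‖ₑ)
        (fun y => ‖f τ y‖ₑ) x) ≤ ε / 2 := by
    refine hPle.trans (le_trans (setLIntegral_mono' measurableSet_Ioo fun τ hτ => ?_) ht1)
    rw [indicator_of_mem (mem_Iio.2 hτ.2)]
    exact mul_le_mul_right (hb τ ⟨hτ.1, by linarith [hτ.2]⟩) _
  calc lpn volume m (fun x => ‖duh α a f t x - duh α a f t₀ x‖ₑ)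
      ≤ _ := lpn_mono_ae hm0 (by
        filter_upwards [hduh t htT, hduh t₀ ht₀] with x hx hx0
        exact enorm_duh_sub_le_of_split hc0 (by linarith : c ≤ t) (by linarith) hx hx0)
    _ ≤ _ := lpn_add_le hm hPm (hQm.add hRm)
    _ ≤ ε / 2 + (ε / 2 / 2 + ε / 2 / 2) := by
        refine add_le_add hP ((lpn_add_le hm hQm hRm).trans (add_le_add ?_ ?_))
        · exact hQR t (by linarith) (by linarith) htT.2
        · exact hQR t₀ (by linarith) (by linarith) ht₀.2
    _ = ε := by
        rw [ENNReal.add_halves, ENNReal.add_halves]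

end Continuity

/-! ### The power nonlinearity -/

section Nonlinearity

variable {𝕜 : Type*} [RCLike 𝕜] {σ b : ℝ}

/-- In terms of s = w/z it suffices that 1 - s^b ≤ (1+b)(1-s), which is Bernoulli's inequality for b
≥ 1 and s ≤ s^b for b ≤ 1. -/
lemma rpow_sub_rpow_mul_le (hb : 0 < b) {w z : ℝ} (hw : 0 ≤ w) (hwz : w ≤ z) :
    (z ^ b - w ^ b) * w ≤ (1 + b) * z ^ b * (z - w) := by
  rcases hw.eq_or_lt with rfl | hw0
  · have : 0 ≤ z ^ b := rpow_nonneg hwz _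
    simp only [mul_zero, sub_zero]
    positivity
  have hz : 0 < z := hw0.trans_le hwz
  set s := w / z with hs
  have hs0 : 0 < s := by positivity
  have hs1 : s ≤ 1 := (div_le_one hz).2 hwz
  have hws : w = z * s := by rw [hs]; field_simp
  have key : 1 - s ^ b ≤ (1 + b) * (1 - s) := by
    rcases le_total 1 b with h | h
    · have := one_add_mul_self_le_rpow_one_add (s := s - 1) (by linarith) h
      rw [add_sub_cancel] at this
      nlinarith
    · have h1 : s ≤ s ^ b := by
        conv_lhs => rw [← Real.rpow_one s]
        exact Real.rpow_le_rpow_of_exponent_ge hs0 hs1 h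
      nlinarith
  have h2 : w ^ b = z ^ b * s ^ b := by rw [hws, mul_rpow hz.le hs0.le]
  have hzb : 0 < z ^ b := by positivity
  have h3 : 0 ≤ (1 + b) * (1 - s) := by
    have : 0 ≤ 1 - s := by linarith
    positivity
  calc (z ^ b - w ^ b) * w = z ^ b * (1 - s ^ b) * w := by rw [h2]; ring
    _ ≤ z ^ b * ((1 + b) * (1 - s)) * w := by gcongr
    _ ≤ z ^ b * ((1 + b) * (1 - s)) * z := by gcongr
    _ = (1 + b) * z ^ b * (z - w) := by rw [hws]; ring

/-- If |w| ≤ |z|, write g(z) - g(w) = σ(|z|^b (z - w) + (|z|^b - |w|^b) w). This treats all b > 0 at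
once, real or complex, without differentiating |z|^b, which is not Lipschitz at 0 for b < 1. -/
lemma norm_nonlin_sub_le (hσ : σ = 1 ∨ σ = -1) (hb : 0 < b) (z w : 𝕜) :
    ‖nonlin σ b z - nonlin σ b w‖ ≤ (2 + b) * ((‖z‖ ^ b + ‖w‖ ^ b) * ‖z - w‖) := by
  have hσ' : |σ| = 1 := by rcases hσ with rfl | rfl <;> simp
  have key : ∀ z w : 𝕜, ‖w‖ ≤ ‖z‖ →
      ‖nonlin σ b z - nonlin σ b w‖ ≤ (2 + b) * (‖z‖ ^ b * ‖z - w‖) := by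
    intro z w hwz
    have e : nonlin σ b z - nonlin σ b w = σ • (‖z‖ ^ b • (z - w) + (‖z‖ ^ b - ‖w‖ ^ b) • w) := by
      simp only [nonlin, smul_add, smul_sub, smul_smul, sub_smul]
      abel
    rw [e, norm_smul, Real.norm_eq_abs, hσ', one_mul]
    have hzb : 0 ≤ ‖z‖ ^ b := by positivity
    have hmono : ‖w‖ ^ b ≤ ‖z‖ ^ b := Real.rpow_le_rpow (norm_nonneg _) hwz hb.le
    have h1 : ‖z‖ - ‖w‖ ≤ ‖z - w‖ := norm_sub_norm_le z w
    calc ‖‖z‖ ^ b • (z - w) + (‖z‖ ^ b - ‖w‖ ^ b) • w‖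
        ≤ ‖z‖ ^ b * ‖z - w‖ + (‖z‖ ^ b - ‖w‖ ^ b) * ‖w‖ := by
          refine (norm_add_le _ _).trans_eq ?_
          rw [norm_smul, norm_smul, norm_of_nonneg hzb, norm_of_nonneg (by linarith)]
      _ ≤ ‖z‖ ^ b * ‖z - w‖ + (1 + b) * ‖z‖ ^ b * ‖z - w‖ := by
          refine add_le_add_right ((rpow_sub_rpow_mul_le hb (norm_nonneg w) hwz).trans ?_) _
          gcongr
      _ = (2 + b) * (‖z‖ ^ b * ‖z - w‖) := by ring
  have hz : 0 ≤ ‖z‖ ^ b := by positivity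
  have hw : 0 ≤ ‖w‖ ^ b := by positivity
  rcases le_total ‖w‖ ‖z‖ with h | h
  · refine (key z w h).trans ?_
    gcongr
    linarith
  · rw [norm_sub_rev, norm_sub_rev z w]
    refine (key w z h).trans ?_
    gcongr
    linarith

lemma enorm_rpow_eq (z : 𝕜) (hb : 0 < b) : ‖z‖ₑ ^ b = ofReal (‖z‖ ^ b) := by
  rw [← ofReal_norm, ofReal_rpow_of_nonneg (norm_nonneg _) hb.le]

lemma enorm_nonlin_sub_le (hσ : σ = 1 ∨ σ = -1) (hb : 0 < b) (z w : 𝕜) :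
    ‖nonlin σ b z - nonlin σ b w‖ₑ ≤ ofReal (2 + b) * ((‖z‖ₑ ^ b + ‖w‖ₑ ^ b) * ‖z - w‖ₑ) := by
  rw [enorm_rpow_eq z hb, enorm_rpow_eq w hb, ← ofReal_add (by positivity) (by positivity),
    ← ofReal_norm, ← ofReal_norm, ← ofReal_mul (by positivity), ← ofReal_mul (by positivity)]
  exact ofReal_le_ofReal (norm_nonlin_sub_le hσ hb z w)

@[simp] lemma nonlin_zero : nonlin σ b (0 : 𝕜) = 0 := by simp [nonlin]

lemma measurable_nonlin : Measurable (nonlin σ b : 𝕜 → 𝕜) := by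
  unfold nonlin
  fun_prop

lemma measurable_nonlin_sub {n : ℕ} {U V : ℝ → Eu n → 𝕜} (hU : Measurable (uncurry U))
    (hV : Measurable (uncurry V)) :
    Measurable (uncurry fun τ y => ‖nonlin σ b (U τ y) - nonlin σ b (V τ y)‖ₑ) :=
  ((measurable_nonlin.comp hU).sub (measurable_nonlin.comp hV)).enorm

variable {X : Type*} [MeasurableSpace X] {μ : Measure X}

lemma lpn_rpow_mul_le {ρ m₁ m₂ : ℝ} (hb : 0 < b) (hρ : 0 < ρ) (hm₁ : 0 < m₁) (hm₂ : 0 < m₂)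
    (h : 1 / ρ = b / m₁ + 1 / m₂) {F G : X → ℝ≥0∞} (hF : Measurable F) (hG : Measurable G) :
    lpn μ ρ (fun x => F x ^ b * G x) ≤ lpn μ m₁ F ^ b * lpn μ m₂ G := by
  have h1 := lpn_mul_le (μ := μ) (p := ρ) (s := m₁ / b) (t := m₂) hρ (by positivity) hm₂
    (by rw [h]; field_simp) (hF.pow_const b) hG
  rwa [lpn_rpow (by positivity) hb, mul_div_cancel₀ _ hb.ne'] at h1

lemma lpn_nonlin_sub_le (hσ : σ = 1 ∨ σ = -1) {ρ m₁ m₂ : ℝ} (hb : 0 < b) (hρ : 1 ≤ ρ)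
    (hm₁ : 0 < m₁) (hm₂ : 0 < m₂) (h : 1 / ρ = b / m₁ + 1 / m₂) {u v : X → 𝕜} (hu : Measurable u)
    (hv : Measurable v) :
    lpn μ ρ (fun x => ‖nonlin σ b (u x) - nonlin σ b (v x)‖ₑ) ≤ ofReal (2 + b) *
      ((lpn μ m₁ (fun x => ‖u x‖ₑ) ^ b + lpn μ m₁ (fun x => ‖v x‖ₑ) ^ b) *
        lpn μ m₂ (fun x => ‖u x - v x‖ₑ)) := by
  have hρ0 : 0 < ρ := by linarith
  have e1 := lpn_mono (μ := μ) hρ0 fun x => enorm_nonlin_sub_le hσ hb (u x) (v x)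
  have hd : Measurable fun x => ‖u x - v x‖ₑ := (hu.sub hv).enorm
  have h1 : Measurable fun x => ‖u x‖ₑ ^ b * ‖u x - v x‖ₑ := (hu.enorm.pow_const b).mul hd
  have h2 : Measurable fun x => ‖v x‖ₑ ^ b * ‖u x - v x‖ₑ := (hv.enorm.pow_const b).mul hd
  refine e1.trans ?_
  have h3 : Measurable fun x => (‖u x‖ₑ ^ b + ‖v x‖ₑ ^ b) * ‖u x - v x‖ₑ :=
    ((hu.enorm.pow_const b).add (hv.enorm.pow_const b)).mul hd
  rw [lpn_const_mul hρ0 h3]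
  simp only [add_mul]
  exact mul_le_mul_right ((lpn_add_le hρ h1 h2).trans (add_le_add
    (lpn_rpow_mul_le hb hρ0 hm₁ hm₂ h hu.enorm hd)
    (lpn_rpow_mul_le hb hρ0 hm₁ hm₂ h hv.enorm hd))) _

end Nonlinearity

/-! ### Auxiliary exponents and the contraction estimate -/

section Exponents

/-- The power of `t` gained in the contraction estimate; it vanishes in the critical case. -/
noncomputable def gapExp (n : ℕ) (α b r : ℝ) : ℝ := 1 - 1 / (2 * α) - n / (2 * α) * (b / r)

/-- The weight exponent of the smoothing estimate `L^r → L^{p₁}`. -/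
noncomputable def katoExp (n : ℕ) (α r p₁ : ℝ) : ℝ := n / (2 * α) * (1 / r - 1 / p₁)

/-- Admissible auxiliary exponents `p₁` for the fixed point argument. -/
structure KatoExponents (n : ℕ) (α b r p₁ : ℝ) : Prop where
  n_pos : 0 < n
  hα : 1 / 2 < α
  hb : 0 < b
  hr : 1 < r
  gap : 0 ≤ gapExp n α b r
  r_lt : r < p₁
  b_lt : b + 1 < p₁
  lt_mul : p₁ < r * (b + 1)
  time : (b + 1) * katoExp n α r p₁ < 1

/-- Each condition has its task: r < p₁ gives smoothing; b + 1 < p₁ < r(b+1) places p₁/(b+1), the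
exponent of g(u), between 1 and r, so that the Duhamel term also lands in L^r; `time` makes
τ^{-(b+1)δ} integrable at 0. The extra p₁ < p is for interpolating a given solution between L^r and
L^p. All conditions are linear in y = 1/p₁, and only lower and upper bounds have to be compared. -/
lemma exists_katoExponents {n : ℕ} {α b r p : ℝ} (hn : 0 < n) (hα : 1 / 2 < α) (hb : 0 < b)
    (hr : 1 < r) (hgap : 0 ≤ gapExp n α b r) (hp : b + 1 < p) :
    ∃ p₁, KatoExponents n α b r p₁ ∧ (r < p → p₁ < p) := by
  set d := (n : ℝ) / (2 * α) with hd
  have hn' : (0 : ℝ) < n := by exact_mod_cast hn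
  have hd0 : 0 < d := by positivity
  have hb1 : 0 < b + 1 := by linarith
  have hr0 : 0 < r := by linarith
  have hp0 : 0 < p := by linarith
  have h1α : 0 < 1 / (2 * α) := by positivity
  have hg : d * (b / r) < 1 := by
    rw [gapExp] at hgap
    linarith
  set lo := max (max (1 / (r * (b + 1))) (1 / r - 1 / (d * (b + 1))))
    (if r < p then 1 / p else 0) with hlo
  set hi := min (1 / r) (1 / (b + 1)) with hhi
  have hlohi : lo < hi := by
    refine max_lt (max_lt (lt_min ?_ ?_) (lt_min ?_ ?_)) ?_
    · exact one_div_lt_one_div_of_lt hr0 (by nlinarith)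
    · exact one_div_lt_one_div_of_lt hb1 (by nlinarith)
    · have : 0 < 1 / (d * (b + 1)) := by positivity
      linarith
    · have h1 : d * (1 / r) * (b + 1) < 1 + d := by
        have h2 : d * (1 / r) ≤ d := by
          have : 1 / r ≤ 1 := by rw [div_le_one hr0]; exact hr.le
          nlinarith
        have h3 : d * (b / r) = d * (1 / r) * b := by ring
        nlinarith
      have e1 : 1 / r - 1 / (d * (b + 1)) = (d * (1 / r) * (b + 1) - 1) / (d * (b + 1)) := by
        field_simp
      have e2 : 1 / (b + 1) = d / (d * (b + 1)) := by field_simp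
      rw [e1, e2]
      exact div_lt_div_of_pos_right (by linarith) (by positivity)
    · split_ifs with h
      · exact lt_min (one_div_lt_one_div_of_lt hr0 h) (one_div_lt_one_div_of_lt hb1 hp)
      · positivity
  obtain ⟨y, hy1, hy2⟩ := exists_between hlohi
  have hy1a : 1 / (r * (b + 1)) < y := ((le_max_left _ _).trans (le_max_left _ _)).trans_lt hy1
  have hy1b : 1 / r - 1 / (d * (b + 1)) < y := ((le_max_right _ _).trans (le_max_left _ _)).trans_lt hy1
  have hy1c : (if r < p then 1 / p else 0) < y := (le_max_right _ _).trans_lt hy1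
  have hy2a : y < 1 / r := hy2.trans_le (min_le_left _ _)
  have hy2b : y < 1 / (b + 1) := hy2.trans_le (min_le_right _ _)
  have hy0 : 0 < y := lt_trans (by positivity) hy1a
  refine ⟨1 / y, ⟨hn, hα, hb, hr, hgap, ?_, ?_, ?_, ?_⟩, fun h => ?_⟩
  · rwa [lt_div_iff₀ hy0, mul_comm, ← lt_div_iff₀ hr0]
  · rwa [lt_div_iff₀ hy0, mul_comm, ← lt_div_iff₀ hb1]
  · rwa [div_lt_iff₀ hy0, mul_comm, ← div_lt_iff₀ (by positivity)]
  · rw [katoExp, one_div_one_div, ← hd]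
    have : 1 / r - y < 1 / (d * (b + 1)) := by linarith
    calc (b + 1) * (d * (1 / r - y)) < (b + 1) * (d * (1 / (d * (b + 1)))) := by gcongr
      _ = 1 := by field_simp
  · rw [if_pos h] at hy1c
    rwa [div_lt_iff₀ hy0, mul_comm, ← div_lt_iff₀ hp0]

namespace KatoExponents

variable {n : ℕ} {α b r p₁ : ℝ}

lemma r_pos (h : KatoExponents n α b r p₁) : 0 < r := by linarith [h.hr]

lemma one_lt_p₁ (h : KatoExponents n α b r p₁) : 1 < p₁ := by linarith [h.r_lt, h.hr]

lemma p₁_pos (h : KatoExponents n α b r p₁) : 0 < p₁ := by linarith [h.one_lt_p₁]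

lemma d_pos (h : KatoExponents n α b r p₁) : 0 < (n : ℝ) / (2 * α) := by
  have h2 : (0 : ℝ) < n := by exact_mod_cast h.n_pos
  have h4 : 0 < α := by linarith [h.hα]
  positivity

lemma katoExp_pos (h : KatoExponents n α b r p₁) : 0 < katoExp n α r p₁ := by
  have h1 : 1 / p₁ < 1 / r := one_div_lt_one_div_of_lt h.r_pos h.r_lt
  exact mul_pos h.d_pos (by linarith)

/-- The basic estimate for differences of Duhamel integrals. -/
lemma exists_lpn_maj_nonlin_sub_le (h : KatoExponents n α b r p₁) (𝕜 : Type*) [RCLike 𝕜] {σ : ℝ}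
    (hσ : σ = 1 ∨ σ = -1) : ∃ K : ℝ, 0 < K ∧ ∀ U V : ℝ → Eu n → 𝕜,
      Measurable (uncurry U) → Measurable (uncurry V) →
      ∀ t M N : ℝ, 0 < t → 0 ≤ M → 0 ≤ N →
      (∀ τ ∈ Ioo 0 t, lpn volume p₁ (fun x => ‖U τ x‖ₑ) ≤ ofReal (M * τ ^ (-katoExp n α r p₁))) →
      (∀ τ ∈ Ioo 0 t, lpn volume p₁ (fun x => ‖V τ x‖ₑ) ≤ ofReal (M * τ ^ (-katoExp n α r p₁))) →
      (∀ τ ∈ Ioo 0 t, lpn volume p₁ (fun x => ‖U τ x - V τ x‖ₑ) ≤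
        ofReal (N * τ ^ (-katoExp n α r p₁))) →
      lpn volume p₁ (maj α (fun τ x => ‖nonlin σ b (U τ x) - nonlin σ b (V τ x)‖ₑ) t) ≤
        ofReal (K * M ^ b * N * t ^ (gapExp n α b r - katoExp n α r p₁)) ∧
      lpn volume r (maj α (fun τ x => ‖nonlin σ b (U τ x) - nonlin σ b (V τ x)‖ₑ) t) ≤
        ofReal (K * M ^ b * N * t ^ gapExp n α b r) := by
  have hα := h.hα
  have hα0 : 0 < α := by linarith
  have hb := h.hb
  have hb1 : 0 < b + 1 := by linarith
  have hr0 := h.r_pos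
  have hp0 := h.p₁_pos
  set δ := katoExp n α r p₁ with hδ
  have hδ0 : 0 < δ := h.katoExp_pos
  set ρ := p₁ / (b + 1) with hρ
  have hρ1 : 1 ≤ ρ := by rw [hρ, le_div_iff₀ hb1]; linarith [h.b_lt]
  have hρp : ρ ≤ p₁ := div_le_self hp0.le (by linarith)
  have hρr : ρ ≤ r := by rw [hρ, div_le_iff₀ hb1]; exact h.lt_mul.le
  have hρi : 1 / ρ = (b + 1) / p₁ := by rw [hρ, one_div_div]
  set d := (n : ℝ) / (2 * α) with hd
  have hd0 : 0 < d := h.d_pos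
  have hgap := h.gap
  rw [gapExp, ← hd] at hgap
  have hlt : d * (b / p₁) < d * (b / r) := by
    have : b / p₁ < b / r := div_lt_div_of_pos_left hb hr0 h.r_lt
    gcongr
  -- Singularity exponents of the kernel for the targets L^{p₁} and L^r. Both are below 1 even when
  -- the gap is zero, because b/p₁ < b/r strictly.
  have e₁ : 1 / (2 * α) + d * (1 / ρ - 1 / p₁) = 1 / (2 * α) + d * (b / p₁) := by rw [hρi]; ring
  have e₂ : 1 / (2 * α) + d * (1 / ρ - 1 / r) = 1 / (2 * α) + d * (b / p₁) - δ := by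
    rw [hρi, hδ, katoExp, ← hd]; ring
  obtain ⟨C₁, hC₁, h₁⟩ := exists_lpn_maj_le_rpow hα0 n hρ1 hρp rfl (by rw [← hd, e₁]; linarith)
    (f₀ := (b + 1) * δ) (by positivity) h.time
  obtain ⟨C₂, hC₂, h₂⟩ := exists_lpn_maj_le_rpow hα0 n hρ1 hρr rfl (by rw [← hd, e₂]; linarith)
    (f₀ := (b + 1) * δ) (by positivity) h.time
  refine ⟨(C₁ + C₂) * (2 * (2 + b)), by positivity, fun U V hU hV t M N ht hM hN hUb hVb hD => ?_⟩
  have hF := measurable_nonlin_sub (σ := σ) (b := b) hU hV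
  have hbound : ∀ τ ∈ Ioo 0 t,
      lpn volume ρ (fun x => ‖nonlin σ b (U τ x) - nonlin σ b (V τ x)‖ₑ) ≤
        ofReal ((2 * (2 + b)) * (M ^ b * N) * τ ^ (-((b + 1) * δ))) := by
    intro τ hτ
    have hτ0 : 0 < τ := hτ.1
    refine (lpn_nonlin_sub_le hσ hb hρ1 hp0 hp0 (by rw [hρi]; ring)
      (hU.comp measurable_prodMk_left) (hV.comp measurable_prodMk_left)).trans ?_
    have e3 : ∀ W : ℝ → Eu n → 𝕜, lpn volume p₁ (fun x => ‖W τ x‖ₑ) ≤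
        ofReal (M * τ ^ (-δ)) → lpn volume p₁ (fun x => ‖W τ x‖ₑ) ^ b ≤
        ofReal (M ^ b * τ ^ (-(b * δ))) := by
      intro W hW
      refine (rpow_le_rpow hW hb.le).trans_eq ?_
      rw [ofReal_rpow_of_nonneg (by positivity) hb.le, mul_rpow hM (by positivity),
        ← rpow_mul hτ0.le, neg_mul, mul_comm δ]
    refine (mul_le_mul_right (mul_le_mul' (add_le_add (e3 U (hUb τ hτ)) (e3 V (hVb τ hτ)))
      (hD τ hτ)) _).trans ?_
    rw [← ofReal_add (by positivity) (by positivity), ← ofReal_mul (by positivity),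
      ← ofReal_mul (by positivity)]
    refine ofReal_le_ofReal (le_of_eq ?_)
    rw [show -((b + 1) * δ) = -(b * δ) + -δ by ring, rpow_add hτ0]
    ring
  have hA : 0 ≤ (2 * (2 + b)) * (M ^ b * N) := by positivity
  have r₁ := h₁ _ hF t _ ht hA hbound
  have r₂ := h₂ _ hF t _ ht hA hbound
  refine ⟨r₁.trans (ofReal_le_ofReal ?_), r₂.trans (ofReal_le_ofReal ?_)⟩
  · have e4 : 1 - (1 / (2 * α) + d * (1 / ρ - 1 / p₁)) - (b + 1) * δ = gapExp n α b r - δ := by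
      rw [e₁, hδ, katoExp, gapExp, ← hd]; ring
    rw [e4]
    calc C₁ * (2 * (2 + b) * (M ^ b * N)) * t ^ (gapExp n α b r - δ)
        ≤ (C₁ + C₂) * (2 * (2 + b) * (M ^ b * N)) * t ^ (gapExp n α b r - δ) := by
          gcongr; linarith
      _ = _ := by ring
  · have e4 : 1 - (1 / (2 * α) + d * (1 / ρ - 1 / r)) - (b + 1) * δ = gapExp n α b r := by
      rw [e₂, hδ, katoExp, gapExp, ← hd]; ring
    rw [e4]
    calc C₂ * (2 * (2 + b) * (M ^ b * N)) * t ^ gapExp n α b r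
        ≤ (C₁ + C₂) * (2 * (2 + b) * (M ^ b * N)) * t ^ gapExp n α b r := by
          gcongr; linarith
      _ = _ := by ring

/-- The basic estimate for the difference of two Duhamel terms, in `L^{p₁}` and `L^r`. -/
lemma exists_lpn_duh_sub_le (h : KatoExponents n α b r p₁) (𝕜 : Type*) [RCLike 𝕜] {σ : ℝ}
    (hσ : σ = 1 ∨ σ = -1) (a : Eu n) : ∃ K : ℝ, 0 < K ∧ ∀ U V : ℝ → Eu n → 𝕜,
      Measurable (uncurry U) → Measurable (uncurry V) →
      ∀ t M N : ℝ, 0 < t → 0 ≤ M → 0 ≤ N →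
      (∀ τ ∈ Ioo 0 t, lpn volume p₁ (fun x => ‖U τ x‖ₑ) ≤ ofReal (M * τ ^ (-katoExp n α r p₁))) →
      (∀ τ ∈ Ioo 0 t, lpn volume p₁ (fun x => ‖V τ x‖ₑ) ≤ ofReal (M * τ ^ (-katoExp n α r p₁))) →
      (∀ τ ∈ Ioo 0 t, lpn volume p₁ (fun x => ‖U τ x - V τ x‖ₑ) ≤
        ofReal (N * τ ^ (-katoExp n α r p₁))) →
      (∀ᵐ x, DuhAt α a (fun τ y => nonlin σ b (U τ y)) t x) ∧
      lpn volume p₁ (fun x => ‖duh α a (fun τ y => nonlin σ b (U τ y)) t x -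
        duh α a (fun τ y => nonlin σ b (V τ y)) t x‖ₑ) ≤
        ofReal (K * M ^ b * N * t ^ (gapExp n α b r - katoExp n α r p₁)) ∧
      lpn volume r (fun x => ‖duh α a (fun τ y => nonlin σ b (U τ y)) t x -
        duh α a (fun τ y => nonlin σ b (V τ y)) t x‖ₑ) ≤
        ofReal (K * M ^ b * N * t ^ gapExp n α b r) := by
  obtain ⟨K, hK, hb⟩ := h.exists_lpn_maj_nonlin_sub_le 𝕜 hσ
  obtain ⟨C, hC, hc⟩ := exists_enorm_duh_sub_le 𝕜 h.n_pos h.hα a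
  refine ⟨C * K, by positivity, fun U V hU hV t M N ht hM hN hUb hVb hD => ?_⟩
  -- Absolute convergence for a single function is the difference estimate against zero, as g(0) =
  -- 0.
  have hduh : ∀ W : ℝ → Eu n → 𝕜, Measurable (uncurry W) →
      (∀ τ ∈ Ioo 0 t, lpn volume p₁ (fun x => ‖W τ x‖ₑ) ≤ ofReal (M * τ ^ (-katoExp n α r p₁))) →
      ∀ᵐ x, DuhAt α a (fun τ y => nonlin σ b (W τ y)) t x := by
    intro W hW hWb
    refine ae_duhAt_of_lpn_maj_ne_top h.n_pos h.hα a (f := fun τ y => nonlin σ b (W τ y))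
      (measurable_nonlin.comp hW) h.p₁_pos ?_
    have h0 := (hb W (fun _ _ => 0) hW measurable_const t M M ht hM hM hWb
      (fun τ hτ => by simp [lpn_zero h.p₁_pos]) (by simpa using hWb)).1
    simp only [nonlin_zero, sub_zero] at h0
    exact ne_top_of_le_ne_top ofReal_ne_top h0
  have hU' := hduh U hU hUb
  have hV' := hduh V hV hVb
  have hF := measurable_nonlin_sub (σ := σ) (b := b) hU hV
  obtain ⟨r₁, r₂⟩ := hb U V hU hV t M N ht hM hN hUb hVb hD
  have hle : ∀ m : ℝ, 0 < m → lpn volume m (fun x =>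
      ‖duh α a (fun τ y => nonlin σ b (U τ y)) t x -
        duh α a (fun τ y => nonlin σ b (V τ y)) t x‖ₑ) ≤ ofReal C * lpn volume m
        (maj α (fun τ x => ‖nonlin σ b (U τ x) - nonlin σ b (V τ x)‖ₑ) t) := by
    intro m hm
    rw [← lpn_const_mul hm (measurable_maj hF t)]
    refine lpn_mono_ae hm ?_
    filter_upwards [hU', hV'] with x h1 h2
    exact hc _ _ t x h1 h2
  refine ⟨hU', (hle p₁ h.p₁_pos).trans ((mul_le_mul_right r₁ _).trans_eq ?_),
    (hle r h.r_pos).trans ((mul_le_mul_right r₂ _).trans_eq ?_)⟩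
  · rw [← ofReal_mul hC.le]
    congr 1
    ring
  · rw [← ofReal_mul hC.le]
    congr 1
    ring

end KatoExponents

end Exponents

/-! ### Almost everywhere convergence from geometric bounds -/

section GeometricConvergence

variable {𝕜 : Type*} [RCLike 𝕜] {X : Type*} [MeasurableSpace X] {μ : Measure X}

lemma tsum_ofReal_geometric {A : ℝ} (hA : 0 ≤ A) (k : ℕ) :
    ∑' m : ℕ, ofReal (A * (1 / 2) ^ (k + m)) = ofReal (2 * A * (1 / 2) ^ k) := by
  have hs : Summable fun m : ℕ => A * (1 / 2 : ℝ) ^ (k + m) := by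
    simp only [pow_add, ← mul_assoc]
    exact summable_geometric_two.mul_left _
  rw [← ENNReal.ofReal_tsum_of_nonneg (fun m => by positivity) hs]
  simp only [pow_add, ← mul_assoc]
  rw [tsum_mul_left, tsum_geometric_two]
  congr 1
  ring

lemma lpn_tsum_le [SigmaFinite μ] {p : ℝ} (hp : 1 ≤ p) {F : ℕ → X → ℝ≥0∞}
    (hF : ∀ k, Measurable (F k)) :
    lpn μ p (fun x => ∑' k, F k x) ≤ ∑' k, lpn μ p (F k) := by
  have h : Measurable (uncurry F) := measurable_from_prod_countable_right hF
  have := lpn_lintegral_le (μ := μ) (ν := (Measure.count : Measure ℕ)) hp h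
  simpa only [lintegral_count] using this

/-- By Minkowski the sum of the increments has finite norm, hence is finite almost everywhere, and
its tails bound the error. Taking the limit pointwise rather than in L^p keeps joint measurability
in time and space. -/
lemma ae_tendsto_of_lpn_geometric [SigmaFinite μ] {p : ℝ} (hp : 1 ≤ p) {f : ℕ → X → 𝕜}
    (hf : ∀ k, Measurable (f k)) {A : ℝ} (hA : 0 ≤ A)
    (h : ∀ k, lpn μ p (fun x => ‖f (k + 1) x - f k x‖ₑ) ≤ ofReal (A * (1 / 2) ^ k)) :
    (∀ᵐ x ∂μ, Tendsto (fun k => f k x) atTop (𝓝 (limUnder atTop fun k => f k x))) ∧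
      ∀ k, lpn μ p (fun x => ‖limUnder atTop (fun k => f k x) - f k x‖ₑ) ≤
        ofReal (2 * A * (1 / 2) ^ k) := by
  have hp0 : 0 < p := by linarith
  have hd : ∀ k, Measurable fun x => ‖f (k + 1) x - f k x‖ₑ := fun k =>
    ((hf (k + 1)).sub (hf k)).enorm
  have htail : ∀ k, lpn μ p (fun x => ∑' m, ‖f (k + m + 1) x - f (k + m) x‖ₑ) ≤
      ofReal (2 * A * (1 / 2) ^ k) := fun k =>
    (lpn_tsum_le hp fun m => hd (k + m)).trans
      ((ENNReal.tsum_le_tsum fun m => h (k + m)).trans_eq (tsum_ofReal_geometric hA k))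
  have hsum : ∀ᵐ x ∂μ, ∑' m, ‖f (m + 1) x - f m x‖ₑ ≠ ∞ := by
    have h0 := htail 0
    simp only [zero_add] at h0
    exact ae_ne_top_of_lpn_ne_top hp0 (Measurable.tsum hd) (ne_top_of_le_ne_top ofReal_ne_top h0)
  have hed : ∀ x k, edist (f k x) (f (k + 1) x) ≤ ‖f (k + 1) x - f k x‖ₑ := fun x k => by
    rw [edist_comm, edist_eq_enorm_sub]
  have hlim : ∀ᵐ x ∂μ, Tendsto (fun k => f k x) atTop (𝓝 (limUnder atTop fun k => f k x)) := by
    filter_upwards [hsum] with x hx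
    exact (cauchySeq_of_edist_le_of_tsum_ne_top _ (hed x) hx).tendsto_limUnder
  refine ⟨hlim, fun k => le_trans (lpn_mono_ae hp0 ?_) (htail k)⟩
  filter_upwards [hlim] with x hx
  have := edist_le_tsum_of_edist_le_of_tendsto _ (hed x) hx k
  rwa [edist_comm, edist_eq_enorm_sub] at this

end GeometricConvergence

/-! ### Picard iteration -/

section Picard

variable {𝕜 : Type*} [RCLike 𝕜] {n : ℕ}

/-- The Picard iterates for the mild formulation. -/
noncomputable def picard (α b σ : ℝ) (a : Eu n) (φ : Eu n → 𝕜) : ℕ → ℝ → Eu n → 𝕜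
  | 0 => fun _ _ => 0
  | k + 1 => fun t x =>
      sg α t φ x + duh α a (fun τ y => nonlin σ b (picard α b σ a φ k τ y)) t x

/-- The pointwise limit of the Picard iterates. -/
noncomputable def picardLim (α b σ : ℝ) (a : Eu n) (φ : Eu n → 𝕜) (t : ℝ) (x : Eu n) : 𝕜 :=
  limUnder atTop fun k => picard α b σ a φ k t x

variable {α b r p₁ σ : ℝ} {a : Eu n} {φ : Eu n → 𝕜}

lemma measurable_sg (hn : 0 < n) (hα : 1 / 2 < α) (hφ : Measurable φ) :
    Measurable (uncurry fun t x => sg α t φ x) := by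
  have hc : Measurable fun w : (ℝ × Eu n) × Eu n => w.1.2 - w.1.1 ^ (1 / (2 * α)) • w.2 := by
    have h1 : Measurable fun w : (ℝ × Eu n) × Eu n => w.1.1 ^ (1 / (2 * α)) := by fun_prop
    exact (measurable_snd.comp measurable_fst).sub (h1.smul measurable_snd)
  have h1 : Measurable fun w : (ℝ × Eu n) × Eu n =>
      kernel n α 1 w.2 • φ (w.1.2 - w.1.1 ^ (1 / (2 * α)) • w.2) :=
    ((measurable_kernel hn hα one_pos).comp measurable_snd).smul (hφ.comp hc)
  exact (h1.stronglyMeasurable.integral_prod_right' (ν := volume)).measurable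

lemma measurable_picard (hn : 0 < n) (hα : 1 / 2 < α) (hφ : Measurable φ) (k : ℕ) :
    Measurable (uncurry (picard α b σ a φ k)) := by
  induction k with
  | zero => exact measurable_const
  | succ k ih =>
    exact (measurable_sg hn hα hφ).add (measurable_duh hn hα a (f := fun τ y =>
      nonlin σ b (picard α b σ a φ k τ y)) (measurable_nonlin.comp ih))

lemma measurable_duh_nonlin (hn : 0 < n) (hα : 1 / 2 < α) {W : ℝ → Eu n → 𝕜}
    (hW : Measurable (uncurry W)) (t : ℝ) :
    Measurable (duh α a (fun τ y => nonlin σ b (W τ y)) t) :=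
  (measurable_duh hn hα a (f := fun τ y => nonlin σ b (W τ y))
    (measurable_nonlin.comp hW)).of_uncurry_left

lemma measurable_picardLim (hn : 0 < n) (hα : 1 / 2 < α) (hφ : Measurable φ) :
    Measurable (uncurry (picardLim α b σ a φ)) := by
  have := StronglyMeasurable.limUnder (l := atTop) fun k =>
    (measurable_picard (b := b) (σ := σ) (a := a) hn hα hφ k).stronglyMeasurable
  exact this.measurable

lemma duh_zero_time (f : ℝ → Eu n → 𝕜) (x : Eu n) : duh α a f 0 x = 0 := by
  simp [duh]

lemma duh_zero (t : ℝ) (x : Eu n) : duh α a (fun _ _ => (0 : 𝕜)) t x = 0 := by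
  simp [duh, semigroupDeriv_apply]

lemma picardLim_zero (hn : 0 < n) (hα : 1 / 2 < α) (x : Eu n) : picardLim α b σ a φ 0 x = φ x := by
  refine (Tendsto.congr' (f₁ := fun _ => φ x) ?_ tendsto_const_nhds).limUnder_eq
  filter_upwards [eventually_ge_atTop 1] with k hk
  obtain ⟨j, rfl⟩ := Nat.exists_eq_succ_of_ne_zero (by omega : k ≠ 0)
  change φ x = sg α 0 φ x + duh α a _ 0 x
  rw [duh_zero_time, sg_zero hn hα, add_zero]

namespace KatoExponents

/-- A contraction in sup t^δ ‖·‖_{p₁}, with the L^r bounds of the Duhamel terms as by-product. M is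
any bound for the weighted norm of the linear part, so the same limit can later be re-estimated with
a smaller M on a shorter interval. -/
lemma exists_picard_bounds (h : KatoExponents n α b r p₁) (𝕜 : Type*) [RCLike 𝕜] {σ : ℝ}
    (hσ : σ = 1 ∨ σ = -1) (a : Eu n) : ∃ K : ℝ, 0 < K ∧ ∀ φ : Eu n → 𝕜, Measurable φ →
      ∀ T M Θ : ℝ, 0 ≤ M → (∀ t ∈ Ioo 0 T, t ^ gapExp n α b r ≤ Θ) → K * M ^ b * Θ ≤ 1 →
      (∀ t ∈ Ioo 0 T, lpn volume p₁ (fun x => ‖sg α t φ x‖ₑ) ≤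
        ofReal (M * t ^ (-katoExp n α r p₁))) → ∀ t ∈ Ioo 0 T,
      (∀ k, lpn volume p₁ (fun x => ‖picard α b σ a φ k t x‖ₑ) ≤
        ofReal (2 * M * t ^ (-katoExp n α r p₁))) ∧
      (∀ᵐ x, Tendsto (fun k => picard α b σ a φ k t x) atTop (𝓝 (picardLim α b σ a φ t x))) ∧
      lpn volume p₁ (fun x => ‖picardLim α b σ a φ t x‖ₑ) ≤
        ofReal (4 * M * t ^ (-katoExp n α r p₁)) ∧
      (∀ᵐ x, DuhAt α a (fun τ y => nonlin σ b (picardLim α b σ a φ τ y)) t x) ∧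
      (∀ᵐ x, picardLim α b σ a φ t x =
        sg α t φ x + duh α a (fun τ y => nonlin σ b (picardLim α b σ a φ τ y)) t x) ∧
      lpn volume r (fun x => ‖duh α a (fun τ y => nonlin σ b (picardLim α b σ a φ τ y)) t x‖ₑ) ≤
        ofReal (K * M ^ b * M * t ^ gapExp n α b r) ∧
      ∀ k, lpn volume r (fun x => ‖duh α a (fun τ y => nonlin σ b (picard α b σ a φ k τ y)) t x‖ₑ) ≤
        ofReal (K * M ^ b * M * t ^ gapExp n α b r) := by
  obtain ⟨K, hK, hE⟩ := h.exists_lpn_duh_sub_le 𝕜 hσ a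
  have hb := h.hb
  have hn := h.n_pos
  have hα := h.hα
  have hp0 := h.p₁_pos
  have hp1 : 1 ≤ p₁ := h.one_lt_p₁.le
  have h4 : (0 : ℝ) < 4 ^ b := by positivity
  -- 4M is a radius common to the iterates (2M) and their limit (4M), whence 4^b; the 8 makes the
  -- contraction factor 1/8.
  refine ⟨8 * 4 ^ b * K, by positivity, fun φ hφ T M Θ hM hΘ hsm hlin => ?_⟩
  set δ := katoExp n α r p₁ with hδ
  set κ := gapExp n α b r with hκ
  set U := picard α b σ a φ with hU
  have hUm : ∀ k, Measurable (uncurry (U k)) := measurable_picard hn hα hφ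
  have hMb : 0 ≤ M ^ b := by positivity
  have hsucc : ∀ k t x, U (k + 1) t x = sg α t φ x + duh α a (fun τ y => nonlin σ b (U k τ y)) t x :=
    fun _ _ _ => rfl
  have hsgm : ∀ t, Measurable (sg α t φ) := fun t => (measurable_sg hn hα hφ).of_uncurry_left
  have hτ : ∀ t ∈ Ioo 0 T, ∀ τ ∈ Ioo 0 t, τ ∈ Ioo 0 T := fun t ht τ hτ => ⟨hτ.1, hτ.2.trans ht.2⟩
  -- the contraction constant
  have hcontr : ∀ t ∈ Ioo 0 T, ∀ N : ℝ, 0 ≤ N →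
      K * (4 * M) ^ b * N * t ^ (κ - δ) ≤ 1 / 8 * N * t ^ (-δ) := by
    intro t ht N hN
    have ht0 : 0 < t := ht.1
    rw [mul_rpow (by norm_num) hM, sub_eq_add_neg, rpow_add ht0]
    have e1 : 8 * (4 ^ b * K * M ^ b * t ^ κ) ≤ 1 := by
      refine le_trans ?_ hsm
      have : t ^ κ ≤ Θ := hΘ t ht
      calc 8 * (4 ^ b * K * M ^ b * t ^ κ) ≤ 8 * (4 ^ b * K * M ^ b * Θ) := by gcongr
        _ = _ := by ring
    calc K * (4 ^ b * M ^ b) * N * (t ^ κ * t ^ (-δ))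
        = (4 ^ b * K * M ^ b * t ^ κ) * N * t ^ (-δ) := by ring
      _ ≤ 1 / 8 * N * t ^ (-δ) := by
          gcongr
          linarith
  have hmono : ∀ {x : ℝ≥0∞} {c c' t : ℝ}, 0 < t → c ≤ c' → x ≤ ofReal (c * t ^ (-δ)) →
      x ≤ ofReal (c' * t ^ (-δ)) := by
    intro x c c' t ht hcc hx
    refine hx.trans (ofReal_le_ofReal ?_)
    have : 0 < t ^ (-δ) := by positivity
    gcongr
  have hz : ∀ t, 0 < t → ∀ c : ℝ, lpn volume p₁ (fun _ : Eu n => ‖(0 : 𝕜)‖ₑ) ≤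
      ofReal (c * t ^ (-δ)) := fun t _ c => by simp [lpn_zero hp0]
  -- uniform bound
  have hA : ∀ k, ∀ t ∈ Ioo 0 T,
      lpn volume p₁ (fun x => ‖U k t x‖ₑ) ≤ ofReal (2 * M * t ^ (-δ)) := by
    intro k
    induction k with
    | zero => exact fun t ht => hz t ht.1 _
    | succ k ih =>
      intro t ht
      have ht0 : 0 < t := ht.1
      have h1 := (hE (U k) (fun _ _ => 0) (hUm k) measurable_const t (4 * M) (2 * M) ht0
        (by positivity) (by positivity)
        (fun τ h => hmono h.1 (by linarith) (ih τ (hτ t ht τ h))) (fun τ h => hz τ h.1 _)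
        (fun τ h => by simpa using ih τ (hτ t ht τ h))).2.1
      simp only [nonlin_zero, duh_zero, sub_zero] at h1
      have h2 := h1.trans (ofReal_le_ofReal (hcontr t ht (2 * M) (by positivity)))
      calc lpn volume p₁ (fun x => ‖U (k + 1) t x‖ₑ)
          ≤ lpn volume p₁ (fun x => ‖sg α t φ x‖ₑ +
            ‖duh α a (fun τ y => nonlin σ b (U k τ y)) t x‖ₑ) :=
            lpn_mono hp0 fun x => by rw [hsucc]; exact enorm_add_le _ _
        _ ≤ _ := lpn_add_le hp1 (hsgm t).enorm (measurable_duh_nonlin hn hα (hUm k) t).enorm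
        _ ≤ _ := add_le_add (hlin t ht) h2
        _ ≤ _ := by
            rw [← ofReal_add (by positivity) (by positivity)]
            refine ofReal_le_ofReal ?_
            have : 0 ≤ M * t ^ (-δ) := by positivity
            linarith
  -- geometric decay of the increments
  have hB : ∀ k, ∀ t ∈ Ioo 0 T, lpn volume p₁ (fun x => ‖U (k + 1) t x - U k t x‖ₑ) ≤
      ofReal (2 * M * (1 / 2) ^ k * t ^ (-δ)) := by
    intro k
    induction k with
    | zero =>
      intro t ht
      have e : ∀ x, U 0 t x = 0 := fun _ => rfl
      simp only [e, sub_zero, pow_zero, mul_one]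
      exact hA 1 t ht
    | succ k ih =>
      intro t ht
      have ht0 : 0 < t := ht.1
      have h1 := (hE (U (k + 1)) (U k) (hUm (k + 1)) (hUm k) t (4 * M) (2 * M * (1 / 2) ^ k) ht0
        (by positivity) (by positivity)
        (fun τ h => hmono h.1 (by linarith) (hA (k + 1) τ (hτ t ht τ h)))
        (fun τ h => hmono h.1 (by linarith) (hA k τ (hτ t ht τ h)))
        (fun τ h => ih τ (hτ t ht τ h))).2.1
      have e : ∀ x, U (k + 1 + 1) t x - U (k + 1) t x =
          duh α a (fun τ y => nonlin σ b (U (k + 1) τ y)) t x -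
            duh α a (fun τ y => nonlin σ b (U k τ y)) t x := fun x => by
        rw [hsucc, hsucc]; ring
      simp only [e]
      refine h1.trans (ofReal_le_ofReal ((hcontr t ht _ (by positivity)).trans ?_))
      rw [pow_succ]
      have : 0 ≤ M * (1 / 2) ^ k * t ^ (-δ) := by positivity
      linarith
  have hlim : ∀ t ∈ Ioo 0 T, _ := fun t ht => by
    have ht0 : 0 < t := ht.1
    exact ae_tendsto_of_lpn_geometric (μ := volume) hp1
      (f := fun k x => U k t x) (fun k => (hUm k).of_uncurry_left)
      (A := 2 * M * t ^ (-δ)) (by positivity) fun k => (hB k t ht).trans_eq (by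
        congr 1
        ring)
  set V := picardLim α b σ a φ with hV
  have hVm : Measurable (uncurry V) := measurable_picardLim hn hα hφ
  have hVU : ∀ t ∈ Ioo 0 T, ∀ k, lpn volume p₁ (fun x => ‖V t x - U k t x‖ₑ) ≤
      ofReal (4 * M * (1 / 2) ^ k * t ^ (-δ)) := fun t ht k =>
    ((hlim t ht).2 k).trans_eq (by congr 1; ring)
  have hVb : ∀ t ∈ Ioo 0 T, lpn volume p₁ (fun x => ‖V t x‖ₑ) ≤
      ofReal (4 * M * t ^ (-δ)) := fun t ht => by
    have e : ∀ x, U 0 t x = 0 := fun _ => rfl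
    have := hVU t ht 0
    simpa only [e, sub_zero, pow_zero, mul_one] using this
  intro t ht
  have ht0 : 0 < t := ht.1
  have hfin : ∀ k, _ := fun k => hE V (U k) hVm (hUm k) t (4 * M) (4 * M * (1 / 2) ^ k) ht0
    (by positivity) (by positivity) (fun τ h => hVb τ (hτ t ht τ h))
    (fun τ h => hmono h.1 (by linarith) (hA k τ (hτ t ht τ h))) (fun τ h => hVU τ (hτ t ht τ h) k)
  have hKM : K * (4 * M) ^ b * (4 * M) * t ^ κ ≤ 8 * 4 ^ b * K * M ^ b * M * t ^ κ := by
    rw [mul_rpow (by norm_num) hM]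
    have : 0 ≤ 4 ^ b * K * M ^ b * M * t ^ κ := by positivity
    linarith
  refine ⟨fun k => hA k t ht, (hlim t ht).1, hVb t ht, (hfin 0).1, ?_, ?_, fun k => ?_⟩
  · have hW : Measurable fun x => ‖V t x -
        (sg α t φ x + duh α a (fun τ y => nonlin σ b (V τ y)) t x)‖ₑ :=
      (hVm.of_uncurry_left.sub ((hsgm t).add (measurable_duh_nonlin hn hα hVm t))).enorm
    -- With Φ the Picard map, V - Φ(V) = (V - U_{k+1}) - (Φ(V) - Φ(U_k)), and both terms are
    -- O(2^{-k}).
    have hle : ∀ k, lpn volume p₁ (fun x => ‖V t x -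
        (sg α t φ x + duh α a (fun τ y => nonlin σ b (V τ y)) t x)‖ₑ) ≤
        ofReal (5 * M * t ^ (-δ) * (1 / 2) ^ k) := by
      intro k
      have m1 : Measurable fun x => ‖V t x - U (k + 1) t x‖ₑ :=
        (hVm.of_uncurry_left.sub ((hUm (k + 1)).of_uncurry_left)).enorm
      have m2 : Measurable fun x => ‖duh α a (fun τ y => nonlin σ b (V τ y)) t x -
          duh α a (fun τ y => nonlin σ b (U k τ y)) t x‖ₑ :=
        ((measurable_duh_nonlin hn hα hVm t).sub (measurable_duh_nonlin hn hα (hUm k) t)).enorm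
      calc _ ≤ lpn volume p₁ (fun x => ‖V t x - U (k + 1) t x‖ₑ +
            ‖duh α a (fun τ y => nonlin σ b (V τ y)) t x -
              duh α a (fun τ y => nonlin σ b (U k τ y)) t x‖ₑ) := by
            refine lpn_mono hp0 fun x => ?_
            have e : V t x - (sg α t φ x + duh α a (fun τ y => nonlin σ b (V τ y)) t x) =
                (V t x - U (k + 1) t x) - (duh α a (fun τ y => nonlin σ b (V τ y)) t x -
                  duh α a (fun τ y => nonlin σ b (U k τ y)) t x) := by
              rw [hsucc]; ring
            rw [e]
            exact enorm_sub_le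
        _ ≤ _ := lpn_add_le hp1 m1 m2
        _ ≤ _ := add_le_add (hVU t ht (k + 1)) ((hfin k).2.1.trans
            (ofReal_le_ofReal (hcontr t ht _ (by positivity))))
        _ ≤ _ := by
            rw [← ofReal_add (by positivity) (by positivity)]
            refine ofReal_le_ofReal ?_
            rw [pow_succ]
            have : 0 ≤ M * (1 / 2) ^ k * t ^ (-δ) := by positivity
            linarith
    have hzero : lpn volume p₁ (fun x => ‖V t x -
        (sg α t φ x + duh α a (fun τ y => nonlin σ b (V τ y)) t x)‖ₑ) = 0 := by
      have h5 : Tendsto (fun k : ℕ => (1 / 2 : ℝ) ^ k) atTop (𝓝 0) :=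
        tendsto_pow_atTop_nhds_zero_of_lt_one (by norm_num) (by norm_num)
      have h6 := ENNReal.tendsto_ofReal (h5.const_mul (5 * M * t ^ (-δ)))
      rw [mul_zero, ENNReal.ofReal_zero] at h6
      exact le_antisymm (ge_of_tendsto' h6 hle) zero_le
    have h7 : ∫⁻ x, ‖V t x -
        (sg α t φ x + duh α a (fun τ y => nonlin σ b (V τ y)) t x)‖ₑ ^ p₁ = 0 := by
      rw [← lpn_rpow_self hp0, hzero, zero_rpow_of_pos hp0]
    filter_upwards [(lintegral_eq_zero_iff (hW.pow_const p₁)).1 h7] with x hx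
    have := (ENNReal.rpow_eq_zero_iff_of_pos hp0).1 hx
    rwa [enorm_eq_zero, sub_eq_zero] at this
  · have h1 := (hfin 0).2.2
    have e : ∀ τ y, nonlin σ b (U 0 τ y) = 0 := fun _ _ => nonlin_zero
    simp only [e, duh_zero, sub_zero, pow_zero, mul_one] at h1
    exact h1.trans (ofReal_le_ofReal hKM)
  · have h1 := (hE (U k) (fun _ _ => 0) (hUm k) measurable_const t (4 * M) (4 * M) ht0
        (by positivity) (by positivity)
        (fun τ h => hmono h.1 (by linarith) (hA k τ (hτ t ht τ h))) (fun τ h => hz τ h.1 _)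
        (fun τ h => by simpa using hmono h.1 (by linarith) (hA k τ (hτ t ht τ h)))).2.2
    simp only [nonlin_zero, duh_zero, sub_zero] at h1
    exact h1.trans (ofReal_le_ofReal hKM)

end KatoExponents

end Picard

/-! ### From functions of time and space to L^p-valued functions -/

section Fields

variable {𝕜 : Type*} [RCLike 𝕜] {n : ℕ}

lemma lpn_le_liminf {X : Type*} [MeasurableSpace X] {μ : Measure X} {p : ℝ} (hp : 0 < p)
    {F : X → ℝ≥0∞} {G : ℕ → X → ℝ≥0∞} (hG : ∀ k, Measurable (G k))
    (h : ∀ᵐ x ∂μ, F x ≤ liminf (fun k => G k x) atTop) :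
    lpn μ p F ≤ liminf (fun k => lpn μ p (G k)) atTop := by
  refine (lpn_mono_ae hp h).trans ?_
  have h1 := lintegral_liminf_le (μ := μ) (u := atTop) fun k => (hG k).pow_const p
  have e1 : ∀ x, (liminf (fun k => G k x) atTop) ^ p = liminf (fun k => G k x ^ p) atTop :=
    fun x => (ENNReal.orderIsoRpow p hp).liminf_apply
  have hp' : 0 < 1 / p := by positivity
  have e2 : (liminf (fun k => ∫⁻ x, G k x ^ p ∂μ) atTop) ^ (1 / p) =
      liminf (fun k => lpn μ p (G k)) atTop :=
    (ENNReal.orderIsoRpow (1 / p) hp').liminf_apply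
  rw [← e2, lpn]
  simp only [e1]
  exact rpow_le_rpow h1 hp'.le

lemma memLp_of_lpn_ne_top {X : Type*} [MeasurableSpace X] {μ : Measure X} {p : ℝ} (hp : 0 < p)
    {f : X → 𝕜} (hf : Measurable f) (h : lpn μ p (fun x => ‖f x‖ₑ) ≠ ∞) :
    MemLp f (ofReal p) μ :=
  ⟨hf.aestronglyMeasurable, by rw [eLpNorm_eq_lpn hp]; exact h.lt_top⟩

open Classical in
/-- The `L^p`-valued function of time associated with a function of time and space. -/
noncomputable def toLpField (p : ℝ≥0∞) (V : ℝ → Eu n → 𝕜) (t : ℝ) : LpEu 𝕜 n p :=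
  if h : MemLp (V t) p volume then h.toLp else 0

lemma toLpField_ae {p : ℝ≥0∞} {V : ℝ → Eu n → 𝕜} {t : ℝ} (h : MemLp (V t) p volume) :
    toLpField p V t =ᵐ[volume] V t := by
  rw [toLpField, dif_pos h]
  exact h.coeFn_toLp

lemma edist_eq_lpn {p : ℝ} (hp : 0 < p) {f g : LpEu 𝕜 n (ofReal p)}
    {f' g' : Eu n → 𝕜} (hf : f =ᵐ[volume] f') (hg : g =ᵐ[volume] g') :
    edist f g = lpn volume p (fun x => ‖f' x - g' x‖ₑ) := by
  rw [Lp.edist_def, eLpNorm_eq_lpn hp]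
  refine lpn_congr_ae ?_
  filter_upwards [hf, hg] with x h1 h2
  rw [Pi.sub_apply, h1, h2]

lemma enorm_eq_lpn {p : ℝ} (hp : 0 < p) {f : LpEu 𝕜 n (ofReal p)}
    {f' : Eu n → 𝕜} (hf : f =ᵐ[volume] f') : ‖f‖ₑ = lpn volume p (fun x => ‖f' x‖ₑ) := by
  rw [Lp.enorm_def, eLpNorm_eq_lpn hp]
  refine lpn_congr_ae ?_
  filter_upwards [hf] with x h1
  rw [h1]

/-- Balls form a basis of the topology, and with a countable base they generate the Borel sets; the
preimage of a ball is a sublevel set of a distance function. -/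
lemma stronglyMeasurable_of_measurable_edist {X Y : Type*} [MeasurableSpace X]
    [PseudoMetricSpace Y] [SecondCountableTopology Y] {f : X → Y}
    (h : ∀ y, Measurable fun x => edist (f x) y) : StronglyMeasurable f := by
  borelize Y
  refine Measurable.stronglyMeasurable ?_
  set S : Set (Set Y) := {s | ∃ y : Y, ∃ ε : ℝ≥0∞, s = {z | edist z y < ε}} with hS
  have hopen : ∀ (y : Y) (ε : ℝ≥0∞), IsOpen {z | edist z y < ε} := fun y ε =>
    isOpen_lt (continuous_id.edist continuous_const) continuous_const
  have hbasis : TopologicalSpace.IsTopologicalBasis S := by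
    refine TopologicalSpace.isTopologicalBasis_of_isOpen_of_nhds ?_ fun a u ha hu => ?_
    · rintro _ ⟨y, ε, rfl⟩
      exact hopen y ε
    · obtain ⟨ε, hε, hsub⟩ := EMetric.isOpen_iff.1 hu a ha
      exact ⟨_, ⟨a, ε, rfl⟩, by simpa using hε, hsub⟩
  have hb : ‹MeasurableSpace Y› = MeasurableSpace.generateFrom S := by
    rw [← hbasis.borel_eq_generateFrom]
  rw [hb]
  refine measurable_generateFrom ?_
  rintro _ ⟨y, ε, rfl⟩
  exact measurableSet_lt (h y) measurable_const

lemma stronglyMeasurable_toLpField {p : ℝ} (hp : 0 < p) [Fact (1 ≤ ofReal p)]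
    {V : ℝ → Eu n → 𝕜} (hV : Measurable (uncurry V)) :
    StronglyMeasurable (toLpField (ofReal p) V) := by
  have : Fact (ofReal p ≠ ∞) := ⟨ofReal_ne_top⟩
  refine stronglyMeasurable_of_measurable_edist fun w => ?_
  have hmem : ∀ t, MemLp (V t) (ofReal p) volume ↔ lpn volume p (fun x => ‖V t x‖ₑ) < ∞ := fun t =>
    ⟨fun h => by rw [← eLpNorm_eq_lpn hp]; exact h.2, fun h =>
      memLp_of_lpn_ne_top hp hV.of_uncurry_left h.ne⟩
  have m1 : Measurable fun t => lpn volume p (fun x => ‖V t x‖ₑ) :=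
    ((hV.enorm.pow_const p).lintegral_prod_right').pow_const _
  have hwm : Measurable (w : Eu n → 𝕜) := (Lp.stronglyMeasurable w).measurable
  have m2 : Measurable fun t => lpn volume p (fun x => ‖V t x - w x‖ₑ) :=
    (((hV.sub (hwm.comp measurable_snd)).enorm.pow_const p).lintegral_prod_right').pow_const _
  have e : (fun t => edist (toLpField (ofReal p) V t) w) =
      fun t => if lpn volume p (fun x => ‖V t x‖ₑ) < ∞ then
        lpn volume p (fun x => ‖V t x - w x‖ₑ) else edist 0 w := by
    ext t
    by_cases h : MemLp (V t) (ofReal p) volume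
    · rw [if_pos ((hmem t).1 h)]
      exact edist_eq_lpn hp (toLpField_ae h) (ae_eq_refl _)
    · rw [if_neg (fun h' => h ((hmem t).2 h')), toLpField, dif_neg h]
  rw [e]
  exact Measurable.ite (measurableSet_lt m1 measurable_const) m2 measurable_const

end Fields

/-! ### Space-time bounds for the Picard iterates -/

section SpaceTime

variable {n : ℕ} {α b r p₁ : ℝ}

namespace KatoExponents

/-- In |u|^b u the factor |u|^b is controlled at each time in L^{m/b}, by interpolating u between
L^r and L^{p₁}, and the remaining factor in L^p, with q-th power integrability in time. The choice
of m keeps the product in some L^ρ with ρ ≥ 1 and the time weight below the Hardy threshold; again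
the conditions are linear in 1/m. -/
lemma exists_interp_exponent (h : KatoExponents n α b r p₁) {p : ℝ} (hbp : b + 1 < p)
    {q : ℝ} (hq : 1 / q = n / (2 * α) * (1 / r - 1 / p)) (hrq : r < q) :
    ∃ l m : ℝ, 0 < l ∧ l < 1 ∧ 0 < m ∧ 1 / m = (1 - l) / r + l / p₁ ∧ b / m + 1 / p ≤ 1 ∧
      b * (l * katoExp n α r p₁) + 1 / q < 1 := by
  have hb := h.hb
  have hr0 := h.r_pos
  have hp10 := h.p₁_pos
  have hp0 : 0 < p := by linarith
  have hq0 : 0 < q := by linarith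
  set d := (n : ℝ) / (2 * α) with hd
  have hd0 : 0 < d := h.d_pos
  have hα : 0 < α := by linarith [h.hα]
  have hgap := h.gap
  have h1α : 0 < 1 / (2 * α) := by positivity
  rw [gapExp, ← hd] at hgap
  have hri : 1 / p₁ < 1 / r := one_div_lt_one_div_of_lt hr0 h.r_lt
  have hr1 : 1 / r < 1 := by rw [div_lt_one hr0]; exact h.hr
  have hq1 : 1 / q < 1 := by rw [div_lt_one hq0]; linarith [h.hr]
  have hpi : 1 / p < 1 / (b + 1) := one_div_lt_one_div_of_lt (by linarith) hbp
  have hp1i : 1 / p₁ < 1 / (b + 1) := one_div_lt_one_div_of_lt (by linarith) h.b_lt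
  have hlohi : max (1 / p₁) (1 / r - (1 - 1 / q) / (b * d)) < min (1 / r) ((1 - 1 / p) / b) := by
    refine max_lt (lt_min hri ?_) (lt_min ?_ ?_)
    · rw [lt_div_iff₀ hb]
      have : b * (1 / (b + 1)) + 1 / (b + 1) = 1 := by field_simp
      nlinarith
    · have : 0 < (1 - 1 / q) / (b * d) := div_pos (by linarith) (by positivity)
      linarith
    · have e1 : 1 / r - (1 - 1 / q) / (b * d) = (d * (b / r) - 1 + 1 / q) / (b * d) := by
        field_simp
        ring
      have e2 : (1 - 1 / p) / b = (d - d * (1 / p)) / (b * d) := by field_simp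
      rw [e1, e2]
      refine div_lt_div_of_pos_right ?_ (by positivity)
      rw [hq]
      nlinarith
  obtain ⟨y, hy1, hy2⟩ := exists_between hlohi
  have hy1a : 1 / p₁ < y := (le_max_left _ _).trans_lt hy1
  have hy1b : 1 / r - (1 - 1 / q) / (b * d) < y := (le_max_right _ _).trans_lt hy1
  have hy2a : y < 1 / r := hy2.trans_le (min_le_left _ _)
  have hy2b : y < (1 - 1 / p) / b := hy2.trans_le (min_le_right _ _)
  have hy0 : 0 < y := lt_trans (by positivity) hy1a
  have hden : 0 < 1 / r - 1 / p₁ := by linarith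
  set l := (1 / r - y) / (1 / r - 1 / p₁) with hl
  have hlm : l * (1 / r - 1 / p₁) = 1 / r - y := div_mul_cancel₀ _ hden.ne'
  refine ⟨l, 1 / y, div_pos (by linarith) hden, (div_lt_one hden).2 (by linarith), by positivity,
    ?_, ?_, ?_⟩
  · rw [one_div_one_div]
    have e : (1 - l) / r + l / p₁ = 1 / r - l * (1 / r - 1 / p₁) := by ring
    rw [e, hlm]
    ring
  · rw [lt_div_iff₀ hb] at hy2b
    have : b / (1 / y) = y * b := by field_simp
    rw [this]
    linarith
  · have e : b * (l * katoExp n α r p₁) = b * d * (1 / r - y) := by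
      rw [katoExp, ← hd, mul_left_comm l, hlm]
      ring
    rw [e]
    have h1 : 1 / r - y < (1 - 1 / q) / (b * d) := by linarith
    rw [lt_div_iff₀ (by positivity)] at h1
    linarith

/-- The space-time bound for the Picard limit. -/
lemma exists_space_time_bound (h : KatoExponents n α b r p₁) (𝕜 : Type*) [RCLike 𝕜] {σ : ℝ}
    (hσ : σ = 1 ∨ σ = -1) (a : Eu n) {p : ℝ} (hrp : r < p) (hbp : b + 1 < p) {q : ℝ}
    (hq : 1 / q = n / (2 * α) * (1 / r - 1 / p)) (hrq : r < q) :
    ∃ K l : ℝ, 0 < K ∧ 0 < l ∧ l < 1 ∧ ∀ φ : Eu n → 𝕜, Measurable φ → ∀ (I : Set ℝ) (M R Θ : ℝ),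
      MeasurableSet I → (∀ t ∈ I, 0 < t) → (∀ t ∈ I, ∀ s, 0 < s → s < t → s ∈ I) → 0 ≤ M → 0 ≤ R →
      0 ≤ Θ → (∀ t ∈ I, t ^ gapExp n α b r ≤ Θ) →
      K * R ^ (b * (1 - l)) * M ^ (b * l) * Θ ≤ 1 →
      (∀ k, ∀ t ∈ I, lpn volume p₁ (fun x => ‖picard α b σ a φ k t x‖ₑ) ≤
        ofReal (2 * M * t ^ (-katoExp n α r p₁))) →
      (∀ k, ∀ t ∈ I, lpn volume r (fun x => ‖picard α b σ a φ k t x‖ₑ) ≤ ofReal R) →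
      (∀ t ∈ I, ∀ᵐ x,
        Tendsto (fun k => picard α b σ a φ k t x) atTop (𝓝 (picardLim α b σ a φ t x))) →
      lpn (volume.restrict I) q (fun t => lpn volume p (fun x => ‖picardLim α b σ a φ t x‖ₑ)) ≤
        ofReal K * lpn volume r (fun x => ‖φ x‖ₑ) := by
  obtain ⟨l, m, hl0, hl1, hm0, hml, hmp, hlq⟩ := h.exists_interp_exponent hbp hq hrq
  have hb := h.hb
  have hn := h.n_pos
  have hα := h.hα
  have hα0 : 0 < α := by linarith
  have hr0 := h.r_pos
  have hp10 := h.p₁_pos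
  have hp0 : 0 < p := by linarith
  have hp1 : 1 ≤ p := by linarith
  have hq0 : 0 < q := by linarith
  have hq1 : 1 ≤ q := by linarith [h.hr]
  set δ := katoExp n α r p₁ with hδ
  have hδ0 : 0 < δ := h.katoExp_pos
  set d := (n : ℝ) / (2 * α) with hd
  have hd0 : 0 < d := h.d_pos
  have hri : 1 / p₁ < 1 / r := one_div_lt_one_div_of_lt hr0 h.r_lt
  have hmr : 1 / m < 1 / r := by
    have e : (1 - l) / r + l / p₁ = 1 / r - l * (1 / r - 1 / p₁) := by ring
    have : 0 < l * (1 / r - 1 / p₁) := mul_pos hl0 (by linarith)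
    rw [hml, e]
    linarith
  have hbm : 0 < b / m := by positivity
  have hpi : 0 < 1 / p := by positivity
  set ρ := 1 / (b / m + 1 / p) with hρ
  have hρ0 : 0 < b / m + 1 / p := by positivity
  have hρi : 1 / ρ = b / m + 1 / p := by rw [hρ, one_div_one_div]
  have hρ1 : 1 ≤ ρ := by rw [hρ, le_div_iff₀ hρ0]; linarith
  have hρp : ρ ≤ p := by
    rw [hρ, div_le_iff₀ hρ0]
    have : p * (1 / p) = 1 := by field_simp
    have : 0 < p * (b / m) := by positivity
    linarith [mul_add p (b / m) (1 / p)]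
  set e := 1 / (2 * α) + d * (b / m) with he
  have he0 : 0 ≤ e := by positivity
  have hgap := h.gap
  rw [gapExp, ← hd] at hgap
  have he1 : e < 1 := by
    have : b / m < b / r := by
      have := mul_lt_mul_of_pos_left hmr hb
      calc b / m = b * (1 / m) := by ring
        _ < b * (1 / r) := this
        _ = b / r := by ring
    have : d * (b / m) < d * (b / r) := by gcongr
    linarith
  set β := b * (l * δ) with hβ
  have hβ0 : 0 ≤ β := by positivity
  -- The interpolation parameter drops out: what the kernel gains by m > r is spent on the weight
  -- τ^{-β}.
  have hgapE : 1 - e - β = gapExp n α b r := by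
    have e1 : l * (1 / r - 1 / p₁) = 1 / r - 1 / m := by rw [hml]; ring
    have e2 : β = b * d * (1 / r - 1 / m) := by
      rw [hβ, hδ, katoExp, ← hd, mul_left_comm l, e1]; ring
    rw [e2, he, gapExp, ← hd]
    ring
  obtain ⟨C₁, hC₁, h₁⟩ := exists_lpn_maj_le hα0 n
  obtain ⟨C₂, hC₂, h₂⟩ := exists_enorm_duh_le 𝕜 hn hα a
  obtain ⟨C₃, hC₃, h₃⟩ := exists_hardy he0 he1 hβ0 hq1 hlq
  obtain ⟨C₄, hC₄, h₄⟩ := exists_lpn_lpn_sgMaj_le hα0 hn h.hr hrp hq hrq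
  obtain ⟨C₅, hC₅, h₅⟩ := exists_enorm_semigroup_le 𝕜 hn hα
  set D := C₂ * C₁ * (2 + b) * 2 ^ (b * l) * C₃ with hD
  have hD0 : 0 < D := by positivity
  refine ⟨2 * D + 2 * (C₅ * C₄), l, by positivity, hl0, hl1, fun φ hφ I M R Θ hI hpos hstar hM hR
    hΘ0 hΘ hsm hA hB hlim => ?_⟩
  set U := picard α b σ a φ with hU
  have hUm : ∀ k, Measurable (uncurry (U k)) := measurable_picard hn hα hφ
  have hUt : ∀ k t, Measurable fun x => ‖U k t x‖ₑ := fun k t => (hUm k).of_uncurry_left.enorm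
  have hLm : ∀ k, Measurable fun t => lpn volume p (fun x => ‖U k t x‖ₑ) := fun k =>
    (((hUm k).enorm.pow_const p).lintegral_prod_right').pow_const _
  have hsgm := measurable_sg hn hα hφ
  have hSm : Measurable fun t => lpn volume p (fun x => ‖sg α t φ x‖ₑ) :=
    ((hsgm.enorm.pow_const p).lintegral_prod_right').pow_const _
  set Q := R ^ (b * (1 - l)) * (2 * M) ^ (b * l) with hQ
  have hQ0 : 0 ≤ Q := by positivity
  -- interpolation
  have hinterp : ∀ k, ∀ t ∈ I, lpn volume m (fun x => ‖U k t x‖ₑ) ^ b ≤ ofReal (Q * t ^ (-β)) := by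
    intro k t ht
    have ht0 := hpos t ht
    have h6 := lpn_interpolation (μ := volume) hm0 hr0 hp10 hl0.le hl1.le hml (hUt k t)
    have h7 : lpn volume m (fun x => ‖U k t x‖ₑ) ≤
        ofReal (R ^ (1 - l) * (2 * M * t ^ (-δ)) ^ l) := by
      refine h6.trans ?_
      rw [ofReal_mul (by positivity), ← ofReal_rpow_of_nonneg hR (by linarith),
        ← ofReal_rpow_of_nonneg (by positivity) hl0.le]
      exact mul_le_mul' (rpow_le_rpow (hB k t ht) (by linarith)) (rpow_le_rpow (hA k t ht) hl0.le)
    refine (rpow_le_rpow h7 hb.le).trans_eq ?_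
    rw [ofReal_rpow_of_nonneg (by positivity) hb.le]
    congr 1
    rw [mul_rpow (by positivity) (by positivity), ← rpow_mul hR, ← rpow_mul (by positivity),
      mul_rpow (by positivity) (by positivity), ← rpow_mul ht0.le, hQ, hβ]
    rw [show (1 - l) * b = b * (1 - l) by ring, show l * b = b * l by ring,
      show -δ * (b * l) = -(b * (l * δ)) by ring]
    ring
  -- estimate of the Duhamel term
  have hduh : ∀ k, ∀ t ∈ I, lpn volume p
      (fun x => ‖duh α a (fun τ y => nonlin σ b (U k τ y)) t x‖ₑ) ≤
      ofReal (C₂ * C₁ * (2 + b) * Q) * ∫⁻ τ in Ioo 0 t,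
        ofReal ((t - τ) ^ (-e) * τ ^ (-β)) * lpn volume p (fun x => ‖U k τ x‖ₑ) := by
    intro k t ht
    have hgm : Measurable (uncurry fun τ y => ‖nonlin σ b (U k τ y)‖ₑ) :=
      (measurable_nonlin.comp (hUm k)).enorm
    refine (lpn_mono hp0 fun x => h₂ _ t x).trans ?_
    rw [lpn_const_mul hp0 (measurable_maj hgm t)]
    refine (mul_le_mul_right (h₁ ρ p t hρ1 hρp _ hgm) _).trans ?_
    rw [← lintegral_const_mul' _ _ ofReal_ne_top, ← lintegral_const_mul' _ _ ofReal_ne_top]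
    refine setLIntegral_mono' measurableSet_Ioo fun τ hτ => ?_
    have hτI := hstar t ht τ hτ.1 hτ.2
    have hτ0 : 0 < τ := hτ.1
    have htτ : 0 < t - τ := sub_pos.2 hτ.2
    have hg : lpn volume ρ (fun y => ‖nonlin σ b (U k τ y)‖ₑ) ≤
        ofReal ((2 + b) * (Q * τ ^ (-β))) * lpn volume p (fun x => ‖U k τ x‖ₑ) := by
      have h8 := lpn_nonlin_sub_le (μ := volume) hσ hb hρ1 hm0 hp0 hρi
        ((hUm k).of_uncurry_left (x := τ)) (measurable_const (a := (0 : 𝕜)))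
      simp only [nonlin_zero, sub_zero, enorm_zero, lpn_zero hm0, zero_rpow_of_pos hb,
        add_zero] at h8
      refine h8.trans ?_
      rw [ofReal_mul (by positivity), mul_assoc]
      exact mul_le_mul_right (mul_le_mul_left (hinterp k τ hτI) _) _
    refine (mul_le_mul_right (mul_le_mul_right hg _) _).trans_eq ?_
    rw [← mul_assoc, ← mul_assoc, ← mul_assoc (ofReal (C₂ * C₁ * (2 + b) * Q)),
      ← ofReal_mul (by positivity), ← ofReal_mul (by positivity), ← ofReal_mul (by positivity)]
    congr 2
    rw [hρi, ← hd, show -(1 / (2 * α)) - d * (b / m + 1 / p - 1 / p) = -e by rw [he]; ring]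
    ring
  set L := lpn (volume.restrict I) q (fun t => lpn volume p (fun x => ‖sg α t φ x‖ₑ)) with hL
  have hLb : L ≤ ofReal (C₅ * C₄) * lpn volume r (fun x => ‖φ x‖ₑ) := by
    have hpt : ∀ t ∈ I, lpn volume p (fun x => ‖sg α t φ x‖ₑ) ≤
        ofReal C₅ * lpn volume p (sgMaj α t (fun x => ‖φ x‖ₑ)) := by
      intro t ht
      rw [← lpn_const_mul hp0 (measurable_sgMaj t hφ.enorm)]
      refine lpn_mono hp0 fun x => ?_
      rw [sg_of_pos hα (hpos t ht), sgMaj, ← mul_assoc, ← ofReal_mul hC₅.le]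
      exact h₅ t (hpos t ht) φ x
    refine (lpn_mono_ae hq0 ((ae_restrict_iff' hI).2 (.of_forall hpt))).trans ?_
    have hmm := measurable_lpn_sgMaj (α := α) p (G := fun _ x => ‖φ x‖ₑ)
      (hφ.enorm.comp measurable_snd)
    rw [lpn_const_mul hq0 hmm, ofReal_mul hC₅.le, mul_assoc]
    refine mul_le_mul_right (le_trans ?_ (h₄ _ hφ.enorm)) _
    exact rpow_le_rpow (lintegral_mono_set fun t ht => hpos t ht) (by positivity)
  -- uniform bound for the iterates
  have hsm2 : C₂ * C₁ * (2 + b) * Q * (C₃ * Θ) ≤ 1 / 2 := by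
    have e1 : C₂ * C₁ * (2 + b) * Q * (C₃ * Θ) = D * R ^ (b * (1 - l)) * M ^ (b * l) * Θ := by
      rw [hQ, hD, mul_rpow (by norm_num) hM]
      ring
    have e2 : (2 * D + 2 * (C₅ * C₄)) * R ^ (b * (1 - l)) * M ^ (b * l) * Θ =
        2 * (D * R ^ (b * (1 - l)) * M ^ (b * l) * Θ) +
        2 * (C₅ * C₄) * R ^ (b * (1 - l)) * M ^ (b * l) * Θ := by ring
    have e3 : 0 ≤ 2 * (C₅ * C₄) * R ^ (b * (1 - l)) * M ^ (b * l) * Θ := by positivity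
    rw [e1]
    linarith
  -- The Duhamel estimate is linear in the L^q(L^p) norm of the previous iterate, with factor at
  -- most 1/2, so the bound 2L is preserved. It is proved for iterates because for the limit nothing
  -- is known to be finite beforehand.
  have hN : ∀ k, lpn (volume.restrict I) q (fun t => lpn volume p (fun x => ‖U k t x‖ₑ)) ≤
      2 * L := by
    intro k
    induction k with
    | zero =>
      have e : ∀ t x, U 0 t x = 0 := fun _ _ => rfl
      simp [e, lpn_zero hp0, lpn_zero hq0]
    | succ k ih =>
      set W : ℝ → ℝ≥0∞ := fun t => ∫⁻ τ in Ioo 0 t, ofReal ((t - τ) ^ (-e) * τ ^ (-β)) *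
        lpn volume p (fun x => ‖U k τ x‖ₑ) with hW
      have hWm : Measurable W := by
        have hset : MeasurableSet {z : ℝ × ℝ | 0 < z.2 ∧ z.2 < z.1} :=
          (measurableSet_lt measurable_const measurable_snd).inter
            (measurableSet_lt measurable_snd measurable_fst)
        have h9 : Measurable fun z : ℝ × ℝ => ({z : ℝ × ℝ | 0 < z.2 ∧ z.2 < z.1}).indicator
            (fun z => ofReal ((z.1 - z.2) ^ (-e) * z.2 ^ (-β)) *
              lpn volume p (fun x => ‖U k z.2 x‖ₑ)) z :=
          ((by fun_prop : Measurable fun z : ℝ × ℝ =>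
            ofReal ((z.1 - z.2) ^ (-e) * z.2 ^ (-β))).mul
            ((hLm k).comp measurable_snd)).indicator hset
        have h10 := h9.lintegral_prod_right' (ν := volume)
        convert h10 using 1
        ext t
        simp only [hW]
        rw [← lintegral_indicator measurableSet_Ioo]
        refine lintegral_congr fun τ => ?_
        by_cases hτ : 0 < τ ∧ τ < t <;> simp [indicator, hτ]
      have hpt : ∀ t ∈ I, lpn volume p (fun x => ‖U (k + 1) t x‖ₑ) ≤
          lpn volume p (fun x => ‖sg α t φ x‖ₑ) + ofReal (C₂ * C₁ * (2 + b) * Q) * W t := by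
        intro t ht
        have m1 : Measurable fun x => ‖sg α t φ x‖ₑ := hsgm.of_uncurry_left.enorm
        have m2 : Measurable fun x => ‖duh α a (fun τ y => nonlin σ b (U k τ y)) t x‖ₑ :=
          (measurable_duh_nonlin hn hα (hUm k) t).enorm
        refine (lpn_mono hp0 fun x => ?_).trans ((lpn_add_le hp1 m1 m2).trans
          (add_le_add le_rfl (hduh k t ht)))
        exact enorm_add_le _ _
      calc _ ≤ _ := lpn_mono_ae hq0 ((ae_restrict_iff' hI).2 (.of_forall hpt))
        _ ≤ _ := lpn_add_le hq1 hSm (hWm.const_mul _)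
        _ ≤ L + ofReal (C₂ * C₁ * (2 + b) * Q) * (ofReal (C₃ * Θ) * (2 * L)) := by
            rw [lpn_const_mul hq0 hWm]
            refine add_le_add le_rfl (mul_le_mul_right ?_ _)
            refine (h₃ I Θ hI hpos hstar (fun t ht => ?_) hΘ0 _ (hLm k)).trans
              (mul_le_mul_right ih _)
            rw [hgapE]
            exact hΘ t ht
        _ ≤ L + ofReal (1 / 2) * (2 * L) := by
            rw [← mul_assoc, ← ofReal_mul (by positivity)]
            gcongr
        _ = 2 * L := by
            rw [← mul_assoc]
            have : ofReal (1 / 2) * 2 = 1 := by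
              rw [show (2 : ℝ≥0∞) = ofReal 2 by simp, ← ofReal_mul (by norm_num)]
              simp
            rw [this, one_mul, two_mul]
  -- Fatou's lemma, first in x and then in t, carries the uniform bound to the limit.
  have hfatou : ∀ t ∈ I, lpn volume p (fun x => ‖picardLim α b σ a φ t x‖ₑ) ≤
      liminf (fun k => lpn volume p (fun x => ‖U k t x‖ₑ)) atTop := by
    intro t ht
    refine lpn_le_liminf hp0 (fun k => hUt k t) ?_
    filter_upwards [hlim t ht] with x hx
    exact hx.enorm.liminf_eq.ge
  refine (lpn_le_liminf hq0 hLm ((ae_restrict_iff' hI).2 (.of_forall hfatou))).trans ?_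
  have h11 : liminf (fun k => lpn (volume.restrict I) q
      (fun t => lpn volume p (fun x => ‖U k t x‖ₑ))) atTop ≤ 2 * L :=
    liminf_le_of_le (by isBoundedDefault) fun c hc => by
      obtain ⟨k, hk⟩ := hc.exists
      exact hk.trans (hN k)
  refine h11.trans ((mul_le_mul_right hLb _).trans ?_)
  rw [← mul_assoc]
  refine mul_le_mul_left ?_ _
  rw [show (2 : ℝ≥0∞) = ofReal 2 by simp, ← ofReal_mul (by norm_num)]
  exact ofReal_le_ofReal (by linarith)

end KatoExponents

end SpaceTime

/-! ### Time intervals -/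

section Intervals

/-- Intervals `[0, T)`, `0 < T ≤ ∞`. -/
structure IsTimeInterval (I : Set ℝ) : Prop where
  zero_mem : (0 : ℝ) ∈ I
  nonneg : ∀ t ∈ I, 0 ≤ t
  lower : ∀ t ∈ I, ∀ s, 0 ≤ s → s ≤ t → s ∈ I
  right : ∀ t ∈ I, ∃ T ∈ I, t < T

lemma isTimeInterval_Ico {T : ℝ} (hT : 0 < T) : IsTimeInterval (Ico 0 T) where
  zero_mem := ⟨le_rfl, hT⟩
  nonneg _ ht := ht.1
  lower _ ht _ hs hst := ⟨hs, hst.trans_lt ht.2⟩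
  right t ht := ⟨(t + T) / 2, ⟨by linarith [ht.1], by linarith [ht.2]⟩, by linarith [ht.2]⟩

lemma isTimeInterval_Ici : IsTimeInterval (Ici 0) where
  zero_mem := mem_Ici.2 le_rfl
  nonneg _ ht := ht
  lower _ _ _ hs _ := hs
  right t ht := ⟨t + 1, mem_Ici.2 (by linarith [mem_Ici.1 ht]), by linarith⟩

lemma IsTimeInterval.measurableSet {I : Set ℝ} (hI : IsTimeInterval I) : MeasurableSet I := by
  refine OrdConnected.measurableSet ⟨fun x hx y hy z hz => ?_⟩
  exact hI.lower y hy z ((hI.nonneg x hx).trans hz.1) hz.2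

end Intervals

/-! ### Admissible triplets -/

section Admissible

variable {n : ℕ} {α p r : ℝ} {q : ℝ≥0∞}

/-- The upper bound on p enters here: r < q unwinds to (d - 1)p < dr, which is that bound if n > 2α
and holds automatically if d ≤ 1. -/
lemma IsAdmissible.exists_real (h : IsAdmissible n α q p r) (hn : 0 < n) (hα : 1 / 2 < α)
    (hrp : r < p) :
    ∃ q' : ℝ, q = ofReal q' ∧ 1 / q' = n / (2 * α) * (1 / r - 1 / p) ∧ r < q' := by
  have hn' : (0 : ℝ) < n := by exact_mod_cast hn
  have hr : 0 < r := by linarith [h.one_lt]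
  have hp : 0 < p := by linarith
  have hpr : 1 / p < 1 / r := one_div_lt_one_div_of_lt hr hrp
  set d := (n : ℝ) / (2 * α) with hd
  have hd0 : 0 < d := by positivity
  set y := d * (1 / r - 1 / p) with hy
  have hy0 : 0 < y := mul_pos hd0 (by linarith)
  refine ⟨1 / y, ?_, by rw [one_div_one_div], ?_⟩
  · rw [one_div, ENNReal.ofReal_inv_of_pos hy0, ← h.inv_eq, inv_inv]
  · rw [lt_div_iff₀ hy0, mul_comm, ← lt_div_iff₀ hr]
    have hp' : 0 < 1 / p := by positivity
    have hr' : 0 < 1 / r := by positivity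
    rcases le_or_gt (n : ℝ) (2 * α) with h1 | h1
    · have hd1 : d ≤ 1 := by rw [hd, div_le_one (by linarith)]; exact h1
      have : y < d * (1 / r) := by rw [hy]; gcongr; linarith
      nlinarith
    · have h2 := h.lt h1
      rw [lt_div_iff₀ (by linarith)] at h2
      have h3 : (d - 1) * p < d * r := by
        have : (d - 1) * p = p * (n - 2 * α) / (2 * α) := by rw [hd]; field_simp
        rw [this, hd, div_mul_eq_mul_div]
        exact div_lt_div_of_pos_right h2 (by linarith)
      have h4 : (d - 1) * (1 / r) < d * (1 / p) := by
        have e1 : (d - 1) * (1 / r) = (d - 1) * p / (p * r) := by field_simp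
        have e2 : d * (1 / p) = d * r / (p * r) := by field_simp
        rw [e1, e2]
        exact div_lt_div_of_pos_right h3 (by positivity)
      rw [hy]
      linarith

lemma IsAdmissible.eq_top (h : IsAdmissible n α q p r) (hrp : p = r) : q = ∞ := by
  have := h.inv_eq
  rwa [hrp, sub_self, mul_zero, ENNReal.ofReal_zero, ENNReal.inv_eq_zero] at this

end Admissible

/-! ### Existence of continuous mild solutions -/

section Existence

variable {𝕜 : Type*} [RCLike 𝕜] {n : ℕ} {α b r p₁ σ : ℝ}

lemma lpn_nonlin_le (hσ : σ = 1 ∨ σ = -1) (hb : 0 < b) {m : ℝ} (hm : b + 1 ≤ m) {u : Eu n → 𝕜}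
    (hu : Measurable u) : lpn volume (m / (b + 1)) (fun x => ‖nonlin σ b (u x)‖ₑ) ≤
      ofReal (2 + b) * lpn volume m (fun x => ‖u x‖ₑ) ^ (b + 1) := by
  have hm0 : 0 < m := by linarith
  have hρ1 : 1 ≤ m / (b + 1) := by rw [le_div_iff₀ (by linarith)]; linarith
  have h8 := lpn_nonlin_sub_le (μ := volume) hσ hb hρ1 hm0 hm0 (by rw [one_div_div]; ring)
    hu (measurable_const (a := (0 : 𝕜)))
  simp only [nonlin_zero, sub_zero, enorm_zero, lpn_zero hm0, zero_rpow_of_pos hb, add_zero] at h8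
  refine h8.trans_eq ?_
  rw [rpow_add_of_nonneg _ _ hb.le zero_le_one, rpow_one]

namespace KatoExponents

lemma lpn_nonlin_le_rpow (h : KatoExponents n α b r p₁) (hσ : σ = 1 ∨ σ = -1) {M τ : ℝ} (hM : 0 ≤ M)
    (hτ : 0 < τ) {u : Eu n → 𝕜} (hu : Measurable u)
    (hb : lpn volume p₁ (fun x => ‖u x‖ₑ) ≤ ofReal (M * τ ^ (-katoExp n α r p₁))) :
    lpn volume (p₁ / (b + 1)) (fun x => ‖nonlin σ b (u x)‖ₑ) ≤
      ofReal ((2 + b) * (M ^ b * M) * τ ^ (-((b + 1) * katoExp n α r p₁))) := by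
  have hb0 : 0 ≤ b := h.hb.le
  refine (lpn_nonlin_le hσ h.hb h.b_lt.le hu).trans ((mul_le_mul_right
    (rpow_le_rpow hb (by positivity)) _).trans_eq ?_)
  rw [ofReal_rpow_of_nonneg (by positivity) (by positivity),
    ← ofReal_mul (by positivity), mul_rpow hM (by positivity), ← rpow_mul hτ.le,
    Real.rpow_add_of_nonneg hM hb0 zero_le_one, Real.rpow_one]
  ring_nf

lemma nonlin_exponents (h : KatoExponents n α b r p₁) : 1 ≤ p₁ / (b + 1) ∧ p₁ / (b + 1) ≤ r ∧
      1 / (2 * α) + n / (2 * α) * (1 / (p₁ / (b + 1)) - 1 / r) < 1 := by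
  have hb0 := h.hb
  have hr0 := h.r_pos
  have hd0 := h.d_pos
  have hgap := h.gap
  have hδ := h.katoExp_pos
  refine ⟨?_, ?_, ?_⟩
  · rw [le_div_iff₀ (by linarith)]; linarith [h.b_lt]
  · rw [div_le_iff₀ (by linarith)]; exact h.lt_mul.le
  · have hlt : (n : ℝ) / (2 * α) * (b / p₁) < n / (2 * α) * (b / r) := by
      have : b / p₁ < b / r := div_lt_div_of_pos_left hb0 hr0 h.r_lt
      gcongr
    have e : (n : ℝ) / (2 * α) * (1 / (p₁ / (b + 1)) - 1 / r) =
        n / (2 * α) * (b / p₁) - katoExp n α r p₁ := by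
      rw [katoExp, one_div_div]
      ring
    rw [gapExp] at hgap
    rw [e]
    linarith

/-- Supplies an arbitrarily small M for arbitrary data, at the price of a time that depends on φ
itself. It gives local existence for r = r₁ and continuity at t = 0. -/
lemma exists_kato_bound_sg (h : KatoExponents n α b r p₁) (φ : Eu n → 𝕜) (hφ : Measurable φ)
    (hfin : lpn volume r (fun x => ‖φ x‖ₑ) ≠ ∞) {ε : ℝ} (hε : 0 < ε) :
    ∃ t₀ : ℝ, 0 < t₀ ∧ ∀ t ∈ Ioo 0 t₀, lpn volume p₁ (fun x => ‖sg α t φ x‖ₑ) ≤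
      ofReal (ε * t ^ (-katoExp n α r p₁)) := by
  obtain ⟨C, hC, hb⟩ := exists_enorm_semigroup_le 𝕜 h.n_pos h.hα
  have hα0 : 0 < α := by linarith [h.hα]
  obtain ⟨t₀, ht₀, hs⟩ := lpn_sgMaj_small hα0 h.n_pos h.hr.le h.r_lt hφ.enorm hfin (div_pos hε hC)
  refine ⟨t₀, ht₀, fun t ht => ?_⟩
  have h1 : lpn volume p₁ (fun x => ‖sg α t φ x‖ₑ) ≤
      lpn volume p₁ (fun x => ofReal C * sgMaj α t (fun x => ‖φ x‖ₑ) x) := by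
    refine lpn_mono h.p₁_pos fun x => ?_
    rw [sg_of_pos h.hα ht.1, sgMaj, ← mul_assoc, ← ofReal_mul hC.le]
    exact hb t ht.1 φ x
  rw [lpn_const_mul h.p₁_pos (measurable_sgMaj t hφ.enorm)] at h1
  refine h1.trans ((mul_le_mul_right (hs t ht.1 ht.2) _).trans_eq ?_)
  rw [← ofReal_mul hC.le, katoExp]
  congr 1
  field_simp

/-- The mild solution, in `C_b(I; L^r)`, built by Picard iteration. -/
theorem exists_mildSolution_aux (h : KatoExponents n α b r p₁) (𝕜 : Type*) [RCLike 𝕜] {σ : ℝ}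
    (hσ : σ = 1 ∨ σ = -1) (a : Eu n) [Fact (1 ≤ ofReal r)] :
    ∃ K : ℝ, 0 < K ∧ ∀ (φ : LpEu 𝕜 n (ofReal r)) (I : Set ℝ) (M Θ : ℝ),
      IsTimeInterval I → 0 ≤ M → 0 ≤ Θ → (∀ t ∈ I, 0 < t → t ^ gapExp n α b r ≤ Θ) →
      K * M ^ b * Θ ≤ 1 →
      (∀ t ∈ I, 0 < t → lpn volume p₁ (fun x => ‖sg α t φ x‖ₑ) ≤
        ofReal (M * t ^ (-katoExp n α r p₁))) →
      IsMildSolution α b σ a φ I (toLpField (ofReal r) (picardLim α b σ a φ)) ∧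
      ContinuousOn (toLpField (ofReal r) (picardLim α b σ a φ)) I ∧
      (∀ t ∈ I, toLpField (ofReal r) (picardLim α b σ a φ) t =ᵐ[volume] picardLim α b σ a φ t) ∧
      (∀ t ∈ I, ‖toLpField (ofReal r) (picardLim α b σ a φ) t‖ ≤ K * ‖φ‖ + M) ∧
      (∀ k, ∀ t ∈ I, 0 < t → lpn volume p₁ (fun x => ‖picard α b σ a φ k t x‖ₑ) ≤
        ofReal (2 * M * t ^ (-katoExp n α r p₁))) ∧
      (∀ k, ∀ t ∈ I, 0 < t → lpn volume r (fun x => ‖picard α b σ a φ k t x‖ₑ) ≤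
        ofReal (K * ‖φ‖ + M)) ∧
      (∀ t ∈ I, 0 < t → ∀ᵐ x,
        Tendsto (fun k => picard α b σ a φ k t x) atTop (𝓝 (picardLim α b σ a φ t x))) := by
  obtain ⟨K, hK, hP⟩ := h.exists_picard_bounds 𝕜 hσ a
  obtain ⟨C, hC, hS⟩ := exists_lpn_semigroup_le (α := α) 𝕜 h.n_pos h.hα
  have hn := h.n_pos
  have hα := h.hα
  have hr0 := h.r_pos
  have hr1 : 1 ≤ r := h.hr.le
  refine ⟨K + C + 1, by positivity, fun φ I M Θ hI hM hΘ0 hΘ hsm hlin => ?_⟩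
  set V := picardLim α b σ a φ with hV
  set f : ℝ → Eu n → 𝕜 := fun τ y => nonlin σ b (V τ y) with hf
  have hφ : Measurable (φ : Eu n → 𝕜) := (Lp.stronglyMeasurable φ).measurable
  have hφn : lpn volume r (fun x => ‖φ x‖ₑ) = ofReal ‖φ‖ := by
    rw [← enorm_eq_lpn hr0 (ae_eq_refl _), ofReal_norm]
  have hφfin : lpn volume r (fun x => ‖φ x‖ₑ) ≠ ∞ := by rw [hφn]; exact ofReal_ne_top
  have hVm : Measurable (uncurry V) := measurable_picardLim hn hα hφ
  have hVt : ∀ t, Measurable (V t) := fun t => hVm.of_uncurry_left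
  have hfm : Measurable (uncurry f) := measurable_nonlin.comp hVm
  have hMb : 0 ≤ M ^ b := by positivity
  have hKM : K * M ^ b * Θ ≤ 1 := le_trans (by gcongr; linarith) hsm
  have hIoo : ∀ T ∈ I, ∀ t ∈ Ioo 0 T, t ∈ I := fun T hT t ht => hI.lower T hT t ht.1.le ht.2.le
  have hPT : ∀ T ∈ I, ∀ t ∈ Ioo 0 T, _ := fun T hT => hP φ hφ T M Θ hM
    (fun t ht => hΘ t (hIoo T hT t ht) ht.1) hKM (fun t ht => hlin t (hIoo T hT t ht) ht.1)
  have hPt : ∀ t ∈ I, 0 < t → _ := fun t ht ht0 =>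
    hPT _ (hI.right t ht).choose_spec.1 t ⟨ht0, (hI.right t ht).choose_spec.2⟩
  have hduhM : ∀ t ∈ I, 0 < t → K * M ^ b * M * t ^ gapExp n α b r ≤ M := by
    intro t ht ht0
    have h1 : t ^ gapExp n α b r ≤ Θ := hΘ t ht ht0
    calc K * M ^ b * M * t ^ gapExp n α b r ≤ K * M ^ b * M * Θ := by gcongr
      _ = (K * M ^ b * Θ) * M := by ring
      _ ≤ 1 * M := by gcongr
      _ = M := one_mul M
  have hsgr : ∀ t, 0 < t → lpn volume r (fun x => ‖sg α t φ x‖ₑ) ≤ ofReal (C * ‖φ‖) := by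
    intro t ht
    rw [sg_of_pos hα ht]
    refine (hS r r t hr1 le_rfl ht φ hφ).trans_eq ?_
    rw [hφn, sub_self, mul_zero, neg_zero, Real.rpow_zero, mul_one, ← ofReal_mul hC.le]
  have hsgm : ∀ t, Measurable (sg α t φ) := fun t => (measurable_sg hn hα hφ).of_uncurry_left
  have hCK : C * ‖φ‖ + M ≤ (K + C + 1) * ‖φ‖ + M := by
    have := norm_nonneg φ
    nlinarith
  have hsum : ∀ {g₁ g₂ : Eu n → 𝕜}, Measurable g₁ → Measurable g₂ → ∀ t ∈ I, 0 < t →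
      lpn volume r (fun x => ‖g₁ x‖ₑ) ≤ ofReal (C * ‖φ‖) →
      lpn volume r (fun x => ‖g₂ x‖ₑ) ≤ ofReal (K * M ^ b * M * t ^ gapExp n α b r) →
      lpn volume r (fun x => ‖g₁ x + g₂ x‖ₑ) ≤ ofReal ((K + C + 1) * ‖φ‖ + M) := by
    intro g₁ g₂ hg₁ hg₂ t ht ht0 h1 h2
    refine (lpn_mono hr0 fun x => enorm_add_le _ _).trans ((lpn_add_le hr1 hg₁.enorm
      hg₂.enorm).trans ((add_le_add h1 (h2.trans (ofReal_le_ofReal (hduhM t ht ht0)))).trans ?_))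
    rw [← ofReal_add (by positivity) hM]
    exact ofReal_le_ofReal hCK
  have hVeq : ∀ t ∈ I, ∀ᵐ x, V t x = sg α t φ x + duh α a f t x := by
    intro t ht
    rcases (hI.nonneg t ht).eq_or_lt with rfl | ht0
    · refine .of_forall fun x => ?_
      rw [hV, picardLim_zero hn hα, duh_zero_time, sg_zero hn hα, add_zero]
    · exact (hPt t ht ht0).2.2.2.2.1
  have hVr : ∀ t ∈ I, lpn volume r (fun x => ‖V t x‖ₑ) ≤ ofReal ((K + C + 1) * ‖φ‖ + M) := by
    intro t ht
    rcases (hI.nonneg t ht).eq_or_lt with rfl | ht0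
    · have e : ∀ x, V 0 x = φ x := fun x => picardLim_zero hn hα x
      simp only [e, hφn]
      refine ofReal_le_ofReal ?_
      have := norm_nonneg φ
      nlinarith
    · have e : lpn volume r (fun x => ‖V t x‖ₑ) =
          lpn volume r (fun x => ‖sg α t φ x + duh α a f t x‖ₑ) :=
        lpn_congr_ae ((hVeq t ht).mono fun x hx => by rw [hx])
      rw [e]
      exact hsum (hsgm t) (measurable_duh_nonlin hn hα hVm t) t ht ht0 (hsgr t ht0) (hPt t ht ht0).2.2.2.2.2.1
  have hmem : ∀ t ∈ I, MemLp (V t) (ofReal r) volume := fun t ht =>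
    memLp_of_lpn_ne_top hr0 (hVt t) (ne_top_of_le_ne_top ofReal_ne_top (hVr t ht))
  set u := toLpField (ofReal r) V with hu
  have huV : ∀ t ∈ I, u t =ᵐ[volume] V t := fun t ht => toLpField_ae (hmem t ht)
  have hfu : ∀ t ∈ I, ∀ᵐ τ ∂(volume.restrict (Ioo 0 t)),
      f τ =ᵐ[volume] fun y => nonlin σ b (u τ y) := by
    intro t ht
    filter_upwards [ae_restrict_mem measurableSet_Ioo] with τ hτ
    filter_upwards [huV τ (hIoo t ht τ hτ)] with x hx
    rw [hf, hx]
  have hduhAt : ∀ t ∈ I, 0 < t → ∀ᵐ x, DuhAt α a (fun τ y => nonlin σ b (u τ y)) t x := by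
    intro t ht ht0
    filter_upwards [(hPt t ht ht0).2.2.2.1] with x hx
    exact hx.congr (hfu t ht)
  refine ⟨⟨?_, ?_, ?_, ?_⟩, ?_, huV, ?_, ?_, ?_, ?_⟩
  · refine Lp.ext ((huV 0 hI.zero_mem).trans (.of_forall fun x => ?_))
    exact picardLim_zero hn hα x
  · exact fun t ht ht0 => (hduhAt t ht ht0).mono fun x hx => hx.1
  · exact fun t ht ht0 => (hduhAt t ht ht0).mono fun x hx => hx.2
  · intro t ht ht0
    filter_upwards [huV t ht, hVeq t ht] with x h1 h2
    rw [h1, h2, sg_of_pos hα ht0, duh_congr (hfu t ht)]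
    rfl
  · intro t₀ ht₀
    rw [ContinuousWithinAt, tendsto_iff_edist_tendsto_0]
    have hB : Tendsto (fun t => lpn volume r (fun x => ‖duh α a f t x - duh α a f t₀ x‖ₑ)) (𝓝[I] t₀)
        (𝓝 0) := by
      -- At t₀ = 0 the Duhamel term is re-estimated with M replaced by an arbitrarily small m, on an
      -- interval where t^δ ‖S_α(t)φ‖_{p₁} ≤ m. No positive power of t is used, so the critical case
      -- is included.
      rcases (hI.nonneg t₀ ht₀).eq_or_lt with rfl | ht0
      · simp only [duh_zero_time, sub_zero]
        rw [ENNReal.tendsto_nhds_zero]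
        intro ε hε
        have hlim : Tendsto (fun m : ℝ => ofReal (K * m ^ b * m * Θ)) (𝓝[>] 0) (𝓝 0) := by
          have hc : Continuous fun m : ℝ => K * m ^ b * m * Θ := by
            have := Real.continuous_rpow_const h.hb.le
            fun_prop
          have := ENNReal.tendsto_ofReal (hc.tendsto 0)
          simp only [mul_zero, zero_mul, ENNReal.ofReal_zero] at this
          exact this.mono_left nhdsWithin_le_nhds
        have hlim2 : Tendsto (fun m : ℝ => K * m ^ b * Θ) (𝓝[>] 0) (𝓝 0) := by
          have hc : Continuous fun m : ℝ => K * m ^ b * Θ := by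
            have := Real.continuous_rpow_const h.hb.le
            fun_prop
          have := hc.tendsto 0
          simp only [Real.zero_rpow h.hb.ne', mul_zero, zero_mul] at this
          exact this.mono_left nhdsWithin_le_nhds
        obtain ⟨m, hm1, hm2, hm3⟩ := ((ENNReal.tendsto_nhds_zero.1 hlim ε hε).and
          (((tendsto_order.1 hlim2).2 1 one_pos).and self_mem_nhdsWithin)).exists
        have hm0 : 0 < m := hm3
        obtain ⟨t₁, ht₁, hk⟩ := h.exists_kato_bound_sg φ hφ hφfin hm0
        obtain ⟨T, hT, hT0⟩ := hI.right 0 hI.zero_mem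
        have hsmall := hP φ hφ (min t₁ T) m Θ hm0.le
          (fun t ht => hΘ t (hIoo T hT t ⟨ht.1, ht.2.trans_le (min_le_right _ _)⟩) ht.1) hm2.le
          (fun t ht => hk t ⟨ht.1, ht.2.trans_le (min_le_left _ _)⟩)
        have hmin : 0 < min t₁ T := lt_min ht₁ hT0
        filter_upwards [self_mem_nhdsWithin, mem_nhdsWithin_of_mem_nhds (Iio_mem_nhds hmin)]
          with t ht htm
        rcases (hI.nonneg t ht).eq_or_lt with rfl | ht0
        · simp only [duh_zero_time, enorm_zero, lpn_zero hr0]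
          exact zero_le
        · refine (hsmall t ⟨ht0, htm⟩).2.2.2.2.2.1.trans (le_trans ?_ hm1)
          refine ofReal_le_ofReal ?_
          have h1 : t ^ gapExp n α b r ≤ Θ := hΘ t ht ht0
          gcongr
      · obtain ⟨T, hT, hT0⟩ := hI.right t₀ ht₀
        obtain ⟨e1, e2, e3⟩ := h.nonlin_exponents
        have hδ := h.katoExp_pos
        have hb0 := h.hb
        refine (tendsto_lpn_duh hn hα a e1 e2 rfl e3 (f₀ := (b + 1) * katoExp n α r p₁)
          (by positivity) h.time hfm (T := T) (A := (2 + b) * ((4 * M) ^ b * (4 * M)))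
          (by positivity) (fun τ hτ => ?_) ⟨ht0, hT0⟩).mono_left nhdsWithin_le_nhds
        exact h.lpn_nonlin_le_rpow hσ (by positivity) hτ.1 (hVt τ) (hPT T hT τ hτ).2.2.1
    have hA := (tendsto_lpn_sg hn hα hr1 φ t₀).mono_left (nhdsWithin_le_nhds (s := I))
    have hAB := hA.add hB
    rw [add_zero] at hAB
    refine tendsto_of_tendsto_of_tendsto_of_le_of_le' tendsto_const_nhds hAB
      (.of_forall fun t => zero_le) ?_
    filter_upwards [self_mem_nhdsWithin] with t ht
    rw [edist_eq_lpn hr0 (huV t ht) (huV t₀ ht₀)]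
    have m1 : Measurable fun x => ‖sg α t φ x - sg α t₀ φ x‖ₑ := ((hsgm t).sub (hsgm t₀)).enorm
    have m2 : Measurable fun x => ‖duh α a f t x - duh α a f t₀ x‖ₑ :=
      ((measurable_duh_nonlin hn hα hVm t).sub (measurable_duh_nonlin hn hα hVm t₀)).enorm
    refine (lpn_mono_ae hr0 ?_).trans (lpn_add_le hr1 m1 m2)
    filter_upwards [hVeq t ht, hVeq t₀ ht₀] with x h1 h2
    rw [h1, h2, add_sub_add_comm]
    exact enorm_add_le _ _
  · intro t ht
    have h1 : ‖u t‖ₑ ≤ ofReal ((K + C + 1) * ‖φ‖ + M) := by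
      rw [enorm_eq_lpn hr0 (huV t ht)]
      exact hVr t ht
    rw [← ofReal_norm] at h1
    exact (ENNReal.ofReal_le_ofReal_iff (by positivity)).1 h1
  · exact fun k t ht ht0 => (hPt t ht ht0).1 k
  · intro k t ht ht0
    cases k with
    | zero =>
      have e : ∀ x, picard α b σ a φ 0 t x = 0 := fun _ => rfl
      simp [e, lpn_zero hr0]
    | succ k =>
      exact hsum (hsgm t) (measurable_duh_nonlin hn hα (measurable_picard hn hα hφ k) t) t ht ht0 (hsgr t ht0)
        ((hPt t ht ht0).2.2.2.2.2.2 k)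
  · exact fun t ht ht0 => (hPt t ht ht0).2.1

end KatoExponents

end Existence

/-! ### Existence in the space-time class -/

section ExistenceClass

variable {𝕜 : Type*} [RCLike 𝕜] {n : ℕ} {α b r p₁ σ p : ℝ} {q : ℝ≥0∞}

namespace KatoExponents

/-- The first smallness condition makes the iteration converge, the second closes its L^q(L^p)
bound. If p = r, then q = ∞ and boundedness in L^r already suffices. -/
theorem exists_mildSolution (h : KatoExponents n α b r p₁) (𝕜 : Type*) [RCLike 𝕜] {σ : ℝ}
    (hσ : σ = 1 ∨ σ = -1) (a : Eu n) [Fact (1 ≤ ofReal r)] [Fact (1 ≤ ofReal p)]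
    (hadm : IsAdmissible n α q p r) (hbp : b + 1 < p) :
    ∃ K l : ℝ, 0 < K ∧ 0 < l ∧ l < 1 ∧ ∀ (φ : LpEu 𝕜 n (ofReal r)) (I : Set ℝ) (M Θ : ℝ),
      IsTimeInterval I → 0 ≤ M → 0 ≤ Θ → (∀ t ∈ I, 0 < t → t ^ gapExp n α b r ≤ Θ) →
      K * M ^ b * Θ ≤ 1 → K * (K * ‖φ‖ + M) ^ (b * (1 - l)) * M ^ (b * l) * Θ ≤ 1 →
      (∀ t ∈ I, 0 < t → lpn volume p₁ (fun x => ‖sg α t φ x‖ₑ) ≤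
        ofReal (M * t ^ (-katoExp n α r p₁))) →
      ∃ u : ℝ → LpEu 𝕜 n (ofReal r), IsMildSolution α b σ a φ I u ∧ MemXb q (ofReal p) I u := by
  obtain ⟨K, hK, hE⟩ := h.exists_mildSolution_aux 𝕜 hσ a
  have hb0 := h.hb
  have hr0 := h.r_pos
  rcases hadm.le.eq_or_lt with hrp | hrp
  · subst hrp
    have hq := hadm.eq_top rfl
    subst hq
    refine ⟨K, 1 / 2, hK, by norm_num, by norm_num, fun φ I M Θ hI hM hΘ0 hΘ h1 _ hk => ?_⟩
    obtain ⟨e1, e2, -, e4, -⟩ := hE φ I M Θ hI hM hΘ0 hΘ h1 hk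
    refine ⟨_, e1, ⟨e2, _, ?_, .of_forall fun t => ae_eq_refl _⟩, _, e4⟩
    have : Fact (ofReal r ≠ ∞) := ⟨ofReal_ne_top⟩
    refine memLp_top_of_bound (e2.aestronglyMeasurable hI.measurableSet) (K * ‖φ‖ + M) ?_
    exact (ae_restrict_mem hI.measurableSet).mono fun t ht => e4 t ht
  · obtain ⟨q', rfl, hq', hrq⟩ := hadm.exists_real h.n_pos h.hα hrp
    obtain ⟨K₂, l, hK₂, hl0, hl1, hS⟩ := h.exists_space_time_bound 𝕜 hσ a hrp hbp hq' hrq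
    refine ⟨K + K₂, l, by positivity, hl0, hl1, fun φ I M Θ hI hM hΘ0 hΘ h1 h2 hk => ?_⟩
    have hMb : 0 ≤ M ^ b := by positivity
    obtain ⟨e1, e2, e3, e4, e5, e6, e7⟩ := hE φ I M Θ hI hM hΘ0 hΘ
      (le_trans (by gcongr; linarith) h1) hk
    set V := picardLim α b σ a φ with hV
    have hφ : Measurable (φ : Eu n → 𝕜) := (Lp.stronglyMeasurable φ).measurable
    have hVm : Measurable (uncurry V) := measurable_picardLim h.n_pos h.hα hφ
    have hp0 : 0 < p := by linarith
    have hq0 : 0 < q' := by linarith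
    have hb1 : 0 ≤ b * (1 - l) := mul_nonneg hb0.le (by linarith)
    have hIm := hI.measurableSet
    have hmem : ∀ t ∈ I ∩ Ioi 0, t ∈ I ∧ 0 < t := fun t ht => ht
    -- The bounds hold for t > 0; the single point 0 is invisible to the measure.
    have hres : (volume.restrict (I ∩ Ioi 0) : Measure ℝ) = volume.restrict I := by
      refine Measure.restrict_congr_set ?_
      have h0 : ∀ᵐ t : ℝ, t ≠ 0 := by simp [ae_iff]
      filter_upwards [h0] with t ht
      refine propext ⟨fun h' => h'.1, fun h' => ⟨h', ?_⟩⟩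
      exact lt_of_le_of_ne (hI.nonneg t h') (Ne.symm ht)
    have hn0 : 0 ≤ ‖φ‖ := norm_nonneg φ
    have hsp := hS φ hφ (I ∩ Ioi 0) M (K * ‖φ‖ + M) Θ (hIm.inter measurableSet_Ioi)
      (fun t ht => ht.2) (fun t ht s hs0 hst => ⟨hI.lower t ht.1 s hs0.le hst.le, hs0⟩) hM
      (by positivity) hΘ0 (fun t ht => hΘ t ht.1 ht.2) (le_trans (by gcongr <;> linarith) h2)
      (fun k t ht => e5 k t ht.1 ht.2) (fun k t ht => e6 k t ht.1 ht.2) (fun t ht => e7 t ht.1 ht.2)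
    rw [hres] at hsp
    have hφn : lpn volume r (fun x => ‖φ x‖ₑ) = ofReal ‖φ‖ := by
      rw [← enorm_eq_lpn hr0 (ae_eq_refl _), ofReal_norm]
    rw [hφn] at hsp
    have hfin : lpn (volume.restrict I) q' (fun t => lpn volume p (fun x => ‖V t x‖ₑ)) ≠ ∞ :=
      ne_top_of_le_ne_top (mul_ne_top ofReal_ne_top ofReal_ne_top) hsp
    have hmeas : Measurable fun t => lpn volume p (fun x => ‖V t x‖ₑ) :=
      ((hVm.enorm.pow_const p).lintegral_prod_right').pow_const _
    have hae := ae_ne_top_of_lpn_ne_top hq0 hmeas hfin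
    have hmV : ∀ᵐ t ∂(volume.restrict I), MemLp (V t) (ofReal p) volume :=
      hae.mono fun t ht => memLp_of_lpn_ne_top hp0 hVm.of_uncurry_left ht
    refine ⟨_, e1, ⟨e2, toLpField (ofReal p) V, ⟨?_, ?_⟩, ?_⟩, _, e4⟩
    · exact (stronglyMeasurable_toLpField hp0 hVm).aestronglyMeasurable
    · rw [eLpNorm_eq_lpn hq0]
      refine lt_of_le_of_lt (le_of_eq (lpn_congr_ae ?_)) hfin.lt_top
      filter_upwards [hmV] with t ht
      exact enorm_eq_lpn hp0 (toLpField_ae ht)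
    · filter_upwards [hmV, ae_restrict_mem hIm] with t ht htI
      exact (toLpField_ae ht).trans (e3 t htI).symm

/-- Existence, with a smallness condition on the norm of the data. -/
theorem exists_mildSolution_of_norm (h : KatoExponents n α b r p₁) (𝕜 : Type*) [RCLike 𝕜] {σ : ℝ}
    (hσ : σ = 1 ∨ σ = -1) (a : Eu n) [Fact (1 ≤ ofReal r)] [Fact (1 ≤ ofReal p)]
    (hadm : IsAdmissible n α q p r) (hbp : b + 1 < p) :
    ∃ c : ℝ, 0 < c ∧ ∀ (φ : LpEu 𝕜 n (ofReal r)) (I : Set ℝ) (Θ : ℝ),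
      IsTimeInterval I → 0 ≤ Θ → (∀ t ∈ I, 0 < t → t ^ gapExp n α b r ≤ Θ) →
      c * ‖φ‖ ^ b * Θ ≤ 1 →
      ∃ u : ℝ → LpEu 𝕜 n (ofReal r), IsMildSolution α b σ a φ I u ∧ MemXb q (ofReal p) I u := by
  obtain ⟨K, l, hK, hl0, hl1, hE⟩ := h.exists_mildSolution (p := p) 𝕜 hσ a hadm hbp
  obtain ⟨C, hC, hS⟩ := exists_lpn_semigroup_le (α := α) 𝕜 h.n_pos h.hα
  have hr0 := h.r_pos
  have hb0 := h.hb
  have hb1 : 0 ≤ b * (1 - l) := mul_nonneg hb0.le (by linarith)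
  have hb2 : 0 ≤ b * l := by positivity
  -- With M = C‖φ‖ both conditions become a constant times ‖φ‖^b Θ ≤ 1, since b(1-l) and bl add up
  -- to b.
  refine ⟨K * C ^ b + K * (K + C) ^ (b * (1 - l)) * C ^ (b * l), by positivity,
    fun φ I Θ hI hΘ0 hΘ hsm => ?_⟩
  have hn0 : 0 ≤ ‖φ‖ := norm_nonneg φ
  have hφ : Measurable (φ : Eu n → 𝕜) := (Lp.stronglyMeasurable φ).measurable
  refine hE φ I (C * ‖φ‖) Θ hI (by positivity) hΘ0 hΘ (le_trans ?_ hsm) (le_trans ?_ hsm) ?_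
  · rw [mul_rpow hC.le hn0, ← mul_assoc]
    gcongr
    have : 0 ≤ K * (K + C) ^ (b * (1 - l)) * C ^ (b * l) := by positivity
    linarith
  · rw [← add_mul, mul_rpow (by positivity) hn0, mul_rpow hC.le hn0]
    calc K * ((K + C) ^ (b * (1 - l)) * ‖φ‖ ^ (b * (1 - l))) * (C ^ (b * l) * ‖φ‖ ^ (b * l)) * Θ
        = K * (K + C) ^ (b * (1 - l)) * C ^ (b * l) *
          (‖φ‖ ^ (b * (1 - l)) * ‖φ‖ ^ (b * l)) * Θ := by ring
      _ = K * (K + C) ^ (b * (1 - l)) * C ^ (b * l) * ‖φ‖ ^ b * Θ := by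
        rw [← Real.rpow_add_of_nonneg hn0 hb1 hb2]
        ring_nf
      _ ≤ _ := by
        gcongr
        have : 0 ≤ K * C ^ b := by positivity
        linarith
  · intro t _ ht
    rw [sg_of_pos h.hα ht]
    refine (hS r p₁ t h.hr.le h.r_lt.le ht φ hφ).trans_eq ?_
    rw [← enorm_eq_lpn hr0 (ae_eq_refl _), ← ofReal_norm, ← ofReal_mul (by positivity), katoExp]
    ring_nf

/-- Local existence for arbitrary data in the critical case. -/
theorem exists_mildSolution_of_gap_eq_zero (h : KatoExponents n α b r p₁) (𝕜 : Type*) [RCLike 𝕜]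
    {σ : ℝ} (hσ : σ = 1 ∨ σ = -1) (a : Eu n) [Fact (1 ≤ ofReal r)]
    [Fact (1 ≤ ofReal p)] (hadm : IsAdmissible n α q p r) (hbp : b + 1 < p)
    (hgap : gapExp n α b r = 0) (φ : LpEu 𝕜 n (ofReal r)) :
    ∃ T : ℝ, 0 < T ∧ ∃ u : ℝ → LpEu 𝕜 n (ofReal r),
        IsMildSolution α b σ a φ (Ico 0 T) u ∧ MemXb q (ofReal p) (Ico 0 T) u := by
  obtain ⟨K, l, hK, hl0, hl1, hE⟩ := h.exists_mildSolution (p := p) 𝕜 hσ a hadm hbp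
  have hr0 := h.r_pos
  have hb0 := h.hb
  have hb1 : 0 ≤ b * (1 - l) := mul_nonneg hb0.le (by linarith)
  have hb2 : 0 < b * l := by positivity
  have hn0 : 0 ≤ ‖φ‖ := norm_nonneg φ
  have hφ : Measurable (φ : Eu n → 𝕜) := (Lp.stronglyMeasurable φ).measurable
  have hsmall : ∀ c s : ℝ, 0 < s → ∀ᶠ m in 𝓝[>] (0 : ℝ), c * m ^ s < 1 := by
    intro c s hs
    have h1 : Tendsto (fun m : ℝ => c * m ^ s) (𝓝 0) (𝓝 (c * 0 ^ s)) :=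
      ((Real.continuousAt_rpow_const 0 s (Or.inr hs.le)).tendsto).const_mul c
    rw [Real.zero_rpow hs.ne', mul_zero] at h1
    exact (h1.eventually_lt_const one_pos).filter_mono nhdsWithin_le_nhds
  have h4 : ∀ᶠ m in 𝓝[>] (0 : ℝ), m < 1 := nhdsWithin_le_nhds (Iio_mem_nhds one_pos)
  have h5 : ∀ᶠ m in 𝓝[>] (0 : ℝ), 0 < m := self_mem_nhdsWithin
  -- With m < 1 the radius K‖φ‖ + m is at most K‖φ‖ + 1, so the second condition also becomes a
  -- smallness condition on a positive power of m.
  obtain ⟨m, h1, h2, h3, hm0⟩ := ((hsmall K b hb0).and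
    ((hsmall (K * (K * ‖φ‖ + 1) ^ (b * (1 - l))) (b * l) hb2).and (h4.and h5))).exists
  have hfin : lpn volume r (fun x => ‖φ x‖ₑ) ≠ ∞ := by
    rw [← enorm_eq_lpn hr0 (ae_eq_refl _)]
    exact enorm_ne_top
  obtain ⟨T, hT, hk⟩ := h.exists_kato_bound_sg φ hφ hfin hm0
  refine ⟨T, hT, hE φ (Ico 0 T) m 1 (isTimeInterval_Ico hT) hm0.le zero_le_one
    (fun t _ _ => by rw [hgap, Real.rpow_zero]) (by rw [mul_one]; exact h1.le) (le_trans ?_ h2.le)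
    fun t ht ht0 => hk t ⟨ht0, ht.2⟩⟩
  rw [mul_one]
  gcongr

end KatoExponents

end ExistenceClass

/-! ### Measurable representatives and a local-to-global principle -/

section Representative

variable {𝕜 : Type*} [RCLike 𝕜] {n : ℕ}

lemma ae_eq_zero_of_lpn_eq_zero {X : Type*} [MeasurableSpace X] {μ : Measure X} {p : ℝ} (hp : 0 < p)
    {F : X → ℝ≥0∞} (hF : Measurable F) (h : lpn μ p F = 0) : ∀ᵐ x ∂μ, F x = 0 := by
  rw [lpn, ENNReal.rpow_eq_zero_iff_of_pos (by positivity),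
    lintegral_eq_zero_iff (hF.pow_const p)] at h
  filter_upwards [h] with x hx
  exact (ENNReal.rpow_eq_zero_iff_of_pos hp).1 hx

/-- A continuous `L^r`-valued curve has a jointly measurable representative. -/
theorem exists_measurable_representative {r T : ℝ} (hr : 1 ≤ r) [Fact (1 ≤ ofReal r)]
    {u : ℝ → LpEu 𝕜 n (ofReal r)} (hu : ContinuousOn u (Icc 0 T)) :
    ∃ U : ℝ → Eu n → 𝕜, Measurable (uncurry U) ∧ ∀ τ ∈ Icc 0 T, u τ =ᵐ[volume] U τ := by
  have hr0 : 0 < r := by linarith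
  have huc := isCompact_Icc.uniformContinuousOn_of_continuous hu
  rw [Metric.uniformContinuousOn_iff] at huc
  have hε : ∀ k : ℕ, (0 : ℝ) < (1 / 2) ^ k := fun k => by positivity
  choose δ hδ hδu using fun k : ℕ => huc _ (hε k)
  -- Rounding down to a grid of mesh δ_k/2 moves τ by less than δ_k and stays in [0, T]. It takes
  -- countably many values, so u composed with it is jointly measurable, and uniform continuity
  -- makes the error at most 2^{-k}.
  set g : ℕ → ℝ → ℝ := fun k τ => δ k / 2 * ⌊τ / (δ k / 2)⌋ with hg
  have hgI : ∀ k, ∀ τ ∈ Icc 0 T, g k τ ∈ Icc 0 T ∧ dist (g k τ) τ < δ k := by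
    intro k τ hτ
    have h2 : 0 < δ k / 2 := by linarith [hδ k]
    have h3 : δ k / 2 * (⌊τ / (δ k / 2)⌋ : ℝ) ≤ τ := by
      rw [mul_comm, ← le_div_iff₀ h2]; exact Int.floor_le _
    have h4 : τ < δ k / 2 * (⌊τ / (δ k / 2)⌋ : ℝ) + δ k / 2 := by
      have := Int.lt_floor_add_one (τ / (δ k / 2))
      rw [div_lt_iff₀ h2] at this
      linarith
    have h5 : (0 : ℝ) ≤ (⌊τ / (δ k / 2)⌋ : ℝ) := by
      exact_mod_cast Int.floor_nonneg.2 (div_nonneg hτ.1 h2.le)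
    refine ⟨⟨by positivity, h3.trans hτ.2⟩, ?_⟩
    rw [Real.dist_eq, abs_lt]
    constructor <;> simp only [hg] <;> linarith [hδ k]
  set f : ℕ → ℝ → Eu n → 𝕜 := fun k τ x => u (g k τ) x with hf
  have hfm : ∀ k, Measurable (uncurry (f k)) := by
    intro k
    have h1 : Measurable fun z : Eu n × ℤ => u (δ k / 2 * (z.2 : ℝ)) z.1 :=
      measurable_from_prod_countable_left fun j =>
        (Lp.stronglyMeasurable (u (δ k / 2 * (j : ℝ)))).measurable
    have h2 : Measurable fun z : ℝ × Eu n => (z.2, ⌊z.1 / (δ k / 2)⌋) :=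
      measurable_snd.prodMk (Int.measurable_floor.comp (measurable_fst.div_const _))
    exact h1.comp h2
  have hft : ∀ k τ, Measurable (f k τ) := fun k τ => (Lp.stronglyMeasurable _).measurable
  have hclose : ∀ k, ∀ τ ∈ Icc 0 T, lpn volume r (fun x => ‖f k τ x - u τ x‖ₑ) ≤
      ofReal ((1 / 2) ^ k) := by
    intro k τ hτ
    rw [← edist_eq_lpn hr0 (ae_eq_refl (u (g k τ))) (ae_eq_refl (u τ)), edist_dist]
    exact ofReal_le_ofReal (hδu k _ (hgI k τ hτ).1 τ hτ (hgI k τ hτ).2).le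
  have hum : ∀ τ, Measurable (u τ : Eu n → 𝕜) := fun τ => (Lp.stronglyMeasurable _).measurable
  have hclose' : ∀ k, ∀ τ ∈ Icc 0 T, lpn volume r (fun x => ‖u τ x - f k τ x‖ₑ) ≤
      ofReal ((1 / 2) ^ k) := by
    intro k τ hτ
    simp_rw [fun x => enorm_sub_rev (u τ x) (f k τ x)]
    exact hclose k τ hτ
  refine ⟨fun τ x => limUnder atTop fun k => f k τ x, ?_, fun τ hτ => ?_⟩
  · exact (StronglyMeasurable.limUnder (l := atTop) fun k => (hfm k).stronglyMeasurable).measurable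
  have hinc : ∀ k, lpn volume r (fun x => ‖f (k + 1) τ x - f k τ x‖ₑ) ≤
      ofReal (2 * (1 / 2) ^ k) := by
    intro k
    have h1 : lpn volume r (fun x => ‖f (k + 1) τ x - f k τ x‖ₑ) ≤
        lpn volume r (fun x => ‖f (k + 1) τ x - u τ x‖ₑ + ‖u τ x - f k τ x‖ₑ) := by
      refine lpn_mono hr0 fun x => ?_
      rw [← sub_add_sub_cancel (f (k + 1) τ x) (u τ x) (f k τ x)]
      exact enorm_add_le _ _
    refine h1.trans ((lpn_add_le hr ((hft _ τ).sub (hum τ)).enorm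
      ((hum τ).sub (hft _ τ)).enorm).trans ?_)
    refine (add_le_add (hclose (k + 1) τ hτ) (hclose' k τ hτ)).trans ?_
    rw [← ofReal_add (by positivity) (by positivity)]
    refine ofReal_le_ofReal ?_
    rw [pow_succ]
    linarith [hε k]
  obtain ⟨-, h2⟩ := ae_tendsto_of_lpn_geometric (μ := volume) hr (fun k => hft k τ) zero_le_two hinc
  have hlm : Measurable fun x => limUnder atTop fun k => f k τ x :=
    (StronglyMeasurable.limUnder (l := atTop) fun k => (hft k τ).stronglyMeasurable).measurable
  have h3 : ∀ k, lpn volume r (fun x => ‖u τ x - limUnder atTop fun k => f k τ x‖ₑ) ≤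
      ofReal (5 * (1 / 2) ^ k) := by
    intro k
    have h1 : lpn volume r (fun x => ‖u τ x - limUnder atTop fun k => f k τ x‖ₑ) ≤
        lpn volume r (fun x => ‖u τ x - f k τ x‖ₑ +
          ‖(limUnder atTop fun k => f k τ x) - f k τ x‖ₑ) := by
      refine lpn_mono hr0 fun x => ?_
      rw [enorm_sub_rev (limUnder atTop fun k => f k τ x), ← sub_add_sub_cancel (u τ x) (f k τ x)]
      exact enorm_add_le _ _
    refine h1.trans ((lpn_add_le hr ((hum τ).sub (hft _ τ)).enorm (hlm.sub (hft _ τ)).enorm).trans ?_)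
    refine (add_le_add (hclose' k τ hτ) (h2 k)).trans_eq ?_
    rw [← ofReal_add (by positivity) (by positivity)]
    ring_nf
  have h4 : lpn volume r (fun x => ‖u τ x - limUnder atTop fun k => f k τ x‖ₑ) = 0 := by
    have h5 : Tendsto (fun k : ℕ => ofReal (5 * (1 / 2) ^ k)) atTop (𝓝 0) := by
      have := ((tendsto_pow_atTop_nhds_zero_of_lt_one (r := (1 / 2 : ℝ)) (by norm_num)
        (by norm_num)).const_mul 5)
      simpa using ENNReal.tendsto_ofReal this
    exact le_antisymm (ge_of_tendsto' h5 h3) zero_le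
  filter_upwards [ae_eq_zero_of_lpn_eq_zero hr0 ((hum τ).sub hlm).enorm h4] with x hx
  exact sub_eq_zero.1 (enorm_eq_zero.1 hx)

/-- The times up to which u and v agree form a closed set that can always be extended to the right.
This reduces uniqueness to a short interval following a time of agreement. -/
lemma eqOn_Icc_of_local {Y : Type*} [TopologicalSpace Y] [T2Space Y] {u v : ℝ → Y} {T : ℝ}
    (hu : ContinuousOn u (Icc 0 T)) (hv : ContinuousOn v (Icc 0 T)) (h0 : u 0 = v 0)
    (hloc : ∀ t₀ ∈ Ico 0 T, EqOn u v (Icc 0 t₀) → ∃ t₁, t₀ < t₁ ∧ EqOn u v (Ioc t₀ t₁)) :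
    EqOn u v (Icc 0 T) := by
  set E : Set ℝ := {t ∈ Icc 0 T | u t = v t} with hE
  have hEc : IsClosed E := by
    have := (hu.prodMk hv).preimage_isClosed_of_isClosed isClosed_Icc isClosed_diagonal
    exact this
  set s : Set ℝ := {t | Icc 0 t ⊆ E} with hs
  have hsE : s ∩ Icc 0 T ⊆ E := fun t ht => ht.1 ⟨ht.2.1, le_rfl⟩
  have hsc : IsClosed (s ∩ Icc 0 T) := by
    refine isClosed_of_closure_subset fun t ht => ?_
    have htE : t ∈ E := (closure_minimal hsE hEc) ht
    refine ⟨fun τ hτ => ?_, htE.1⟩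
    rcases hτ.2.eq_or_lt with rfl | h
    · exact htE
    · obtain ⟨t', h1, h2⟩ := mem_closure_iff.1 ht (Ioi τ) isOpen_Ioi h
      exact h2.1 ⟨hτ.1, (mem_Ioi.1 h1).le⟩
  intro t ht
  have hT : 0 ≤ T := ht.1.trans ht.2
  have h0s : (0 : ℝ) ∈ s := by
    intro τ hτ
    have : τ = 0 := le_antisymm hτ.2 hτ.1
    rw [this]
    exact ⟨⟨le_rfl, hT⟩, h0⟩
  refine (hsE ⟨hsc.Icc_subset_of_forall_exists_gt h0s (fun x hx y hy => ?_) ht, ht⟩).2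
  obtain ⟨t₁, h1, h2⟩ := hloc x hx.2 fun τ hτ => (hx.1 hτ).2
  have hm : x < min (min t₁ T) y := lt_min (lt_min h1 hx.2.2) hy
  refine ⟨min (min t₁ T) y, fun τ hτ => ?_, hm, min_le_right _ _⟩
  rcases le_or_gt τ x with h | h
  · exact hx.1 ⟨hτ.1, h⟩
  · have h3 : τ ≤ min t₁ T := hτ.2.trans (min_le_left _ _)
    exact ⟨⟨hτ.1, h3.trans (min_le_right _ _)⟩, h2 ⟨h, h3.trans (min_le_left _ _)⟩⟩

end Representative

/-! ### Tools for the halving argument -/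

section WeakTools

/-- Iteration yields the bounds N 2^{-k} X for all k. The initial constant need not be small, only
finite, which is why uniqueness requires no smallness of the solutions. -/
lemma eq_zero_of_halving {Q : ℝ≥0∞ → Prop} {N : ℝ≥0∞} (hN : N ≠ ∞) (h0 : Q N)
    (hs : ∀ M, M ≠ ∞ → Q M → Q (M / 2)) {A X : ℝ≥0∞} (hX : X ≠ ∞) (hA : ∀ M, Q M → A ≤ M * X) :
    A = 0 := by
  have h1 : ∀ k : ℕ, N * 2⁻¹ ^ k ≠ ∞ ∧ Q (N * 2⁻¹ ^ k) := by
    intro k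
    induction k with
    | zero => simpa using ⟨hN, h0⟩
    | succ k ih =>
      rw [pow_succ, ← mul_assoc, ← div_eq_mul_inv]
      exact ⟨ENNReal.div_ne_top ih.1 two_ne_zero, hs _ ih.1 ih.2⟩
  have h2 : Tendsto (fun k : ℕ => N * 2⁻¹ ^ k * X) atTop (𝓝 (N * 0 * X)) := by
    refine ENNReal.Tendsto.mul_const (ENNReal.Tendsto.const_mul ?_ (Or.inr hN)) (Or.inr hX)
    exact ENNReal.tendsto_pow_atTop_nhds_zero_of_lt_one (by simp)
  rw [mul_zero, zero_mul] at h2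
  exact le_antisymm (ge_of_tendsto' h2 fun k => hA _ (h1 k).2) zero_le

lemma setLIntegral_Ioi_rpow {e c : ℝ} (he : e < -1) (hc : 0 < c) :
    ∫⁻ s in Ioi c, ofReal (s ^ e) = ofReal (c ^ (e + 1) / (-(e + 1))) := by
  rw [← ofReal_integral_eq_lintegral_ofReal (integrableOn_Ioi_rpow_of_lt he hc),
    integral_Ioi_rpow_of_lt he hc, div_neg, neg_div]
  exact (ae_restrict_iff' measurableSet_Ioi).2 (.of_forall fun τ hτ =>
      rpow_nonneg (hc.le.trans (mem_Ioi.1 hτ).le) _)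

lemma lpn_indicator_one {X : Type*} [MeasurableSpace X] {μ : Measure X} {m : ℝ} (hm : 0 < m)
    {E : Set X} (hE : MeasurableSet E) : lpn μ m (E.indicator 1) = μ E ^ (1 / m) := by
  rw [lpn, ← lintegral_indicator_one hE]
  congr 1
  refine lintegral_congr fun x => ?_
  by_cases h : x ∈ E
  · simp [h]
  · simp [h, zero_rpow_of_pos hm]

variable {G : Type*} [AddCommGroup G] [MeasurableSpace G] [MeasurableAdd₂ G] [MeasurableNeg G]
  {μ : Measure G} [SFinite μ] [μ.IsAddLeftInvariant] [μ.IsNegInvariant]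

/-- Fubini: convolution is dual to convolution with the reflected kernel. It moves the kernel from
the unknown function to the indicator of a test set. -/
lemma lintegral_mul_cv {k F W : G → ℝ≥0∞} (hk : Measurable k) (hF : Measurable F)
    (hW : Measurable W) :
    ∫⁻ x, W x * cv μ k F x ∂μ = ∫⁻ z, F z * cv μ (fun y => k (-y)) W z ∂μ := by
  have hm : Measurable fun z : G × G => W z.1 * (k z.2 * F (z.1 - z.2)) :=
    (hW.comp measurable_fst).mul ((hk.comp measurable_snd).mul
      (hF.comp (measurable_fst.sub measurable_snd)))
  have hm' : Measurable fun z : G × G => F z.1 * (k z.2 * W (z.1 + z.2)) :=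
    (hF.comp measurable_fst).mul ((hk.comp measurable_snd).mul
      (hW.comp (measurable_fst.add measurable_snd)))
  have e1 : ∀ x, W x * cv μ k F x = ∫⁻ y, W x * (k y * F (x - y)) ∂μ := fun x =>
    (lintegral_const_mul _ (hk.mul (hF.comp (measurable_const.sub measurable_id)))).symm
  have e2 : ∀ z, F z * cv μ (fun y => k (-y)) W z = ∫⁻ y, F z * (k y * W (z + y)) ∂μ := fun z => by
    have h1 : Measurable fun y => k y * W (z + y) := hk.mul (hW.comp (measurable_const_add z))
    rw [lintegral_const_mul _ h1, cv, ← lintegral_neg_eq_self (fun y => k y * W (z + y))]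
    simp only [sub_eq_add_neg]
  simp only [e1, e2]
  rw [lintegral_lintegral_swap (f := fun x y => W x * (k y * F (x - y))) hm.aemeasurable,
    lintegral_lintegral_swap (f := fun z y => F z * (k y * W (z + y))) hm'.aemeasurable]
  refine lintegral_congr fun y => ?_
  rw [← lintegral_add_right_eq_self (fun x => W x * (k y * F (x - y))) y]
  refine lintegral_congr fun x => ?_
  rw [add_sub_cancel_right]
  ring

lemma lpn_comp_neg {G : Type*} [AddCommGroup G] [MeasurableSpace G] [MeasurableNeg G]
    {μ : Measure G} [μ.IsNegInvariant] {m : ℝ} (F : G → ℝ≥0∞) : lpn μ m (fun y => F (-y)) = lpn μ m F := by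
  rw [lpn, lpn, lintegral_neg_eq_self (fun y => F y ^ m)]

end WeakTools

/-! ### Endpoint fractional integration in time -/

section WeakTime

/-- The kernel `s^{κ - 1}` of fractional integration on the half-line. -/
noncomputable def fracKer (κ : ℝ) : ℝ → ℝ≥0∞ := (Ioi 0).indicator fun s => ofReal (s ^ (κ - 1))

lemma measurable_fracKer (κ : ℝ) : Measurable (fracKer κ) :=
  (by fun_prop : Measurable fun s : ℝ => ofReal (s ^ (κ - 1))).indicator measurableSet_Ioi

/-- The kernel is cut at the length Z = |E|: the near part is taken in L^1 against the indicator in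
L^{1/e}, the far part in L^{1/e}, which needs e < 1 - κ, against the indicator in L^1. Both give
Z^{κ+e}. -/
lemma exists_lpn_cv_fracKer_le {κ e : ℝ} (hκ : 0 < κ) (he : 0 < e) (heκ : e < 1 - κ) :
    ∃ C : ℝ, 0 < C ∧ ∀ (E : Set ℝ) (Z : ℝ), MeasurableSet E → 0 < Z → volume E = ofReal Z →
      lpn volume (1 / e) (cv volume (fun s => fracKer κ (-s)) (E.indicator 1)) ≤
        ofReal (C * Z ^ (κ + e)) := by
  set s := 1 / e with hs
  have hs0 : 0 < s := by positivity
  have hs1 : 1 ≤ s := by rw [hs, le_div_iff₀ he]; linarith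
  have hes : 1 / s = e := by rw [hs, one_div_one_div]
  have hneg : (κ - 1) * s < -1 := by
    rw [hs, mul_one_div, div_lt_iff₀ he]; linarith
  set D : ℝ := (1 / (-((κ - 1) * s + 1))) ^ (1 / s) with hD
  have hD0 : 0 < D := rpow_pos_of_pos (one_div_pos.2 (by linarith)) _
  refine ⟨1 / κ + D, by positivity, fun E Z hE hZ hEZ => ?_⟩
  set g : ℝ → ℝ≥0∞ := fun s => ofReal (s ^ (κ - 1)) with hg
  have hgm : Measurable g := by fun_prop
  set k₁ := (Ioc 0 Z).indicator g with hk₁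
  set k₂ := (Ioi Z).indicator g with hk₂
  have hm₁ : Measurable k₁ := hgm.indicator measurableSet_Ioc
  have hm₂ : Measurable k₂ := hgm.indicator measurableSet_Ioi
  have h1E : Measurable (E.indicator (1 : ℝ → ℝ≥0∞)) := measurable_one.indicator hE
  have hsplit : ∀ t, cv volume (fun s => fracKer κ (-s)) (E.indicator 1) t =
      cv volume (fun s => k₁ (-s)) (E.indicator 1) t +
        cv volume (fun s => k₂ (-s)) (E.indicator 1) t := by
    intro t
    have h1 : Measurable fun y => k₁ (-y) * E.indicator (1 : ℝ → ℝ≥0∞) (t - y) :=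
      (hm₁.comp measurable_neg).mul (h1E.comp (measurable_const.sub measurable_id))
    rw [cv, cv, cv, ← lintegral_add_left h1]
    refine lintegral_congr fun y => ?_
    rw [← add_mul]
    congr 1
    rw [fracKer, ← Ioc_union_Ioi_eq_Ioi hZ.le, indicator_union_of_disjoint (by
        rw [Set.disjoint_left]; exact fun x hx hx' => absurd hx.2 (not_le.2 hx'))]
  have hn₁ : lpn volume 1 (fun s => k₁ (-s)) ≤ ofReal (Z ^ κ / κ) := by
    rw [lpn_comp_neg, lpn]
    simp only [rpow_one, div_one]
    rw [hk₁, lintegral_indicator measurableSet_Ioc, ← Measure.restrict_congr_set Ioo_ae_eq_Ioc]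
    have := setLIntegral_Ioo_rpow (f := 1 - κ) (t := Z) (by linarith) hZ
    rw [neg_sub, sub_sub_cancel] at this
    exact this.le
  have hn₂ : lpn volume s (fun s => k₂ (-s)) ≤ ofReal (D * Z ^ (κ - 1 + e)) := by
    rw [lpn_comp_neg, lpn]
    have h1 : ∫⁻ x, k₂ x ^ s = ∫⁻ x in Ioi Z, ofReal (x ^ ((κ - 1) * s)) := by
      rw [← lintegral_indicator measurableSet_Ioi]
      refine lintegral_congr fun x => ?_
      by_cases hx : x ∈ Ioi Z
      · have hx0 : 0 ≤ x := hZ.le.trans (mem_Ioi.1 hx).le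
        rw [hk₂, indicator_of_mem hx, indicator_of_mem hx, hg,
          ofReal_rpow_of_nonneg (rpow_nonneg hx0 _) hs0.le, ← rpow_mul hx0]
      · rw [hk₂, indicator_of_notMem hx, indicator_of_notMem hx, zero_rpow_of_pos hs0]
    have h2 : 0 < -((κ - 1) * s + 1) := by linarith
    rw [h1, setLIntegral_Ioi_rpow hneg hZ, ofReal_rpow_of_nonneg (by positivity) (by positivity)]
    refine ofReal_le_ofReal (le_of_eq ?_)
    rw [div_eq_mul_one_div, mul_rpow (by positivity) (by positivity), ← rpow_mul hZ.le,
      mul_comm, hD]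
    congr 2
    field_simp
    rw [hs]
    field_simp
  have hmk : ∀ {k : ℝ → ℝ≥0∞}, Measurable k → Measurable fun s => k (-s) := fun hk =>
    hk.comp measurable_neg
  have y1 := lpn_cv_le (μ := volume) (m := s) (h := 1) (ρ := s) one_pos hs0 hs1 le_rfl
    (by norm_num) (hmk hm₁) h1E
  have y2 := lpn_cv_le (μ := volume) (m := s) (h := s) (ρ := 1) hs0 one_pos le_rfl hs1
    (by ring) (hmk hm₂) h1E
  rw [lpn_indicator_one hs0 hE, hEZ, hes, ofReal_rpow_of_pos hZ] at y1
  rw [lpn_indicator_one one_pos hE, hEZ, div_one, rpow_one] at y2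
  calc lpn volume s (cv volume (fun s => fracKer κ (-s)) (E.indicator 1))
      = lpn volume s (fun t => cv volume (fun s => k₁ (-s)) (E.indicator 1) t +
        cv volume (fun s => k₂ (-s)) (E.indicator 1) t) := by simp only [← hsplit]
    _ ≤ _ := lpn_add_le hs1 (measurable_cv (hmk hm₁) h1E) (measurable_cv (hmk hm₂) h1E)
    _ ≤ ofReal (Z ^ κ / κ) * ofReal (Z ^ e) +
        ofReal (D * Z ^ (κ - 1 + e)) * ofReal Z :=
      add_le_add (y1.trans (by gcongr)) (y2.trans (by gcongr))
    _ = ofReal ((1 / κ + D) * Z ^ (κ + e)) := by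
      rw [← ofReal_mul (by positivity), ← ofReal_mul (by positivity),
        ← ofReal_add (by positivity) (by positivity)]
      congr 1
      have z1 : Z ^ (κ + e) = Z ^ κ * Z ^ e := rpow_add hZ _ _
      have z2 : Z ^ (κ + e) = Z ^ (κ - 1 + e) * Z := by
        rw [show κ + e = κ - 1 + e + 1 by ring, Real.rpow_add_one hZ.ne']
      rw [add_mul]
      nth_rewrite 1 [z1]
      rw [z2]
      ring

/-- A weak-type substitute for the Hardy–Littlewood–Sobolev inequality: a function dominated by the
fractional integral of its product with a small function of the critical class vanishes. -/
theorem exists_ae_eq_zero_of_le_fracKer {q κ : ℝ} (hq : 1 < q) (hκ : 0 < κ) (hqκ : 1 / q + κ < 1) :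
    ∃ C : ℝ, 0 < C ∧ ∀ (y h : ℝ → ℝ≥0∞) (η : ℝ), Measurable y → Measurable h →
      lpn volume q y ≠ ∞ → (∀ᵐ t, y t ≤ cv volume (fracKer κ) (fun τ => h τ * y τ) t) → 0 < η →
      lpn volume (1 / κ) h ≤ ofReal η → C * η ≤ 1 / 2 → ∀ᵐ t, y t = 0 := by
  have hq0 : 0 < 1 / q := by positivity
  set a := 1 - 1 / q with ha
  -- Room on both sides: a - κ ± δ must lie in (0, 1 - κ), where the fractional integral of an
  -- indicator is controlled.
  obtain ⟨δ, hδ0, hδ⟩ : ∃ δ : ℝ, 0 < δ ∧ δ < min (1 / q) (a - κ) :=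
    exists_between (lt_min hq0 (by linarith))
  obtain ⟨hδ1, hδ2⟩ := lt_min_iff.1 hδ
  obtain ⟨C₁, hC₁, hk₁⟩ := exists_lpn_cv_fracKer_le (κ := κ) (e := a - κ + δ) hκ (by linarith)
    (by linarith)
  obtain ⟨C₂, hC₂, hk₂⟩ := exists_lpn_cv_fracKer_le (κ := κ) (e := a - κ - δ) hκ (by linarith)
    (by linarith)
  have ha0 : 0 < a := by linarith
  refine ⟨2 * a / δ * (C₁ + C₂), by positivity, fun y h η hy hh hfin hle hη hhη hsm => ?_⟩
  -- Multiplication by h in L^{1/κ} followed by fractional integration of order κ leads back to the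
  -- same exponent, so there is nothing to gain by bootstrapping. The weak bound is preserved
  -- instead, with its constant multiplied by Cη ≤ 1/2.
  set Q : ℝ≥0∞ → Prop := fun N => ∀ E, MeasurableSet E → volume E ≠ ∞ →
    ∫⁻ t in E, y t ≤ N * volume E ^ a with hQ
  have h0 : Q (lpn volume q y) := fun E hE _ => setLIntegral_le_lpn hq hy hE
  have hstep : ∀ N, N ≠ ∞ → Q N → Q (N / 2) := by
    intro N _ hN E hE hEfin
    rcases eq_or_ne (volume E) 0 with h0 | h0
    · rw [setLIntegral_measure_zero _ _ h0]
      exact zero_le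
    set Z := (volume E).toReal with hZ
    have hZ0 : 0 < Z := ENNReal.toReal_pos h0 hEfin
    have hEZ : volume E = ofReal Z := (ofReal_toReal hEfin).symm
    have h1E : Measurable (E.indicator (1 : ℝ → ℝ≥0∞)) := measurable_one.indicator hE
    have hkm : Measurable fun s => fracKer κ (-s) := (measurable_fracKer κ).comp measurable_neg
    have hcm := measurable_cv (μ := volume) hkm h1E
    have hdual : ∫⁻ t in E, y t ≤
        ∫⁻ t, y t * (h t * cv volume (fun s => fracKer κ (-s)) (E.indicator 1) t) := by
      calc ∫⁻ t in E, y t ≤ ∫⁻ t in E, cv volume (fracKer κ) (fun τ => h τ * y τ) t :=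
            lintegral_mono_ae (ae_restrict_of_ae hle)
        _ = ∫⁻ t, E.indicator 1 t * cv volume (fracKer κ) (fun τ => h τ * y τ) t := by
            rw [← lintegral_indicator hE]
            refine lintegral_congr fun t => ?_
            by_cases ht : t ∈ E <;> simp [ht]
        _ = _ := by
            rw [lintegral_mul_cv (F := fun τ => h τ * y τ) (measurable_fracKer κ) (hh.mul hy) h1E]
            refine lintegral_congr fun t => ?_
            ring
    have hkey : ∀ e : ℝ, 0 < e → ∀ C : ℝ, 0 < C → C ≤ C₁ + C₂ →
        lpn volume (1 / e) (cv volume (fun s => fracKer κ (-s)) (E.indicator 1)) ≤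
          ofReal (C * Z ^ (κ + e)) →
        lpn volume (1 / (κ + e))
          (fun t => h t * cv volume (fun s => fracKer κ (-s)) (E.indicator 1) t) ≤
          ofReal ((C₁ + C₂) * η * Z ^ (κ + e)) := by
      intro e he C hC hCC hb
      refine (lpn_mul_le (s := 1 / κ) (t := 1 / e) (by positivity) (by positivity) (by positivity)
        (by simp only [one_div_one_div]) hh hcm).trans ((mul_le_mul' hhη hb).trans ?_)
      rw [← ofReal_mul hη.le]
      refine ofReal_le_ofReal ?_
      calc η * (C * Z ^ (κ + e)) ≤ η * ((C₁ + C₂) * Z ^ (κ + e)) := by gcongr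
        _ = _ := by ring
    have b1 := hkey (a - κ + δ) (by linarith) C₁ hC₁ (by linarith) (hk₁ E Z hE hZ0 hEZ)
    have b2 := hkey (a - κ - δ) (by linarith) C₂ hC₂ (by linarith) (hk₂ E Z hE hZ0 hEZ)
    rw [show κ + (a - κ + δ) = a + δ by ring, rpow_add hZ0, ← mul_assoc] at b1
    rw [show κ + (a - κ - δ) = a + -δ by ring, rpow_add hZ0, ← mul_assoc,
      ← sub_eq_add_neg] at b2
    have hw := lintegral_mul_le_of_weak (μ := volume) hδ0 (by linarith) hy (hh.mul hcm) hN
      (B := (C₁ + C₂) * η * Z ^ a) (by positivity) hZ0 b1 b2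
    refine hdual.trans (hw.trans ?_)
    have h2 : (2 : ℝ≥0∞)⁻¹ = ofReal (1 / 2) := by
      rw [one_div, ENNReal.ofReal_inv_of_pos two_pos, ENNReal.ofReal_ofNat]
    rw [mul_left_comm, ← ofReal_mul (by positivity), hEZ, ofReal_rpow_of_pos hZ0,
      div_eq_mul_inv N, mul_assoc N, h2, ← ofReal_mul (by norm_num)]
    refine mul_le_mul_right (ofReal_le_ofReal ?_) _
    calc 2 * a / δ * ((C₁ + C₂) * η * Z ^ a) = 2 * a / δ * (C₁ + C₂) * η * Z ^ a := by ring
      _ ≤ 1 / 2 * Z ^ a := by gcongr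
  have hzero : ∀ E, MeasurableSet E → volume E < ∞ → ∫⁻ t in E, y t = ∫⁻ t in E, 0 := by
    intro E hE hfinE
    rw [lintegral_zero]
    exact eq_zero_of_halving hfin h0 hstep (rpow_ne_top_of_nonneg ha0.le hfinE.ne)
      fun M hM => hM E hE hfinE.ne
  exact ae_eq_of_forall_setLIntegral_eq_of_sigmaFinite hy measurable_zero hzero

end WeakTime

/-! ### The difference of two mild solutions -/

section Difference

variable {𝕜 : Type*} [RCLike 𝕜] {n : ℕ} {α b σ r : ℝ}

lemma cv_mono_ae {k F G : Eu n → ℝ≥0∞} (h : ∀ᵐ y, F y ≤ G y) (x : Eu n) :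
    cv volume k F x ≤ cv volume k G x := by
  refine lintegral_mono_ae ?_
  filter_upwards [(quasiMeasurePreserving_sub_left volume x).ae h] with y hy
  gcongr

lemma cv_eq_lintegral_sub (k F : ℝ → ℝ≥0∞) (t : ℝ) : cv volume k F t = ∫⁻ τ, k (t - τ) * F τ := by
  rw [cv, ← lintegral_sub_left_eq_self (fun y => k y * F (t - y)) t]
  simp only [sub_sub_cancel]

/-- The linear parts cancel, and the integrand vanishes up to t₀, where the solutions agree, so only
(t₀, t) contributes. -/
lemma exists_enorm_sub_le_of_eqOn (𝕜 : Type*) [RCLike 𝕜] (hn : 0 < n) (hα : 1 / 2 < α) (a : Eu n) :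
    ∃ C : ℝ, 0 < C ∧ ∀ (b σ r : ℝ) (φ : LpEu 𝕜 n (ofReal r))
      (I : Set ℝ) (u v : ℝ → LpEu 𝕜 n (ofReal r)) (T t₀ t : ℝ)
      (U V : ℝ → Eu n → 𝕜), IsMildSolution α b σ a φ I u → IsMildSolution α b σ a φ I v →
      (∀ τ ∈ Icc 0 T, u τ =ᵐ[volume] U τ) → (∀ τ ∈ Icc 0 T, v τ =ᵐ[volume] V τ) →
      0 ≤ t₀ → EqOn u v (Icc 0 t₀) → t ∈ I → t₀ < t → t ≤ T → ∀ᵐ x, ‖U t x - V t x‖ₑ ≤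
        ofReal C * ∫⁻ τ in Ioo t₀ t, cv volume (jk ((t - τ) ^ (1 / (2 * α))))
          (fun y => ‖nonlin σ b (U τ y) - nonlin σ b (V τ y)‖ₑ) x := by
  obtain ⟨C, hC, hb⟩ := exists_enorm_duh_sub_le 𝕜 hn hα a
  refine ⟨C, hC, fun b σ r φ I u v T t₀ t U V hu hv hU hV ht₀ heq ht htt htT => ?_⟩
  have ht0 : 0 < t := ht₀.trans_lt htt
  have htm : t ∈ Icc 0 T := ⟨ht0.le, htT⟩
  filter_upwards [hU t htm, hV t htm, hu.duhamel t ht ht0, hv.duhamel t ht ht0,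
    hu.conv_exists t ht ht0, hv.conv_exists t ht ht0, hu.integrable t ht ht0,
    hv.integrable t ht ht0] with x h1 h2 h3 h4 h5 h6 h7 h8
  rw [← h1, ← h2, h3, h4, add_sub_add_left_eq_sub]
  refine (hb (fun τ y => nonlin σ b (u τ y)) (fun τ y => nonlin σ b (v τ y)) t x ⟨h5, h7⟩
    ⟨h6, h8⟩).trans (mul_le_mul_right ?_ _)
  have e : Ioo t₀ t = Ioi t₀ ∩ Ioo 0 t := by
    ext τ
    exact ⟨fun h => ⟨h.1, ht₀.trans_lt h.1, h.2⟩, fun h => ⟨h.1, h.2.2⟩⟩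
  rw [e, ← Measure.restrict_restrict measurableSet_Ioi, ← lintegral_indicator measurableSet_Ioi, maj]
  refine setLIntegral_mono' measurableSet_Ioo fun τ hτ => ?_
  have hτm : τ ∈ Icc 0 T := ⟨hτ.1.le, hτ.2.le.trans htT⟩
  rcases le_or_gt τ t₀ with h | h
  · rw [indicator_of_notMem (by simpa using h), heq ⟨hτ.1.le, h⟩]
    simp [cv]
  · rw [indicator_of_mem (mem_Ioi.2 h)]
    refine cv_mono_ae ?_ x
    filter_upwards [hU τ hτm, hV τ hτm] with y hy1 hy2
    rw [hy1, hy2]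

/-- Absolute continuity of the integral. The bound t₁ ≤ t₀ + 1 keeps time lags below 1, where powers
of the lag can be compared. -/
lemma exists_lpn_indicator_Ioo_le {F : ℝ → ℝ≥0∞} {m t₀ T : ℝ} (hm : 0 < m) (hT : t₀ < T)
    (h : lpn (volume.restrict (Ioo t₀ T)) m F ≠ ∞) {η : ℝ} (hη : 0 < η) :
    ∃ t₁, t₀ < t₁ ∧ t₁ ≤ T ∧ t₁ ≤ t₀ + 1 ∧ lpn volume m ((Ioo t₀ t₁).indicator F) ≤ ofReal η := by
  have hfin : ∫⁻ t in Ioo t₀ T, F t ^ m ≠ ∞ := by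
    intro h'
    rw [lpn, h', ENNReal.top_rpow_of_pos (by positivity)] at h
    exact h rfl
  obtain ⟨δ, hδ, hs⟩ := exists_pos_setLIntegral_lt_of_measure_lt hfin
    (ε := ofReal η ^ m) (by simp [hη, hm.not_gt])
  obtain ⟨c, hc0, hcδ⟩ : ∃ c : ℝ, 0 < c ∧ ofReal c < δ := by
    obtain ⟨c, h1, h2⟩ := ENNReal.lt_iff_exists_nnreal_btwn.1 hδ
    exact ⟨c, by exact_mod_cast h1, by simpa using h2⟩
  set t₁ := min (min T (t₀ + 1)) (t₀ + c) with ht₁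
  refine ⟨t₁, lt_min (lt_min hT (by linarith)) (by linarith),
    (min_le_left _ _).trans (min_le_left _ _), (min_le_left _ _).trans (min_le_right _ _), ?_⟩
  have hsub : Ioo t₀ t₁ ∩ Ioo t₀ T = Ioo t₀ t₁ :=
    inter_eq_left.2 (Ioo_subset_Ioo_right ((min_le_left _ _).trans (min_le_left _ _)))
  have h1 := hs (Ioo t₀ t₁) (by
    rw [Measure.restrict_apply measurableSet_Ioo, hsub, Real.volume_Ioo]
    refine (ofReal_le_ofReal ?_).trans_lt hcδ
    linarith [min_le_right (min T (t₀ + 1)) (t₀ + c)])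
  rw [Measure.restrict_restrict measurableSet_Ioo, hsub] at h1
  have h2 : ∫⁻ t, ((Ioo t₀ t₁).indicator F t) ^ m = ∫⁻ t in Ioo t₀ t₁, F t ^ m := by
    rw [← lintegral_indicator measurableSet_Ioo]
    refine lintegral_congr fun t => ?_
    by_cases ht : t ∈ Ioo t₀ t₁
    · simp only [indicator_of_mem ht]
    · simp only [indicator_of_notMem ht, zero_rpow_of_pos hm]
  rw [lpn, h2]
  refine (rpow_le_rpow h1.le (by positivity)).trans_eq ?_
  rw [← ENNReal.rpow_mul, mul_one_div_cancel hm.ne', rpow_one]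

lemma lpn_space_time_ne_top {I : Set ℝ} {u : ℝ → LpEu 𝕜 n (ofReal r)}
    {q p T : ℝ} [Fact (1 ≤ ofReal r)] [Fact (1 ≤ ofReal p)] (hq : 0 < q) (hp : 0 < p)
    (hu : MemX (ofReal q) (ofReal p) I u) (hI : Icc 0 T ⊆ I) {U : ℝ → Eu n → 𝕜}
    (hU : ∀ τ ∈ Icc 0 T, u τ =ᵐ[volume] U τ) :
    lpn (volume.restrict (Icc 0 T)) q (fun τ => lpn volume p (fun x => ‖U τ x‖ₑ)) ≠ ∞ := by
  obtain ⟨v, hv, hvu⟩ := hu.memLp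
  have h1 : eLpNorm v (ofReal q) (volume.restrict (Icc 0 T)) < ∞ :=
    (hv.mono_measure (Measure.restrict_mono_set volume hI)).2
  rw [eLpNorm_eq_lpn hq] at h1
  rw [← lpn_congr_ae (F := fun τ => ‖v τ‖ₑ)]
  · exact h1.ne
  · filter_upwards [ae_restrict_of_ae_restrict_of_subset hI hvu,
      ae_restrict_mem measurableSet_Icc] with τ h2 h3
    exact enorm_eq_lpn hp (h2.trans (hU τ h3))

lemma exists_norm_bound {E : Type*} [NormedAddCommGroup E] {u : ℝ → E} {T : ℝ}
    (hu : ContinuousOn u (Icc 0 T)) : ∃ R : ℝ, 0 ≤ R ∧ ∀ τ ∈ Icc 0 T, ‖u τ‖ ≤ R := by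
  obtain ⟨R, hR⟩ := isCompact_Icc.exists_bound_of_continuousOn hu
  exact ⟨max R 0, le_max_right _ _, fun τ hτ => (hR τ hτ).trans (le_max_left _ _)⟩

lemma measurable_lintegral_Ioo_cv {F : ℝ → Eu n → ℝ≥0∞} (hF : Measurable (uncurry F))
    (t₀ t : ℝ) : Measurable fun x => ∫⁻ τ in Ioo t₀ t,
      cv volume (jk ((t - τ) ^ (1 / (2 * α)))) (F τ) x :=
  (measurable_maj_integrand hF t).lintegral_prod_left'

lemma lpn_lintegral_Ioo_cv_le {F : ℝ → Eu n → ℝ≥0∞} (hF : Measurable (uncurry F))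
    {m : ℝ} (hm : 1 ≤ m) (t₀ t : ℝ) :
    lpn volume m (fun x => ∫⁻ τ in Ioo t₀ t, cv volume (jk ((t - τ) ^ (1 / (2 * α)))) (F τ) x) ≤
      ∫⁻ τ in Ioo t₀ t, lpn volume m (cv volume (jk ((t - τ) ^ (1 / (2 * α)))) (F τ)) :=
  lpn_lintegral_le hm (measurable_maj_integrand hF t)

end Difference

/-! ### Uniqueness when r < p -/

section UniquenessSpaceTime

variable {𝕜 : Type*} [RCLike 𝕜] {n : ℕ} {α b σ r p p₁ : ℝ}

/-- Interpolation between `L^∞ L^r` and `L^q L^p`. -/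
lemma lpn_interp_ne_top {q T R : ℝ} (h : KatoExponents n α b r p₁) (hp : p₁ < p)
    (hq : 1 / q = n / (2 * α) * (1 / r - 1 / p)) {U : ℝ → Eu n → 𝕜} (hUm : Measurable (uncurry U))
    (hR : ∀ τ ∈ Icc 0 T, lpn volume r (fun x => ‖U τ x‖ₑ) ≤ ofReal R)
    (hfin : lpn (volume.restrict (Icc 0 T)) q (fun τ => lpn volume p (fun x => ‖U τ x‖ₑ)) ≠ ∞) :
    lpn (volume.restrict (Icc 0 T)) (1 / katoExp n α r p₁)
      (fun τ => lpn volume p₁ (fun x => ‖U τ x‖ₑ)) ≠ ∞ := by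
  have hr0 := h.r_pos
  have hp10 := h.p₁_pos
  have hp0 : 0 < p := by linarith
  have hδ := h.katoExp_pos
  have hd := h.d_pos
  have y1 : 1 / p < 1 / p₁ := one_div_lt_one_div_of_lt hp10 hp
  have y2 : 1 / p₁ < 1 / r := one_div_lt_one_div_of_lt hr0 h.r_lt
  have hq0 : 0 < 1 / q := by rw [hq]; exact mul_pos hd (by linarith)
  set l := (1 / r - 1 / p₁) / (1 / r - 1 / p) with hl
  have hl0 : 0 < l := div_pos (by linarith) (by linarith)
  have hl1 : l < 1 := by rw [hl, div_lt_one (by linarith)]; linarith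
  have hle : l * (1 / r - 1 / p) = 1 / r - 1 / p₁ := div_mul_cancel₀ _ (by linarith)
  -- The pair (1/δ, p₁) lies on the same admissible line as (q, p), so the time exponent produced by
  -- interpolation is exactly 1/δ.
  have hlq : l * (1 / katoExp n α r p₁) = q := by
    have e : katoExp n α r p₁ = l * (1 / q) := by
      rw [katoExp, hq, ← hle]; ring
    rw [e]
    have := one_div_pos.1 hq0
    field_simp
  have hint : ∀ τ ∈ Icc 0 T, lpn volume p₁ (fun x => ‖U τ x‖ₑ) ≤
      ofReal R ^ (1 - l) * lpn volume p (fun x => ‖U τ x‖ₑ) ^ l := by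
    intro τ hτ
    have hUt : Measurable (U τ) := hUm.of_uncurry_left
    refine (lpn_interpolation (μ := volume) hp10 hr0 hp0 hl0.le hl1.le ?_ hUt.enorm).trans ?_
    · have e1 : (1 - l) / r = 1 / r - l * (1 / r) := by ring
      have e2 : l / p = l * (1 / p) := by ring
      rw [e1, e2]
      linarith
    · exact mul_le_mul' (rpow_le_rpow (hR τ hτ) (by linarith)) le_rfl
  have hm : Measurable fun τ => lpn volume p (fun x => ‖U τ x‖ₑ) :=
    ((hUm.enorm.pow_const p).lintegral_prod_right').pow_const _
  refine ne_top_of_le_ne_top ?_ (lpn_mono_ae (by positivity)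
    ((ae_restrict_mem measurableSet_Icc).mono hint))
  rw [lpn_const_mul (by positivity) (hm.pow_const l), lpn_rpow (by positivity) hl0, hlq]
  exact mul_ne_top (rpow_ne_top_of_nonneg (by linarith) ofReal_ne_top)
    (rpow_ne_top_of_nonneg hl0.le hfin)

/-- A nonnegative gap means that for s ≤ 1 the kernel power is at most s^{bδ-1}, with equality of
exponents in the critical case. Thus all r ≥ r₁ reduce to one fractional integral of order bδ. -/
lemma lpn_cv_nonlin_sub_le (h : KatoExponents n α b r p₁) (hσ : σ = 1 ∨ σ = -1) :
    ∃ C : ℝ, 0 < C ∧ ∀ (U V : Eu n → 𝕜) (s : ℝ), Measurable U → Measurable V → 0 < s → s ≤ 1 →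
      lpn volume p₁ (cv volume (jk (s ^ (1 / (2 * α))))
          (fun y => ‖nonlin σ b (U y) - nonlin σ b (V y)‖ₑ)) ≤
        fracKer (b * katoExp n α r p₁) s * (ofReal C *
          (lpn volume p₁ (fun x => ‖U x‖ₑ) ^ b + lpn volume p₁ (fun x => ‖V x‖ₑ) ^ b) *
            lpn volume p₁ (fun x => ‖U x - V x‖ₑ)) := by
  have hα := h.hα
  obtain ⟨C, hC, hcv⟩ := exists_lpn_cv_jk_time_le (α := α) (by linarith) n
  have hb0 := h.hb
  have hp0 := h.p₁_pos
  have hρ1 : 1 ≤ p₁ / (b + 1) := by rw [le_div_iff₀ (by linarith)]; linarith [h.b_lt]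
  have hρm : p₁ / (b + 1) ≤ p₁ := div_le_self hp0.le (by linarith)
  refine ⟨C * (2 + b), by positivity, fun U V s hU hV hs hs1 => ?_⟩
  have hF : Measurable fun y => ‖nonlin σ b (U y) - nonlin σ b (V y)‖ₑ :=
    ((measurable_nonlin.comp hU).sub (measurable_nonlin.comp hV)).enorm
  refine (hcv (p₁ / (b + 1)) p₁ s hρ1 hρm hs _ hF).trans ?_
  have h8 := lpn_nonlin_sub_le (μ := volume) hσ hb0 hρ1 hp0 hp0 (by rw [one_div_div]; ring) hU hV
  refine (mul_le_mul_right h8 _).trans ?_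
  have e1 : s ^ (-(1 / (2 * α)) - n / (2 * α) * (1 / (p₁ / (b + 1)) - 1 / p₁)) ≤
      s ^ (b * katoExp n α r p₁ - 1) := by
    refine Real.rpow_le_rpow_of_exponent_ge hs hs1 ?_
    have hgap := h.gap
    rw [gapExp] at hgap
    rw [katoExp, one_div_div]
    have e : (n : ℝ) / (2 * α) * (b / r) = b * (n / (2 * α) * (1 / r - 1 / p₁)) +
      n / (2 * α) * ((b + 1) / p₁ - 1 / p₁) := by ring
    linarith
  rw [fracKer, indicator_of_mem (mem_Ioi.2 hs), ← mul_assoc, ← mul_assoc, ← mul_assoc, ← mul_assoc,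
    ← ofReal_mul (by positivity), ← ofReal_mul (by positivity)]
  refine mul_le_mul_left (mul_le_mul_left (ofReal_le_ofReal ?_) _) _
  calc _ ≤ C * s ^ (b * katoExp n α r p₁ - 1) * (2 + b) := by gcongr
    _ = _ := by ring

/-- Local step of uniqueness in `C(L^r) ∩ L^q(L^p)`, `r < p`. -/
theorem KatoExponents.exists_eqOn_Ioc (h : KatoExponents n α b r p₁) (hσ : σ = 1 ∨ σ = -1)
    (a : Eu n) [Fact (1 ≤ ofReal r)] [Fact (1 ≤ ofReal p)] {q : ℝ} (hp : p₁ < p)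
    (hq : 1 / q = n / (2 * α) * (1 / r - 1 / p)) (hq0 : 0 < q) {φ : LpEu 𝕜 n (ofReal r)} {I : Set ℝ}
    {u v : ℝ → LpEu 𝕜 n (ofReal r)} {T t₀ : ℝ} (hu : IsMildSolution α b σ a φ I u)
    (hv : IsMildSolution α b σ a φ I v) (hu' : MemX (ofReal q) (ofReal p) I u)
    (hv' : MemX (ofReal q) (ofReal p) I v) (hI : Icc 0 T ⊆ I) (ht₀ : t₀ ∈ Ico 0 T)
    (heq : EqOn u v (Icc 0 t₀)) :
    ∃ t₁, t₀ < t₁ ∧ EqOn u v (Ioc t₀ t₁) := by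
  have hn := h.n_pos
  have hα := h.hα
  have hb0 := h.hb
  have hr0 := h.r_pos
  have hp10 := h.p₁_pos
  have hp0 : 0 < p := by linarith
  have hδ := h.katoExp_pos
  set δ := katoExp n α r p₁ with hδd
  have hcu := hu'.continuousOn.mono hI
  have hcv := hv'.continuousOn.mono hI
  obtain ⟨U, hUm, hU⟩ := exists_measurable_representative h.hr.le hcu
  obtain ⟨V, hVm, hV⟩ := exists_measurable_representative h.hr.le hcv
  obtain ⟨C₁, hC₁, hdiff⟩ := exists_enorm_sub_le_of_eqOn 𝕜 hn hα a
  obtain ⟨C₂, hC₂, hnl⟩ := lpn_cv_nonlin_sub_le (𝕜 := 𝕜) h hσ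
  -- The distance lies in L^{1/δ} and the coefficient in L^{1/(bδ)}; the requirement 1/q + κ < 1
  -- becomes (b+1)δ < 1, which is `time`.
  obtain ⟨C₃, hC₃, hzero⟩ := exists_ae_eq_zero_of_le_fracKer (q := 1 / δ) (κ := b * δ)
    (by rw [lt_div_iff₀ hδ, one_mul]; nlinarith [h.time]) (by positivity)
    (by rw [one_div_one_div]; linarith [h.time])
  have hfinq : ∀ {w : ℝ → LpEu 𝕜 n (ofReal r)} {W : ℝ → Eu n → 𝕜},
      MemX (ofReal q) (ofReal p) I w → ContinuousOn w (Icc 0 T) →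
      Measurable (uncurry W) → (∀ τ ∈ Icc 0 T, w τ =ᵐ[volume] W τ) →
      lpn (volume.restrict (Icc 0 T)) (1 / δ) (fun τ => lpn volume p₁ (fun x => ‖W τ x‖ₑ)) ≠ ∞ := by
    intro w W hw hcw hWm hW
    obtain ⟨R, -, hR⟩ := exists_norm_bound hcw
    refine lpn_interp_ne_top (R := R) h hp hq hWm (fun τ hτ => ?_)
      (lpn_space_time_ne_top hq0 hp0 hw hI hW)
    rw [← enorm_eq_lpn hr0 (hW τ hτ), ← ofReal_norm]
    exact ofReal_le_ofReal (hR τ hτ)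
  have hfu := hfinq hu' hcu hUm hU
  have hfv := hfinq hv' hcv hVm hV
  have hmp : ∀ {W : ℝ → Eu n → 𝕜}, Measurable (uncurry W) →
      Measurable fun τ => lpn volume p₁ (fun x => ‖W τ x‖ₑ) := fun hW =>
    ((hW.enorm.pow_const p₁).lintegral_prod_right').pow_const _
  have hmU := hmp hUm
  have hmV := hmp hVm
  have hmW : Measurable fun τ => lpn volume p₁ (fun x => ‖U τ x - V τ x‖ₑ) := hmp (hUm.sub hVm)
  have hres : volume.restrict (Ioo t₀ T) ≤ (volume.restrict (Icc 0 T) : Measure ℝ) :=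
    Measure.restrict_mono_set volume fun τ hτ => ⟨ht₀.1.trans hτ.1.le, hτ.2.le⟩
  have hmono : ∀ {m : ℝ} {F : ℝ → ℝ≥0∞}, 0 < m → lpn (volume.restrict (Icc 0 T)) m F ≠ ∞ →
      lpn (volume.restrict (Ioo t₀ T)) m F ≠ ∞ := fun hm hF =>
    ne_top_of_le_ne_top hF (rpow_le_rpow (lintegral_mono' hres le_rfl) (by positivity))
  set g : ℝ → ℝ≥0∞ := fun τ => ofReal (C₁ * C₂) *
    (lpn volume p₁ (fun x => ‖U τ x‖ₑ) ^ b + lpn volume p₁ (fun x => ‖V τ x‖ₑ) ^ b) with hg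
  have hgm : Measurable g := ((hmU.pow_const b).add (hmV.pow_const b)).const_mul _
  have hbδ : 0 < 1 / (b * δ) := by positivity
  have hbδ1 : 1 ≤ 1 / (b * δ) := by
    rw [le_div_iff₀ (by positivity), one_mul]; nlinarith [h.time]
  have hgfin : lpn (volume.restrict (Ioo t₀ T)) (1 / (b * δ)) g ≠ ∞ := by
    refine hmono hbδ ?_
    have h1 : Measurable fun τ => lpn volume p₁ (fun x => ‖U τ x‖ₑ) ^ b +
      lpn volume p₁ (fun x => ‖V τ x‖ₑ) ^ b := (hmU.pow_const b).add (hmV.pow_const b)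
    rw [hg, lpn_const_mul hbδ h1]
    refine mul_ne_top ofReal_ne_top (ne_top_of_le_ne_top ?_
      (lpn_add_le hbδ1 (hmU.pow_const b) (hmV.pow_const b)))
    rw [lpn_rpow hbδ hb0, lpn_rpow hbδ hb0, show b * (1 / (b * δ)) = 1 / δ by field_simp]
    exact ENNReal.add_ne_top.2 ⟨rpow_ne_top_of_nonneg hb0.le hfu, rpow_ne_top_of_nonneg hb0.le hfv⟩
  -- Smallness comes from shortening the interval after t₀, not from the size of the solutions.
  obtain ⟨t₁, h01, h1T, h11, hsmall⟩ := exists_lpn_indicator_Ioo_le hbδ ht₀.2 hgfin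
    (η := 1 / (2 * C₃)) (by positivity)
  set y : ℝ → ℝ≥0∞ := (Ioo t₀ t₁).indicator fun τ => lpn volume p₁ (fun x => ‖U τ x - V τ x‖ₑ)
    with hy
  have hym : Measurable y := hmW.indicator measurableSet_Ioo
  have hle : ∀ t, y t ≤ cv volume (fracKer (b * δ)) (fun τ => (Ioo t₀ t₁).indicator g τ * y τ) t := by
    intro t
    by_cases ht : t ∈ Ioo t₀ t₁
    · rw [hy, indicator_of_mem ht]
      have htT : t ≤ T := ht.2.le.trans h1T
      have hd := hdiff b σ r φ I u v T t₀ t U V hu hv hU hV ht₀.1 heq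
        (hI ⟨ht₀.1.trans ht.1.le, htT⟩) ht.1 htT
      refine (lpn_mono_ae hp10 hd).trans ?_
      rw [lpn_const_mul hp10 (measurable_lintegral_Ioo_cv (measurable_nonlin_sub hUm hVm) t₀ t)]
      refine (mul_le_mul_right ((lpn_lintegral_Ioo_cv_le (measurable_nonlin_sub hUm hVm)
        h.one_lt_p₁.le t₀ t).trans (setLIntegral_mono' measurableSet_Ioo fun τ hτ =>
          hnl (U τ) (V τ) (t - τ) hUm.of_uncurry_left
            hVm.of_uncurry_left (by linarith [hτ.2])
            (by linarith [hτ.1, ht.2]))) _).trans ?_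
      rw [← lintegral_const_mul' _ _ ofReal_ne_top, cv_eq_lintegral_sub,
        ← lintegral_indicator measurableSet_Ioo]
      refine lintegral_mono fun τ => ?_
      by_cases hτ : τ ∈ Ioo t₀ t
      · have hτ' : τ ∈ Ioo t₀ t₁ := ⟨hτ.1, hτ.2.trans ht.2⟩
        rw [indicator_of_mem hτ, hg, indicator_of_mem hτ', indicator_of_mem hτ', ofReal_mul hC₁.le]
        exact le_of_eq (by ring)
      · rw [indicator_of_notMem hτ]
        exact zero_le
    · rw [hy, indicator_of_notMem ht]
      exact zero_le
  have hyfin : lpn volume (1 / δ) y ≠ ∞ := by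
    have e : lpn volume (1 / δ) y = lpn (volume.restrict (Ioo t₀ t₁)) (1 / δ)
        (fun τ => lpn volume p₁ (fun x => ‖U τ x - V τ x‖ₑ)) := by
      rw [lpn, lpn, ← lintegral_indicator measurableSet_Ioo]
      congr 1
      refine lintegral_congr fun τ => ?_
      by_cases hτ : τ ∈ Ioo t₀ t₁
      · simp only [hy, indicator_of_mem hτ]
      · simp only [hy, indicator_of_notMem hτ, zero_rpow_of_pos (one_div_pos.2 hδ)]
    have h1δ : 1 ≤ 1 / δ := by
      rw [le_div_iff₀ hδ, one_mul]; nlinarith [h.time]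
    have hsub : volume.restrict (Ioo t₀ t₁) ≤ (volume.restrict (Icc 0 T) : Measure ℝ) :=
      (Measure.restrict_mono_set volume (Ioo_subset_Ioo_right h1T)).trans hres
    rw [e]
    refine ne_top_of_le_ne_top (ENNReal.add_ne_top.2 ⟨hfu, hfv⟩) (le_trans
      (rpow_le_rpow (lintegral_mono' hsub le_rfl) (by positivity))
      (le_trans (lpn_mono (by positivity) fun τ => ?_) (lpn_add_le h1δ hmU hmV)))
    have m1 : ∀ {W : ℝ → Eu n → 𝕜}, Measurable (uncurry W) →
        Measurable fun x => ‖W τ x‖ₑ := fun hW =>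
      hW.of_uncurry_left.enorm
    refine (lpn_mono hp10 fun x => ?_).trans (lpn_add_le h.one_lt_p₁.le (m1 hUm) (m1 hVm))
    exact enorm_sub_le
  have hy0 := hzero y ((Ioo t₀ t₁).indicator g) (1 / (2 * C₃)) hym (hgm.indicator measurableSet_Ioo)
    hyfin (.of_forall hle) (by positivity) hsmall (by field_simp; norm_num)
  refine ⟨(t₀ + t₁) / 2, by linarith, fun t ht => ?_⟩
  have ht1 : t ∈ Ioo t₀ t₁ := ⟨ht.1, by linarith [ht.2]⟩
  have htT : t ∈ Icc 0 T := ⟨ht₀.1.trans ht.1.le, ht1.2.le.trans h1T⟩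
  -- The previous step gives vanishing for almost every time; inserting this into the integral
  -- inequality gives every time.
  have h0 : y t = 0 := by
    refine le_antisymm ((hle t).trans_eq ?_) zero_le
    rw [cv]
    refine (lintegral_congr_ae ?_).trans lintegral_zero
    filter_upwards [(quasiMeasurePreserving_sub_left volume t).ae hy0] with τ hτ
    rw [hτ, mul_zero, mul_zero]
  rw [hy, indicator_of_mem ht1] at h0
  have hsubm : Measurable fun x => ‖U t x - V t x‖ₑ :=
    (hUm.of_uncurry_left.sub hVm.of_uncurry_left).enorm
  refine Lp.ext ?_
  filter_upwards [hU t htT, hV t htT, ae_eq_zero_of_lpn_eq_zero hp10 hsubm h0] with x h1 h2 h3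
  rw [h1, h2]
  exact sub_eq_zero.1 (enorm_eq_zero.1 h3)

end UniquenessSpaceTime

/-! ### Weak-type estimates in space -/

section WeakSpace

variable {n : ℕ} {α : ℝ}

/-- Hölder with H in L^{1/β} and smoothing of the indicator of E give two norms of the product, at
1/(a+δ) and 1/(a-δ), differing by powers of s^d; hence s^d plays the part of Z in the duality lemma.
The two choices of e measure the indicator with different powers of |E|. -/
lemma exists_lintegral_mul_cv_weak_le (hα : 1 / 2 < α) (hn : 0 < n) {a β δ : ℝ} (hβ : 0 < β)
    (hδ : 0 < δ) (h1 : δ < a - β) (h2 : 2 * δ ≤ β) (h3 : a + δ ≤ 1) :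
    ∃ C : ℝ, 0 < C ∧ ∀ (W H : Eu n → ℝ≥0∞) (s e : ℝ) (E : Set (Eu n)) (N : ℝ≥0∞) (Z η : ℝ),
      Measurable W → Measurable H → 0 < s → (e = a - δ ∨ e = a + δ) → MeasurableSet E → 0 < Z →
      volume E = ofReal Z → 0 < η →
      (∀ S, MeasurableSet S → volume S ≠ ∞ → ∫⁻ x in S, W x ≤ N * volume S ^ a) →
      lpn volume (1 / β) H ≤ ofReal η →
      ∫⁻ x, W x * (H x * cv volume (jk (s ^ (1 / (2 * α)))) (E.indicator 1) x) ≤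
        ofReal (C * η * s ^ (-(1 / (2 * α)) - n / (2 * α) * (e - a + β)) * Z ^ e) * N := by
  have hα0 : 0 < α := by linarith
  obtain ⟨C, hC, hcv⟩ := exists_lpn_cv_jk_time_le hα0 n
  have hn' : (0 : ℝ) < n := by exact_mod_cast hn
  set d := (n : ℝ) / (2 * α) with hd
  have ha : 0 < a := by linarith
  refine ⟨2 * a / δ * C, by positivity, fun W H s e E N Z η hW hH hs he hE hZ hEZ hη hN hHη => ?_⟩
  have he0 : a - δ ≤ e := by rcases he with rfl | rfl <;> linarith
  have he1 : e ≤ 1 := by rcases he with rfl | rfl <;> linarith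
  have hep : 0 < e := by linarith
  have h1E : Measurable (E.indicator (1 : Eu n → ℝ≥0∞)) := measurable_one.indicator hE
  have hcm := measurable_cv (μ := volume) (measurable_jk (n := n) (s ^ (1 / (2 * α)))) h1E
  set B : ℝ := C * η * s ^ (-(1 / (2 * α)) - d * (e - a + β)) * Z ^ e with hB
  have hsd : 0 < s ^ d := by positivity
  have hkey : ∀ c : ℝ, 0 < c → c ≤ e → lpn volume (1 / (β + c))
      (fun x => H x * cv volume (jk (s ^ (1 / (2 * α)))) (E.indicator 1) x) ≤
        ofReal (C * η * s ^ (-(1 / (2 * α)) - d * (e - c)) * Z ^ e) := by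
    intro c hc hce
    have b1 := hcv (1 / e) (1 / c) s (by rw [le_div_iff₀ hep]; linarith)
      (one_div_le_one_div_of_le hc hce) hs _ h1E
    rw [lpn_indicator_one (by positivity) hE, hEZ, ofReal_rpow_of_pos hZ,
      ← ofReal_mul (by positivity), one_div_one_div, one_div_one_div] at b1
    refine (lpn_mul_le (s := 1 / β) (t := 1 / c) (by positivity) (by positivity) (by positivity)
      (by simp only [one_div_one_div]) hH hcm).trans ((mul_le_mul' hHη b1).trans_eq ?_)
    rw [← ofReal_mul hη.le]
    congr 1
    ring
  have b1 := hkey (a - β + δ) (by linarith) (by linarith)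
  have b2 := hkey (a - β - δ) (by linarith) (by linarith)
  rw [show β + (a - β + δ) = a + δ by ring, show C * η *
      s ^ (-(1 / (2 * α)) - d * (e - (a - β + δ))) * Z ^ e = B * (s ^ d) ^ δ by
    rw [hB, ← rpow_mul hs.le, show -(1 / (2 * α)) - d * (e - (a - β + δ)) =
      -(1 / (2 * α)) - d * (e - a + β) + d * δ by ring, rpow_add hs]
    ring] at b1
  rw [show β + (a - β - δ) = a - δ by ring, show C * η *
      s ^ (-(1 / (2 * α)) - d * (e - (a - β - δ))) * Z ^ e = B * (s ^ d) ^ (-δ) by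
    rw [hB, ← rpow_mul hs.le, show -(1 / (2 * α)) - d * (e - (a - β - δ)) =
      -(1 / (2 * α)) - d * (e - a + β) + d * -δ by ring, rpow_add hs]
    ring] at b2
  have hw := lintegral_mul_le_of_weak (μ := volume) hδ (by linarith) hW (hH.mul hcm) hN
      (B := B) (by positivity) hsd b1 b2
  refine hw.trans_eq ?_
  rw [mul_comm N, ← mul_assoc, ← ofReal_mul (by positivity), hB]
  congr 2
  ring

/-- With e = a - δ for short time lags and e = a + δ for long ones, the lag s appears as s^{-1+dδ}
and s^{-1-dδ}, integrable at 0 and at infinity; cutting at s = |E|^{1/d} turns both into |E|^a. The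
choice e = a would leave the divergent s^{-1} when the gap vanishes. A positive gap only adds a
power of t - t₀. -/
lemma exists_setLIntegral_weak_le (hα : 1 / 2 < α) (hn : 0 < n) {a β : ℝ} (hβ : 0 < β)
    (hβa : β < a) (ha1 : a < 1) (hgap : 0 ≤ 1 - 1 / (2 * α) - n / (2 * α) * β) :
    ∃ C : ℝ, 0 < C ∧ ∀ (W H : ℝ → Eu n → ℝ≥0∞) (t₀ t : ℝ) (E : Set (Eu n)) (N : ℝ≥0∞) (η : ℝ),
      (∀ τ, Measurable (W τ)) → (∀ τ, Measurable (H τ)) → t₀ < t → MeasurableSet E →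
      volume E ≠ ∞ → 0 < η →
      (∀ τ ∈ Ioo t₀ t, ∀ S, MeasurableSet S → volume S ≠ ∞ → ∫⁻ x in S, W τ x ≤ N * volume S ^ a) →
      (∀ τ ∈ Ioo t₀ t, lpn volume (1 / β) (H τ) ≤ ofReal η) →
      ∫⁻ τ in Ioo t₀ t, ∫⁻ x, W τ x *
          (H τ x * cv volume (jk ((t - τ) ^ (1 / (2 * α)))) (E.indicator 1) x) ≤
        ofReal (C * η * (t - t₀) ^ (1 - 1 / (2 * α) - n / (2 * α) * β)) * (N * volume E ^ a) := by
  obtain ⟨δ, hδ, hδ'⟩ : ∃ δ : ℝ, 0 < δ ∧ δ < min (a - β) (min (β / 2) (1 - a)) :=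
    exists_between (lt_min (by linarith) (lt_min (by linarith) (by linarith)))
  obtain ⟨g1, g23⟩ := lt_min_iff.1 hδ'
  obtain ⟨g2, g3⟩ := lt_min_iff.1 g23
  obtain ⟨C, hC, hwk⟩ := exists_lintegral_mul_cv_weak_le (n := n) hα hn hβ hδ g1 (by linarith)
    (by linarith)
  have hα0 : 0 < α := by linarith
  have hn' : (0 : ℝ) < n := by exact_mod_cast hn
  set d := (n : ℝ) / (2 * α) with hd
  have hd0 : 0 < d := by positivity
  set γ := 1 - 1 / (2 * α) - d * β with hγ
  have ha : 0 < a := by linarith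
  have hdδ : 0 < d * δ := by positivity
  refine ⟨2 * C / (d * δ), by positivity,
    fun W H t₀ t E N η hW hH ht hE hEfin hη hN hHη => ?_⟩
  have h1E : Measurable (E.indicator (1 : Eu n → ℝ≥0∞)) := measurable_one.indicator hE
  rcases eq_or_ne (volume E) 0 with h0 | h0
  · have : ∀ τ x, cv volume (jk ((t - τ) ^ (1 / (2 * α)))) (E.indicator 1) x = 0 := by
      intro τ x
      rw [cv]
      refine (lintegral_congr_ae ?_).trans lintegral_zero
      have h1 : ∀ᵐ y : Eu n, y ∉ E := measure_eq_zero_iff_ae_notMem.1 h0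
      filter_upwards [(quasiMeasurePreserving_sub_left volume x).ae h1] with y hy
      rw [indicator_of_notMem hy, mul_zero]
    simp only [this, mul_zero, lintegral_zero]
    exact zero_le
  set Z := (volume E).toReal with hZ
  have hZ0 : 0 < Z := ENNReal.toReal_pos h0 hEfin
  have hEZ : volume E = ofReal Z := (ofReal_toReal hEfin).symm
  have htt : 0 < t - t₀ := by linarith
  set z := Z ^ (1 / d) with hz
  have hz0 : 0 < z := by positivity
  have hzd : ∀ c : ℝ, z ^ (d * c) = Z ^ c := fun c => by
    rw [hz, ← rpow_mul hZ0.le]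
    congr 1
    field_simp
  set A : ℝ := C * η * (t - t₀) ^ γ with hA
  have hA0 : 0 ≤ A := by positivity
  set G₁ : ℝ → ℝ≥0∞ := fun s => ofReal (A * Z ^ (a - δ)) * N * ofReal (s ^ (-(1 - d * δ))) with hG₁
  set G₂ : ℝ → ℝ≥0∞ := fun s => ofReal (A * Z ^ (a + δ)) * N * ofReal (s ^ (-1 - d * δ)) with hG₂
  set G : ℝ → ℝ≥0∞ := fun s => (Ioo 0 z).indicator G₁ s + (Ici z).indicator G₂ s with hG
  have hbound : ∀ s e : ℝ, 0 < s → s < t - t₀ →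
      C * η * s ^ (-(1 / (2 * α)) - d * (e - a + β)) * Z ^ e ≤
        A * Z ^ e * s ^ (-1 - d * (e - a)) := by
    intro s e hs hst
    have e1 : s ^ (-(1 / (2 * α)) - d * (e - a + β)) = s ^ γ * s ^ (-1 - d * (e - a)) := by
      rw [← rpow_add hs]
      congr 1
      rw [hγ]
      ring
    have e2 : s ^ γ ≤ (t - t₀) ^ γ := Real.rpow_le_rpow hs.le hst.le hgap
    calc C * η * s ^ (-(1 / (2 * α)) - d * (e - a + β)) * Z ^ e
        = C * η * s ^ γ * Z ^ e * s ^ (-1 - d * (e - a)) := by rw [e1]; ring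
      _ ≤ _ := by rw [hA]; gcongr
  have hle : ∀ τ ∈ Ioo t₀ t, ∫⁻ x, W τ x *
      (H τ x * cv volume (jk ((t - τ) ^ (1 / (2 * α)))) (E.indicator 1) x) ≤ G (t - τ) := by
    intro τ hτ
    have hs : 0 < t - τ := by linarith [hτ.2]
    have hst : t - τ < t - t₀ := by linarith [hτ.1]
    have hb : ∀ e, e = a - δ ∨ e = a + δ → _ := fun e he =>
      (hwk (W τ) (H τ) (t - τ) e E N Z η (hW τ) (hH τ) hs he hE hZ0 hEZ hη (hN τ hτ) (hHη τ hτ)).trans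
        (mul_le_mul_left (ofReal_le_ofReal (hbound (t - τ) e hs hst)) N)
    simp only [hG]
    rcases lt_or_ge (t - τ) z with h | h
    · refine (hb _ (Or.inl rfl)).trans (le_trans (le_of_eq ?_) le_self_add)
      rw [indicator_of_mem (show t - τ ∈ Ioo 0 z from ⟨hs, h⟩), hG₁,
        ofReal_mul (by positivity), show -1 - d * (a - δ - a) = -(1 - d * δ) by ring]
      ring
    · refine (hb _ (Or.inr rfl)).trans (le_trans (le_of_eq ?_) le_add_self)
      rw [indicator_of_mem (show t - τ ∈ Ici z from h), hG₂,
        ofReal_mul (by positivity), show -1 - d * (a + δ - a) = -1 - d * δ by ring]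
      ring
  have hm₁ : Measurable fun s : ℝ => ofReal (s ^ (-(1 - d * δ))) := by fun_prop
  have hm₂ : Measurable fun s : ℝ => ofReal (s ^ (-1 - d * δ)) := by fun_prop
  calc _ ≤ ∫⁻ τ in Ioo t₀ t, G (t - τ) := setLIntegral_mono' measurableSet_Ioo hle
    _ = ∫⁻ s in Ioo 0 (t - t₀), G s := setLIntegral_Ioo_reflect G t₀ t
    _ ≤ ∫⁻ s, G s := setLIntegral_le_lintegral _ _
    _ = (∫⁻ s in Ioo 0 z, G₁ s) + ∫⁻ s in Ici z, G₂ s := by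
      rw [hG, lintegral_add_left ((hm₁.const_mul _).indicator measurableSet_Ioo),
        lintegral_indicator measurableSet_Ioo, lintegral_indicator measurableSet_Ici]
    _ = ofReal (A * Z ^ a / (d * δ)) * N + ofReal (A * Z ^ a / (d * δ)) * N := by
      congr 1
      · rw [hG₁, lintegral_const_mul _ hm₁, setLIntegral_Ioo_rpow (by linarith) hz0, mul_right_comm,
          ← ofReal_mul (by positivity), sub_sub_cancel, hzd]
        congr 2
        rw [show Z ^ a = Z ^ (a - δ) * Z ^ δ by rw [← rpow_add hZ0]; ring_nf]
        ring
      · rw [← Measure.restrict_congr_set Ioi_ae_eq_Ici, hG₂, lintegral_const_mul _ hm₂,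
          setLIntegral_Ioi_rpow (by linarith) hz0, mul_right_comm,
          ← ofReal_mul (by positivity), show -1 - d * δ + 1 = d * -δ by ring, hzd]
        congr 2
        rw [show Z ^ a = Z ^ (a + δ) * Z ^ (-δ) by rw [← rpow_add hZ0]; ring_nf]
        ring
    _ = _ := by
      rw [hEZ, ofReal_rpow_of_pos hZ0, ← add_mul, ← ofReal_add (by positivity) (by positivity),
        mul_comm N, ← mul_assoc, ← ofReal_mul (by positivity)]
      congr 2
      rw [hA]
      ring

end WeakSpace

/-! ### Uniqueness when p = r -/

section UniquenessSpace

lemma exists_mul_rpow_le {K s ε : ℝ} (hK : 0 < K) (hs : 0 < s) (hε : 0 < ε) :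
    ∃ c : ℝ, 0 < c ∧ K * c ^ s ≤ ε := by
  refine ⟨(ε / K) ^ (1 / s), by positivity, ?_⟩
  rw [← rpow_mul (by positivity), one_div_mul_cancel hs.ne', Real.rpow_one]
  field_simp
  exact le_rfl

lemma add_add_rpow_le {b : ℝ} (hb : 0 < b) (x y z : ℝ≥0∞) :
    (x + y + z) ^ b ≤ 3 ^ b * (x ^ b + y ^ b + z ^ b) := by
  set m := max x (max y z) with hm
  have h1 : x + y + z ≤ 3 * m := by
    have e : (3 : ℝ≥0∞) * m = m + m + m := by ring
    rw [e]
    exact add_le_add (add_le_add (le_max_left _ _) ((le_max_left _ _).trans (le_max_right _ _)))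
      ((le_max_right _ _).trans (le_max_right _ _))
  refine (rpow_le_rpow h1 hb.le).trans ?_
  rw [mul_rpow_of_nonneg _ _ hb.le]
  refine mul_le_mul_right ?_ _
  rcases max_choice x (max y z) with h | h
  · rw [hm, h]; exact le_self_add.trans le_self_add
  · rcases max_choice y z with h' | h'
    · rw [hm, h, h']; exact le_add_self.trans le_self_add
    · rw [hm, h, h']; exact le_add_self

variable {𝕜 : Type*} [RCLike 𝕜] {n : ℕ} {α b σ r : ℝ}

lemma jk_neg (T : ℝ) : (fun x : Eu n => jk T (-x)) = jk T := by
  ext x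
  rw [jk, jk, norm_neg]

lemma setLIntegral_cv_jk {T : ℝ} {F : Eu n → ℝ≥0∞} (hF : Measurable F) {E : Set (Eu n)}
    (hE : MeasurableSet E) : ∫⁻ x in E, cv volume (jk T) F x =
      ∫⁻ x, F x * cv volume (jk T) (E.indicator 1) x := by
  have h1E : Measurable (E.indicator (1 : Eu n → ℝ≥0∞)) := measurable_one.indicator hE
  calc ∫⁻ x in E, cv volume (jk T) F x = ∫⁻ x, E.indicator 1 x * cv volume (jk T) F x := by
        rw [← lintegral_indicator hE]
        refine lintegral_congr fun x => ?_
        by_cases hx : x ∈ E <;> simp [hx]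
    _ = _ := by rw [lintegral_mul_cv (measurable_jk _) hF h1E, jk_neg]

lemma setLIntegral_Ioo_cv_le {F W H₁ : ℝ → Eu n → ℝ≥0∞} {H₂ : Eu n → ℝ≥0∞} {C t₀ t : ℝ}
    {E : Set (Eu n)} (hF : Measurable (uncurry F)) (hW : Measurable (uncurry W))
    (hH₁ : Measurable (uncurry H₁)) (hE : MeasurableSet E)
    (hle : ∀ τ x, F τ x ≤ ofReal C * (W τ x * (H₁ τ x + H₂ x))) {B₁ B₂ : ℝ≥0∞}
    (h1 : ∫⁻ τ in Ioo t₀ t, ∫⁻ x, W τ x *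
      (H₁ τ x * cv volume (jk ((t - τ) ^ (1 / (2 * α)))) (E.indicator 1) x) ≤ B₁)
    (h2 : ∫⁻ τ in Ioo t₀ t, ∫⁻ x, W τ x *
      (H₂ x * cv volume (jk ((t - τ) ^ (1 / (2 * α)))) (E.indicator 1) x) ≤ B₂) :
    ∫⁻ x in E, ∫⁻ τ in Ioo t₀ t, cv volume (jk ((t - τ) ^ (1 / (2 * α)))) (F τ) x ≤
      ofReal C * (B₁ + B₂) := by
  have h1E : Measurable (E.indicator (1 : Eu n → ℝ≥0∞)) := measurable_one.indicator hE
  set J : ℝ → Eu n → ℝ≥0∞ := fun τ => jk ((t - τ) ^ (1 / (2 * α))) with hJ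
  have hJE : Measurable (uncurry fun τ x => cv volume (J τ) (E.indicator 1) x) :=
    measurable_maj_integrand (α := α) (F := fun _ => E.indicator 1) (h1E.comp measurable_snd) t
  have hm : Measurable (uncurry fun τ x => W τ x *
      (H₁ τ x * cv volume (J τ) (E.indicator 1) x)) := hW.mul (hH₁.mul hJE)
  have hτ : ∀ τ, ∫⁻ x in E, cv volume (J τ) (F τ) x ≤ ofReal C *
      ((∫⁻ x, W τ x * (H₁ τ x * cv volume (J τ) (E.indicator 1) x)) +
        ∫⁻ x, W τ x * (H₂ x * cv volume (J τ) (E.indicator 1) x)) := by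
    intro τ
    have hmτ : Measurable fun x => W τ x * (H₁ τ x * cv volume (J τ) (E.indicator 1) x) :=
      hm.of_uncurry_left
    have hFτ : Measurable (F τ) := hF.of_uncurry_left
    rw [setLIntegral_cv_jk hFτ hE, ← lintegral_add_left hmτ,
      ← lintegral_const_mul' _ _ ofReal_ne_top]
    refine lintegral_mono fun x => (mul_le_mul_left (hle τ x) _).trans_eq ?_
    ring
  have hsw : AEMeasurable (uncurry fun x τ => cv volume (J τ) (F τ) x)
      ((volume.restrict E).prod (volume.restrict (Ioo t₀ t))) :=
    ((measurable_maj_integrand hF t).comp measurable_swap).aemeasurable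
  have mt : Measurable fun τ => ∫⁻ x, W τ x * (H₁ τ x * cv volume (J τ) (E.indicator 1) x) :=
    hm.lintegral_prod_right'
  rw [lintegral_lintegral_swap hsw]
  refine (lintegral_mono hτ).trans ?_
  rw [lintegral_const_mul' _ _ ofReal_ne_top, lintegral_add_left mt]
  gcongr

set_option maxHeartbeats 800000 in
/-- Local step of uniqueness in `C(L^r)`, `r > b + 1`. -/
theorem exists_eqOn_Ioc_of_continuousOn (hn : 0 < n) (hα : 1 / 2 < α) (hb : 0 < b) (hbr : b + 1 < r)
    (hgap : 0 ≤ gapExp n α b r) (hσ : σ = 1 ∨ σ = -1) (a : Eu n) [Fact (1 ≤ ofReal r)]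
    {φ : LpEu 𝕜 n (ofReal r)} {I : Set ℝ} {u v : ℝ → LpEu 𝕜 n (ofReal r)} {T t₀ : ℝ}
    (hu : IsMildSolution α b σ a φ I u) (hv : IsMildSolution α b σ a φ I v)
    (hcu : ContinuousOn u (Icc 0 T)) (hcv : ContinuousOn v (Icc 0 T)) (hI : Icc 0 T ⊆ I)
    (ht₀ : t₀ ∈ Ico 0 T) (heq : EqOn u v (Icc 0 t₀)) :
    ∃ t₁, t₀ < t₁ ∧ EqOn u v (Ioc t₀ t₁) := by
  have hr1 : 1 < r := by linarith
  have hr0 : 0 < r := by linarith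
  have hα0 : 0 < α := by linarith
  have hn' : (0 : ℝ) < n := by exact_mod_cast hn
  set d := (n : ℝ) / (2 * α) with hd
  have hd0 : 0 < d := by positivity
  rw [gapExp, ← hd] at hgap
  obtain ⟨U, hUm, hU⟩ := exists_measurable_representative hr1.le hcu
  obtain ⟨V, hVm, hV⟩ := exists_measurable_representative hr1.le hcv
  have hUt : ∀ τ, Measurable (U τ) := fun τ => hUm.of_uncurry_left
  have hVt : ∀ τ, Measurable (V τ) := fun τ => hVm.of_uncurry_left
  obtain ⟨C₁, hC₁, hdiff⟩ := exists_enorm_sub_le_of_eqOn 𝕜 hn hα a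
  set e := 1 - 1 / r with he
  set β := b / r with hβ
  have hβ0 : 0 < β := by positivity
  have hβe : β < e := by
    have : (b + 1) / r < 1 := by rw [div_lt_one hr0]; exact hbr
    rw [add_div] at this
    rw [he]
    linarith
  have he1 : e < 1 := by rw [he]; linarith [one_div_pos.2 hr0]
  have he0 : 0 < e := hβ0.trans hβe
  have hdβ : 0 < d * β := by positivity
  -- Two instances: β = b/r for coefficients small in L^{r/b}, possibly without any gain in time,
  -- and β/2 for coefficients bounded in L^{2r/b}, always with the positive power γ of the time
  -- elapsed.
  obtain ⟨C₂, hC₂, hweak₁⟩ := exists_setLIntegral_weak_le (n := n) hα hn hβ0 hβe he1 hgap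
  obtain ⟨C₃, hC₃, hweak₂⟩ := exists_setLIntegral_weak_le (n := n) hα hn (β := β / 2) (a := e)
    (by linarith) (by linarith) he1 (by linarith)
  set γ := 1 - 1 / (2 * α) - d * (β / 2) with hγ
  have hγ0 : 0 < γ := by linarith
  have h1β : 1 / β = r / b := by rw [hβ, one_div_div]
  have hβ1 : 1 ≤ 1 / β := by rw [le_div_iff₀ hβ0]; linarith
  have hβ2 : 1 ≤ 1 / (β / 2) := by rw [le_div_iff₀ (by linarith)]; linarith
  obtain ⟨ε, hε, hεs⟩ := exists_mul_rpow_le (K := C₁ * (2 + b) * (C₂ * (3 ^ b * 4))) (s := b)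
    (ε := 1 / 4) (by positivity) hb (by norm_num)
  set F₀ : Eu n → ℝ≥0∞ := fun x => ‖u t₀ x‖ₑ with hF₀
  have hF₀m : Measurable F₀ := (Lp.stronglyMeasurable (u t₀)).measurable.enorm
  have hF₀fin : lpn volume r F₀ ≠ ∞ := by
    rw [← enorm_eq_lpn hr0 (ae_eq_refl _)]
    exact enorm_ne_top
  -- The coefficients |u|^b and |v|^b are dominated through three pieces: the distance to u(t₀),
  -- small in L^r by continuity; the high part of u(t₀), small in L^r for large k; and its low part,
  -- which lies in L^{2r}.
  obtain ⟨k, hk⟩ := ((tendsto_lpn_indicator_lt hr0 hF₀m hF₀fin).eventually_lt_const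
    (ENNReal.ofReal_pos.2 hε)).exists
  set A : Set (Eu n) := {x | (k : ℝ≥0∞) < F₀ x} with hA
  have hAm : MeasurableSet A := measurableSet_lt measurable_const hF₀m
  have hA1 : Measurable (A.indicator F₀) := hF₀m.indicator hAm
  have hA2 : Measurable (Aᶜ.indicator F₀) := hF₀m.indicator hAm.compl
  have hLfin : lpn volume (2 * r) (Aᶜ.indicator F₀) ≠ ∞ :=
    lpn_indicator_le_ne_top hr0 (by linarith) hF₀m hF₀fin k
  set D : (ℝ → Eu n → 𝕜) → ℝ → Eu n → ℝ≥0∞ := fun W τ x => ‖W τ x - u t₀ x‖ₑ with hD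
  have hDm : ∀ {W : ℝ → Eu n → 𝕜}, Measurable (uncurry W) → Measurable (uncurry (D W)) := fun hW =>
    (hW.sub ((Lp.stronglyMeasurable (u t₀)).measurable.comp measurable_snd)).enorm
  set H₁ : ℝ → Eu n → ℝ≥0∞ := fun τ x => 3 ^ b * (D U τ x ^ b + D V τ x ^ b +
    (A.indicator F₀ x ^ b + A.indicator F₀ x ^ b)) with hH₁
  set H₂ : Eu n → ℝ≥0∞ := fun x => 3 ^ b * (Aᶜ.indicator F₀ x ^ b + Aᶜ.indicator F₀ x ^ b) with hH₂
  have hH₁m : Measurable (uncurry H₁) :=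
    ((((hDm hUm).pow_const b).add ((hDm hVm).pow_const b)).add
      (((hA1.comp measurable_snd).pow_const b).add
        ((hA1.comp measurable_snd).pow_const b))).const_mul _
  have hH₂m : Measurable H₂ := ((hA2.pow_const b).add (hA2.pow_const b)).const_mul _
  have hpt : ∀ τ x, ‖U τ x‖ₑ ^ b + ‖V τ x‖ₑ ^ b ≤ H₁ τ x + H₂ x := by
    intro τ x
    have h1 : ∀ W : ℝ → Eu n → 𝕜, ‖W τ x‖ₑ ^ b ≤
        3 ^ b * (D W τ x ^ b + A.indicator F₀ x ^ b + Aᶜ.indicator F₀ x ^ b) := by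
      intro W
      refine (rpow_le_rpow ?_ hb.le).trans (add_add_rpow_le hb _ _ _)
      rw [add_assoc, ← Pi.add_apply (A.indicator F₀) (Aᶜ.indicator F₀), indicator_self_add_compl]
      calc ‖W τ x‖ₑ = ‖(W τ x - u t₀ x) + u t₀ x‖ₑ := by rw [sub_add_cancel]
        _ ≤ _ := enorm_add_le _ _
    refine (add_le_add (h1 U) (h1 V)).trans_eq ?_
    simp only [hH₁, hH₂]
    ring
  have h3top : (3 : ℝ≥0∞) ^ b ≠ ∞ := rpow_ne_top_of_nonneg hb.le (by norm_num)
  have hlpb : ∀ {m : ℝ} {F : Eu n → ℝ≥0∞}, 0 < m →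
      lpn volume (m / b) (fun x => F x ^ b) = lpn volume m F ^ b := fun hm => by
    rw [lpn_rpow (by positivity) hb, mul_div_cancel₀ _ hb.ne']
  -- smallness in time
  have hclose : ∀ {w : ℝ → LpEu 𝕜 n (ofReal r)},
      ContinuousOn w (Icc 0 T) → w t₀ = u t₀ → ∃ c, 0 < c ∧ ∀ τ ∈ Icc 0 T, t₀ ≤ τ → τ < t₀ + c →
        edist (w τ) (u t₀) ≤ ofReal ε := by
    intro w hw hwt
    obtain ⟨c, hc, h⟩ := Metric.continuousOn_iff.1 hw t₀ ⟨ht₀.1, ht₀.2.le⟩ ε hε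
    refine ⟨c, hc, fun τ hτ h1 h2 => ?_⟩
    rw [edist_dist, ← hwt]
    refine ofReal_le_ofReal (h τ hτ ?_).le
    rw [Real.dist_eq, abs_of_nonneg (by linarith)]
    linarith
  obtain ⟨c₁, hc₁, hcl₁⟩ := hclose hcu rfl
  obtain ⟨c₂, hc₂, hcl₂⟩ := hclose hcv (heq ⟨ht₀.1, le_rfl⟩).symm
  set η₂ : ℝ := (lpn volume (1 / (β / 2)) H₂).toReal + 1 with hη₂
  have hη₂0 : 0 < η₂ := by positivity
  have hH₂fin : lpn volume (1 / (β / 2)) H₂ ≤ ofReal η₂ := by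
    have h1 : lpn volume (1 / (β / 2)) H₂ ≠ ∞ := by
      have h2 : 1 / (β / 2) = 2 * r / b := by rw [hβ]; field_simp
      have h3 : Measurable fun x => Aᶜ.indicator F₀ x ^ b + Aᶜ.indicator F₀ x ^ b :=
        (hA2.pow_const b).add (hA2.pow_const b)
      rw [hH₂, lpn_const_mul (by positivity) h3]
      refine mul_ne_top h3top (ne_top_of_le_ne_top ?_
        (lpn_add_le hβ2 (hA2.pow_const b) (hA2.pow_const b)))
      rw [h2, hlpb (by linarith)]
      have := rpow_ne_top_of_nonneg hb.le hLfin
      exact ENNReal.add_ne_top.2 ⟨this, this⟩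
    rw [← ofReal_toReal h1]
    exact ofReal_le_ofReal (by rw [hη₂]; linarith)
  obtain ⟨c₃, hc₃, hc₃s⟩ := exists_mul_rpow_le (K := C₁ * (2 + b) * (C₃ * η₂)) (s := γ)
    (ε := 1 / 4) (by positivity) hγ0 (by norm_num)
  set c := min (min c₁ c₂) (min c₃ 1) with hc
  have hc0 : 0 < c := lt_min (lt_min hc₁ hc₂) (lt_min hc₃ one_pos)
  have hcc1 : c ≤ c₁ := (min_le_left _ _).trans (min_le_left _ _)
  have hcc2 : c ≤ c₂ := (min_le_left _ _).trans (min_le_right _ _)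
  have hcc3 : c ≤ c₃ := (min_le_right _ _).trans (min_le_left _ _)
  have hcc4 : c ≤ 1 := (min_le_right _ _).trans (min_le_right _ _)
  set t₁ := min T (t₀ + c) with ht₁
  have ht01 : t₀ < t₁ := lt_min ht₀.2 (by linarith)
  have ht1T : t₁ ≤ T := min_le_left _ _
  have ht1c : t₁ ≤ t₀ + c := min_le_right _ _
  have hIcc : ∀ τ ∈ Ioo t₀ t₁, τ ∈ Icc 0 T := fun τ hτ => ⟨ht₀.1.trans hτ.1.le, hτ.2.le.trans ht1T⟩
  set η₁ : ℝ := 3 ^ b * 4 * ε ^ b with hη₁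
  have hη₁0 : 0 < η₁ := by positivity
  have hH₁s : ∀ τ ∈ Ioo t₀ t₁, lpn volume (1 / β) (H₁ τ) ≤ ofReal η₁ := by
    intro τ hτ
    have hτI := hIcc τ hτ
    have dU : lpn volume r (D U τ) ≤ ofReal ε := by
      rw [← edist_eq_lpn hr0 (hU τ hτI) (ae_eq_refl (u t₀))]
      exact hcl₁ τ hτI hτ.1.le (by linarith [hτ.2])
    have dV : lpn volume r (D V τ) ≤ ofReal ε := by
      rw [← edist_eq_lpn hr0 (hV τ hτI) (ae_eq_refl (u t₀))]
      exact hcl₂ τ hτI hτ.1.le (by linarith [hτ.2])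
    have mU : Measurable fun x => D U τ x ^ b := (hDm hUm).of_uncurry_left.pow_const b
    have mV : Measurable fun x => D V τ x ^ b := (hDm hVm).of_uncurry_left.pow_const b
    have mA := hA1.pow_const b
    have hpow : ∀ {F : Eu n → ℝ≥0∞}, lpn volume r F ≤ ofReal ε →
        lpn volume (1 / β) (fun x => F x ^ b) ≤ ofReal (ε ^ b) := fun hF => by
      rw [h1β, hlpb hr0, ← ofReal_rpow_of_nonneg hε.le hb.le]
      exact rpow_le_rpow hF hb.le
    have h4 := (lpn_add_le (μ := volume) hβ1 (mU.add mV) (mA.add mA)).trans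
      (add_le_add ((lpn_add_le hβ1 mU mV).trans (add_le_add (hpow dU) (hpow dV)))
        ((lpn_add_le hβ1 mA mA).trans (add_le_add (hpow hk.le) (hpow hk.le))))
    have h5 := lpn_const_mul (μ := volume) (by positivity : 0 < 1 / β)
      ((mU.add mV).add (mA.add mA)) (3 ^ b)
    refine h5.le.trans ((mul_le_mul_right h4 _).trans_eq ?_)
    have h6 : (3 : ℝ≥0∞) ^ b = ofReal (3 ^ b) := by
      rw [← ofReal_rpow_of_nonneg (by norm_num) hb.le, ENNReal.ofReal_ofNat]
    rw [h6, ← ofReal_add (by positivity) (by positivity),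
      ← ofReal_add (by positivity) (by positivity), ← ofReal_mul (by positivity), hη₁]
    congr 1
    ring
  clear_value H₁ H₂
  have hH₁t : ∀ τ, Measurable (H₁ τ) := fun τ => hH₁m.of_uncurry_left
  set W : ℝ → Eu n → ℝ≥0∞ := fun τ x => ‖U τ x - V τ x‖ₑ with hW
  have hWm : Measurable (uncurry W) := (hUm.sub hVm).enorm
  have hWt : ∀ τ, Measurable (W τ) := fun τ => hWm.of_uncurry_left
  set Q : ℝ≥0∞ → Prop := fun N => ∀ t ∈ Ioo t₀ t₁, ∀ E, MeasurableSet E → volume E ≠ ∞ →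
    ∫⁻ x in E, W t x ≤ N * volume E ^ e with hQ
  obtain ⟨R, hR0, hR⟩ := exists_norm_bound (hcu.sub hcv)
  have h0 : Q (ofReal R) := by
    intro t ht E hE _
    refine (setLIntegral_le_lpn hr1 (hWt t) hE).trans (mul_le_mul_left ?_ _)
    rw [← edist_eq_lpn hr0 (hU t (hIcc t ht)) (hV t (hIcc t ht)), edist_dist, dist_eq_norm]
    exact ofReal_le_ofReal (hR t (hIcc t ht))
  -- Each of the two coefficients contributes at most N/4: the first by the choice of ε, the second
  -- by that of the time step c₃.
  have hstep : ∀ N, N ≠ ∞ → Q N → Q (N / 2) := by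
    intro N _ hN t ht E hE hEfin
    have hsub : ∀ τ ∈ Ioo t₀ t, τ ∈ Ioo t₀ t₁ := fun τ hτ => ⟨hτ.1, hτ.2.trans ht.2⟩
    have hw1 := hweak₁ W H₁ t₀ t E N η₁ hWt hH₁t ht.1 hE hEfin hη₁0
      (fun τ hτ => hN τ (hsub τ hτ)) (fun τ hτ => hH₁s τ (hsub τ hτ))
    have hw2 := hweak₂ W (fun _ => H₂) t₀ t E N η₂ hWt (fun τ => hH₂m) ht.1 hE hEfin hη₂0
      (fun τ hτ => hN τ (hsub τ hτ)) (fun τ hτ => hH₂fin)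
    have hw := setLIntegral_Ioo_cv_le (measurable_nonlin_sub (σ := σ) (b := b) hUm hVm) hWm hH₁m hE
      (C := 2 + b) (fun τ x => (enorm_nonlin_sub_le hσ hb (U τ x) (V τ x)).trans
        (mul_le_mul_right ((mul_le_mul_left (hpt τ x) _).trans_eq (mul_comm _ _)) _)) hw1 hw2
    have hd1 := hdiff b σ r φ I u v T t₀ t U V hu hv hU hV ht₀.1 heq (hI (hIcc t ht)) ht.1
      (hIcc t ht).2
    have htt : 0 ≤ t - t₀ := by linarith [ht.1]
    have htt1 : t - t₀ ≤ 1 := by linarith [ht.2]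
    have htt3 : t - t₀ ≤ c₃ := by linarith [ht.2]
    have q1 : C₁ * ((2 + b) * (C₂ * η₁ * (t - t₀) ^ (1 - 1 / (2 * α) - d * β))) ≤ 1 / 4 := by
      refine le_trans ?_ hεs
      have : (t - t₀) ^ (1 - 1 / (2 * α) - d * β) ≤ 1 := Real.rpow_le_one htt htt1 hgap
      calc _ ≤ C₁ * ((2 + b) * (C₂ * η₁ * 1)) := by gcongr
        _ = _ := by rw [hη₁]; ring
    have q2 : C₁ * ((2 + b) * (C₃ * η₂ * (t - t₀) ^ γ)) ≤ 1 / 4 := by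
      refine le_trans ?_ hc₃s
      calc _ ≤ C₁ * ((2 + b) * (C₃ * η₂ * c₃ ^ γ)) := by gcongr
        _ = _ := by ring
    calc ∫⁻ x in E, W t x
        ≤ ∫⁻ x in E, ofReal C₁ * ∫⁻ τ in Ioo t₀ t, cv volume (jk ((t - τ) ^ (1 / (2 * α))))
              (fun y => ‖nonlin σ b (U τ y) - nonlin σ b (V τ y)‖ₑ) x :=
          lintegral_mono_ae (ae_restrict_of_ae hd1)
      _ ≤ ofReal C₁ * (ofReal (2 + b) * (ofReal (C₂ * η₁ * (t - t₀) ^ (1 - 1 / (2 * α) - d * β)) *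
              (N * volume E ^ e) +
            ofReal (C₃ * η₂ * (t - t₀) ^ γ) * (N * volume E ^ e))) := by
          rw [lintegral_const_mul' _ _ ofReal_ne_top]
          exact mul_le_mul_right hw _
      _ = (ofReal (C₁ * ((2 + b) * (C₂ * η₁ * (t - t₀) ^ (1 - 1 / (2 * α) - d * β)))) +
            ofReal (C₁ * ((2 + b) * (C₃ * η₂ * (t - t₀) ^ γ)))) * (N * volume E ^ e) := by
          rw [ofReal_mul (p := C₁) hC₁.le, ofReal_mul (p := C₁) hC₁.le,
            ofReal_mul (p := 2 + b) (by positivity), ofReal_mul (p := 2 + b) (by positivity)]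
          ring
      _ ≤ (ofReal (1 / 4) + ofReal (1 / 4)) * (N * volume E ^ e) := by gcongr
      _ = N / 2 * volume E ^ e := by
          have h2 : (2 : ℝ≥0∞)⁻¹ = ofReal (1 / 2) := by
            rw [one_div, ENNReal.ofReal_inv_of_pos two_pos, ENNReal.ofReal_ofNat]
          rw [← ofReal_add (by norm_num) (by norm_num), div_eq_mul_inv N, h2,
            show (1 / 4 : ℝ) + 1 / 4 = 1 / 2 by norm_num]
          ring
  refine ⟨(t₀ + t₁) / 2, by linarith, fun t ht => ?_⟩
  have ht1 : t ∈ Ioo t₀ t₁ := ⟨ht.1, by linarith [ht.2]⟩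
  have hzero : ∀ E, MeasurableSet E → volume E < ∞ → ∫⁻ x in E, W t x = ∫⁻ x in E, 0 := by
    intro E hE hfinE
    rw [lintegral_zero]
    exact eq_zero_of_halving ofReal_ne_top h0 hstep
      (rpow_ne_top_of_nonneg he0.le hfinE.ne) fun M hM => hM t ht1 E hE hfinE.ne
  have hae := ae_eq_of_forall_setLIntegral_eq_of_sigmaFinite (hWt t) measurable_zero hzero
  refine Lp.ext ?_
  filter_upwards [hU t (hIcc t ht1), hV t (hIcc t ht1), hae] with x h1 h2 h3
  rw [h1, h2]
  exact sub_eq_zero.1 (enorm_eq_zero.1 h3)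

end UniquenessSpace

/-! ### Unconditional uniqueness -/

section Uniqueness

variable {𝕜 : Type*} [RCLike 𝕜] {n : ℕ} {α b σ r p : ℝ} {q : ℝ≥0∞}

/-- Unconditional uniqueness of mild solutions in `X(I)`. -/
theorem IsMildSolution.eqOn (hn : 0 < n) (hα : 1 / 2 < α) (hb : 0 < b) (hgap : 0 ≤ gapExp n α b r)
    (hσ : σ = 1 ∨ σ = -1) (a : Eu n) [Fact (1 ≤ ofReal r)] [Fact (1 ≤ ofReal p)]
    (hadm : IsAdmissible n α q p r) (hbp : b + 1 < p) {φ : LpEu 𝕜 n (ofReal r)} {I : Set ℝ}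
    (hI : IsTimeInterval I) {u v : ℝ → LpEu 𝕜 n (ofReal r)} (hu : IsMildSolution α b σ a φ I u)
    (hv : IsMildSolution α b σ a φ I v) (hu' : MemX q (ofReal p) I u)
    (hv' : MemX q (ofReal p) I v) : EqOn u v I := by
  intro T hT
  have hIT : Icc 0 T ⊆ I := fun t ht => hI.lower T hT t ht.1 ht.2
  have hcu := hu'.continuousOn.mono hIT
  have hcv := hv'.continuousOn.mono hIT
  refine eqOn_Icc_of_local hcu hcv (hu.initial.trans hv.initial.symm) (fun t₀ ht₀ heq => ?_)
    ⟨hI.nonneg T hT, le_rfl⟩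
  -- For p = r the class provides no integrability above L^r for a given solution, so p₁ > r is
  -- unavailable and the test-set argument in space is needed. For r < p interpolation yields L^{p₁}
  -- and the argument in time suffices.
  rcases hadm.le.eq_or_lt with hrp | hrp
  · exact exists_eqOn_Ioc_of_continuousOn hn hα hb (hrp ▸ hbp) hgap hσ a hu hv hcu hcv hIT ht₀ heq
  · obtain ⟨p₁, h, hp₁⟩ := exists_katoExponents hn hα hb hadm.one_lt hgap hbp
    obtain ⟨q', rfl, hq, hrq⟩ := hadm.exists_real hn hα hrp
    exact h.exists_eqOn_Ioc hσ a (hp₁ hrp) hq (by linarith [h.hr]) hu hv hu' hv' hIT ht₀ heq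

end Uniqueness

/-! ### The semigroup property -/

section SemigroupProperty

variable {𝕜 : Type*} [RCLike 𝕜] {n : ℕ} {α : ℝ}

/-- Fubini after the shift z ↦ z - y. Finiteness at x of the iterated convolution of absolute values
is precisely the integrability required. -/
lemma integral_smul_integral_smul {k₁ k₂ : Eu n → ℝ} {f : Eu n → 𝕜} (hk₁ : Measurable k₁)
    (hk₂ : Measurable k₂) (hf : Measurable f) {x : Eu n}
    (h : cv volume (fun y => ‖k₁ y‖ₑ) (cv volume (fun y => ‖k₂ y‖ₑ) (fun y => ‖f y‖ₑ)) x ≠ ∞) :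
    ∫ y, k₁ y • ∫ z, k₂ z • f (x - y - z) = ∫ z, (∫ y, k₁ y * k₂ (z - y)) • f (x - z) := by
  have hm : Measurable (uncurry fun y z => (k₁ y * k₂ (z - y)) • f (x - z)) :=
    ((hk₁.comp measurable_fst).mul (hk₂.comp (measurable_snd.sub measurable_fst))).smul
      (hf.comp (measurable_const.sub measurable_snd))
  have hint : Integrable (uncurry fun y z => (k₁ y * k₂ (z - y)) • f (x - z))
      ((volume : Measure (Eu n)).prod (volume : Measure (Eu n))) := by
    refine ⟨hm.aestronglyMeasurable, ?_⟩
    rw [hasFiniteIntegral_iff_enorm, lintegral_prod _ hm.enorm.aemeasurable]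
    refine lt_of_le_of_lt (le_of_eq ?_) h.lt_top
    rw [cv]
    refine lintegral_congr fun y => ?_
    have m1 : Measurable fun z => ‖k₂ z‖ₑ * ‖f (x - y - z)‖ₑ :=
      hk₂.enorm.mul (hf.comp (measurable_const.sub measurable_id)).enorm
    rw [cv, ← lintegral_const_mul _ m1,
      ← lintegral_sub_right_eq_self (fun z => ‖k₁ y‖ₑ * (‖k₂ z‖ₑ * ‖f (x - y - z)‖ₑ)) y]
    refine lintegral_congr fun z => ?_
    simp only [uncurry]
    rw [enorm_smul, enorm_mul, mul_assoc, sub_sub_sub_cancel_right]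
  calc ∫ y, k₁ y • ∫ z, k₂ z • f (x - y - z)
      = ∫ y, ∫ z, (k₁ y * k₂ (z - y)) • f (x - z) := by
        refine integral_congr_ae (.of_forall fun y => ?_)
        simp only
        rw [← integral_sub_right_eq_self (fun z => k₂ z • f (x - y - z)) y, ← integral_smul]
        refine integral_congr_ae (.of_forall fun z => ?_)
        simp only
        rw [sub_sub_sub_cancel_right, smul_smul]
    _ = ∫ z, ∫ y, (k₁ y * k₂ (z - y)) • f (x - z) := integral_integral_swap hint
    _ = _ := by
        refine integral_congr_ae (.of_forall fun z => ?_)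
        exact integral_smul_const _ _

lemma semigroup_semigroup (hn : 0 < n) (hα : 1 / 2 < α) {t s : ℝ} (ht : 0 < t) (hs : 0 < s)
    {f : Eu n → 𝕜} (hf : Measurable f) {x : Eu n} (h : cv volume (fun y => ‖kernel n α t y‖ₑ)
      (cv volume (fun y => ‖kernel n α s y‖ₑ) (fun y => ‖f y‖ₑ)) x ≠ ∞) :
    semigroup α t (semigroup α s f) x = semigroup α (t + s) f x := by
  simp only [semigroup_apply]
  rw [integral_smul_integral_smul (measurable_kernel hn hα ht) (measurable_kernel hn hα hs) hf h]
  simp only [kernel_convolution_kernel hn hα ht hs]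

lemma semigroup_semigroupDeriv (hn : 0 < n) (hα : 1 / 2 < α) (a : Eu n) {t s : ℝ} (ht : 0 < t)
    (hs : 0 < s) {f : Eu n → 𝕜} (hf : Measurable f) {x : Eu n}
    (h : cv volume (fun y => ‖kernel n α t y‖ₑ)
      (cv volume (fun y => ‖derivKernel α a s y‖ₑ) (fun y => ‖f y‖ₑ)) x ≠ ∞) :
    semigroup α t (semigroupDeriv α a s f) x = semigroupDeriv α a (t + s) f x := by
  simp only [semigroup_apply, semigroupDeriv_apply]
  rw [integral_smul_integral_smul (measurable_kernel hn hα ht) (measurable_derivKernel hn hα a hs)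
    hf h]
  simp only [kernel_convolution_derivKernel hn hα ht hs]

/-- Fubini in (y, τ) moves S_α(t) inside the time integral, and the semigroup identity is applied
for almost every τ. The integral still ends at s: this is the contribution of the past to a
restarted solution. -/
lemma semigroup_duh (hn : 0 < n) (hα : 1 / 2 < α) (a : Eu n) {t s : ℝ} (ht : 0 < t)
    {f : ℝ → Eu n → 𝕜} (hf : Measurable (uncurry f)) {x : Eu n}
    (h : cv volume (fun y => ‖kernel n α t y‖ₑ) (maj α (fun τ y => ‖f τ y‖ₑ) s) x ≠ ∞) :
    semigroup α t (duh α a f s) x = ∫ τ in Ioo 0 s, semigroupDeriv α a (t + s - τ) (f τ) x := by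
  obtain ⟨C, hC, hb⟩ := exists_enorm_derivKernel_le hn hα a
  have hft : ∀ τ, Measurable (f τ) := fun τ => hf.of_uncurry_left
  have hkm := measurable_kernel hn hα ht
  set P : ℝ → Eu n → ℝ≥0∞ := fun τ y =>
    ofReal C * cv volume (jk ((s - τ) ^ (1 / (2 * α)))) (fun y => ‖f τ y‖ₑ) y with hP
  have hcvP : ∀ τ ∈ Ioo 0 s, ∀ y, cv volume (fun y => ‖derivKernel α a (s - τ) y‖ₑ)
      (fun y => ‖f τ y‖ₑ) y ≤ P τ y := by
    intro τ hτ y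
    rw [hP]
    simp only
    rw [← cv_const_mul ofReal_ne_top]
    exact cv_mono_left (hb _ (sub_pos.2 hτ.2)) y
  have hPm : Measurable (uncurry P) :=
    (measurable_maj_integrand (F := fun τ y => ‖f τ y‖ₑ) hf.enorm s).const_mul _
  have hPfin : ∫⁻ y, ∫⁻ τ in Ioo 0 s, ‖kernel n α t y‖ₑ * P τ (x - y) ≠ ∞ := by
    have e : ∫⁻ y, ∫⁻ τ in Ioo 0 s, ‖kernel n α t y‖ₑ * P τ (x - y) = ofReal C *
        cv volume (fun y => ‖kernel n α t y‖ₑ) (maj α (fun τ y => ‖f τ y‖ₑ) s) x := by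
      rw [cv, ← lintegral_const_mul' _ _ ofReal_ne_top]
      refine lintegral_congr fun y => ?_
      rw [lintegral_const_mul' _ _ enorm_ne_top, hP]
      simp only
      rw [lintegral_const_mul' _ _ ofReal_ne_top, maj]
      ring
    rw [e]
    exact mul_ne_top ofReal_ne_top h
  clear_value P
  have hPx : Measurable (uncurry fun (y : Eu n) (τ : ℝ) =>
      ‖kernel n α t y‖ₑ * P τ (x - y)) := by
    have h1 : Measurable fun z : Eu n × ℝ => uncurry P (z.2, x - z.1) :=
      hPm.comp (measurable_snd.prodMk (measurable_const.sub measurable_fst))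
    exact (hkm.comp measurable_fst).enorm.mul h1
  have hcv : ∀ᵐ τ ∂volume.restrict (Ioo 0 s), cv volume (fun y => ‖kernel n α t y‖ₑ)
      (cv volume (fun y => ‖derivKernel α a (s - τ) y‖ₑ) (fun y => ‖f τ y‖ₑ)) x ≠ ∞ := by
    have h1 := hPfin
    rw [lintegral_lintegral_swap hPx.aemeasurable] at h1
    have hm : Measurable fun τ => ∫⁻ y, ‖kernel n α t y‖ₑ * P τ (x - y) := hPx.lintegral_prod_left'
    filter_upwards [ae_lt_top hm h1, ae_restrict_mem measurableSet_Ioo] with τ h2 hτ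
    refine ne_top_of_le_ne_top h2.ne (lintegral_mono fun y => ?_)
    gcongr
    exact hcvP τ hτ _
  have hint : Integrable (uncurry fun (y : Eu n) (τ : ℝ) => kernel n α t y •
      semigroupDeriv α a (s - τ) (f τ) (x - y))
      ((volume : Measure (Eu n)).prod (volume.restrict (Ioo 0 s))) := by
    have h1 := measurable_semigroupDeriv_param hn hα a (s := fun τ => s - τ) (by fun_prop) hf
    have h2 : Measurable fun z : Eu n × ℝ => kernel n α t z.1 •
        (((fun τ => s - τ) ⁻¹' Ioi 0) ×ˢ univ : Set (ℝ × Eu n)).indicator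
        (fun z : ℝ × Eu n => semigroupDeriv α a (s - z.1) (f z.1) z.2) (z.2, x - z.1) :=
      (hkm.comp measurable_fst).smul
        (h1.comp (measurable_snd.prodMk (measurable_const.sub measurable_fst)))
    have hae : ∀ᵐ z : Eu n × ℝ ∂((volume : Measure (Eu n)).prod (volume.restrict (Ioo 0 s))),
        z.2 ∈ Ioo 0 s := by
      have := Measure.quasiMeasurePreserving_snd (μ := (volume : Measure (Eu n))) (ν := volume.restrict (Ioo 0 s))
      exact this.ae (ae_restrict_mem measurableSet_Ioo)
    refine ⟨h2.aestronglyMeasurable.congr ?_, ?_⟩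
    · filter_upwards [hae] with z hz
      simp [indicator, hz.2, uncurry]
    · rw [hasFiniteIntegral_iff_enorm]
      refine lt_of_le_of_lt (lintegral_mono_ae (g := uncurry fun (y : Eu n) (τ : ℝ) =>
        ‖kernel n α t y‖ₑ * P τ (x - y)) ?_) ?_
      · filter_upwards [hae] with z hz
        simp only [uncurry]
        rw [enorm_smul]
        gcongr
        exact (enorm_integral_smul_le _ _ _).trans (hcvP z.2 hz _)
      · rw [lintegral_prod _ hPx.aemeasurable]
        exact hPfin.lt_top
  calc semigroup α t (duh α a f s) x
      = ∫ y, ∫ τ in Ioo 0 s, kernel n α t y • semigroupDeriv α a (s - τ) (f τ) (x - y) := by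
        rw [semigroup_apply]
        refine integral_congr_ae (.of_forall fun y => ?_)
        simp only [duh]
        rw [integral_smul]
    _ = ∫ τ in Ioo 0 s, ∫ y, kernel n α t y • semigroupDeriv α a (s - τ) (f τ) (x - y) :=
        integral_integral_swap hint
    _ = _ := by
        refine integral_congr_ae ?_
        filter_upwards [hcv, ae_restrict_mem measurableSet_Ioo] with τ h1 hτ
        rw [add_sub_assoc, ← semigroup_semigroupDeriv hn hα a ht (sub_pos.2 hτ.2) (hft τ) h1]
        rfl

end SemigroupProperty

/-! ### Finiteness of the Duhamel majorant on X(I) -/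

section MajorantFinite

variable {𝕜 : Type*} [RCLike 𝕜] {n : ℕ} {α b σ r p m : ℝ} {q : ℝ≥0∞}

/-- Keeping the exponent m/(b+1) fixed, the derivative kernel costs only (s-τ)^{-1/(2α)}, so
finiteness becomes a condition in time alone. -/
lemma lpn_maj_nonlin_ne_top (hα : 1 / 2 < α) (hσ : σ = 1 ∨ σ = -1) (hb : 0 < b) (hm : b + 1 ≤ m)
    {U : ℝ → Eu n → 𝕜} (hU : Measurable (uncurry U)) {s : ℝ}
    (h : ∫⁻ τ in Ioo 0 s, ofReal ((s - τ) ^ (-(1 / (2 * α)))) *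
      lpn volume m (fun x => ‖U τ x‖ₑ) ^ (b + 1) ≠ ∞) :
    lpn volume (m / (b + 1)) (maj α (fun τ x => ‖nonlin σ b (U τ x)‖ₑ) s) ≠ ∞ := by
  obtain ⟨C, hC, hmaj⟩ := exists_lpn_maj_le (α := α) (by linarith) n
  have hρ1 : 1 ≤ m / (b + 1) := by rw [le_div_iff₀ (by linarith)]; linarith
  have hF : Measurable (uncurry fun τ x => ‖nonlin σ b (U τ x)‖ₑ) := by
    have h1 : Measurable fun z : ℝ × Eu n => nonlin σ b (uncurry U z) := measurable_nonlin.comp hU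
    exact h1.enorm
  refine ne_top_of_le_ne_top ?_ (hmaj (m / (b + 1)) (m / (b + 1)) s hρ1 le_rfl _ hF)
  rw [sub_self, mul_zero, sub_zero]
  refine ne_top_of_le_ne_top (mul_ne_top (a := ofReal (C * (2 + b))) ofReal_ne_top h) ?_
  rw [← lintegral_const_mul' _ _ ofReal_ne_top]
  refine setLIntegral_mono' measurableSet_Ioo fun τ _ => ?_
  have hUτ : Measurable (U τ) := hU.of_uncurry_left
  refine (mul_le_mul_right (lpn_nonlin_le hσ hb hm hUτ) _).trans_eq ?_
  rw [ofReal_mul hC.le, ofReal_mul hC.le]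
  ring

lemma setLIntegral_Ioo_sub_rpow_ne_top {c : ℝ} (hc : c < 1) {s : ℝ} (hs : 0 < s) :
    ∫⁻ τ in Ioo 0 s, ofReal ((s - τ) ^ (-c)) ≠ ∞ := by
  rw [setLIntegral_Ioo_reflect (fun τ => ofReal (τ ^ (-c))), sub_zero, setLIntegral_Ioo_rpow hc hs]
  exact ofReal_ne_top

/-- The Duhamel term of an element of `X(I)` converges absolutely, in a Lebesgue space. -/
lemma exists_lpn_maj_ne_top (hn : 0 < n) (hα : 1 / 2 < α) (hb : 0 < b) (hgap : 0 ≤ gapExp n α b r)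
    (hσ : σ = 1 ∨ σ = -1) [Fact (1 ≤ ofReal r)] [Fact (1 ≤ ofReal p)]
    (hadm : IsAdmissible n α q p r) (hbp : b + 1 < p) {I : Set ℝ} {u : ℝ → LpEu 𝕜 n (ofReal r)}
    (hu : MemX q (ofReal p) I u) {s : ℝ} (hs : 0 < s) (hI : Icc 0 s ⊆ I) {U : ℝ → Eu n → 𝕜}
    (hUm : Measurable (uncurry U)) (hU : ∀ τ ∈ Icc 0 s, u τ =ᵐ[volume] U τ) :
    ∃ m, 1 ≤ m ∧ lpn volume m (maj α (fun τ x => ‖nonlin σ b (U τ x)‖ₑ) s) ≠ ∞ := by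
  have hr0 : 0 < r := by linarith [hadm.one_lt]
  have hα1 : 1 / (2 * α) < 1 := by rw [div_lt_one (by linarith)]; linarith
  obtain ⟨R, -, hR⟩ := exists_norm_bound (hu.continuousOn.mono hI)
  have hUR : ∀ τ ∈ Icc 0 s, lpn volume r (fun x => ‖U τ x‖ₑ) ≤ ofReal R := by
    intro τ hτ
    rw [← enorm_eq_lpn hr0 (hU τ hτ), ← ofReal_norm]
    exact ofReal_le_ofReal (hR τ hτ)
  rcases hadm.le.eq_or_lt with hrp | hrp
  · have hbr : b + 1 < r := hrp ▸ hbp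
    refine ⟨r / (b + 1), by rw [le_div_iff₀ (by linarith)]; linarith,
      lpn_maj_nonlin_ne_top hα hσ hb hbr.le hUm ?_⟩
    have h1 : (∫⁻ τ in Ioo 0 s, ofReal ((s - τ) ^ (-(1 / (2 * α))))) * ofReal R ^ (b + 1) ≠ ∞ :=
      mul_ne_top (setLIntegral_Ioo_sub_rpow_ne_top hα1 hs)
        (rpow_ne_top_of_nonneg (by linarith) ofReal_ne_top)
    refine ne_top_of_le_ne_top h1 ?_
    rw [← lintegral_mul_const' _ _ (rpow_ne_top_of_nonneg (by linarith) ofReal_ne_top)]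
    refine setLIntegral_mono' measurableSet_Ioo fun τ hτ => ?_
    gcongr
    exact hUR τ ⟨hτ.1.le, hτ.2.le⟩
  · obtain ⟨p₁, h, hp₁⟩ := exists_katoExponents hn hα hb hadm.one_lt hgap hbp
    obtain ⟨q', rfl, hq, hrq⟩ := hadm.exists_real hn hα hrp
    have hδ := h.katoExp_pos
    have hp10 := h.p₁_pos
    have hd := h.d_pos
    have htime := h.time
    have hfin := lpn_interp_ne_top (R := R) h (hp₁ hrp) hq hUm hUR
      (lpn_space_time_ne_top (by linarith) (by linarith) hu hI hU)
    refine ⟨p₁ / (b + 1), by rw [le_div_iff₀ (by linarith)]; linarith [h.b_lt],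
      lpn_maj_nonlin_ne_top hα hσ hb h.b_lt.le hUm ?_⟩
    set δ := katoExp n α r p₁ with hδd
    -- Hölder in time with ‖U‖_{p₁}^{b+1} in L^{1/((b+1)δ)} leaves (s-τ)^{-1/(2α)} in the dual
    -- space. The required inequality follows from the nonnegative gap and p₁ < r(b+1).
    have hc : 1 / (2 * α) < 1 - (b + 1) * δ := by
      have h1 := h.gap
      rw [gapExp] at h1
      have h2 : 1 / r < (b + 1) * (1 / p₁) := by
        rw [mul_one_div, div_lt_div_iff₀ hr0 hp10, one_mul, mul_comm]
        exact h.lt_mul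
      have h3 : (b + 1) * δ < n / (2 * α) * (b / r) := by
        rw [hδd, katoExp]
        have : n / (2 * α) * ((b + 1) * (1 / r - 1 / p₁)) < n / (2 * α) * (b / r) := by
          refine mul_lt_mul_of_pos_left ?_ hd
          have : b / r = b * (1 / r) := by ring
          rw [this]
          linarith
        linarith
      linarith
    have hc0 : 0 < 1 - (b + 1) * δ := by linarith
    have hm1 : Measurable fun τ : ℝ => ofReal ((s - τ) ^ (-(1 / (2 * α)))) := by fun_prop
    have hm2 : Measurable fun τ => lpn volume p₁ (fun x => ‖U τ x‖ₑ) :=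
      ((hUm.enorm.pow_const p₁).lintegral_prod_right').pow_const _
    have hholder := lpn_mul_le (μ := volume.restrict (Ioo 0 s)) one_pos
      (s := 1 / (1 - (b + 1) * δ)) (t := 1 / ((b + 1) * δ)) (by positivity) (by positivity)
      (by rw [one_div_one_div, one_div_one_div]; norm_num) hm1 (hm2.pow_const (b + 1))
    rw [lpn] at hholder
    simp only [rpow_one, div_one] at hholder
    refine ne_top_of_le_ne_top (mul_ne_top ?_ ?_) hholder
    · refine rpow_ne_top_of_nonneg (by positivity) ?_
      have e : ∀ τ ∈ Ioo 0 s, ofReal ((s - τ) ^ (-(1 / (2 * α)))) ^ (1 / (1 - (b + 1) * δ)) =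
          ofReal ((s - τ) ^ (-(1 / (2 * α) / (1 - (b + 1) * δ)))) := by
        intro τ hτ
        have : 0 < s - τ := sub_pos.2 hτ.2
        rw [ofReal_rpow_of_nonneg (by positivity) (by positivity), ← rpow_mul this.le]
        congr 2
        ring
      rw [setLIntegral_congr_fun measurableSet_Ioo e]
      exact setLIntegral_Ioo_sub_rpow_ne_top (by rw [div_lt_one hc0]; exact hc) hs
    · rw [lpn_rpow (by positivity) (by linarith),
        show (b + 1) * (1 / ((b + 1) * δ)) = 1 / δ by field_simp]
      refine rpow_ne_top_of_nonneg (by linarith) (ne_top_of_le_ne_top hfin ?_)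
      exact rpow_le_rpow (lintegral_mono' (Measure.restrict_mono_set volume
        Ioo_subset_Icc_self) le_rfl) (by positivity)

end MajorantFinite

/-! ### Convolution with the integrable kernel -/

section KernelConvolution

variable {𝕜 : Type*} [RCLike 𝕜] {n : ℕ} {α : ℝ}

lemma lpn_cv_kernel_ne_top (hn : 0 < n) (hα : 1 / 2 < α) {t m : ℝ} (ht : 0 < t) (hm : 1 ≤ m)
    {G : Eu n → ℝ≥0∞} (hG : Measurable G) (hfin : lpn volume m G ≠ ∞) :
    lpn volume m (cv volume (fun y => ‖kernel n α t y‖ₑ) G) ≠ ∞ := by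
  have hk := measurable_kernel hn hα ht
  refine ne_top_of_le_ne_top (mul_ne_top ?_ hfin) (lpn_cv_le (μ := volume) (h := 1)
    one_pos (by linarith) hm le_rfl (by norm_num) hk.enorm hG)
  rw [lpn]
  simp only [rpow_one, div_one]
  have := (integrable_kernel hn hα ht).2
  rw [hasFiniteIntegral_iff_enorm] at this
  exact this.ne

lemma integrable_kernel_smul (hn : 0 < n) (hα : 1 / 2 < α) {t : ℝ} (ht : 0 < t) {g : Eu n → 𝕜}
    (hg : Measurable g) {G : Eu n → ℝ≥0∞} (hle : ∀ y, ‖g y‖ₑ ≤ G y) {x : Eu n}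
    (h : cv volume (fun y => ‖kernel n α t y‖ₑ) G x ≠ ∞) :
    Integrable fun y => kernel n α t y • g (x - y) := by
  refine ⟨((measurable_kernel hn hα ht).smul
    (hg.comp (measurable_const.sub measurable_id))).aestronglyMeasurable, ?_⟩
  rw [hasFiniteIntegral_iff_enorm]
  refine lt_of_le_of_lt (lintegral_mono fun y => ?_) h.lt_top
  rw [enorm_smul]
  gcongr
  exact hle _

end KernelConvolution

/-! ### Time translation -/

section Translation

lemma measurePreserving_sub_right_restrict (s t : ℝ) :
    MeasurePreserving (fun τ => τ - s) (volume.restrict (Ico s t))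
      (volume.restrict (Ico 0 (t - s))) := by
  have h := (measurePreserving_sub_right volume s).restrict_preimage_emb
    (MeasurableEquiv.subRight s).measurableEmbedding (Ico 0 (t - s))
  have e : (fun τ => τ - s) ⁻¹' Ico 0 (t - s) = Ico s t := by
    ext τ
    simp only [mem_preimage, mem_Ico]
    constructor <;> rintro ⟨h1, h2⟩ <;> constructor <;> linarith
  rwa [e] at h

end Translation

/-! ### Gluing Duhamel integrals -/

section Gluing

variable {𝕜 : Type*} [RCLike 𝕜] {n : ℕ} {α : ℝ}

/-- The majorant kernel decreases in time, so a source switched off after s is easier to integrate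
at t than at s. -/
lemma duhAt_of_maj_ne_top_of_le (hn : 0 < n) (hα : 1 / 2 < α) (a : Eu n) {f : ℝ → Eu n → 𝕜}
    (hf : Measurable (uncurry f)) {s t : ℝ} (hst : s ≤ t) {x : Eu n}
    (h : maj α (fun τ y => ‖f τ y‖ₑ) s x ≠ ∞) :
    DuhAt α a ((Iio s).piecewise f 0) t x := by
  have hm : Measurable (uncurry ((Iio s).piecewise f 0)) := by
    have e : uncurry ((Iio s).piecewise f 0) =
        fun z : ℝ × Eu n => if z.1 < s then uncurry f z else 0 := by
      ext z
      by_cases hz : z.1 < s <;> simp [uncurry, Set.piecewise, hz]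
    rw [e]
    exact Measurable.ite (measurableSet_lt measurable_fst measurable_const) hf measurable_const
  refine duhAt_of_maj_ne_top hn hα a hm (ne_top_of_le_ne_top h ?_)
  have h0 : ∀ τ, s ≤ τ → cv volume (jk ((t - τ) ^ (1 / (2 * α))))
      (fun y => ‖(Iio s).piecewise f 0 τ y‖ₑ) x = 0 := by
    intro τ hτ
    have : τ ∉ Iio s := not_lt.2 hτ
    simp [cv, Set.piecewise_eq_of_notMem _ _ _ this]
  rw [maj, maj, ← lintegral_indicator measurableSet_Ioo, ← lintegral_indicator measurableSet_Ioo]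
  refine lintegral_mono fun τ => ?_
  by_cases hτ : τ ∈ Ioo 0 s
  · rw [indicator_of_mem hτ, indicator_of_mem (show τ ∈ Ioo 0 t from ⟨hτ.1, hτ.2.trans_le hst⟩),
      Set.piecewise_eq_of_mem _ _ _ (mem_Iio.2 hτ.2)]
    have hs : 0 < s - τ := sub_pos.2 hτ.2
    refine cv_mono_left (jk_anti (by positivity) ?_) x
    exact Real.rpow_le_rpow hs.le (by linarith) (by positivity)
  · rw [indicator_of_notMem hτ]
    by_cases hτ0 : 0 < τ
    · refine (indicator_le_self' (fun _ _ => zero_le) τ).trans_eq (h0 τ (not_lt.1 fun h' => hτ ⟨hτ0, h'⟩))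
    · rw [indicator_of_notMem fun h' => hτ0 h'.1]

/-- Split (0, t) at s; on (s, t) the translation τ ↦ τ - s produces the Duhamel integral of the
restarted field. Absolute convergence is carried through both pieces. -/
lemma duhAt_glue {a : Eu n} {f g w : ℝ → Eu n → 𝕜} {s t : ℝ} (hs : 0 < s) (hst : s < t) {x : Eu n}
    (hf : DuhAt α a ((Iio s).piecewise f 0) t x) (hg : DuhAt α a g (t - s) x)
    (hwf : ∀ τ ∈ Ioo 0 s, w τ =ᵐ[volume] f τ) (hwg : ∀ τ ∈ Ioo s t, w τ =ᵐ[volume] g (τ - s)) :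
    DuhAt α a w t x ∧ duh α a w t x =
      (∫ τ in Ioo 0 s, semigroupDeriv α a (t - τ) (f τ) x) + duh α a g (t - s) x := by
  have hset : Ioc 0 s ∪ Ioo s t = Ioo 0 t := Ioc_union_Ioo_eq_Ioo hs.le hst
  have hdisj : Disjoint (Ioc 0 s) (Ioo s t) :=
    Set.disjoint_left.2 fun τ h1 h2 => absurd h2.1 (not_lt.2 h1.2)
  have hr : (volume : Measure ℝ).restrict (Ioc 0 s) = volume.restrict (Ioo 0 s) :=
    (restrict_Ioo_eq_restrict_Ioc).symm
  have hsub : Ioo 0 s ⊆ Ioo 0 t := Ioo_subset_Ioo_right hst.le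
  have hpf : ∀ τ ∈ Ioo 0 s, w τ =ᵐ[volume] (Iio s).piecewise f 0 τ := fun τ hτ => by
    rw [Set.piecewise_eq_of_mem _ _ _ (mem_Iio.2 hτ.2)]
    exact hwf τ hτ
  have mp := measurePreserving_sub_right_restrict s t
  rw [← restrict_Ioo_eq_restrict_Ico, ← restrict_Ioo_eq_restrict_Ico] at mp
  have emb : MeasurableEmbedding fun τ : ℝ => τ - s := (MeasurableEquiv.subRight s).measurableEmbedding
  have e1 : ∀ τ ∈ Ioo 0 s, semigroupDeriv α a (t - τ) (w τ) x =
      semigroupDeriv α a (t - τ) (f τ) x := fun τ hτ => by rw [semigroupDeriv_congr (hwf τ hτ)]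
  have e2 : ∀ τ ∈ Ioo s t, semigroupDeriv α a (t - τ) (w τ) x =
      (fun τ => semigroupDeriv α a (t - s - τ) (g τ) x) (τ - s) := fun τ hτ => by
    rw [semigroupDeriv_congr (hwg τ hτ)]
    simp only
    rw [sub_sub_sub_cancel_right]
  have hcongr : ∀ {k : Eu n → ℝ} {f₁ f₂ : Eu n → 𝕜}, f₁ =ᵐ[volume] f₂ →
      ConvolutionExistsAt k f₂ x (ContinuousLinearMap.lsmul ℝ ℝ) volume →
      ConvolutionExistsAt k f₁ x (ContinuousLinearMap.lsmul ℝ ℝ) volume := by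
    intro k f₁ f₂ h h'
    refine Integrable.congr h' ?_
    filter_upwards [ae_comp_sub_left h x] with y hy
    rw [hy]
  have hint1 : IntegrableOn (fun τ => semigroupDeriv α a (t - τ) (w τ) x) (Ioc 0 s) := by
    rw [IntegrableOn, hr]
    refine (IntegrableOn.congr_fun (hf.2.mono_set hsub) (fun τ hτ => ?_) measurableSet_Ioo)
    rw [semigroupDeriv_congr (hpf τ hτ)]
  have hint2 : IntegrableOn (fun τ => semigroupDeriv α a (t - τ) (w τ) x) (Ioo s t) := by
    have h1 := (mp.integrable_comp_emb emb).2 hg.2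
    exact IntegrableOn.congr_fun h1 (fun τ hτ => (e2 τ hτ).symm) measurableSet_Ioo
  refine ⟨⟨?_, ?_⟩, ?_⟩
  · rw [← hset, ae_restrict_union_iff, hr]
    constructor
    · filter_upwards [ae_restrict_of_ae_restrict_of_subset hsub hf.1,
        ae_restrict_mem measurableSet_Ioo] with τ h1 hτ
      exact hcongr (hpf τ hτ) h1
    · filter_upwards [mp.quasiMeasurePreserving.ae hg.1,
        ae_restrict_mem measurableSet_Ioo] with τ h1 hτ
      rw [sub_sub_sub_cancel_right] at h1
      exact hcongr (hwg τ hτ) h1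
  · rw [← hset]
    exact hint1.union hint2
  · rw [duh, ← hset, setIntegral_union hdisj measurableSet_Ioo hint1 hint2, hr,
      setIntegral_congr_fun measurableSet_Ioo e1, setIntegral_congr_fun measurableSet_Ioo e2,
      mp.integral_comp emb (fun τ => semigroupDeriv α a (t - s - τ) (g τ) x), duh]

/-- Mild formulation restarted at time `s`. -/
lemma ae_semigroup_restart (hn : 0 < n) (hα : 1 / 2 < α) (a : Eu n) {s t r m : ℝ} (hs : 0 < s)
    (ht : 0 < t) (hr : 1 ≤ r) (hm : 1 ≤ m) {φ : Eu n → 𝕜} (hφ : Measurable φ)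
    (hφr : lpn volume r (fun x => ‖φ x‖ₑ) ≠ ∞) {f : ℝ → Eu n → 𝕜} (hf : Measurable (uncurry f))
    (h : lpn volume m (maj α (fun τ y => ‖f τ y‖ₑ) s) ≠ ∞) {v : Eu n → 𝕜}
    (hv : ∀ᵐ x, v x = semigroup α s φ x + duh α a f s x) :
    ∀ᵐ x, semigroup α t v x = semigroup α (t + s) φ x +
      ∫ τ in Ioo 0 s, semigroupDeriv α a (t + s - τ) (f τ) x := by
  obtain ⟨C, hC, hB⟩ := exists_enorm_duh_le 𝕜 hn hα a
  set k : Eu n → ℝ≥0∞ := fun y => ‖kernel n α t y‖ₑ with hk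
  set G : Eu n → ℝ≥0∞ := cv volume (fun y => ‖kernel n α s y‖ₑ) (fun y => ‖φ y‖ₑ) with hG
  set H : Eu n → ℝ≥0∞ := maj α (fun τ y => ‖f τ y‖ₑ) s with hH
  have hkm : Measurable k := (measurable_kernel hn hα ht).enorm
  have hGm : Measurable G := measurable_cv (measurable_kernel hn hα hs).enorm hφ.enorm
  have hHm : Measurable H := measurable_maj (F := fun τ y => ‖f τ y‖ₑ) hf.enorm s
  have h1 := ae_ne_top_of_lpn_ne_top (zero_lt_one.trans_le hr) (measurable_cv hkm hGm)
    (lpn_cv_kernel_ne_top hn hα ht hr hGm (lpn_cv_kernel_ne_top hn hα hs hr hφ.enorm hφr))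
  have h2 := ae_ne_top_of_lpn_ne_top (zero_lt_one.trans_le hm) (measurable_cv hkm hHm)
    (lpn_cv_kernel_ne_top hn hα ht hm hHm h)
  have hAm : Measurable (semigroup α s φ) := by
    rw [← sg_of_pos hα hs]
    exact (measurable_sg hn hα hφ).of_uncurry_left
  have hDm : Measurable (duh α a f s) := (measurable_duh hn hα a hf).of_uncurry_left
  filter_upwards [h1, h2] with x hx1 hx2
  have hx3 : cv volume k (fun y => ofReal C * H y) x ≠ ∞ := by
    have e : cv volume k (fun y => ofReal C * H y) x = ofReal C * cv volume k H x := by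
      simp only [cv, mul_left_comm _ (ofReal C)]
      rw [lintegral_const_mul' _ _ ofReal_ne_top]
    rw [e]
    exact mul_ne_top ofReal_ne_top hx2
  have i1 := integrable_kernel_smul hn hα ht hAm (G := G) (fun y => by
    rw [semigroup_apply]; exact enorm_integral_smul_le _ _ _) hx1
  have i2 := integrable_kernel_smul hn hα ht hDm (fun y => hB f s y) hx3
  rw [semigroup_congr (g := fun x => semigroup α s φ x + duh α a f s x) hv, semigroup_apply]
  simp only [smul_add]
  rw [integral_add i1 i2, ← semigroup_apply, ← semigroup_apply, semigroup_semigroup hn hα ht hs hφ hx1,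
    semigroup_duh hn hα a ht hf hx2]

end Gluing

/-! ### Restarting, maximality and the blow-up rate -/

section Restart

variable {𝕜 : Type*} [RCLike 𝕜] {n : ℕ} {α b σ r p : ℝ} {q : ℝ≥0∞}

/-- The field `u` up to time `s`, followed by the field `v` started at time `s`. -/
noncomputable def glue {E : Type*} (s : ℝ) (u v : ℝ → E) (t : ℝ) : E :=
  if t ≤ s then u t else v (t - s)

lemma glue_of_le {E : Type*} {s t : ℝ} (u v : ℝ → E) (h : t ≤ s) : glue s u v t = u t := if_pos h

lemma glue_of_lt {E : Type*} {s t : ℝ} (u v : ℝ → E) (h : s < t) : glue s u v t = v (t - s) :=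
  if_neg (not_le.2 h)

lemma IsMildSolution.congr {r : ℝ≥0∞} {a : Eu n} {φ : LpEu 𝕜 n r} {J : Set ℝ}
    {u w : ℝ → LpEu 𝕜 n r} (h : IsMildSolution α b σ a φ J u) {t : ℝ}
    (ht : t ∈ J) (ht0 : 0 < t) (hw : ∀ τ ∈ Ioc 0 t, w τ = u τ) :
    (∀ᵐ x, DuhAt α a (fun τ y => nonlin σ b (w τ y)) t x) ∧
      ∀ᵐ x, w t x = semigroup α t φ x + duh α a (fun τ y => nonlin σ b (w τ y)) t x := by
  have e : ∀ᵐ τ ∂volume.restrict (Ioo 0 t), (fun y => nonlin σ b (u τ y)) =ᵐ[volume]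
      fun y => nonlin σ b (w τ y) := by
    filter_upwards [ae_restrict_mem measurableSet_Ioo] with τ hτ
    rw [hw τ ⟨hτ.1, hτ.2.le⟩]
  constructor
  · filter_upwards [h.conv_exists t ht ht0, h.integrable t ht ht0] with x h1 h2
    exact DuhAt.congr (f := fun τ y => nonlin σ b (u τ y)) ⟨h1, h2⟩ e
  · rw [← duh_congr e, hw t ⟨ht0, le_rfl⟩]
    exact h.duhamel t ht ht0

/-- A mild solution can be continued by a mild solution that starts at its value at time `s`. -/
theorem IsMildSolution.glue (hn : 0 < n) (hα : 1 / 2 < α) (hb : 0 < b) (hgap : 0 ≤ gapExp n α b r)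
    (hσ : σ = 1 ∨ σ = -1) [Fact (1 ≤ ofReal r)] [Fact (1 ≤ ofReal p)]
    (hadm : IsAdmissible n α q p r) (hbp : b + 1 < p) {a : Eu n} {φ : LpEu 𝕜 n (ofReal r)}
    {I : Set ℝ} {s L : ℝ} {u v : ℝ → LpEu 𝕜 n (ofReal r)} (hs : 0 < s) (hI : Icc 0 s ⊆ I)
    (hu : IsMildSolution α b σ a φ I u) (hu' : MemX q (ofReal p) I u)
    (hv : IsMildSolution α b σ a (u s) (Ico 0 L) v) :
    IsMildSolution α b σ a φ (Ico 0 (s + L)) (glue s u v) := by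
  have hr1 : 1 < r := hadm.one_lt
  have hr0 : 0 < r := by linarith
  have hsI : s ∈ I := hI ⟨hs.le, le_rfl⟩
  obtain ⟨U, hUm, hU⟩ := exists_measurable_representative hr1.le (hu'.continuousOn.mono hI)
  obtain ⟨m, hm, hmaj⟩ := exists_lpn_maj_ne_top hn hα hb hgap hσ hadm hbp hu' hs hI hUm hU
  set f : ℝ → Eu n → 𝕜 := fun τ y => nonlin σ b (U τ y) with hf
  have hfm : Measurable (uncurry f) := by
    have h1 : Measurable fun z : ℝ × Eu n => nonlin σ b (uncurry U z) := measurable_nonlin.comp hUm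
    exact h1
  have huf : ∀ τ ∈ Icc 0 s, (fun y => nonlin σ b (u τ y)) =ᵐ[volume] f τ := fun τ hτ => by
    filter_upwards [hU τ hτ] with y hy
    rw [hf, hy]
  have hus : ∀ᵐ x, u s x = semigroup α s φ x + duh α a f s x := by
    have e : ∀ᵐ τ ∂volume.restrict (Ioo 0 s), (fun y => nonlin σ b (u τ y)) =ᵐ[volume] f τ := by
      filter_upwards [ae_restrict_mem measurableSet_Ioo] with τ hτ
      exact huf τ ⟨hτ.1.le, hτ.2.le⟩
    rw [← duh_congr e]
    exact hu.duhamel s hsI hs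
  have hφr : lpn volume r (fun x => ‖φ x‖ₑ) ≠ ∞ := by
    rw [← enorm_eq_lpn hr0 (ae_eq_refl _)]
    exact enorm_ne_top
  have key : ∀ t ∈ Ico 0 (s + L), 0 < t →
      (∀ᵐ x, DuhAt α a (fun τ y => nonlin σ b (FracConv.glue s u v τ y)) t x) ∧
      ∀ᵐ x, FracConv.glue s u v t x = semigroup α t φ x +
        duh α a (fun τ y => nonlin σ b (FracConv.glue s u v τ y)) t x := by
    intro t ht ht0
    rcases le_or_gt t s with hts | hst
    · exact hu.congr (hI ⟨ht0.le, hts⟩) ht0 fun τ hτ => glue_of_le u v (hτ.2.trans hts)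
    · have hts : 0 < t - s := sub_pos.2 hst
      have htL : t - s ∈ Ico 0 L := ⟨hts.le, by linarith [ht.2]⟩
      have hwf : ∀ τ ∈ Ioo 0 s, (fun y => nonlin σ b (FracConv.glue s u v τ y)) =ᵐ[volume] f τ :=
        fun τ hτ => by
          rw [glue_of_le u v hτ.2.le]
          exact huf τ ⟨hτ.1.le, hτ.2.le⟩
      have hwg : ∀ τ ∈ Ioo s t, (fun y => nonlin σ b (FracConv.glue s u v τ y)) =ᵐ[volume]
          (fun τ y => nonlin σ b (v τ y)) (τ - s) := fun τ hτ => by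
        rw [glue_of_lt u v hτ.1]
      have hg : ∀ᵐ x, DuhAt α a (fun τ y => nonlin σ b (v τ y)) (t - s) x := by
        filter_upwards [hv.conv_exists _ htL hts, hv.integrable _ htL hts] with x h1 h2
        exact ⟨h1, h2⟩
      have hF : Measurable (uncurry fun τ y => ‖f τ y‖ₑ) := hfm.enorm
      have hboth : ∀ᵐ x, DuhAt α a (fun τ y => nonlin σ b (FracConv.glue s u v τ y)) t x ∧
          duh α a (fun τ y => nonlin σ b (FracConv.glue s u v τ y)) t x =
            (∫ τ in Ioo 0 s, semigroupDeriv α a (t - τ) (f τ) x) +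
              duh α a (fun τ y => nonlin σ b (v τ y)) (t - s) x := by
        filter_upwards [ae_ne_top_of_lpn_ne_top (by linarith) (measurable_maj hF s) hmaj, hg]
          with x h1 h2
        exact duhAt_glue hs hst (duhAt_of_maj_ne_top_of_le hn hα a hfm hst.le h1) h2 hwf hwg
      refine ⟨hboth.mono fun x h => h.1, ?_⟩
      filter_upwards [hboth, hv.duhamel _ htL hts, ae_semigroup_restart hn hα a hs hts hr1.le hm
        (Lp.stronglyMeasurable φ).measurable hφr hfm hmaj hus] with x h1 h2 h3
      rw [glue_of_lt u v hst, h2, h1.2, h3, sub_add_cancel, add_assoc]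
      rfl
  exact
    { initial := by rw [glue_of_le u v hs.le, hu.initial]
      conv_exists := fun t ht ht0 => (key t ht ht0).1.mono fun x h => h.1
      integrable := fun t ht ht0 => (key t ht ht0).1.mono fun x h => h.2
      duhamel := fun t ht ht0 => (key t ht ht0).2 }

lemma MemXb.glue {r p : ℝ≥0∞} [Fact (1 ≤ r)] [Fact (1 ≤ p)] {I : Set ℝ} {s L : ℝ}
    {u v : ℝ → LpEu 𝕜 n r} (hI : Icc 0 s ⊆ I)
    (hu : MemXb q p I u) (hv : MemXb q p (Ico 0 L) v) (huv : v 0 = u s) :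
    MemXb q p (Ico 0 (s + L)) (glue s u v) := by
  have mp := measurePreserving_sub_right_restrict s (s + L)
  rw [add_sub_cancel_left] at mp
  refine ⟨⟨?_, ?_⟩, ?_⟩
  · have h1 : ContinuousOn (fun t => v (t - s)) (Ico 0 (s + L) ∩ Ici s) :=
      hv.memX.continuousOn.comp (by fun_prop) fun t ht =>
        ⟨by linarith [mem_Ici.1 ht.2], by linarith [ht.1.2]⟩
    have h2 : ContinuousOn u (Ico 0 (s + L) ∩ Iic s) :=
      hu.memX.continuousOn.mono fun t ht => hI ⟨ht.1.1, ht.2⟩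
    refine ContinuousOn.if (p := fun t => t ≤ s) ?_ ?_ ?_
    · rintro t ⟨-, ht⟩
      have : t = s := by
        have h := frontier_Iic_subset s ht
        exact h
      rw [this, sub_self, huv]
    · refine h2.mono (inter_subset_inter_right _ ?_)
      exact (isClosed_Iic (a := s)).closure_subset
    · refine h1.mono (inter_subset_inter_right _ (closure_minimal ?_ isClosed_Ici))
      exact fun t ht => (not_le.1 ht).le
  · obtain ⟨f, hf, hfu⟩ := hu.memX.memLp
    obtain ⟨g, hg, hgv⟩ := hv.memX.memLp
    have hS : MeasurableSet (Iic s) := measurableSet_Iic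
    have e1 : ((volume : Measure ℝ).restrict (Ico 0 (s + L))).restrict (Iic s) ≤
        volume.restrict I := by
      rw [Measure.restrict_restrict hS]
      exact Measure.restrict_mono_set _ fun t ht => hI ⟨ht.2.1, ht.1⟩
    have e2 : ((volume : Measure ℝ).restrict (Ico 0 (s + L))).restrict (Iic s)ᶜ ≤
        volume.restrict (Ico s (s + L)) := by
      rw [Measure.restrict_restrict hS.compl]
      exact Measure.restrict_mono_set _ fun t ht => ⟨(not_le.1 (show ¬t ≤ s from ht.1)).le, ht.2.2⟩
    refine ⟨(Iic s).piecewise f fun t => g (t - s), MemLp.piecewise hS (hf.mono_measure e1)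
      ((hg.comp_measurePreserving mp).mono_measure e2), ?_⟩
    have h1 := (ae_restrict_iff' hS).1 ((Measure.absolutelyContinuous_of_le e1).ae_le hfu)
    have h2 := (ae_restrict_iff' hS.compl).1
      ((Measure.absolutelyContinuous_of_le e2).ae_le (mp.quasiMeasurePreserving.ae hgv))
    filter_upwards [h1, h2] with t ht1 ht2
    by_cases hts : t ≤ s
    · rw [Set.piecewise_eq_of_mem _ _ _ (mem_Iic.2 hts), glue_of_le u v hts]
      exact ht1 hts
    · have hts' : t ∉ Iic s := hts
      rw [Set.piecewise_eq_of_notMem _ _ _ hts', glue_of_lt u v (not_le.1 hts)]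
      exact ht2 hts'
  · obtain ⟨M, hM⟩ := hu.bounded
    obtain ⟨N, hN⟩ := hv.bounded
    refine ⟨max M N, fun t ht => ?_⟩
    rcases le_or_gt t s with hts | hst
    · rw [glue_of_le u v hts]
      exact (hM t (hI ⟨ht.1, hts⟩)).trans (le_max_left _ _)
    · rw [glue_of_lt u v hst]
      exact (hN _ ⟨by linarith, by linarith [ht.2]⟩).trans (le_max_right _ _)

lemma IsMildSolution.mono {r : ℝ≥0∞} {a : Eu n} {φ : LpEu 𝕜 n r} {I J : Set ℝ}
    {u : ℝ → LpEu 𝕜 n r} (h : IsMildSolution α b σ a φ J u) (hIJ : I ⊆ J) :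
    IsMildSolution α b σ a φ I u :=
  ⟨h.initial, fun t ht => h.conv_exists t (hIJ ht), fun t ht => h.integrable t (hIJ ht),
    fun t ht => h.duhamel t (hIJ ht)⟩

lemma MemX.mono {r p : ℝ≥0∞} [Fact (1 ≤ r)] [Fact (1 ≤ p)] {I J : Set ℝ}
    {u : ℝ → LpEu 𝕜 n r} (h : MemX q p J u) (hIJ : I ⊆ J) : MemX q p I u := by
  obtain ⟨f, hf, hfu⟩ := h.memLp
  exact ⟨h.continuousOn.mono hIJ, f, hf.mono_measure (Measure.restrict_mono_set _ hIJ),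
    ae_restrict_of_ae_restrict_of_subset hIJ hfu⟩

/-- Lower bound for the blow-up rate. -/
theorem exists_le_norm_of_isMaximal (hn : 0 < n) (hα : 1 / 2 < α) (hb : 0 < b)
    (hgap : 0 < gapExp n α b r) (hσ : σ = 1 ∨ σ = -1) (a : Eu n) [Fact (1 ≤ ofReal r)]
    [Fact (1 ≤ ofReal p)] (hadm : IsAdmissible n α q p r) (hbp : b + 1 < p) :
    ∃ C : ℝ, 0 < C ∧ ∀ (φ : LpEu 𝕜 n (ofReal r)) (T : ℝ) (u : ℝ → LpEu 𝕜 n (ofReal r)),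
      IsMaximal q (ofReal p) α b σ a φ T u → ∀ s ∈ Ico 0 T,
        C / (T - s) ^ (gapExp n α b r / b) ≤ ‖u s‖ := by
  obtain ⟨p₁, h, -⟩ := exists_katoExponents hn hα hb hadm.one_lt hgap.le hbp
  obtain ⟨c, hc, hex⟩ := h.exists_mildSolution_of_norm (p := p) 𝕜 hσ a hadm hbp
  refine ⟨c ^ (-(1 / b)), by positivity, fun φ T u hmax s hs => ?_⟩
  have hTs : 0 < T - s := sub_pos.2 hs.2
  by_contra! hlt
  have hsmall : c * ‖u s‖ ^ b * (T - s) ^ gapExp n α b r < 1 := by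
    have h1 := Real.rpow_lt_rpow (norm_nonneg _) hlt hb
    rw [Real.div_rpow (by positivity) (by positivity), ← rpow_mul hc.le, ← rpow_mul hTs.le,
      div_mul_cancel₀ _ hb.ne', neg_mul, one_div_mul_cancel hb.ne', Real.rpow_neg_one,
      lt_div_iff₀ (by positivity)] at h1
    have h2 := mul_lt_mul_of_pos_left h1 hc
    rwa [mul_inv_cancel₀ hc.ne', ← mul_assoc] at h2
  -- The strict inequality leaves room for L > T - s, so the restarted solution outlives T.
  obtain ⟨L, hL, hLs⟩ : ∃ L, T - s < L ∧ c * ‖u s‖ ^ b * L ^ gapExp n α b r < 1 := by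
    have hcont : Continuous fun L : ℝ => c * ‖u s‖ ^ b * L ^ gapExp n α b r :=
      continuous_const.mul (Real.continuous_rpow_const hgap.le)
    have h1 := (hcont.tendsto (T - s)).eventually (gt_mem_nhds hsmall)
    have h2 : ∀ᶠ L in 𝓝[>] (T - s), c * ‖u s‖ ^ b * L ^ gapExp n α b r < 1 :=
      h1.filter_mono nhdsWithin_le_nhds
    obtain ⟨L, hL1, hL2⟩ := (h2.and self_mem_nhdsWithin).exists
    exact ⟨L, hL2, hL1⟩
  have hL0 : 0 < L := hTs.trans hL
  obtain ⟨v, hv, hv'⟩ := hex (u s) (Ico 0 L) (L ^ gapExp n α b r) (isTimeInterval_Ico hL0)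
    (by positivity) (fun t ht _ => Real.rpow_le_rpow ht.1 ht.2.le hgap.le) hLs.le
  obtain ⟨w, hw, hw'⟩ : ∃ w, IsMildSolution α b σ a φ (Ico 0 (s + L)) w ∧
      MemXb q (ofReal p) (Ico 0 (s + L)) w := by
    rcases hs.1.eq_or_lt with rfl | hs0
    · obtain ⟨h1, -⟩ := hmax.sol (T / 2) (by linarith [hmax.pos]) (by linarith [hmax.pos])
      rw [zero_add]
      exact ⟨v, h1.initial ▸ hv, hv'⟩
    · obtain ⟨h1, h2⟩ := hmax.sol ((s + T) / 2) (by linarith [hmax.pos]) (by linarith)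
      have hsub : Icc 0 s ⊆ Ico 0 ((s + T) / 2) := fun t ht => ⟨ht.1, by linarith [ht.2]⟩
      exact ⟨glue s u v, h1.glue hn hα hb hgap.le hσ hadm hbp hs0 hsub h2.memX hv,
        h2.glue hsub hv' hv.initial⟩
  -- Maximality concerns extensions of u itself, so uniqueness on every [0, T') with T' < T is
  -- needed to see that the glued solution coincides with u.
  refine hmax.maximal (s + L) (by linarith) w hw hw' fun t ht => ?_
  obtain ⟨T', hT1, hT2⟩ := exists_between ht.2
  obtain ⟨h1, h2⟩ := hmax.sol T' (ht.1.trans_lt hT1) hT2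
  have hsub : Ico 0 T' ⊆ Ico 0 (s + L) := Ico_subset_Ico_right (by linarith)
  exact IsMildSolution.eqOn hn hα hb hgap.le hσ a hadm hbp (isTimeInterval_Ico (ht.1.trans_lt hT1))
    (hw.mono hsub) h1 (hw'.memX.mono hsub) h2.memX ⟨ht.1, hT1⟩

end Restart

end FracConv

/-! ### The well-posedness theorem -/

theorem theorem4p3 {𝕜 : Type*} [RCLike 𝕜] (n : ℕ) (α b σ r p : ℝ) (q : ℝ≥0∞)
    (a : EuclideanSpace ℝ (Fin n))
    [Fact (1 ≤ ENNReal.ofReal r)] [Fact (1 ≤ ENNReal.ofReal p)]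
    (hα : 1 / 2 < α) (hb : 0 < b) (hσ : σ = 1 ∨ σ = -1)
    (hr₁ : 1 < n * b / (2 * α - 1)) (hr : n * b / (2 * α - 1) ≤ r)
    (hadm : FracConv.IsAdmissible n α q p r) (hp : b + 1 < p) :
    -- local well-posedness, subcritical case: `T` depends only on the norm of the data
    (n * b / (2 * α - 1) < r → ∀ M : ℝ, ∃ T : ℝ, 0 < T ∧
      ∀ φ : Lp 𝕜 (ENNReal.ofReal r) (volume : Measure (EuclideanSpace ℝ (Fin n))), ‖φ‖ ≤ M →
        ∃ u : ℝ → Lp 𝕜 (ENNReal.ofReal r) (volume : Measure (EuclideanSpace ℝ (Fin n))),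
          FracConv.IsMildSolution α b σ a φ (Ico 0 T) u ∧
          FracConv.MemX q (ENNReal.ofReal p) (Ico 0 T) u ∧
          ∀ v, FracConv.IsMildSolution α b σ a φ (Ico 0 T) v →
            FracConv.MemX q (ENNReal.ofReal p) (Ico 0 T) v → EqOn v u (Ico 0 T)) ∧
    -- local well-posedness, critical case: `T` depends on the data
    (r = n * b / (2 * α - 1) →
      ∀ φ : Lp 𝕜 (ENNReal.ofReal r) (volume : Measure (EuclideanSpace ℝ (Fin n))),
        ∃ T : ℝ, 0 < T ∧
        ∃ u : ℝ → Lp 𝕜 (ENNReal.ofReal r) (volume : Measure (EuclideanSpace ℝ (Fin n))),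
          FracConv.IsMildSolution α b σ a φ (Ico 0 T) u ∧
          FracConv.MemX q (ENNReal.ofReal p) (Ico 0 T) u ∧
          ∀ v, FracConv.IsMildSolution α b σ a φ (Ico 0 T) v →
            FracConv.MemX q (ENNReal.ofReal p) (Ico 0 T) v → EqOn v u (Ico 0 T)) ∧
    -- global well-posedness for small data in the critical case
    (r = n * b / (2 * α - 1) → ∃ ε : ℝ, 0 < ε ∧
      ∀ φ : Lp 𝕜 (ENNReal.ofReal r) (volume : Measure (EuclideanSpace ℝ (Fin n))), ‖φ‖ ≤ ε →
        ∃ u : ℝ → Lp 𝕜 (ENNReal.ofReal r) (volume : Measure (EuclideanSpace ℝ (Fin n))),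
          FracConv.IsMildSolution α b σ a φ (Ici 0) u ∧
          FracConv.MemXb q (ENNReal.ofReal p) (Ici 0) u ∧
          ∀ v, FracConv.IsMildSolution α b σ a φ (Ici 0) v →
            FracConv.MemX q (ENNReal.ofReal p) (Ici 0) v → EqOn v u (Ici 0)) ∧
    -- lower bound for the blow-up rate in the subcritical case
    (n * b / (2 * α - 1) < r → ∃ C : ℝ, 0 < C ∧
      ∀ (φ : Lp 𝕜 (ENNReal.ofReal r) (volume : Measure (EuclideanSpace ℝ (Fin n)))) (T : ℝ)
        (u : ℝ → Lp 𝕜 (ENNReal.ofReal r) (volume : Measure (EuclideanSpace ℝ (Fin n)))),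
        FracConv.IsMaximal q (ENNReal.ofReal p) α b σ a φ T u →
        ∀ s ∈ Ico 0 T,
          C / (T - s) ^ (1 / b - 1 / (2 * b * α) - n / (2 * r * α)) ≤ ‖u s‖) := by
  have hα0 : 0 < 2 * α - 1 := by linarith
  -- In dimension 0 the critical exponent would be 0, against r₁ > 1.
  have hn : 0 < n := by
    rcases Nat.eq_zero_or_pos n with rfl | h
    · norm_num at hr₁
    · exact h
  have hr1 : 1 < r := hadm.one_lt
  have hr0 : 0 < r := by linarith
  -- The sign of the gap is that of r - r₁; all four assertions refer to r₁ only through this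
  -- identity.
  have hgap : FracConv.gapExp n α b r = (2 * α - 1) / (2 * α * r) * (r - n * b / (2 * α - 1)) := by
    rw [FracConv.gapExp]
    field_simp
  have hfac : 0 < (2 * α - 1) / (2 * α * r) := by positivity
  have hgap0 : 0 ≤ FracConv.gapExp n α b r := by
    rw [hgap]
    exact mul_nonneg hfac.le (by linarith)
  have huniq : ∀ {φ : Lp 𝕜 (ENNReal.ofReal r) (volume : Measure (EuclideanSpace ℝ (Fin n)))}
      {I : Set ℝ} {u v : ℝ → Lp 𝕜 (ENNReal.ofReal r) (volume : Measure (EuclideanSpace ℝ (Fin n)))},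
      FracConv.IsTimeInterval I → FracConv.IsMildSolution α b σ a φ I u →
      FracConv.MemX q (ENNReal.ofReal p) I u → FracConv.IsMildSolution α b σ a φ I v →
      FracConv.MemX q (ENNReal.ofReal p) I v → EqOn v u I := fun hI hu hu' hv hv' =>
    FracConv.IsMildSolution.eqOn hn hα hb hgap0 hσ a hadm hp hI hv hu hv' hu'
  obtain ⟨p₁, h, -⟩ := FracConv.exists_katoExponents hn hα hb hr1 hgap0 hp
  obtain ⟨c, hc, hex⟩ := h.exists_mildSolution_of_norm (p := p) 𝕜 hσ a hadm hp
  refine ⟨fun hlt M => ?_, fun heq φ => ?_, fun heq => ?_, fun hlt => ?_⟩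
  · have hgap1 : 0 < FracConv.gapExp n α b r := by
      rw [hgap]
      exact mul_pos hfac (by linarith)
    have hM : 0 < c * (max M 0 + 1) ^ b := by positivity
    -- T solves c (max M 0 + 1)^b T^{gapExp} = 1; the maximum and the added 1 keep the base positive
    -- for every real M.
    have hT : 0 < (c * (max M 0 + 1) ^ b)⁻¹ ^ (1 / FracConv.gapExp n α b r) := by positivity
    refine ⟨_, hT, fun φ hφ => ?_⟩
    have hTI := FracConv.isTimeInterval_Ico hT
    obtain ⟨u, hu, hu'⟩ := hex φ _ (c * (max M 0 + 1) ^ b)⁻¹ hTI (by positivity) (fun t ht ht0 => by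
      have h1 := Real.rpow_le_rpow ht0.le ht.2.le hgap1.le
      rwa [← Real.rpow_mul (by positivity), one_div_mul_cancel hgap1.ne', Real.rpow_one] at h1) (by
      rw [mul_inv_le_iff₀ hM, one_mul]
      gcongr
      linarith [le_max_left M 0])
    exact ⟨u, hu, hu'.memX, fun v hv hv' => huniq hTI hu hu'.memX hv hv'⟩
  · obtain ⟨T, hT, u, hu, hu'⟩ := h.exists_mildSolution_of_gap_eq_zero (p := p) 𝕜 hσ a hadm hp
      (by rw [hgap, ← heq, sub_self, mul_zero]) φ
    exact ⟨T, hT, u, hu, hu'.memX, fun v hv hv' =>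
      huniq (FracConv.isTimeInterval_Ico hT) hu hu'.memX hv hv'⟩
  · have hgap1 : FracConv.gapExp n α b r = 0 := by rw [hgap, ← heq, sub_self, mul_zero]
    -- With zero gap one may take Θ = 1 on the whole half-line, and this radius satisfies c ε^b = 1.
    refine ⟨c⁻¹ ^ (1 / b), by positivity, fun φ hφ => ?_⟩
    obtain ⟨u, hu, hu'⟩ := hex φ (Ici 0) 1 FracConv.isTimeInterval_Ici zero_le_one
      (fun t _ _ => by rw [hgap1, Real.rpow_zero]) (by
      have h1 := Real.rpow_le_rpow (norm_nonneg φ) hφ hb.le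
      rw [← Real.rpow_mul (by positivity), one_div_mul_cancel hb.ne', Real.rpow_one,
        inv_eq_one_div, le_div_iff₀ hc] at h1
      linarith)
    exact ⟨u, hu, hu', fun v hv hv' => huniq FracConv.isTimeInterval_Ici hu hu'.memX hv hv'⟩
  · have hgap1 : 0 < FracConv.gapExp n α b r := by
      rw [hgap]
      exact mul_pos hfac (by linarith)
    have he : 1 / b - 1 / (2 * b * α) - n / (2 * r * α) = FracConv.gapExp n α b r / b := by
      rw [FracConv.gapExp]
      field_simp
    rw [he]
    exact FracConv.exists_le_norm_of_isMaximal hn hα hb hgap1 hσ a hadm hp
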